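/- Let $V=\mathbb C^7$ and let $\omega$ be a non-degenerate four-form on $V$, i.e. one whose $GL_7(\mathbb C)$-orbit is open. Let $G_2\subset G(5,V)$, in the Plücker embedding, be the variety of five-dimensional subspaces of $V$ on which $\omega$ vanishes (the adjoint variety of the simple group of type $G_2$). Let $\Delta\subset\mathbb C$ be the open unit disc. A flat projective family over $\Delta$ is a closed subscheme of $\mathbb P^N\times\Delta$ given by finitely many homogeneous polynomials with coefficients holomorphic on $\Delta$ whose relative homogeneous coordinate ring is flat over $\mathcal O(\Delta)$; a variety $X$ degenerates over $\Delta$ to $Y$ if there is such a family whose fibre over every $s\neq 0$ is isomorphic to $X$ and whose fibre over $0$ is isomorphic to $Y$, as polarized projective schemes (graded isomorphism of homogeneous coordinate rings). In $\mathbb P^5$ with coordinates $(x,y,z,t,u,v)$, and for $s\in\Delta$, let $C_s$ be the curve given by $u=v=0$ and the $2\times2$ minors of $\begin{pmatrix} s x& y& z\\ t& x& s y\end{pmatrix}$. **Proposition.** For $s\ne0$ the curve $C_s$ is a twisted cubic, and $C_0$ is a chain of three lines spanning a $\mathbb P^3$. For every $s\in\Delta$ the space of quadrics containing $C_s$ has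 dimension $14$, and it has a basis $Q_s$ that depends holomorphically on $s$, such that the closures $X_s\subset\mathbb P^{13}$ of the images of $\mathbb P^5$ under the rational maps given by $Q_s$ are the fibres of a flat projective family over $\Delta$ (the one defined by all polynomial relations over $\mathcal O(\Delta)$ among the fourteen quadrics). For every $s\in\Delta$, $G_2$ degenerates over $\Delta$ to $X_s$. In particular $G_2$ degenerates over $\Delta$ to $T:=X_0$, where $T$ is the variety obtained from the chain of three lines, and $T$ has the following properties. 1. $T$ is a projective toric variety of dimension $5$: it is the closure in $\mathbb P^{13}$ of an orbit, isomorphic to the torus, of a diagonal action of $(\mathbb C^*)^5$. 2. $T$ is normal and Gorenstein (Cohen–Macaulay with invertible canonical sheaf) and Fano: $\omega_T^{-1}\cong\mathcal O_T(r)$ for some $r>0$, so that $-K_T$ is an ample Cartier divisor. 3. The only singularities of $T$ are three conifold singularities along toric strata of codimension $3$ and degree $1$. That is, the singular locus of $T$ is the union of the closures $S_0,S_1,S_2$ of three distinct two-dimensional torus orbits, each $S_k\subset\mathbb P^{13}$ has degree $1$, and at every point lying on exactly one of the $S_k$ the completed local ring of $T$ is isomorphic to $\mathbb C[[x_0,\dots,x_5]]/(x_0x_1-x_2x_3)$.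 -/

import Mathlib

open scoped Topology

noncomputable section

/-! ### Holomorphic functions on the unit disc -/

/-- The open unit disc in `ℂ`, as a type. -/
abbrev Disc : Type := Metric.ball (0 : ℂ) 1

/-- The centre of the disc. -/
def Disc.center : Disc := ⟨0, by simp⟩

/-- The ring of holomorphic functions on the open unit disc. -/
def HolDisc : Subalgebra ℂ (Disc → ℂ) where
  carrier := {f | ∃ g : ℂ → ℂ, DifferentiableOn ℂ g (Metric.ball 0 1) ∧ ∀ s : Disc, f s = g s}
  mul_mem' := by
    rintro _ _ ⟨g, hg, hfg⟩ ⟨h, hh, hfh⟩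
    exact ⟨fun z => g z * h z, hg.mul hh, fun s => by simp [hfg, hfh]⟩
  add_mem' := by
    rintro _ _ ⟨g, hg, hfg⟩ ⟨h, hh, hfh⟩
    exact ⟨fun z => g z + h z, hg.add hh, fun s => by simp [hfg, hfh]⟩
  algebraMap_mem' c := ⟨fun _ => c, differentiableOn_const c, fun _ => rfl⟩

/-- The ring of holomorphic functions on the open unit disc, as a type. -/
def HolRing : Type := HolDisc

instance : CommRing HolRing := inferInstanceAs (CommRing HolDisc)

/-- Evaluation of holomorphic functions at a point of the disc. -/
def HolRing.ev (s : Disc) : HolRing →+* ℂ :=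
  (Pi.evalRingHom (fun _ : Disc => ℂ) s).comp HolDisc.val.toRingHom

/-- Specialization at `s` of a polynomial whose coefficients are holomorphic on the disc. -/
def specialize {σ : Type} (s : Disc) : MvPolynomial σ HolRing →+* MvPolynomial σ ℂ :=
  MvPolynomial.map (HolRing.ev s)

/-! ### Closed subschemes of projective space and flat families of such

A closed subscheme of the projective space with homogeneous coordinates indexed by `σ` is given by
a homogeneous ideal `I` of `MvPolynomial σ ℂ`; its homogeneous coordinate ring is the quotient by
`I`. -/

/-- An ideal of a polynomial ring is homogeneous if it contains the homogeneous components of its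
elements. -/
def IsHomogeneousIdeal {R : Type} [CommRing R] {σ : Type} (I : Ideal (MvPolynomial σ R)) : Prop :=
  ∀ f ∈ I, ∀ d : ℕ, MvPolynomial.homogeneousComponent d f ∈ I

/-- The degree `d` part of the homogeneous coordinate ring. -/
def gradedPiece {σ : Type} (I : Ideal (MvPolynomial σ ℂ)) (d : ℕ) :
    Submodule ℂ (MvPolynomial σ ℂ ⧸ I) :=
  (MvPolynomial.homogeneousSubmodule σ ℂ d).map (Ideal.Quotient.mkₐ ℂ I).toLinearMap

/-- The closed subschemes defined by `I` and `J` are isomorphic as polarized projective schemes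
(that is, projectively equivalent inside their linear spans): the homogeneous coordinate rings are
isomorphic as graded `ℂ`-algebras. As these rings are generated in degree one, the isomorphism is
graded as soon as it matches the parts of degree one. -/
def ProjectivelyIsomorphic {σ τ : Type} (I : Ideal (MvPolynomial σ ℂ))
    (J : Ideal (MvPolynomial τ ℂ)) : Prop :=
  ∃ e : (MvPolynomial σ ℂ ⧸ I) ≃ₐ[ℂ] (MvPolynomial τ ℂ ⧸ J),
    (gradedPiece I 1).map e.toLinearMap = gradedPiece J 1

/-- `𝓘` defines a flat projective family over the disc: it is generated by finitely many homogeneous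
polynomials with coefficients holomorphic on the disc, and the relative homogeneous coordinate
ring is flat over the ring of holomorphic functions. -/
structure IsFlatFamilyOverDisc {σ : Type} (𝓘 : Ideal (MvPolynomial σ HolRing)) : Prop where
  fg : 𝓘.FG
  homogeneous : IsHomogeneousIdeal 𝓘
  flat : Module.Flat HolRing (MvPolynomial σ HolRing ⧸ 𝓘)

/-- The fibre over `s` of the family defined by `𝓘`. -/
def fibreIdeal {σ : Type} (𝓘 : Ideal (MvPolynomial σ HolRing)) (s : Disc) :
    Ideal (MvPolynomial σ ℂ) :=
  𝓘.map (specialize s)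

/-- `X = V(I)` degenerates over the disc to `Y = V(J)`: there is a flat projective family over the
disc whose fibre over every `s ≠ 0` is isomorphic to `X` and whose fibre over `0` is isomorphic
to `Y`. -/
def DegeneratesOverDisc {σ τ : Type} (I : Ideal (MvPolynomial σ ℂ))
    (J : Ideal (MvPolynomial τ ℂ)) : Prop :=
  ∃ (N : ℕ) (𝓘 : Ideal (MvPolynomial (Fin N) HolRing)),
    IsFlatFamilyOverDisc 𝓘 ∧
    (∀ s : Disc, s ≠ Disc.center → ProjectivelyIsomorphic (fibreIdeal 𝓘 s) I) ∧
    ProjectivelyIsomorphic (fibreIdeal 𝓘 Disc.center) J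

/-! ### The variety `G₂` -/

/-- A four-form on `ℂ⁷` is non-degenerate if its `GL(7)`-orbit is open. -/
def IsNondegenerateForm (ω : (Fin 7 → ℂ) [⋀^Fin 4]→L[ℂ] ℂ) : Prop :=
  IsOpen {η : (Fin 7 → ℂ) [⋀^Fin 4]→L[ℂ] ℂ |
    ∃ g : (Fin 7 → ℂ) ≃L[ℂ] (Fin 7 → ℂ),
      η = ω.compContinuousLinearMap (g : (Fin 7 → ℂ) →L[ℂ] (Fin 7 → ℂ))}

/-- Plücker coordinates (maximal minors) of the five-space spanned by the rows of `A`. -/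
def pluecker (A : Matrix (Fin 5) (Fin 7) ℂ) : (Fin 5 ↪o Fin 7) → ℂ :=
  fun e => (A.submatrix id e).det

/-- The affine cone (without its vertex) over the set of five-dimensional subspaces of `ℂ⁷` that
are isotropic for `ω`, in the Plücker embedding of `G(5,7)`. -/
def isotropicCone (ω : (Fin 7 → ℂ) [⋀^Fin 4]→L[ℂ] ℂ) : Set ((Fin 5 ↪o Fin 7) → ℂ) :=
  {P | ∃ A : Matrix (Fin 5) (Fin 7) ℂ, LinearIndependent ℂ A.row ∧
    (∀ v : Fin 4 → (Fin 7 → ℂ), (∀ a, v a ∈ Submodule.span ℂ (Set.range A.row)) → ω v = 0) ∧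
    P = pluecker A}

/-- The homogeneous ideal of the variety of isotropic five-spaces. For non-degenerate `ω` this
variety is `G₂`, in the Plücker embedding. -/
def G2Ideal (ω : (Fin 7 → ℂ) [⋀^Fin 4]→L[ℂ] ℂ) : Ideal (MvPolynomial (Fin 5 ↪o Fin 7) ℂ) :=
  MvPolynomial.vanishingIdeal ℂ (isotropicCone ω)

/-! ### Cubic curves, and the images of `ℙ⁵` under the quadrics containing them

All curves are described by their affine cones in `ℂ⁶`, with coordinates
`(x, y, z, t, u, v) = (p 0, p 1, p 2, p 3, p 4, p 5)`. -/

/-- The cone over the curve `u = v = 0`, `rank (s x, y, z; t, x, s y) ≤ 1`. -/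
def cubicCone (s : ℂ) : Set (Fin 6 → ℂ) :=
  {p | p 4 = 0 ∧ p 5 = 0 ∧
    (!![s * p 0, p 1, p 2; p 3, p 0, s * p 1] : Matrix (Fin 2) (Fin 3) ℂ).rank ≤ 1}

/-- The cone over a twisted cubic (a rational normal cubic curve spanning a `ℙ³`). -/
def IsTwistedCubicCone (C : Set (Fin 6 → ℂ)) : Prop :=
  ∃ e : Fin 4 → (Fin 6 → ℂ), LinearIndependent ℂ e ∧
    C = {p | ∃ a b : ℂ, p = ∑ j : Fin 4, (a ^ (3 - (j : ℕ)) * b ^ (j : ℕ)) • e j}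

/-- The cone over a chain of three lines spanning a `ℙ³`. -/
def IsChainOfThreeLinesCone (C : Set (Fin 6 → ℂ)) : Prop :=
  ∃ e : Fin 4 → (Fin 6 → ℂ), LinearIndependent ℂ e ∧
    C = (Submodule.span ℂ {e 0, e 1} : Set (Fin 6 → ℂ)) ∪ Submodule.span ℂ {e 1, e 2} ∪
      Submodule.span ℂ {e 2, e 3}

/-- The space of quadratic forms vanishing on the cone `C`. -/
def quadricsThrough (C : Set (Fin 6 → ℂ)) : Submodule ℂ (MvPolynomial (Fin 6) ℂ) :=
  MvPolynomial.homogeneousSubmodule (Fin 6) ℂ 2 ⊓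
    (MvPolynomial.vanishingIdeal ℂ C).restrictScalars ℂ

/-- The family `Q` is a basis of the submodule `W`. -/
def IsBasisOf {ι : Type} (Q : ι → MvPolynomial (Fin 6) ℂ)
    (W : Submodule ℂ (MvPolynomial (Fin 6) ℂ)) : Prop :=
  LinearIndependent ℂ Q ∧ Submodule.span ℂ (Set.range Q) = W

/-- The ideal of polynomial relations among the forms `Q i`. Over `ℂ` and for forms of equal degree
it is the homogeneous ideal of the closure of the image of the rational map
`[Q i]ᵢ : ℙ⁵ ⇢ ℙ(σ)`. -/
def imageIdeal {R : Type} [CommRing R] {σ : Type} (Q : σ → MvPolynomial (Fin 6) R) :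
    Ideal (MvPolynomial σ R) :=
  RingHom.ker (MvPolynomial.aeval Q : MvPolynomial σ R →ₐ[R] MvPolynomial (Fin 6) R)

/-! ### Geometry of a projective variety -/

/-- `I` is the homogeneous ideal of a (reduced, irreducible) projective variety of dimension `n`. -/
structure IsProjectiveVariety {σ : Type} (I : Ideal (MvPolynomial σ ℂ)) (n : ℕ) : Prop where
  prime : I.IsPrime
  homogeneous : IsHomogeneousIdeal I
  dim : ringKrullDim (MvPolynomial σ ℂ ⧸ I) = n + 1

/-- The coordinate ring of the standard affine chart `x i ≠ 0` of `V(I)`, obtained by setting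
`x i = 1`. The closed points of the chart are its maximal ideals `𝔪`, and the local ring there is
`Localization.AtPrime 𝔪`. -/
abbrev Chart {σ : Type} (I : Ideal (MvPolynomial σ ℂ)) (i : σ) : Type :=
  MvPolynomial σ ℂ ⧸ (I ⊔ Ideal.span {MvPolynomial.X i - 1})

/-- The closed point `𝔪` of the chart `x i ≠ 0` lies on the closed subset `V(J)`. -/
def LiesOn {σ : Type} {I : Ideal (MvPolynomial σ ℂ)} {i : σ} (𝔪 : Ideal (Chart I i))
    (J : Ideal (MvPolynomial σ ℂ)) : Prop :=
  J.map (Ideal.Quotient.mk (I ⊔ Ideal.span {MvPolynomial.X i - 1})) ≤ 𝔪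

/-- The variety is normal. -/
def IsNormalVariety {σ : Type} (I : Ideal (MvPolynomial σ ℂ)) : Prop :=
  ∀ i : σ, MvPolynomial.X i ∉ I → IsDomain (Chart I i) ∧ IsIntegrallyClosed (Chart I i)

/-- A Noetherian local ring is Cohen-Macaulay if its maximal ideal contains a regular sequence
whose length is the dimension of the ring. -/
def IsCohenMacaulayLocal (R : Type) [CommRing R] [IsLocalRing R] : Prop :=
  IsNoetherianRing R ∧ ∃ rs : List R, (∀ r ∈ rs, r ∈ IsLocalRing.maximalIdeal R) ∧
    RingTheory.Sequence.IsRegular R rs ∧ (rs.length : WithBot ℕ∞) = ringKrullDim R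

/-- All local rings of the variety are Cohen-Macaulay. -/
def IsCohenMacaulayVariety {σ : Type} (I : Ideal (MvPolynomial σ ℂ)) : Prop :=
  ∀ (i : σ) (𝔪 : Ideal (Chart I i)) [𝔪.IsMaximal],
    IsCohenMacaulayLocal (Localization.AtPrime 𝔪)

/-- Let `A` be a normal finitely generated domain over `ℂ` of dimension `n`, with fraction
field `K`. The canonical module of `A` consists of the rational `n`-forms that are regular in
codimension one: at every prime `𝔭` of height one they lie in the image of the `n`-forms
of `A` localized at `𝔭`. -/
def canonicalModule {K : Type} [Field K] [Algebra ℂ K] (n : ℕ) (A : Subalgebra ℂ K) :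
    Submodule A (⋀[K]^n Ω[K⁄ℂ]) where
  carrier := {η | ∀ 𝔭 : Ideal A, 𝔭.IsPrime → 𝔭.height = 1 → ∃ s : A, s ∉ 𝔭 ∧
    s • η ∈ Submodule.span A (Set.range fun f : Fin n → A =>
      exteriorPower.ιMulti K n fun k => KaehlerDifferential.D ℂ K (f k : K))}
  zero_mem' 𝔭 h𝔭 _ := ⟨1, (Ideal.ne_top_iff_one 𝔭).1 h𝔭.ne_top, by simp⟩
  add_mem' := by
    intro η θ hη hθ 𝔭 h𝔭 h1
    obtain ⟨s, hs, hsη⟩ := hη 𝔭 h𝔭 h1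
    obtain ⟨r, hr, hrθ⟩ := hθ 𝔭 h𝔭 h1
    refine ⟨s * r, fun h => (h𝔭.mem_or_mem h).elim hs hr, ?_⟩
    rw [smul_add]
    refine add_mem ?_ ?_
    · rw [mul_comm, mul_smul]
      exact Submodule.smul_mem _ _ hsη
    · rw [mul_smul]
      exact Submodule.smul_mem _ _ hrθ
  smul_mem' := by
    intro c η hη 𝔭 h𝔭 h1
    obtain ⟨s, hs, hsη⟩ := hη 𝔭 h𝔭 h1
    refine ⟨s, hs, ?_⟩
    rw [smul_comm]
    exact Submodule.smul_mem _ _ hsη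

/-- The rational function `x j / x i₀` in the function field, realized as the fraction field of the
chart `x i₀ ≠ 0`. -/
def ratCoord {σ : Type} (I : Ideal (MvPolynomial σ ℂ)) (i₀ : σ) [IsDomain (Chart I i₀)] (j : σ) :
    FractionRing (Chart I i₀) :=
  algebraMap (Chart I i₀) (FractionRing (Chart I i₀)) (Ideal.Quotient.mk _ (MvPolynomial.X j))

/-- The coordinate ring of the chart `x i ≠ 0`, as the subalgebra of the function field generated
by the rational functions `x j / x i`. -/
def chartSubalgebra {σ : Type} (I : Ideal (MvPolynomial σ ℂ)) (i₀ : σ) [IsDomain (Chart I i₀)]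
    (i : σ) : Subalgebra ℂ (FractionRing (Chart I i₀)) :=
  Algebra.adjoin ℂ (Set.range fun j => ratCoord I i₀ j / ratCoord I i₀ i)

/-- The canonical sheaf `ω` of the normal `n`-dimensional variety `V(I)` is invertible, i.e. the
canonical divisor is Cartier. -/
def CanonicalSheafInvertible {σ : Type} (I : Ideal (MvPolynomial σ ℂ)) (n : ℕ) : Prop :=
  ∃ (i₀ : σ) (_ : IsDomain (Chart I i₀)), ∀ i : σ, MvPolynomial.X i ∉ I →
    Module.Invertible (chartSubalgebra I i₀ i) (canonicalModule n (chartSubalgebra I i₀ i))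

/-- A normal variety is Gorenstein if it is Cohen-Macaulay and its canonical sheaf is invertible. -/
def IsGorensteinVariety {σ : Type} (I : Ideal (MvPolynomial σ ℂ)) (n : ℕ) : Prop :=
  IsNormalVariety I ∧ IsCohenMacaulayVariety I ∧ CanonicalSheafInvertible I n

/-- The canonical sheaf of `V(I)` is isomorphic to `𝒪(-r)`: there is a rational `n`-form `η` such
that on every chart `x i ≠ 0` the canonical module is freely generated by
`(x i / x i₀) ^ (-r) • η`. -/
def CanonicalSheafIsTwist {σ : Type} (I : Ideal (MvPolynomial σ ℂ)) (n r : ℕ) : Prop :=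
  ∃ (i₀ : σ) (_ : IsDomain (Chart I i₀)) (η : ⋀[FractionRing (Chart I i₀)]^n
      Ω[FractionRing (Chart I i₀)⁄ℂ]), η ≠ 0 ∧
    ∀ i : σ, MvPolynomial.X i ∉ I →
      canonicalModule n (chartSubalgebra I i₀ i) =
        Submodule.span (chartSubalgebra I i₀ i) {((ratCoord I i₀ i) ^ r)⁻¹ • η}

/-- The anticanonical sheaf of `V(I)` is ample, being isomorphic to a positive multiple `𝒪(r)` of
the hyperplane bundle. -/
def IsFanoVariety {σ : Type} (I : Ideal (MvPolynomial σ ℂ)) (n : ℕ) : Prop :=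
  ∃ r : ℕ, 0 < r ∧ CanonicalSheafIsTwist I n r

/-- The degree of an `n`-dimensional closed subscheme `V(I)` of projective space is `d`: the Hilbert
function grows like `d * k ^ n / n!`. -/
def HasDegree {σ : Type} (I : Ideal (MvPolynomial σ ℂ)) (n d : ℕ) : Prop :=
  Filter.Tendsto (fun k : ℕ => (n.factorial : ℝ) * Module.finrank ℂ (gradedPiece I k) / (k : ℝ) ^ n)
    Filter.atTop (𝓝 (d : ℝ))

/-- The local ring of a five-dimensional variety at a conifold singularity along a surface: its
completion is that of a three-dimensional ordinary double point times a smooth surface germ,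
`ℂ⟦x₀, …, x₅⟧ / (x₀ x₁ - x₂ x₃)`. -/
def IsConifoldLocal (R : Type) [CommRing R] [Algebra ℂ R] [IsLocalRing R] : Prop :=
  Nonempty (AdicCompletion (IsLocalRing.maximalIdeal R) R ≃ₐ[ℂ]
    (MvPowerSeries (Fin 6) ℂ ⧸ Ideal.span
      {(MvPowerSeries.X 0 * MvPowerSeries.X 1 - MvPowerSeries.X 2 * MvPowerSeries.X 3 :
        MvPowerSeries (Fin 6) ℂ)}))

/-! ### Projective toric varieties -/

/-- The diagonal action of the torus `(ℂˣ)ⁿ` through the characters `m i`. -/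
def torusAct {σ : Type} {n : ℕ} (m : σ → Fin n → ℤ) (t : Fin n → ℂˣ) (p : σ → ℂ) : σ → ℂ :=
  fun i => ((∏ k, t k ^ m i k : ℂˣ) : ℂ) * p i

/-- The homogeneous ideal of the closure of the torus orbit of the point `[p]` of projective
space. -/
def orbitIdeal {σ : Type} {n : ℕ} (m : σ → Fin n → ℤ) (p : σ → ℂ) : Ideal (MvPolynomial σ ℂ) :=
  MvPolynomial.vanishingIdeal ℂ {q | ∃ (c : ℂ) (t : Fin n → ℂˣ), q = c • torusAct m t p}

/-- `V(I)` is the `n`-dimensional projective toric variety given by the characters `m i`: it is the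
closure of the orbit of a point with non-zero coordinates. As the differences of the characters
generate the character lattice, this orbit is a copy of the torus `(ℂˣ)ⁿ`, open in `V(I)`, and
the action of the torus on it extends to `V(I)`. -/
def IsProjectiveToric {σ : Type} {n : ℕ} (I : Ideal (MvPolynomial σ ℂ)) (m : σ → Fin n → ℤ) :
    Prop :=
  AddSubgroup.closure {a | ∃ i j, a = m i - m j} = ⊤ ∧
    ∃ p : σ → ℂ, (∀ i, p i ≠ 0) ∧ I = orbitIdeal m p

/-- The only singularities of the five-dimensional toric variety `V(I)` are three conifold
singularities along strata of codimension three and degree one. That is, there are exactly three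
two-dimensional torus orbits whose closures `S₀, S₁, S₂` make up the singular locus; these closures
have degree one, and `V(I)` has a conifold singularity at every point that lies on exactly one of
them (in particular along the three orbits). -/
def HasThreeConifoldStrata {σ : Type} (I : Ideal (MvPolynomial σ ℂ)) (m : σ → Fin 5 → ℤ) : Prop :=
  ∃ q : Fin 3 → (σ → ℂ),
    (∀ k, q k ≠ 0 ∧ q k ∈ MvPolynomial.zeroLocus ℂ I) ∧
    Function.Injective (fun k => orbitIdeal m (q k)) ∧
    (∀ k, IsProjectiveVariety (orbitIdeal m (q k)) 2 ∧ HasDegree (orbitIdeal m (q k)) 2 1) ∧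
    ∀ (i : σ) (𝔪 : Ideal (Chart I i)) [𝔪.IsMaximal],
      (¬ IsRegularLocalRing (Localization.AtPrime 𝔪) ↔
        ∃ k, LiesOn 𝔪 (orbitIdeal m (q k))) ∧
      ((∃! k, LiesOn 𝔪 (orbitIdeal m (q k))) → IsConifoldLocal (Localization.AtPrime 𝔪))

end

/-!
The theorem rests on a family of ideals `familyIdeal l s` in fourteen variables with two parameters,
each generated by twenty-eight quadrics. They are the Plücker relations of `G(2, 7)` restricted to a
linear section. For invertible `l`, `s` the family gives `G₂`, for `l = 0` the image of `ℙ⁵` under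
the quadrics through the curve `C_s`, and for `l = s = 0` the toric variety `T`.

*Flatness.* The variables are indexed by fourteen degree two monomials in the six letters
`t < x < y < z < u < v`. Modulo the relations every polynomial is a combination of standard
monomials, those in which the indices are pairwise sorted (`exists_standard_sub_mem`). The family is
parametrized by quartics in the six letters, which for `l = 0` are the quadrics times `u ^ 2`; the
leading monomials of the quartics are the fourteen monomials times `u ^ 2`. A standard monomial is determined by the letters occurring in it
(`leadExp_edgeExp_injOn`), so the standard monomials have linearly independent images, whatever
the parameters in whatever ring. Hence the quadrics generate all relations (`imageIdeal_quadric`)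
and the quotient is free over the base ring (`isFlatFamilyOverDisc_familyIdeal`).

*The general member.* The five-spaces isotropic for a four-form `fourForm l s` are dual to the
bivectors that satisfy seven linear equations (`isLinearSection_iff`), and these bivectors make up
the member of the family (`projectivelyIsomorphic_familyIdeal_G2Ideal`). The infinitesimal action of
the general linear group at `fourForm l s` is surjective. Since the forms with this property on a
line are the complement of a finite set, which is connected, and orbits are open there, every form
with open orbit is in the orbit of `fourForm l s` (`sameOrbit_of_isOpen`). Letting `l`, or `l` and
`s`, tend to zero gives the degenerations (`degeneratesOverDisc_G2Ideal`).

*The toric fibre.* The charts of `T` are the monoid algebras of the tangent cones of a normal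
lattice polytope with nine facets (`chartEquiv`, `coneAlgebra`). Inequalities on exponents define
integrally closed subrings of the Laurent polynomials, so `T` is normal
(`isNormalVariety_toricIdeal`). A rational `5`-form is regular in codimension one if and only if its
coefficient with respect to the invariant form satisfies all facet inequalities strictly
(`mem_canonicalModule_iff`). The facets through a lattice point of the polytope have lattice
distance one from a common point, and this makes the canonical module free on each chart, with
generators that glue to a negative multiple of the hyperplane bundle (`isFanoVariety_toricIdeal`).

*Singularities.* The local ring of `T` at a closed point is that of a point of affine space, of the
product of a conifold with a plane, or of an affine variety in eight-space defined by five binomials,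
according to the coordinates that do not vanish at the point (`exists_pointCoord_ne_zero`,
`LocalChart.exists_isLocalModel`).
Each of the three models is free over a polynomial ring in five variables (`flat_smooth`,
`flat_conifold`, `flat_pentagon`), which gives the Cohen-Macaulay property
(`isCohenMacaulayLocal_of_flat`). Regularity and completions are read off the equations
(`localization_chart_toricIdeal`), and the singular points make up three coordinate planes
(`orbitIdeal_stratumPoint`).
-/

noncomputable section

/-! ### Leading monomials and standard monomials -/

section LeadingTerms

open MvPolynomial

variable {R : Type*} [CommRing R] {σ τ : Type*}

/-- The polynomials all of whose monomials have `w`-weight at least `k`. -/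
def highWeight (R : Type*) [CommRing R] {τ : Type*} (w : τ → ℕ) (k : ℕ) :
    Submodule R (MvPolynomial τ R) where
  carrier := {f | ∀ d ∈ f.support, k ≤ Finsupp.weight w d}
  zero_mem' := by simp
  add_mem' := by
    classical
    intro f g hf hg d hd
    rcases Finset.mem_union.1 (support_add hd) with h | h
    exacts [hf d h, hg d h]
  smul_mem' := by
    intro c f hf d hd
    exact hf d (support_smul hd)

lemma mul_mem_highWeight {w : τ → ℕ} {k l : ℕ} {f g : MvPolynomial τ R}
    (hf : f ∈ highWeight R w k) (hg : g ∈ highWeight R w l) : f * g ∈ highWeight R w (k + l) := by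
  classical
  intro d hd
  obtain ⟨a, ha, b, hb, rfl⟩ := Finset.mem_add.1 (support_mul f g hd)
  rw [map_add]
  exact add_le_add (hf a ha) (hg b hb)

lemma highWeight_anti {w : τ → ℕ} {k l : ℕ} (h : k ≤ l) : highWeight R w l ≤ highWeight R w k :=
  fun _ hf d hd => h.trans (hf d hd)

lemma monomial_mem_highWeight (w : τ → ℕ) (e : τ →₀ ℕ) (r : R) :
    monomial e r ∈ highWeight R w (Finsupp.weight w e) := by
  classical
  intro d hd
  rw [support_monomial] at hd
  split_ifs at hd
  · simp at hd
  · rw [Finset.mem_singleton.1 hd]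

lemma coeff_eq_zero_of_mem_highWeight {w : τ → ℕ} {k : ℕ} {f : MvPolynomial τ R}
    (hf : f ∈ highWeight R w k) {d : τ →₀ ℕ} (hd : Finsupp.weight w d < k) : coeff d f = 0 := by
  by_contra h
  exact absurd (hf d (mem_support_iff.2 h)) (by omega)

/-- The polynomial `f` is the monic monomial with exponent `e` plus terms of larger weight. -/
def HasLead (w : τ → ℕ) (f : MvPolynomial τ R) (e : τ →₀ ℕ) : Prop :=
  f - monomial e 1 ∈ highWeight R w (Finsupp.weight w e + 1)

lemma HasLead.mem {w : τ → ℕ} {f : MvPolynomial τ R} {e : τ →₀ ℕ} (h : HasLead w f e) :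
    f ∈ highWeight R w (Finsupp.weight w e) := by
  have := add_mem (highWeight_anti (Nat.le_succ _) h) (monomial_mem_highWeight w e (1 : R))
  simpa using this

lemma HasLead.mul {w : τ → ℕ} {f g : MvPolynomial τ R} {e e' : τ →₀ ℕ} (hf : HasLead w f e)
    (hg : HasLead w g e') : HasLead w (f * g) (e + e') := by
  have h1 := mul_mem_highWeight hf hg.mem
  have h2 := mul_mem_highWeight (monomial_mem_highWeight w e (1 : R)) hg
  have : f * g - monomial (e + e') 1 =
      (f - monomial e 1) * g + monomial e 1 * (g - monomial e' 1) := by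
    rw [mul_sub, monomial_mul, one_mul]; ring
  unfold HasLead
  rw [this, map_add]
  exact add_mem (highWeight_anti (by omega) h1) (highWeight_anti (by omega) h2)

lemma HasLead.one (w : τ → ℕ) : HasLead w (1 : MvPolynomial τ R) 0 := by
  have : (1 : MvPolynomial τ R) - monomial 0 1 = 0 := by simp
  unfold HasLead
  rw [this]; exact zero_mem _

lemma HasLead.pow {w : τ → ℕ} {f : MvPolynomial τ R} {e : τ →₀ ℕ} (hf : HasLead w f e) (n : ℕ) :
    HasLead w (f ^ n) (n • e) := by
  induction n with
  | zero => simpa using HasLead.one w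
  | succ n ih => rw [pow_succ, succ_nsmul]; exact ih.mul hf

/-- The exponent of the leading monomial of a product of powers of forms with leading exponents
`e i`. -/
def leadExp [Fintype σ] (e : σ → (τ →₀ ℕ)) (μ : σ →₀ ℕ) : τ →₀ ℕ := ∑ i, μ i • e i

lemma HasLead.prod {w : τ → ℕ} [Fintype σ] {P : σ → MvPolynomial τ R} {e : σ → (τ →₀ ℕ)}
    (h : ∀ i, HasLead w (P i) (e i)) (μ : σ →₀ ℕ) :
    HasLead w (∏ i, P i ^ μ i) (leadExp e μ) := by
  classical
  unfold leadExp
  induction (Finset.univ : Finset σ) using Finset.induction_on with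
  | empty => simpa using HasLead.one w
  | insert a s ha ih =>
    rw [Finset.prod_insert ha, Finset.sum_insert ha]
    exact ((h a).pow _).mul ih

lemma aeval_monomial_eq [Fintype σ] (P : σ → MvPolynomial τ R) (μ : σ →₀ ℕ) (c : R) :
    aeval P (monomial μ c) = c • ∏ i, P i ^ μ i := by
  rw [aeval_monomial, Finsupp.prod_fintype _ _ (by simp), Algebra.smul_def]

/-- A polynomial supported on monomials whose images have pairwise distinct leading exponents is
zero as soon as its image is. -/
theorem eq_zero_of_aeval_eq_zero [Fintype σ] {w : τ → ℕ} {P : σ → MvPolynomial τ R}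
    {e : σ → (τ →₀ ℕ)} (h : ∀ i, HasLead w (P i) (e i)) {S : Set (σ →₀ ℕ)}
    (hS : Set.InjOn (leadExp e) S) {f : MvPolynomial σ R} (hf : (f.support : Set (σ →₀ ℕ)) ⊆ S)
    (h0 : aeval P f = 0) : f = 0 := by
  classical
  by_contra hne
  obtain ⟨μ, hμ, hmin⟩ := Finset.exists_min_image f.support
    (fun μ => Finsupp.weight w (leadExp e μ)) (support_nonempty.2 hne)
  have key : coeff (leadExp e μ) (aeval P f) = coeff μ f := by
    conv_lhs => rw [f.as_sum, map_sum, coeff_sum]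
    rw [Finset.sum_eq_single μ]
    · rw [aeval_monomial_eq, coeff_smul]
      have := coeff_eq_zero_of_mem_highWeight (HasLead.prod h μ)
        (d := leadExp e μ) (Nat.lt_succ_self _)
      rw [coeff_sub, coeff_monomial, if_pos rfl, sub_eq_zero] at this
      rw [this, smul_eq_mul, mul_one]
    · intro ν hν hne'
      rw [aeval_monomial_eq, coeff_smul]
      have := coeff_eq_zero_of_mem_highWeight (HasLead.prod h ν)
        (d := leadExp e μ) (Nat.lt_succ_of_le (hmin ν hν))
      rw [coeff_sub, coeff_monomial, if_neg, sub_zero] at this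
      · rw [this, smul_zero]
      · intro he
        exact hne' (hS (hf hν) (hf hμ) he)
    · intro hn
      exact absurd hμ hn
  rw [h0, coeff_zero] at key
  exact mem_support_iff.1 hμ key.symm

end LeadingTerms

/-! ### Sorted monomials -/

section Sorting

/-- The first letter of the `j`-th degree two monomial in the list
`ty, tz, tu, tv, xz, xu, xv, yu, yv, zu, zv, uu, uv, vv`. -/
def lo : Fin 14 → Fin 6 := ![3, 3, 3, 3, 0, 0, 0, 1, 1, 2, 2, 4, 4, 5]

/-- The second letter of the `j`-th degree two monomial in the list
`ty, tz, tu, tv, xz, xu, xv, yu, yv, zu, zv, uu, uv, vv`. -/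
def hi : Fin 14 → Fin 6 := ![1, 2, 4, 5, 2, 4, 5, 4, 5, 4, 5, 4, 5, 5]

/-- The position of a letter in the order `t < x < y < z < u < v`. -/
def pos : Fin 6 → ℕ := ![1, 2, 3, 0, 4, 5]

/-- A pair of monomials `ab`, `a'b'` is sorted if `a ≤ a' ≤ b ≤ b'`. -/
def SortedPair (i j : Fin 14) : Prop :=
  pos (lo i) ≤ pos (lo j) ∧ pos (lo j) ≤ pos (hi i) ∧ pos (hi i) ≤ pos (hi j)

instance (i j : Fin 14) : Decidable (SortedPair i j) := by unfold SortedPair; infer_instance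

/-- Standard monomials in the fourteen variables: any two of the variables occurring form a sorted
pair. -/
def standard : Set (Fin 14 →₀ ℕ) :=
  {μ | ∀ i ∈ μ.support, ∀ j ∈ μ.support, SortedPair i j ∨ SortedPair j i}

/-- The exponent of the `j`-th degree two monomial. -/
def edgeExp (j : Fin 14) : Fin 6 →₀ ℕ := Finsupp.single (lo j) 1 + Finsupp.single (hi j) 1

lemma edge_ext {i j : Fin 14} (h1 : pos (lo i) = pos (lo j)) (h2 : pos (hi i) = pos (hi j)) :
    i = j := by
  revert i j; decide

lemma pos_lo_le (j : Fin 14) : pos (lo j) ≤ pos (hi j) := by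
  revert j; decide

lemma weight_leadExp (c : Fin 6 → ℕ) (e : Fin 14 → (Fin 6 →₀ ℕ)) (μ : Fin 14 →₀ ℕ) :
    Finsupp.weight c (leadExp e μ) = ∑ j, μ j * Finsupp.weight c (e j) := by
  simp [leadExp, map_sum]

lemma weight_edgeExp (c : Fin 6 → ℕ) (j : Fin 14) :
    Finsupp.weight c (edgeExp j) = c (lo j) + c (hi j) := by
  simp [edgeExp, Finsupp.weight_single]

/-- The number of letters up to position `k`. -/
def letterBound (k : ℕ) (a : Fin 6) : ℕ := if pos a ≤ k then 1 else 0

lemma exists_least_edge {μ : Fin 14 →₀ ℕ} (hμ : μ ∈ standard) (h0 : μ ≠ 0) :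
    ∃ i ∈ μ.support, ∀ j ∈ μ.support, SortedPair i j := by
  obtain ⟨i, hi', hmin⟩ := Finset.exists_min_image μ.support
    (fun j => pos (lo j) + pos (hi j)) (Finsupp.support_nonempty_iff.2 h0)
  refine ⟨i, hi', fun j hj => ?_⟩
  rcases hμ i hi' j hj with h | h
  · exact h
  · have h1 := hmin j hj
    have h2 := h.1
    have h3 := h.2.2
    have : i = j := edge_ext (by omega) (by omega)
    rwa [this] at h ⊢

/-- In a standard monomial with exponent `μ` and least variable `i`, at least `deg μ + 1` letters
come no later than the second letter of `i`. -/
lemma lt_weight_letterBound {μ : Fin 14 →₀ ℕ} {i : Fin 14} (hi' : i ∈ μ.support)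
    (h : ∀ j ∈ μ.support, SortedPair i j) :
    ∑ j, μ j < Finsupp.weight (letterBound (pos (hi i))) (leadExp edgeExp μ) := by
  rw [weight_leadExp]
  refine Finset.sum_lt_sum (fun j _ => ?_) ⟨i, Finset.mem_univ _, ?_⟩
  · by_cases hj : j ∈ μ.support
    · have : letterBound (pos (hi i)) (lo j) = 1 := if_pos (h j hj).2.1
      rw [weight_edgeExp, this]
      exact Nat.le_mul_of_pos_right _ (by omega)
    · rw [Finsupp.notMem_support_iff.1 hj, zero_mul]
  · have h1 : letterBound (pos (hi i)) (lo i) = 1 := if_pos (pos_lo_le i)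
    have h2 : letterBound (pos (hi i)) (hi i) = 1 := if_pos le_rfl
    rw [weight_edgeExp, h1, h2]
    have := Finsupp.mem_support_iff.1 hi'
    omega

lemma weight_letterBound_le {μ : Fin 14 →₀ ℕ} {k : ℕ}
    (h : ∀ j ∈ μ.support, k < pos (hi j)) :
    Finsupp.weight (letterBound k) (leadExp edgeExp μ) ≤ ∑ j, μ j := by
  rw [weight_leadExp]
  refine Finset.sum_le_sum fun j _ => ?_
  by_cases hj : j ∈ μ.support
  · have : letterBound k (hi j) = 0 := if_neg (by have := h j hj; omega)
    rw [weight_edgeExp, this]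
    have : letterBound k (lo j) ≤ 1 := by unfold letterBound; split_ifs <;> omega
    nlinarith
  · simp [Finsupp.notMem_support_iff.1 hj]

lemma two_mul_degree (μ : Fin 14 →₀ ℕ) :
    Finsupp.weight (fun _ => 1) (leadExp edgeExp μ) = 2 * ∑ j, μ j := by
  rw [weight_leadExp, Finset.mul_sum]
  refine Finset.sum_congr rfl fun j _ => ?_
  rw [weight_edgeExp]; ring

lemma pos_lo_le_of_least {μ ν : Fin 14 →₀ ℕ} {i i' : Fin 14} (hi' : i' ∈ ν.support)
    (hl : ∀ j ∈ μ.support, SortedPair i j)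
    (h : leadExp edgeExp μ = leadExp edgeExp ν) : pos (lo i) ≤ pos (lo i') := by
  by_contra hlt
  push Not at hlt
  have h1 : Finsupp.weight (letterBound (pos (lo i'))) (leadExp edgeExp μ) = 0 := by
    rw [weight_leadExp]
    refine Finset.sum_eq_zero fun j _ => ?_
    by_cases hj : j ∈ μ.support
    · have h3 := (hl j hj).1
      have h4 := (hl j hj).2.1
      have h5 := pos_lo_le j
      rw [weight_edgeExp, letterBound, letterBound, if_neg (by omega), if_neg (by omega)]; simp
    · simp [Finsupp.notMem_support_iff.1 hj]
  rw [h, weight_leadExp] at h1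
  have := (Finset.sum_eq_zero_iff.1 h1) i' (Finset.mem_univ _)
  rw [weight_edgeExp, letterBound, if_pos le_rfl] at this
  have := Finsupp.mem_support_iff.1 hi'
  simp_all

lemma pos_hi_le_of_least {μ ν : Fin 14 →₀ ℕ} {i i' : Fin 14} (hi' : i' ∈ ν.support)
    (hl' : ∀ j ∈ ν.support, SortedPair i' j) (hl : ∀ j ∈ μ.support, SortedPair i j)
    (h : leadExp edgeExp μ = leadExp edgeExp ν) : pos (hi i) ≤ pos (hi i') := by
  by_contra hlt
  push Not at hlt
  have h1 := weight_letterBound_le (μ := μ) (k := pos (hi i')) fun j hj =>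
    lt_of_lt_of_le hlt (hl j hj).2.2
  have h2 := lt_weight_letterBound hi' hl'
  have h3 := two_mul_degree μ
  have h4 := two_mul_degree ν
  rw [h] at h1 h3
  omega

/-- A standard monomial is determined by the number of times each letter occurs in it. -/
theorem leadExp_edgeExp_injOn : Set.InjOn (leadExp edgeExp) standard := by
  suffices H : ∀ n : ℕ, ∀ μ ∈ standard, ∀ ν ∈ standard, ∑ j, μ j = n →
      leadExp edgeExp μ = leadExp edgeExp ν → μ = ν from
    fun μ hμ ν hν h => H _ μ hμ ν hν rfl h
  intro n
  induction n with
  | zero =>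
    intro μ _ ν _ hn h
    have h3 := two_mul_degree μ
    have h4 := two_mul_degree ν
    rw [h] at h3
    have e1 : ∀ j, μ j = 0 := fun j => Finset.sum_eq_zero_iff.1 hn j (Finset.mem_univ _)
    have hn' : ∑ j, ν j = 0 := by omega
    have e2 : ∀ j, ν j = 0 := fun j => Finset.sum_eq_zero_iff.1 hn' j (Finset.mem_univ _)
    ext j; rw [e1, e2]
  | succ n ih =>
    intro μ hμ ν hν hn h
    have h3 := two_mul_degree μ
    have h4 := two_mul_degree ν
    rw [h] at h3
    have hμ0 : μ ≠ 0 := by rintro rfl; simp at hn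
    have hν0 : ν ≠ 0 := by rintro rfl; simp at h4; omega
    obtain ⟨i, hiμ, hl⟩ := exists_least_edge hμ hμ0
    obtain ⟨i', hiν, hl'⟩ := exists_least_edge hν hν0
    have hii : i = i' := edge_ext
      (le_antisymm (pos_lo_le_of_least hiν hl h) (pos_lo_le_of_least hiμ hl' h.symm))
      (le_antisymm (pos_hi_le_of_least hiν hl' hl h) (pos_hi_le_of_least hiμ hl hl' h.symm))
    subst hii
    have dec : ∀ {ρ : Fin 14 →₀ ℕ}, i ∈ ρ.support →
        ∃ ρ' : Fin 14 →₀ ℕ, ρ = ρ' + Finsupp.single i 1 := fun {ρ} hρ =>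
      ⟨ρ - Finsupp.single i 1, (tsub_add_cancel_of_le (Finsupp.single_le_iff.2
        (Nat.one_le_iff_ne_zero.2 (Finsupp.mem_support_iff.1 hρ)))).symm⟩
    obtain ⟨μ', rfl⟩ := dec hiμ
    obtain ⟨ν', rfl⟩ := dec hiν
    have hst : ∀ {ρ : Fin 14 →₀ ℕ}, ρ + Finsupp.single i 1 ∈ standard → ρ ∈ standard := by
      intro ρ hρ a ha b hb
      refine hρ a ?_ b ?_ <;> simp_all
    have hlead : ∀ ρ : Fin 14 →₀ ℕ, leadExp edgeExp (ρ + Finsupp.single i 1) =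
        leadExp edgeExp ρ + leadExp edgeExp (Finsupp.single i 1) := by
      intro ρ; simp [leadExp, add_smul, Finset.sum_add_distrib]
    rw [ih μ' (hst hμ) ν' (hst hν) ?_ ?_]
    · simp only [Finsupp.add_apply, Finset.sum_add_distrib] at hn
      have : ∑ j, (Finsupp.single i 1 : Fin 14 →₀ ℕ) j = 1 := by
        simp [Finsupp.single_apply]
      omega
    · rw [hlead, hlead] at h
      exact add_right_cancel h

end Sorting

/-! ### The twenty-eight relations and straightening -/

section Straightening

open MvPolynomial

/-- First variable of the leading (unsorted) term of the `k`-th relation. -/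
def leadA : Fin 28 → Fin 14 :=
  ![0, 0, 0, 0, 0, 1, 1, 1, 2, 2, 3, 3, 3, 3, 3, 4, 4, 4, 5, 6, 6, 6, 7, 8, 8, 9, 10, 11]

/-- Second variable of the leading (unsorted) term of the `k`-th relation. -/
def leadB : Fin 28 → Fin 14 :=
  ![9, 10, 11, 12, 13, 11, 12, 13, 4, 13, 4, 5, 7, 9, 11, 11, 12, 13, 13, 7, 9, 11, 13, 9, 11, 13,
    11, 13]

/-- First variable of the sorted term of the `k`-th relation. -/
def sortA : Fin 28 → Fin 14 :=
  ![1, 1, 2, 2, 3, 2, 2, 3, 1, 3, 1, 2, 2, 2, 2, 5, 5, 6, 6, 5, 5, 5, 8, 7, 7, 10, 9, 12]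

/-- Second variable of the sorted term of the `k`-th relation. -/
def sortB : Fin 28 → Fin 14 :=
  ![7, 8, 7, 8, 8, 9, 10, 10, 5, 12, 6, 6, 8, 10, 12, 9, 10, 10, 12, 8, 10, 12, 12, 10, 12, 12,
    12, 12]

/-- First variable of the first perturbation term of the `k`-th relation. -/
def pertA : Fin 28 → Fin 14 :=
  ![4, 4, 5, 5, 6, 5, 6, 6, 0, 1, 0, 0, 0, 1, 0, 7, 7, 8, 1, 0, 1, 2, 1, 4, 4, 4, 4, 1]

/-- Second variable of the first perturbation term of the `k`-th relation. -/
def pertB : Fin 28 → Fin 14 :=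
  ![5, 6, 5, 6, 6, 7, 7, 8, 7, 3, 8, 0, 1, 1, 5, 7, 8, 8, 6, 4, 4, 4, 8, 4, 5, 8, 7, 12]

/-- First variable of the second perturbation term of the `k`-th relation. -/
def pertA' : Fin 28 → Fin 14 :=
  ![1, 1, 2, 0, 3, 2, 1, 3, 1, 0, 1, 2, 2, 0, 2, 5, 1, 6, 0, 5, 5, 1, 0, 7, 1, 10, 1, 0]

/-- Second variable of the second perturbation term of the `k`-th relation. -/
def pertB' : Fin 28 → Fin 14 :=
  ![7, 8, 7, 1, 8, 9, 1, 10, 5, 6, 6, 6, 8, 4, 12, 9, 4, 10, 8, 8, 10, 5, 10, 10, 7, 12, 9, 4]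

variable {R : Type*} [CommRing R]

/-- Coefficient of the first perturbation term. -/
def pertC (l s : R) : Fin 28 → R :=
  ![-s, -s, -s, -s, -s, -s ^ 2, -s ^ 2, -s ^ 2, -s, l, -s, -(s * l), -l, -l, s ^ 2 * l, -s, -s, -s,
    l, -l, -l, -l, l, -(s * l), -(s * l), s ^ 2 * l, -(s ^ 2 * l), l]

/-- Coefficient of the second perturbation term. -/
def pertC' (l s : R) : Fin 28 → R :=
  ![0, 0, 0, -l, 0, 0, -l, 0, 0, -(s ^ 2 * l), 0, 0, 0, s ^ 2 * l, 0, 0, -l, 0, -(s * l), 0, 0, l,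
    -l, 0, l, 0, l, s ^ 2 * l ^ 2]

/-- The twenty-eight quadrics cutting out the member with parameters `l`, `s` of the two parameter
family: for `l`, `s` invertible it is `G₂`, for `l = 0` it is the image of `ℙ⁵` under the quadrics
through the cubic curve with parameter `s`. They are Plücker relations of `G(2,7)`, restricted to a
linear section. -/
def rel (l s : R) (k : Fin 28) : MvPolynomial (Fin 14) R :=
  X (leadA k) * X (leadB k) - X (sortA k) * X (sortB k) -
    C (pertC l s k) * (X (pertA k) * X (pertB k)) -
    C (pertC' l s k) * (X (pertA' k) * X (pertB' k))

/-- The ideal generated by the twenty-eight quadrics. -/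
def familyIdeal (l s : R) : Ideal (MvPolynomial (Fin 14) R) := Ideal.span (Set.range (rel l s))

/-- A weight on the fourteen variables for which the unsorted term of every relation is the heaviest
one. -/
def varWeight : Fin 14 → ℕ :=
  ![604, 809, 1216, 625, 634, 1039, 446, 1064, 469, 1291, 694, 1720, 1121, 550]

lemma varWeight_lt (k : Fin 28) :
    varWeight (sortA k) + varWeight (sortB k) < varWeight (leadA k) + varWeight (leadB k) ∧
    varWeight (pertA k) + varWeight (pertB k) < varWeight (leadA k) + varWeight (leadB k) ∧
    varWeight (pertA' k) + varWeight (pertB' k) < varWeight (leadA k) + varWeight (leadB k) := by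
  revert k; decide

set_option maxRecDepth 4000 in
lemma exists_lead_of_not_sorted : ∀ i j : Fin 14, ¬ SortedPair i j → ¬ SortedPair j i →
    ∃ k, (leadA k = i ∧ leadB k = j) ∨ (leadA k = j ∧ leadB k = i) := by
  decide

lemma not_sortedPair_lead (k : Fin 28) :
    ¬ SortedPair (leadA k) (leadB k) ∧ ¬ SortedPair (leadB k) (leadA k) := by
  revert k; decide

/-- Modulo the relations every polynomial is a combination of standard monomials. -/
theorem exists_standard_sub_mem (l s : R) (f : MvPolynomial (Fin 14) R) :
    ∃ g : MvPolynomial (Fin 14) R, (g.support : Set (Fin 14 →₀ ℕ)) ⊆ standard ∧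
      f - g ∈ familyIdeal l s := by
  classical
  let N : Submodule R (MvPolynomial (Fin 14) R) :=
    MvPolynomial.restrictSupport R standard ⊔ (familyIdeal l s).restrictScalars R
  have hN : ∀ n : ℕ, ∀ μ : Fin 14 →₀ ℕ, Finsupp.weight varWeight μ = n →
      (monomial μ (1 : R)) ∈ N := by
    intro n
    induction n using Nat.strong_induction_on with
    | _ n ih =>
      intro μ hμ
      by_cases hst : μ ∈ standard
      · refine Submodule.mem_sup_left ?_
        rw [mem_restrictSupport_iff]
        intro d hd
        rw [Finset.mem_coe, support_monomial] at hd
        split_ifs at hd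
        · simp at hd
        · rw [Finset.mem_singleton.1 hd]; exact hst
      · -- An unsorted pair of variables divides the monomial; apply the relation it leads.
        simp only [standard, Set.mem_ofPred_eq, not_forall, not_or] at hst
        obtain ⟨i, hi', j, hj, h1, h2⟩ := hst
        obtain ⟨k, hk⟩ := exists_lead_of_not_sorted i j h1 h2
        have hab : leadA k ≠ leadB k := by
          intro h
          have := (not_sortedPair_lead k).1
          rw [h] at this
          exact this ⟨le_rfl, pos_lo_le _, le_rfl⟩
        have hA : leadA k ∈ μ.support := by rcases hk with h | h <;> rw [h.1] <;> assumption
        have hB : leadB k ∈ μ.support := by rcases hk with h | h <;> rw [h.2] <;> assumption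
        have hle : Finsupp.single (leadA k) 1 + Finsupp.single (leadB k) 1 ≤ μ := by
          intro a
          have hA' := Finsupp.mem_support_iff.1 hA
          have hB' := Finsupp.mem_support_iff.1 hB
          simp only [Finsupp.add_apply, Finsupp.single_apply]
          split_ifs with e1 e2 e2
          · exact absurd (e1.trans e2.symm) hab
          · rw [← e1]; omega
          · rw [← e2]; omega
          · omega
        obtain ⟨ν, rfl⟩ := exists_add_of_le hle
        have hw := varWeight_lt k
        have hx : ∀ a b : Fin 14, (monomial ν (1 : R)) * (X a * X b) =
            monomial (Finsupp.single a 1 + Finsupp.single b 1 + ν) 1 := by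
          intro a b
          rw [X, X, monomial_mul, monomial_mul]
          simp [add_comm]
        have hlt : ∀ a b : Fin 14, varWeight a + varWeight b <
            varWeight (leadA k) + varWeight (leadB k) → monomial ν (1 : R) * (X a * X b) ∈ N := by
          intro a b h
          rw [hx]
          refine ih _ ?_ _ rfl
          rw [← hμ]
          simp only [map_add, Finsupp.weight_single, smul_eq_mul, one_mul]
          omega
        have e : monomial (Finsupp.single (leadA k) 1 + Finsupp.single (leadB k) 1 + ν) (1 : R) =
            monomial ν 1 * rel l s k + monomial ν 1 * (X (sortA k) * X (sortB k)) +
            pertC l s k • (monomial ν 1 * (X (pertA k) * X (pertB k))) +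
            pertC' l s k • (monomial ν 1 * (X (pertA' k) * X (pertB' k))) := by
          rw [← hx, rel, smul_eq_C_mul, smul_eq_C_mul]; ring
        rw [e]
        refine add_mem (add_mem (add_mem ?_ (hlt _ _ hw.1)) (N.smul_mem _ (hlt _ _ hw.2.1)))
          (N.smul_mem _ (hlt _ _ hw.2.2))
        exact Submodule.mem_sup_right (Ideal.mul_mem_left _ _ (Ideal.subset_span ⟨k, rfl⟩))
  have hf : f ∈ N := by
    rw [f.as_sum]
    refine sum_mem fun μ _ => ?_
    have : monomial μ (coeff μ f) = coeff μ f • monomial μ (1 : R) := by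
      rw [smul_monomial, smul_eq_mul, mul_one]
    rw [this]
    exact N.smul_mem _ (hN _ μ rfl)
  obtain ⟨g, hg, h, hh, rfl⟩ := Submodule.mem_sup.1 hf
  exact ⟨g, (mem_restrictSupport_iff R).1 hg, by simpa using hh⟩

/-- If the relations vanish on forms with leading monomials as prescribed, they generate all
polynomial relations among these forms. -/
theorem ker_aeval_eq_familyIdeal {τ : Type*} {w : τ → ℕ} {P : Fin 14 → MvPolynomial τ R}
    {e : Fin 14 → (τ →₀ ℕ)} (h : ∀ i, HasLead w (P i) (e i))
    (he : Set.InjOn (leadExp e) standard) (l s : R) (hrel : ∀ k, aeval P (rel l s k) = 0)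
    (f : MvPolynomial (Fin 14) R) : aeval P f = 0 ↔ f ∈ familyIdeal l s := by
  have hle : familyIdeal l s ≤ RingHom.ker (aeval P : MvPolynomial (Fin 14) R →ₐ[R] _) :=
    Ideal.span_le.2 (by rintro _ ⟨k, rfl⟩; exact hrel k)
  refine ⟨fun hf => ?_, fun hf => hle hf⟩
  obtain ⟨g, hg, hfg⟩ := exists_standard_sub_mem l s f
  have h1 : aeval P g = 0 := by
    have := hle hfg
    rw [RingHom.mem_ker, map_sub, hf, zero_sub, neg_eq_zero] at this
    exact this
  rw [eq_zero_of_aeval_eq_zero h he hg h1, sub_zero] at hfg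
  exact hfg

/-- If the relations vanish on forms with leading monomials as prescribed, the quotient by them is a
free module, with basis the standard monomials. -/
theorem free_quotient_familyIdeal {τ : Type*} {w : τ → ℕ} {P : Fin 14 → MvPolynomial τ R}
    {e : Fin 14 → (τ →₀ ℕ)} (h : ∀ i, HasLead w (P i) (e i))
    (he : Set.InjOn (leadExp e) standard) (l s : R) (hrel : ∀ k, aeval P (rel l s k) = 0) :
    Module.Free R (MvPolynomial (Fin 14) R ⧸ familyIdeal l s) := by
  let φ : MvPolynomial.restrictSupport R standard →ₗ[R]
      (MvPolynomial (Fin 14) R ⧸ familyIdeal l s) :=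
    ((Ideal.Quotient.mkₐ R (familyIdeal l s)).toLinearMap).comp (Submodule.subtype _)
  have hφ : Function.Bijective φ := by
    constructor
    · rw [← LinearMap.ker_eq_bot, LinearMap.ker_eq_bot']
      rintro ⟨g, hg⟩ h0
      have h1 : g ∈ familyIdeal l s := by
        have : Ideal.Quotient.mk (familyIdeal l s) g = 0 := h0
        exact Ideal.Quotient.eq_zero_iff_mem.1 this
      have h2 := (ker_aeval_eq_familyIdeal h he l s hrel g).2 h1
      exact Subtype.ext (eq_zero_of_aeval_eq_zero h he ((mem_restrictSupport_iff R).1 hg) h2)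
    · intro y
      obtain ⟨f, rfl⟩ := Ideal.Quotient.mk_surjective y
      obtain ⟨g, hg, hfg⟩ := exists_standard_sub_mem l s f
      exact ⟨⟨g, (mem_restrictSupport_iff R).2 hg⟩, (Ideal.Quotient.eq.2 hfg).symm⟩
  have : Module.Free R (MvPolynomial.restrictSupport R (standard : Set (Fin 14 →₀ ℕ))) :=
    Module.Free.of_basis (basisRestrictSupport R standard)
  exact Module.Free.of_equiv (LinearEquiv.ofBijective φ hφ)

attribute [local instance] MvPolynomial.gradedAlgebra in
lemma homogeneousComponent_mem_familyIdeal (l s : R) {f : MvPolynomial (Fin 14) R}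
    (hf : f ∈ familyIdeal l s) (d : ℕ) : homogeneousComponent d f ∈ familyIdeal l s := by
  have h : (familyIdeal l s).IsHomogeneous (homogeneousSubmodule (Fin 14) R) := by
    refine Ideal.homogeneous_span _ _ ?_
    rintro _ ⟨k, rfl⟩
    refine ⟨2, ?_⟩
    rw [mem_homogeneousSubmodule]
    have hX : ∀ a b : Fin 14, (X a * X b : MvPolynomial (Fin 14) R).IsHomogeneous 2 :=
      fun a b => (isHomogeneous_X R a).mul (isHomogeneous_X R b)
    have hC : ∀ (c : R) (a b : Fin 14),
        (C c * (X a * X b) : MvPolynomial (Fin 14) R).IsHomogeneous 2 := fun c a b => by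
      simpa using (isHomogeneous_C (Fin 14) c).mul (hX a b)
    exact ((((hX _ _).sub (hX _ _))).sub (hC _ _ _)).sub (hC _ _ _)
  exact MvPolynomial.homogeneousComponent_mem_of_mem h hf d

end Straightening

/-! ### Parametrizations -/

section Parametrization

open MvPolynomial

/-- The fourteen quadrics through the cubic curve with parameter `s`, in coordinates
`(x, y, z, t, u, v) = (p 0, …, p 5)`. -/
def quadricVal {A : Type*} [CommRing A] (s : A) (p : Fin 6 → A) : Fin 14 → A :=
  ![p 1 * p 3 - s * p 0 ^ 2, p 2 * p 3 - s ^ 2 * (p 0 * p 1), p 3 * p 4, p 3 * p 5,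
    p 0 * p 2 - s * p 1 ^ 2, p 0 * p 4, p 0 * p 5, p 1 * p 4, p 1 * p 5, p 2 * p 4, p 2 * p 5,
    p 4 ^ 2, p 4 * p 5, p 5 ^ 2]

/-- Homogenization, by powers of `u = p 4`, of the Plücker coordinates of the plane spanned by
`(1, 0, s x, y, z, s l q₃, v)` and `(0, 1, t, x, s y, v + l q₂, - s l q₁)`, where
`q₁ = y t - s x ^ 2`, `q₂ = z t - s ^ 2 x y`, `q₃ = x z - s y ^ 2`. -/
def quarticVal {A : Type*} [CommRing A] (l s : A) (p : Fin 6 → A) : Fin 14 → A :=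
  fun j => p 4 ^ 2 * quadricVal s p j +
    (![0, 0, 0, s ^ 2 * l * p 4 * p 0 * (p 1 * p 3 - s * p 0 ^ 2), 0, 0,
      s * l * p 4 * p 1 * (p 1 * p 3 - s * p 0 ^ 2), 0,
      l * p 4 * (p 1 * (p 2 * p 3 - s ^ 2 * (p 0 * p 1)) - s * p 0 * (p 0 * p 2 - s * p 1 ^ 2)), 0,
      l * p 4 * (p 2 * (p 2 * p 3 - s ^ 2 * (p 0 * p 1)) - s ^ 2 * p 1 * (p 0 * p 2 - s * p 1 ^ 2)),
      0, 0,
      l * p 4 * p 5 * (p 2 * p 3 - s ^ 2 * (p 0 * p 1)) +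
        s ^ 2 * l ^ 2 * ((p 1 * p 3 - s * p 0 ^ 2) * (p 0 * p 2 - s * p 1 ^ 2))] : Fin 14 → A) j

/-- The weight of the six letters for which the `j`-th monomial of the list is the lightest one in the
`j`-th quadric. -/
def letterWeight : Fin 6 → ℕ := ![3, 3, 2, 2, 0, 3]

/-- The relations hold between the quartics. -/
lemma quarticVal_rel {A : Type*} [CommRing A] (l s : A) (p : Fin 6 → A) (k : Fin 28) :
    eval (quarticVal l s p) (rel l s k) = 0 := by
  fin_cases k <;>
  simp [rel, quarticVal, quadricVal, leadA, leadB, sortA, sortB, pertA, pertB, pertA', pertB',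
    pertC, pertC'] <;> ring

/-- The relations with `l = 0` hold between the quadrics. -/
lemma quadricVal_rel {A : Type*} [CommRing A] (s : A) (p : Fin 6 → A) (k : Fin 28) :
    eval (quadricVal s p) (rel 0 s k) = 0 := by
  fin_cases k <;>
  simp [rel, quadricVal, leadA, leadB, sortA, sortB, pertA, pertB, pertA', pertB',
    pertC, pertC'] <;> ring

variable {R : Type*} [CommRing R]

/-- The quadrics through the cubic curve with parameter `s`, as polynomials. -/
def quadric (s : R) : Fin 14 → MvPolynomial (Fin 6) R := quadricVal (C s) X

/-- The quartics parametrizing the member with parameters `l`, `s`, as polynomials. -/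
def quartic (l s : R) : Fin 14 → MvPolynomial (Fin 6) R := quarticVal (C l) (C s) X

lemma aeval_rel {τ : Type*} (l s : R) (P : Fin 14 → MvPolynomial τ R) (k : Fin 28) :
    aeval P (rel l s k) = eval P (rel (C l) (C s) k) := by
  have h1 : C (pertC l s k) = (pertC (C l) (C s) k : MvPolynomial τ R) := by
    fin_cases k <;> simp [pertC]
  have h2 : C (pertC' l s k) = (pertC' (C l) (C s) k : MvPolynomial τ R) := by
    fin_cases k <;> simp [pertC']
  simp only [rel, map_sub, map_mul, aeval_X, eval_X, algHom_C, eval_C, algebraMap_eq, h1, h2]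

lemma aeval_quartic_rel (l s : R) (k : Fin 28) : aeval (quartic l s) (rel l s k) = 0 := by
  rw [aeval_rel]; exact quarticVal_rel _ _ _ _

lemma aeval_quadric_rel (s : R) (k : Fin 28) : aeval (quadric s) (rel 0 s k) = 0 := by
  rw [aeval_rel, C_0]; exact quadricVal_rel _ _ _

lemma hasLead_of_terms {τ : Type*} {w : τ → ℕ} {f : MvPolynomial τ R} (M : List τ)
    (T : List (R × List τ)) (hT : ∀ t ∈ T, (M.map w).sum < (t.2.map w).sum)
    (h : f = (M.map X).prod + (T.map fun t => C t.1 * (t.2.map X).prod).sum) {e : τ →₀ ℕ}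
    (he : e = (M.map fun a => Finsupp.single a 1).sum) : HasLead w f e := by
  have key : ∀ N : List τ, ((N.map X).prod : MvPolynomial τ R) =
      monomial (N.map fun a => Finsupp.single a 1).sum 1 := by
    intro N
    induction N with
    | nil => simp
    | cons a N ih =>
      rw [List.map_cons, List.prod_cons, ih, X, monomial_mul, List.map_cons, List.sum_cons, one_mul]
  have hw : ∀ N : List τ,
      Finsupp.weight w (N.map fun a => Finsupp.single a 1).sum = (N.map w).sum := by
    intro N
    induction N with
    | nil => simp
    | cons a N ih => simp [ih, Finsupp.weight_single]
  unfold HasLead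
  rw [h, key, he, add_sub_cancel_left]
  refine list_sum_mem ?_
  intro g hg
  obtain ⟨t, ht, rfl⟩ := List.mem_map.1 hg
  rw [← smul_eq_C_mul, key]
  refine Submodule.smul_mem _ _ (highWeight_anti ?_ (monomial_mem_highWeight w _ (1 : R)))
  rw [hw, hw]
  exact hT t ht

lemma hasLead_quadric (s : R) (j : Fin 14) : HasLead letterWeight (quadric s j) (edgeExp j) := by
  refine hasLead_of_terms [lo j, hi j]
    ((![[(-s, [0, 0])], [(-s ^ 2, [0, 1])], [], [], [(-s, [1, 1])], [], [], [], [], [], [], [], [],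
      []] : Fin 14 → List (R × List (Fin 6))) j) ?_ ?_ ?_
  · fin_cases j <;> simp [letterWeight, lo, hi]
  · fin_cases j <;> simp [quadric, quadricVal, lo, hi] <;> ring
  · simp [edgeExp]

/-- The leading exponent of the `j`-th quartic. -/
def quarticExp (j : Fin 14) : Fin 6 →₀ ℕ := edgeExp j + Finsupp.single 4 2

lemma hasLead_quartic (l s : R) (j : Fin 14) :
    HasLead letterWeight (quartic l s j) (quarticExp j) := by
  refine hasLead_of_terms [lo j, hi j, 4, 4]
    ((![[(-s, [0, 0, 4, 4])], [(-s ^ 2, [0, 1, 4, 4])], [],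
      [(s ^ 2 * l, [4, 0, 1, 3]), (-(s ^ 3 * l), [4, 0, 0, 0])],
      [(-s, [1, 1, 4, 4])], [], [(s * l, [4, 1, 1, 3]), (-(s ^ 2 * l), [4, 1, 0, 0])], [],
      [(l, [4, 1, 2, 3]), (-(s * l), [4, 0, 0, 2])], [],
      [(l, [4, 2, 2, 3]), (-(s ^ 2 * l), [4, 2, 0, 1]), (-(s ^ 2 * l), [4, 1, 0, 2]), (s ^ 3 * l, [4, 1, 1, 1])], [], [],
      [(l, [4, 5, 2, 3]), (-(s ^ 2 * l), [4, 5, 0, 1]), (s ^ 2 * l ^ 2, [1, 3, 0, 2]),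
        (-(s ^ 3 * l ^ 2), [1, 3, 1, 1]), (-(s ^ 3 * l ^ 2), [0, 0, 0, 2]),
        (s ^ 4 * l ^ 2, [0, 0, 1, 1])]] : Fin 14 → List (R × List (Fin 6))) j) ?_ ?_ ?_
  · fin_cases j <;> simp [letterWeight, lo, hi]
  · fin_cases j <;> simp [quartic, quarticVal, quadricVal, lo, hi] <;> ring
  · simp [quarticExp, edgeExp, ← Finsupp.single_add, add_assoc]

lemma leadExp_quarticExp_injOn : Set.InjOn (leadExp quarticExp) standard := by
  have hl : ∀ ρ : Fin 14 →₀ ℕ, leadExp quarticExp ρ =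
      leadExp edgeExp ρ + (∑ j, ρ j) • Finsupp.single 4 2 := by
    intro ρ; simp [leadExp, quarticExp, Finset.sum_add_distrib, Finset.sum_smul]
  intro μ hμ ν hν h
  rw [hl, hl] at h
  have h1 := congrArg (Finsupp.weight (fun _ : Fin 6 => 1)) h
  simp only [map_add, two_mul_degree, map_nsmul, Finsupp.weight_single, smul_eq_mul] at h1
  have h2 : ∑ j, μ j = ∑ j, ν j := by omega
  rw [h2] at h
  exact leadExp_edgeExp_injOn hμ hν (add_right_cancel h)

/-- All polynomial relations between the quadrics are generated by the twenty-eight ones. -/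
theorem imageIdeal_quadric {R : Type} [CommRing R] (s : R) :
    imageIdeal (quadric s) = familyIdeal 0 s := by
  ext f
  exact ker_aeval_eq_familyIdeal (hasLead_quadric s) leadExp_edgeExp_injOn 0 s
    (aeval_quadric_rel s) f

theorem aeval_quartic_eq_zero_iff (l s : R) (f : MvPolynomial (Fin 14) R) :
    aeval (quartic l s) f = 0 ↔ f ∈ familyIdeal l s :=
  ker_aeval_eq_familyIdeal (hasLead_quartic l s) leadExp_quarticExp_injOn l s
    (aeval_quartic_rel l s) f

/-- Every member of the two parameter family over a ring is flat over this ring. -/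
theorem isFlatFamilyOverDisc_familyIdeal (l s : HolRing) :
    IsFlatFamilyOverDisc (familyIdeal l s) where
  fg := ⟨(Set.finite_range (rel l s)).toFinset, by simp [familyIdeal]⟩
  homogeneous _ hf d := homogeneousComponent_mem_familyIdeal l s hf d
  flat := by
    have := free_quotient_familyIdeal (hasLead_quartic l s) leadExp_quarticExp_injOn l s
      (aeval_quartic_rel l s)
    infer_instance

theorem map_familyIdeal {S : Type*} [CommRing S] (φ : R →+* S) (l s : R) :
    (familyIdeal l s).map (MvPolynomial.map φ) = familyIdeal (φ l) (φ s) := by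
  have h1 : ∀ k, φ (pertC l s k) = pertC (φ l) (φ s) k := by intro k; fin_cases k <;> simp [pertC]
  have h2 : ∀ k, φ (pertC' l s k) = pertC' (φ l) (φ s) k := by
    intro k; fin_cases k <;> simp [pertC']
  rw [familyIdeal, Ideal.map_span, familyIdeal, ← Set.range_comp]
  congr 2
  funext k
  simp [rel, h1, h2]

theorem fibreIdeal_familyIdeal (l s : HolRing) (c : Disc) :
    fibreIdeal (familyIdeal l s) c = familyIdeal (HolRing.ev c l) (HolRing.ev c s) :=
  map_familyIdeal (HolRing.ev c) l s

end Parametrization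

/-! ### The cubic curves and the quadrics through them -/

section Curves

open MvPolynomial

lemma rank_le_one_iff_minors (a b c d e f : ℂ) :
    (!![a, b, c; d, e, f] : Matrix (Fin 2) (Fin 3) ℂ).rank ≤ 1 ↔
      a * e = b * d ∧ a * f = c * d ∧ b * f = c * e := by
  have hrow : (!![a, b, c; d, e, f] : Matrix (Fin 2) (Fin 3) ℂ).row = ![![a, b, c], ![d, e, f]] := by
    ext i j; fin_cases i <;> rfl
  have h2 : (!![a, b, c; d, e, f] : Matrix (Fin 2) (Fin 3) ℂ).rank ≤ 1 ↔
      ¬ LinearIndependent ℂ (!![a, b, c; d, e, f] : Matrix (Fin 2) (Fin 3) ℂ).row := by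
    rw [← Matrix.rank_transpose, Matrix.rank_eq_finrank_span_cols,
      linearIndependent_iff_card_eq_finrank_span,      Fintype.card_fin]
    have hle : (Set.range (!![a, b, c; d, e, f] : Matrix (Fin 2) (Fin 3) ℂ).row).finrank ℂ ≤ 2 := by
      simpa using finrank_range_le_card (R := ℂ)
        (b := (!![a, b, c; d, e, f] : Matrix (Fin 2) (Fin 3) ℂ).row)
    have e1 : Module.finrank ℂ (Submodule.span ℂ (Set.range
        (!![a, b, c; d, e, f] : Matrix (Fin 2) (Fin 3) ℂ).transpose.col)) =
        (Set.range (!![a, b, c; d, e, f] : Matrix (Fin 2) (Fin 3) ℂ).row).finrank ℂ := rfl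
    rw [e1]; omega
  rw [h2, hrow, LinearIndependent.pair_iff]
  constructor
  · intro h
    refine ⟨?_, ?_, ?_⟩ <;> by_contra hne <;> apply h <;> intro p q hpq
    all_goals
      have h0 := congrFun hpq 0
      have h1 := congrFun hpq 1
      have h2 := congrFun hpq 2
      simp at h0 h1 h2
    · have hne' := sub_ne_zero.2 hne
      constructor
      · apply (mul_eq_zero.1 (?_ : p * (a * e - b * d) = 0)).resolve_right hne'
        linear_combination e * h0 - d * h1
      · apply (mul_eq_zero.1 (?_ : q * (a * e - b * d) = 0)).resolve_right hne'
        linear_combination a * h1 - b * h0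
    · have hne' := sub_ne_zero.2 hne
      constructor
      · apply (mul_eq_zero.1 (?_ : p * (a * f - c * d) = 0)).resolve_right hne'
        linear_combination f * h0 - d * h2
      · apply (mul_eq_zero.1 (?_ : q * (a * f - c * d) = 0)).resolve_right hne'
        linear_combination a * h2 - c * h0
    · have hne' := sub_ne_zero.2 hne
      constructor
      · apply (mul_eq_zero.1 (?_ : p * (b * f - c * e) = 0)).resolve_right hne'
        linear_combination f * h1 - e * h2
      · apply (mul_eq_zero.1 (?_ : q * (b * f - c * e) = 0)).resolve_right hne'
        linear_combination b * h2 - c * h1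
  · rintro ⟨h1, h2, h3⟩ h
    have k1 := h d (-a) (by
      ext i
      fin_cases i <;> simp
      · ring
      · linear_combination -h1
      · linear_combination -h2)
    have k2 := h e (-b) (by
      ext i
      fin_cases i <;> simp
      · linear_combination h1
      · ring
      · linear_combination -h3)
    have k3 := h f (-c) (by
      ext i
      fin_cases i <;> simp
      · linear_combination h2
      · linear_combination h3
      · ring)
    have k4 := h 1 0 (by
      ext i
      fin_cases i <;> simp
      · simpa using k1.2
      · simpa using k2.2
      · simpa using k3.2)
    exact one_ne_zero k4.1

lemma mem_cubicCone_iff (s : ℂ) (p : Fin 6 → ℂ) : p ∈ cubicCone s ↔ p 4 = 0 ∧ p 5 = 0 ∧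
    s * p 0 * p 0 = p 1 * p 3 ∧ s * p 0 * (s * p 1) = p 2 * p 3 ∧ p 1 * (s * p 1) = p 2 * p 0 := by
  show _ ∧ _ ∧ _ ↔ _
  rw [rank_le_one_iff_minors]

lemma linearIndependent_smul_single {n : ℕ} (c : Fin 4 → ℂ) (hc : ∀ i, c i ≠ 0)
    (f : Fin 4 → Fin n) (hf : Function.Injective f) :
    LinearIndependent ℂ fun i => (Pi.single (f i) (c i) : Fin n → ℂ) := by
  have h := ((Pi.basisFun ℂ (Fin n)).linearIndependent.comp f hf).units_smul
    (fun i => Units.mk0 (c i) (hc i))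
  convert h using 2 with i
  simp [Units.smul_def, ← Pi.single_smul]

theorem isTwistedCubicCone_cubicCone {s : ℂ} (hs : s ≠ 0) : IsTwistedCubicCone (cubicCone s) := by
  refine ⟨fun i => Pi.single ((![3, 0, 1, 2] : Fin 4 → Fin 6) i) ((![s, 1, 1, s] : Fin 4 → ℂ) i),
    linearIndependent_smul_single _ ?_ _ (by decide), ?_⟩
  · intro i; fin_cases i <;> simp [hs]
  ext p
  have hp : ∀ a b : ℂ, (p = ∑ j : Fin 4, (a ^ (3 - (j : ℕ)) * b ^ (j : ℕ)) •
      (Pi.single ((![3, 0, 1, 2] : Fin 4 → Fin 6) j) ((![s, 1, 1, s] : Fin 4 → ℂ) j) : Fin 6 → ℂ)) ↔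
      p 0 = a ^ 2 * b ∧ p 1 = a * b ^ 2 ∧ p 2 = b ^ 3 * s ∧ p 3 = a ^ 3 * s ∧ p 4 = 0 ∧ p 5 = 0 := by
    intro a b
    rw [funext_iff]
    simp [Fin.forall_fin_succ, Fin.sum_univ_four, Pi.single_apply]
  rw [mem_cubicCone_iff]
  simp only [Set.mem_ofPred_eq, hp]
  constructor
  · rintro ⟨h4, h5, h1, h2, h3⟩
    obtain ⟨a, ha⟩ := IsAlgClosed.exists_pow_nat_eq (p 3 / s) (n := 3) (by norm_num)
    have ha' : p 3 = a ^ 3 * s := by rw [ha]; field_simp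
    by_cases ha0 : a = 0
    · -- The point lies over the point `t = 0` of the curve.
      obtain ⟨b, hb⟩ := IsAlgClosed.exists_pow_nat_eq (p 2 / s) (n := 3) (by norm_num)
      have hb' : p 2 = b ^ 3 * s := by rw [hb]; field_simp
      have hp3 : p 3 = 0 := by rw [ha', ha0]; ring
      have hp0 : p 0 = 0 := by
        rw [hp3, mul_zero] at h1
        simpa [hs] using h1
      have hp1 : p 1 = 0 := by
        rw [hp0, mul_zero] at h3
        simpa [hs] using h3
      exact ⟨0, b, by simp [hp0], by simp [hp1], hb', by simp [hp3], h4, h5⟩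
    · refine ⟨a, p 0 / a ^ 2, by field_simp, ?_, ?_, ha', h4, h5⟩
      · have : s * (p 1 * a ^ 3) = s * (p 0 ^ 2) := by rw [ha'] at h1; linear_combination -h1
        have := mul_left_cancel₀ hs this
        field_simp
        linear_combination this
      · have e1 : s * (p 1 * a ^ 3) = s * (p 0 ^ 2) := by rw [ha'] at h1; linear_combination -h1
        have e1 := mul_left_cancel₀ hs e1
        have e2 : s * (p 2 * a ^ 3) = s * (s * p 0 * p 1) := by
          rw [ha'] at h2; linear_combination -h2
        have e2 := mul_left_cancel₀ hs e2
        have ha3 : a ^ 3 ≠ 0 := pow_ne_zero _ ha0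
        apply mul_right_cancel₀ (pow_ne_zero 2 ha3)
        field_simp
        linear_combination a ^ 3 * e2 + s * p 0 * e1
  · rintro ⟨a, b, h0, h1, h2, h3, h4, h5⟩
    refine ⟨h4, h5, ?_, ?_, ?_⟩ <;> rw [h0, h1]
    · rw [h3]; ring
    · rw [h2, h3]; ring
    · rw [h2]; ring

theorem isChainOfThreeLinesCone_cubicCone : IsChainOfThreeLinesCone (cubicCone 0) := by
  refine ⟨fun i => Pi.single ((![3, 0, 1, 2] : Fin 4 → Fin 6) i) 1,
    linearIndependent_smul_single _ (fun _ => one_ne_zero) _ (by decide), ?_⟩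
  have hspan : ∀ (a b : Fin 6) (p : Fin 6 → ℂ), p ∈ Submodule.span ℂ
      {(Pi.single a 1 : Fin 6 → ℂ), Pi.single b 1} ↔ ∃ c d : ℂ,
        c • (Pi.single a 1 : Fin 6 → ℂ) + d • Pi.single b 1 = p := fun a b p =>
    Submodule.mem_span_pair
  ext p
  rw [mem_cubicCone_iff]
  simp only [Set.mem_union, SetLike.mem_coe, hspan]
  constructor
  · rintro ⟨h4, h5, h1, h2, h3⟩
    have key : (p 1 = 0 ∧ p 2 = 0) ∨ (p 2 = 0 ∧ p 3 = 0) ∨ (p 3 = 0 ∧ p 0 = 0) := by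
      simp only [zero_mul, mul_zero, zero_eq_mul] at h1 h2 h3
      tauto
    rcases key with ⟨e1, e2⟩ | ⟨e1, e2⟩ | ⟨e1, e2⟩
    · refine Or.inl (Or.inl ⟨p 3, p 0, ?_⟩)
      ext i; fin_cases i <;> simp [*]
    · refine Or.inl (Or.inr ⟨p 0, p 1, ?_⟩)
      ext i; fin_cases i <;> simp [*]
    · refine Or.inr ⟨p 1, p 2, ?_⟩
      ext i; fin_cases i <;> simp [*]
  · rintro ((⟨c, d, rfl⟩ | ⟨c, d, rfl⟩) | ⟨c, d, rfl⟩) <;> simp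

/-- The degree two monomials not occurring in the list of the fourteen, as pairs of letters. -/
def nonEdge : Fin 7 → Fin 6 × Fin 6 := ![(0, 0), (1, 1), (2, 2), (3, 3), (3, 0), (0, 1), (1, 2)]

/-- The exponent of the `n`-th degree two monomial not in the list of the fourteen. -/
def nonEdgeExp (n : Fin 7) : Fin 6 →₀ ℕ :=
  Finsupp.single (nonEdge n).1 1 + Finsupp.single (nonEdge n).2 1

lemma edge_or_nonEdge (a b : Fin 6) : (∃ j, (lo j = a ∧ hi j = b) ∨ (lo j = b ∧ hi j = a)) ∨
    ∃ n, nonEdge n = (a, b) ∨ nonEdge n = (b, a) := by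
  revert a b; decide

lemma exists_edgeExp_or_nonEdgeExp {d : Fin 6 →₀ ℕ} (hd : d.degree = 2) :
    (∃ j, d = edgeExp j) ∨ ∃ n, d = nonEdgeExp n := by
  have h0 : d ≠ 0 := by rintro rfl; simp at hd
  obtain ⟨a, ha⟩ := Finsupp.support_nonempty_iff.2 h0
  obtain ⟨e, rfl⟩ := exists_add_of_le (Finsupp.single_le_iff.2
    (Nat.one_le_iff_ne_zero.2 (Finsupp.mem_support_iff.1 ha)))
  rw [map_add, Finsupp.degree_single] at hd
  have h1 : e ≠ 0 := by rintro rfl; simp at hd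
  obtain ⟨b, hb⟩ := Finsupp.support_nonempty_iff.2 h1
  obtain ⟨f, rfl⟩ := exists_add_of_le (Finsupp.single_le_iff.2
    (Nat.one_le_iff_ne_zero.2 (Finsupp.mem_support_iff.1 hb)))
  rw [map_add, Finsupp.degree_single] at hd
  have hf : f = 0 := (Finsupp.degree_eq_zero_iff f).1 (by omega)
  subst hf
  rw [add_zero]
  rcases edge_or_nonEdge a b with ⟨j, hj⟩ | ⟨n, hn⟩
  · refine Or.inl ⟨j, ?_⟩
    rcases hj with ⟨rfl, rfl⟩ | ⟨rfl, rfl⟩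
    · rfl
    · rw [edgeExp, add_comm]
  · refine Or.inr ⟨n, ?_⟩
    rcases hn with h | h <;> rw [nonEdgeExp, h]
    rw [add_comm]

lemma nonEdgeExp_injective : Function.Injective nonEdgeExp := by
  intro m n h
  have h' : ∀ a : Fin 6, ((if (nonEdge m).1 = a then 1 else 0) + if (nonEdge m).2 = a then 1 else 0)
      = ((if (nonEdge n).1 = a then 1 else 0) + if (nonEdge n).2 = a then 1 else 0) := by
    intro a
    have := DFunLike.congr_fun h a
    simpa [nonEdgeExp, Finsupp.single_apply] using this
  clear h
  revert m n; decide

lemma eq_zero_of_forall_sum_mul_pow_eq_zero {n : ℕ} (a : Fin n → ℂ)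
    (h : ∀ x : ℂ, ∑ i, a i * x ^ (i : ℕ) = 0) (i : Fin n) : a i = 0 := by
  have hq : ∑ i : Fin n, Polynomial.monomial (i : ℕ) (a i) = 0 := Polynomial.funext fun x => by
    rw [Polynomial.eval_finsetSum]
    simpa using h x
  have := congrArg (fun q => Polynomial.coeff q i) hq
  simpa [Polynomial.finsetSum_coeff, Polynomial.coeff_monomial, Fin.val_inj] using this

/-- A quadratic form without the fourteen monomials which vanishes on the cubic cone is zero. -/
lemma eq_zero_of_vanish_of_coeff {s : ℂ} {f : MvPolynomial (Fin 6) ℂ} (hf : f.IsHomogeneous 2)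
    (hv : ∀ p ∈ cubicCone s, eval p f = 0) (hc : ∀ j, coeff (edgeExp j) f = 0) : f = 0 := by
  classical
  have hsub : f.support ⊆ Finset.univ.image nonEdgeExp := by
    intro d hd
    have hd' := mem_support_iff.1 hd
    have : d.degree = 2 := by
      rw [Finsupp.degree_eq_weight_one]
      exact hf hd'
    rcases exists_edgeExp_or_nonEdgeExp this with ⟨j, rfl⟩ | ⟨n, rfl⟩
    · exact absurd (hc j) hd'
    · exact Finset.mem_image_of_mem _ (Finset.mem_univ n)
  have hsum : f = ∑ n, monomial (nonEdgeExp n) (coeff (nonEdgeExp n) f) := by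
    conv_lhs => rw [f.as_sum]
    rw [Finset.sum_subset hsub (fun d _ hd => by
      rw [notMem_support_iff.1 hd, monomial_zero]), Finset.sum_image (nonEdgeExp_injective.injOn)]
  set c : Fin 7 → ℂ := fun n => coeff (nonEdgeExp n) f with hcdef
  have heval : ∀ p : Fin 6 → ℂ, eval p f = c 0 * p 0 ^ 2 + c 1 * p 1 ^ 2 + c 2 * p 2 ^ 2 +
      c 3 * p 3 ^ 2 + c 4 * (p 3 * p 0) + c 5 * (p 0 * p 1) + c 6 * (p 1 * p 2) := by
    intro p
    have hm : ∀ n, eval p (monomial (nonEdgeExp n) (coeff (nonEdgeExp n) f)) =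
        c n * (p (nonEdge n).1 * p (nonEdge n).2) := by
      intro n
      rw [eval_monomial, nonEdgeExp, Finsupp.prod_add_index' (by simp) (by intros; ring),
        Finsupp.prod_single_index (by simp), Finsupp.prod_single_index (by simp), pow_one, pow_one]
      rfl
    rw [hsum, map_sum, Finset.sum_congr rfl fun n _ => hm n]
    simp [Fin.sum_univ_succ, nonEdge]
    ring
  suffices h : ∀ n, c n = 0 by
    rw [hsum]
    exact Finset.sum_eq_zero fun n _ => by
      have : coeff (nonEdgeExp n) f = 0 := h n
      rw [this, monomial_zero]
  by_cases hs : s = 0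
  · subst hs
    have hv' : ∀ p : Fin 6 → ℂ, p 4 = 0 → p 5 = 0 → p 1 * p 3 = 0 → p 2 * p 3 = 0 →
        p 2 * p 0 = 0 → eval p f = 0 := fun p h4 h5 h1 h2 h3 => hv p
      ((mem_cubicCone_iff 0 p).2 ⟨h4, h5, by simp [h1], by simp [h2], by simp [h3]⟩)
    have e0 := hv' ![1, 0, 0, 0, 0, 0] (by simp) (by simp) (by simp) (by simp) (by simp)
    have e1 := hv' ![0, 1, 0, 0, 0, 0] (by simp) (by simp) (by simp) (by simp) (by simp)
    have e2 := hv' ![0, 0, 1, 0, 0, 0] (by simp) (by simp) (by simp) (by simp) (by simp)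
    have e3 := hv' ![0, 0, 0, 1, 0, 0] (by simp) (by simp) (by simp) (by simp) (by simp)
    have e4 := hv' ![1, 0, 0, 1, 0, 0] (by simp) (by simp) (by simp) (by simp) (by simp)
    have e5 := hv' ![1, 1, 0, 0, 0, 0] (by simp) (by simp) (by simp) (by simp) (by simp)
    have e6 := hv' ![0, 1, 1, 0, 0, 0] (by simp) (by simp) (by simp) (by simp) (by simp)
    rw [heval] at e0 e1 e2 e3 e4 e5 e6
    simp at e0 e1 e2 e3 e4 e5 e6
    rw [e0, e3] at e4
    rw [e0, e1] at e5
    rw [e1, e2] at e6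
    simp only [zero_add] at e4 e5 e6
    clear_value c
    intro n; fin_cases n <;> assumption
  · -- The points `(a ^ 2, a, s, s a ^ 3)` of the affine part of the twisted cubic.
    have hp : ∀ a : ℂ, c 3 * s ^ 2 * a ^ 6 + c 4 * s * a ^ 5 + c 0 * a ^ 4 + c 5 * a ^ 3 +
        c 1 * a ^ 2 + c 6 * s * a + c 2 * s ^ 2 = 0 := by
      intro a
      have := hv ![a ^ 2, a, s, s * a ^ 3, 0, 0] ((mem_cubicCone_iff s _).2
        ⟨by simp, by simp, by simp; ring, by simp; ring, by simp; ring⟩)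
      rw [heval] at this
      simp at this
      linear_combination this
    have hz := eq_zero_of_forall_sum_mul_pow_eq_zero
      ![c 2 * s ^ 2, c 6 * s, c 1, c 5, c 0, c 4 * s, c 3 * s ^ 2] (fun a => by
        rw [← hp a]; simp [Fin.sum_univ_succ]; ring)
    have e0 := hz 0
    have e1 := hz 1
    have e2 := hz 2
    have e3 := hz 3
    have e4 := hz 4
    have e5 := hz 5
    have e6 := hz 6
    clear hz hp heval hcdef
    clear_value c
    simp [hs] at e0 e1 e2 e3 e4 e5 e6
    intro n; fin_cases n <;> assumption

lemma edgeExp_injective : Function.Injective edgeExp := by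
  intro i j h
  have h' : ∀ a : Fin 6, ((if lo i = a then 1 else 0) + if hi i = a then 1 else 0)
      = ((if lo j = a then 1 else 0) + if hi j = a then 1 else 0) := by
    intro a
    have := DFunLike.congr_fun h a
    simpa [edgeExp, Finsupp.single_apply] using this
  clear h
  revert i j; decide

lemma edgeExp_ne_nonEdgeExp (j : Fin 14) (n : Fin 7) : edgeExp j ≠ nonEdgeExp n := by
  intro h
  have h' : ∀ a : Fin 6, ((if lo j = a then 1 else 0) + if hi j = a then 1 else 0)
      = ((if (nonEdge n).1 = a then 1 else 0) + if (nonEdge n).2 = a then 1 else 0) := by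
    intro a
    have := DFunLike.congr_fun h a
    simpa [edgeExp, nonEdgeExp, Finsupp.single_apply] using this
  clear h
  revert j n; decide

lemma monomial_single_add_single {R : Type*} [CommRing R] (a b : Fin 6) (c : R) :
    monomial (Finsupp.single a 1 + Finsupp.single b 1) c = C c * (X a * X b) := by
  rw [X, X, monomial_mul, C_mul_monomial, one_mul, mul_one]

lemma exists_quadric_eq (s : ℂ) (j : Fin 14) : ∃ (c : ℂ) (n : Fin 7),
    quadric s j = monomial (edgeExp j) 1 + monomial (nonEdgeExp n) c := by
  simp only [edgeExp, nonEdgeExp, monomial_single_add_single]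
  fin_cases j
  · exact ⟨-s, 0, by simp [quadric, quadricVal, lo, hi, nonEdge]; ring⟩
  · exact ⟨-s ^ 2, 5, by simp [quadric, quadricVal, lo, hi, nonEdge]; ring⟩
  · exact ⟨0, 0, by simp [quadric, quadricVal, lo, hi, nonEdge]⟩
  · exact ⟨0, 0, by simp [quadric, quadricVal, lo, hi, nonEdge]⟩
  · exact ⟨-s, 1, by simp [quadric, quadricVal, lo, hi, nonEdge]; ring⟩
  all_goals exact ⟨0, 0, by simp [quadric, quadricVal, lo, hi, nonEdge, sq]⟩

theorem isBasisOf_quadric (s : ℂ) : IsBasisOf (quadric s) (quadricsThrough (cubicCone s)) := by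
  classical
  have hhom : ∀ j, (quadric s j).IsHomogeneous 2 := by
    intro j
    obtain ⟨c, n, h⟩ := exists_quadric_eq s j
    rw [h]
    exact (isHomogeneous_monomial _ (by simp [edgeExp])).add
      (isHomogeneous_monomial _ (by simp [nonEdgeExp]))
  have hvan : ∀ j, ∀ p ∈ cubicCone s, eval p (quadric s j) = 0 := by
    intro j p hp
    obtain ⟨h4, h5, h1, h2, h3⟩ := (mem_cubicCone_iff s p).1 hp
    fin_cases j <;> simp [quadric, quadricVal, h4, h5]
    · linear_combination -h1
    · linear_combination -h2
    · linear_combination -h3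
  have hcoeff : ∀ i j, coeff (edgeExp i) (quadric s j) = if j = i then 1 else 0 := by
    intro i j
    obtain ⟨c, n, h⟩ := exists_quadric_eq s j
    rw [h, coeff_add, coeff_monomial, coeff_monomial, if_neg (edgeExp_ne_nonEdgeExp i n).symm,
      add_zero]
    simp only [edgeExp_injective.eq_iff]
  refine ⟨Fintype.linearIndependent_iff.2 fun c hc i => ?_, le_antisymm ?_ ?_⟩
  · have := congrArg (coeff (edgeExp i)) hc
    simpa [coeff_sum, hcoeff] using this
  · rw [Submodule.span_le]
    rintro _ ⟨j, rfl⟩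
    refine ⟨hhom j, ?_⟩
    show quadric s j ∈ vanishingIdeal ℂ (cubicCone s)
    rw [mem_vanishingIdeal_iff]
    intro p hp
    rw [← hvan j p hp]
    rfl
  · rintro f ⟨hf, hfv⟩
    have hfv' : ∀ p ∈ cubicCone s, eval p f = 0 := by
      intro p hp
      exact (mem_vanishingIdeal_iff.1 (show f ∈ vanishingIdeal ℂ (cubicCone s) from hfv)) p hp
    have h0 := eq_zero_of_vanish_of_coeff (s := s)
      (f := f - ∑ j, coeff (edgeExp j) f • quadric s j)
      (IsHomogeneous.sub hf (IsHomogeneous.sum _ _ _ fun j _ => by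
        rw [smul_eq_C_mul]
        simpa using (isHomogeneous_C (Fin 6) _).mul (hhom j)))
      (fun p hp => by simp [hfv' p hp, hvan _ p hp])
      (fun i => by simp [coeff_sum, hcoeff])
    rw [sub_eq_zero.1 h0]
    exact Submodule.sum_mem _ fun j _ => Submodule.smul_mem _ _ (Submodule.subset_span ⟨j, rfl⟩)

end Curves

/-! ### Alternating forms on coordinate space -/

section AlternatingForms

variable {k n : ℕ}

/-- The alternating form `v ↦ det (v a (r b))`, the wedge product of the coordinate functions
`r 0, …, r (k - 1)`. -/
def detForm (r : Fin k → Fin n) : (Fin n → ℂ) [⋀^Fin k]→L[ℂ] ℂ :=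
  { (Matrix.detRowAlternating (n := Fin k) (R := ℂ)).compLinearMap (LinearMap.funLeft ℂ ℂ r) with
    cont := by
      show Continuous fun v : Fin k → Fin n → ℂ => Matrix.det (Matrix.of fun a b => v a (r b))
      fun_prop }

lemma detForm_apply (r : Fin k → Fin n) (v : Fin k → Fin n → ℂ) :
    detForm r v = Matrix.det (Matrix.of fun a b => v a (r b)) := rfl

lemma detForm_comp_perm (r : Fin k → Fin n) (σ : Equiv.Perm (Fin k)) :
    detForm (r ∘ σ) = ((Equiv.Perm.sign σ : ℤ) : ℂ) • detForm r := by
  ext v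
  exact Matrix.det_permute' σ (Matrix.of fun a b => v a (r b))

lemma detForm_eq_zero {r : Fin k → Fin n} (hr : ¬ Function.Injective r) : detForm r = 0 := by
  ext v
  simp only [Function.Injective, not_forall] at hr
  obtain ⟨a, b, hab, hne⟩ := hr
  exact Matrix.det_zero_of_column_eq hne fun c => by simp [hab]

/-- Up to sign, every non-zero form `detForm r` is given by an increasing sequence. -/
lemma detForm_mem_span (r : Fin k → Fin n) :
    detForm r ∈ Submodule.span ℂ (Set.range fun e : Fin k ↪o Fin n => detForm (e : Fin k → Fin n)) := by
  by_cases hr : Function.Injective r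
  · have hmono : StrictMono (r ∘ Tuple.sort r) :=
      (Tuple.monotone_sort r).strictMono_of_injective (hr.comp (Tuple.sort r).injective)
    have h := detForm_comp_perm (r ∘ Tuple.sort r) (Tuple.sort r)⁻¹
    rw [Function.comp_assoc, ← Equiv.Perm.coe_mul, mul_inv_cancel, Equiv.Perm.coe_one,
      Function.comp_id] at h
    rw [h]
    exact Submodule.smul_mem _ _ (Submodule.subset_span ⟨OrderEmbedding.ofStrictMono _ hmono, rfl⟩)
  · rw [detForm_eq_zero hr]
    exact zero_mem _

/-- Expansion of an alternating form in the forms `detForm r`. -/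
lemma sum_apply_single_mul_detForm (f : (Fin n → ℂ) [⋀^Fin k]→ₗ[ℂ] ℂ) (v : Fin k → Fin n → ℂ) :
    ∑ r : Fin k → Fin n, f (fun a => Pi.single (r a) 1) * detForm r v = (k.factorial : ℂ) * f v := by
  have h1 : ∀ w : Fin k → Fin n → ℂ,
      f w = ∑ r : Fin k → Fin n, (∏ a, w a (r a)) * f (fun a => Pi.single (r a) 1) := by
    intro w
    have hw : w = fun a => ∑ j, w a j • (Pi.single j 1 : Fin n → ℂ) := by
      ext a j
      simp [Finset.sum_apply, Pi.single_apply]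
    conv_lhs => rw [hw]
    rw [← AlternatingMap.coe_multilinearMap, MultilinearMap.map_sum]
    refine Finset.sum_congr rfl fun r _ => ?_
    rw [MultilinearMap.map_smul_univ]
    rfl
  simp only [detForm_apply, Matrix.det_apply, Finset.mul_sum, Matrix.of_apply]
  rw [Finset.sum_comm]
  have h2 : ∀ σ : Equiv.Perm (Fin k), ∑ r : Fin k → Fin n, f (fun a => Pi.single (r a) 1) *
      (Equiv.Perm.sign σ • ∏ i, v (σ i) (r i)) = f v := by
    intro σ
    have h3 : Equiv.Perm.sign σ • f (v ∘ σ) = f v := by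
      rw [f.map_perm, smul_smul, ← sq, Int.units_sq, one_smul]
    rw [← h3, h1 (v ∘ σ), Finset.smul_sum]
    refine Finset.sum_congr rfl fun r _ => ?_
    rw [mul_smul_comm, mul_comm]
    rfl
  rw [Finset.sum_congr rfl fun σ _ => h2 σ]
  simp [Fintype.card_perm]

/-- The forms `detForm e`, with `e` increasing, span the space of alternating forms. -/
lemma span_detForm :
    Submodule.span ℂ (Set.range fun e : Fin k ↪o Fin n => detForm (e : Fin k → Fin n)) = ⊤ := by
  rw [eq_top_iff]
  rintro f -
  have hf : f = (k.factorial : ℂ)⁻¹ • ∑ r : Fin k → Fin n,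
      f (fun a => Pi.single (r a) 1) • detForm r := by
    ext v
    have := sum_apply_single_mul_detForm f.toAlternatingMap v
    rw [ContinuousAlternatingMap.smul_apply, ContinuousAlternatingMap.sum_apply]
    simp only [ContinuousAlternatingMap.smul_apply, smul_eq_mul]
    have hk : (k.factorial : ℂ) ≠ 0 := Nat.cast_ne_zero.2 k.factorial_ne_zero
    rw [eq_inv_mul_iff_mul_eq₀ hk]
    exact this.symm
  rw [hf]
  exact Submodule.smul_mem _ _ (Submodule.sum_mem _ fun r _ =>
    Submodule.smul_mem _ _ (detForm_mem_span r))

instance : FiniteDimensional ℂ ((Fin n → ℂ) [⋀^Fin k]→L[ℂ] ℂ) :=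
  Module.finite_def.2 (by rw [← span_detForm]; exact Submodule.fg_span (Set.finite_range _))

/-- An alternating function of the rows of a matrix is a linear function of its minors. -/
lemma exists_eq_sum_mul_minor (f : (Fin n → ℂ) [⋀^Fin k]→ₗ[ℂ] ℂ) :
    ∃ c : (Fin k ↪o Fin n) → ℂ, ∀ v : Fin k → Fin n → ℂ,
      f v = ∑ e, c e * detForm (e : Fin k → Fin n) v := by
  let F : (Fin n → ℂ) [⋀^Fin k]→L[ℂ] ℂ := { f with
    cont := by
      have hk : (k.factorial : ℂ) ≠ 0 := Nat.cast_ne_zero.2 k.factorial_ne_zero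
      have : (fun v => f v) = fun v => (k.factorial : ℂ)⁻¹ * ∑ r : Fin k → Fin n,
          f (fun a => Pi.single (r a) 1) * detForm r v := by
        ext v
        rw [sum_apply_single_mul_detForm, inv_mul_cancel_left₀ hk]
      show Continuous fun v => f v
      rw [this]
      exact continuous_const.mul (continuous_finsetSum _ fun r _ =>
        continuous_const.mul (detForm r).cont) }
  have hF : F ∈ Submodule.span ℂ (Set.range fun e : Fin k ↪o Fin n => detForm (e : Fin k → Fin n)) := by
    rw [span_detForm]; trivial
  obtain ⟨c, hc⟩ := (Submodule.mem_span_range_iff_exists_fun ℂ).1 hF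
  refine ⟨c, fun v => ?_⟩
  have := congrArg (fun G : (Fin n → ℂ) [⋀^Fin k]→L[ℂ] ℂ => G v) hc
  rw [ContinuousAlternatingMap.sum_apply] at this
  exact this.symm

/-- The derivative at the identity of the action of `GL(n)` on alternating forms. -/
def infinitesimalAction (η : (Fin n → ℂ) [⋀^Fin k]→L[ℂ] ℂ) :
    ((Fin n → ℂ) →L[ℂ] (Fin n → ℂ)) →L[ℂ] ((Fin n → ℂ) [⋀^Fin k]→L[ℂ] ℂ) :=
  η.fderivCompContinuousLinearMap (ContinuousLinearMap.id ℂ _)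

lemma infinitesimalAction_apply (η : (Fin n → ℂ) [⋀^Fin k]→L[ℂ] ℂ)
    (A : (Fin n → ℂ) →L[ℂ] (Fin n → ℂ)) (v : Fin k → Fin n → ℂ) :
    infinitesimalAction η A v = ∑ a, η (Function.update v a (A (v a))) := by
  rw [infinitesimalAction, ContinuousAlternatingMap.fderivCompContinuousLinearMap_apply]
  refine Finset.sum_congr rfl fun a _ => congrArg η (funext fun b => ?_)
  rcases eq_or_ne b a with rfl | h
  · simp
  · simp [h]

lemma infinitesimalAction_add (η ζ : (Fin n → ℂ) [⋀^Fin k]→L[ℂ] ℂ)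
    (A : (Fin n → ℂ) →L[ℂ] (Fin n → ℂ)) :
    infinitesimalAction (η + ζ) A = infinitesimalAction η A + infinitesimalAction ζ A := by
  ext v
  simp [infinitesimalAction_apply, Finset.sum_add_distrib]

lemma add_zero_smul_form (η ζ : (Fin n → ℂ) [⋀^Fin k]→L[ℂ] ℂ) : η + (0 : ℂ) • ζ = η := by
  ext v
  rw [ContinuousAlternatingMap.add_apply, ContinuousAlternatingMap.smul_apply, zero_smul, add_zero]

lemma infinitesimalAction_smul (c : ℂ) (η : (Fin n → ℂ) [⋀^Fin k]→L[ℂ] ℂ)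
    (A : (Fin n → ℂ) →L[ℂ] (Fin n → ℂ)) :
    infinitesimalAction (c • η) A = c • infinitesimalAction η A := by
  ext v
  simp [infinitesimalAction_apply, Finset.mul_sum]

/-- Two alternating forms are in the same orbit of the general linear group. -/
def SameOrbit (η ζ : (Fin n → ℂ) [⋀^Fin k]→L[ℂ] ℂ) : Prop :=
  ∃ g : (Fin n → ℂ) ≃L[ℂ] (Fin n → ℂ),
    ζ = η.compContinuousLinearMap (g : (Fin n → ℂ) →L[ℂ] (Fin n → ℂ))

lemma SameOrbit.refl (η : (Fin n → ℂ) [⋀^Fin k]→L[ℂ] ℂ) : SameOrbit η η :=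
  ⟨ContinuousLinearEquiv.refl ℂ _, by ext v; rfl⟩

lemma SameOrbit.symm {η ζ : (Fin n → ℂ) [⋀^Fin k]→L[ℂ] ℂ} (h : SameOrbit η ζ) :
    SameOrbit ζ η := by
  obtain ⟨g, rfl⟩ := h
  refine ⟨g.symm, ?_⟩
  ext v
  simp [Function.comp_def]

lemma SameOrbit.trans {η ζ ξ : (Fin n → ℂ) [⋀^Fin k]→L[ℂ] ℂ} (h : SameOrbit η ζ)
    (h' : SameOrbit ζ ξ) : SameOrbit η ξ := by
  obtain ⟨g, rfl⟩ := h
  obtain ⟨g', rfl⟩ := h'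
  exact ⟨g'.trans g, by ext v; rfl⟩

/-- If the infinitesimal action at a form is surjective, its orbit is a neighbourhood of it. -/
lemma eventually_sameOrbit {η : (Fin n → ℂ) [⋀^Fin k]→L[ℂ] ℂ}
    (hη : Function.Surjective (infinitesimalAction η)) : ∀ᶠ ζ in 𝓝 η, SameOrbit η ζ := by
  have hd : HasStrictFDerivAt (fun A : (Fin n → ℂ) →L[ℂ] (Fin n → ℂ) =>
      η.compContinuousLinearMap A) (infinitesimalAction η) (ContinuousLinearMap.id ℂ _) := by
    have := (hasStrictFDerivAt_const (𝕜 := ℂ) η (ContinuousLinearMap.id ℂ (Fin n → ℂ)))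
      |>.continuousAlternatingMapCompContinuousLinearMap
        (hasStrictFDerivAt_id (𝕜 := ℂ) (ContinuousLinearMap.id ℂ (Fin n → ℂ)))
    refine this.congr_fderiv ?_
    rw [ContinuousLinearMap.comp_zero, zero_add]
    rfl
  have : CompleteSpace ((Fin n → ℂ) [⋀^Fin k]→L[ℂ] ℂ) := FiniteDimensional.complete ℂ _
  have hmap := hd.map_nhds_eq_of_surj (LinearMap.range_eq_top.2 hη)
  have hid : η.compContinuousLinearMap (ContinuousLinearMap.id ℂ (Fin n → ℂ)) = η := by
    ext v; rfl
  rw [hid] at hmap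
  rw [← hmap, Filter.eventually_map]
  filter_upwards [(ContinuousLinearEquiv.refl ℂ (Fin n → ℂ)).nhds] with A hA
  obtain ⟨g, rfl⟩ := hA
  exact ⟨g, rfl⟩

/-- On the line through a form with surjective infinitesimal action, all but finitely many forms
have surjective infinitesimal action. -/
lemma finite_not_surjective_infinitesimalAction {η : (Fin n → ℂ) [⋀^Fin k]→L[ℂ] ℂ}
    (hη : Function.Surjective (infinitesimalAction η)) (ζ : (Fin n → ℂ) [⋀^Fin k]→L[ℂ] ℂ) :
    {c : ℂ | ¬ Function.Surjective (infinitesimalAction (η + c • ζ))}.Finite := by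
  obtain ⟨R, hR⟩ := (infinitesimalAction η).toLinearMap.exists_rightInverse_of_surjective
    (LinearMap.range_eq_top.2 hη)
  -- With a right inverse `R` at `η`, the action at `η + c ζ` composed with `R` is `1 + c N`.
  let N : Module.End ℂ ((Fin n → ℂ) [⋀^Fin k]→L[ℂ] ℂ) :=
    (infinitesimalAction ζ).toLinearMap ∘ₗ R
  refine (N.finite_hasEigenvalue.image fun μ => -μ⁻¹).subset fun c hc => ?_
  have hc0 : c ≠ 0 := by
    rintro rfl
    rw [Set.mem_ofPred_eq, add_zero_smul_form] at hc
    exact hc hη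
  refine ⟨-c⁻¹, ?_, by simp⟩
  by_contra hev
  apply hc
  have hinj : Function.Injective (1 + c • N : Module.End ℂ _) := by
    rw [← LinearMap.ker_eq_bot, LinearMap.ker_eq_bot']
    intro x hx
    by_contra hx0
    apply hev
    refine Module.End.hasEigenvalue_of_hasEigenvector (x := x) ⟨?_, hx0⟩
    rw [Module.End.mem_eigenspace_iff]
    have hx' : x + c • N x = 0 := hx
    have : c • N x = -x := by rw [← sub_eq_zero, sub_neg_eq_add, add_comm]; exact hx'
    rw [← inv_smul_smul₀ hc0 (N x), this]
    simp
  intro y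
  obtain ⟨x, hx⟩ := LinearMap.injective_iff_surjective.1 hinj y
  refine ⟨R x, ?_⟩
  rw [infinitesimalAction_add, infinitesimalAction_smul, ← hx]
  have : infinitesimalAction η (R x) = x := LinearMap.congr_fun hR x
  rw [this]
  rfl

/-- A form with open orbit is in the orbit of any form with surjective infinitesimal action: on
the line joining the two forms, all but finitely many forms have open orbits, and the complement
of a finite set in the complex line is connected. -/
theorem sameOrbit_of_isOpen {η ω : (Fin n → ℂ) [⋀^Fin k]→L[ℂ] ℂ}
    (hη : Function.Surjective (infinitesimalAction η)) (hω : IsOpen {ζ | SameOrbit ω ζ}) :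
    SameOrbit η ω := by
  classical
  let line : ℂ → (Fin n → ℂ) [⋀^Fin k]→L[ℂ] ℂ := fun c => η + c • (ω - η)
  have hline : Continuous line := by fun_prop
  set S : Set ℂ := {c | ¬ Function.Surjective (infinitesimalAction (line c))} with hS
  have hfin : S.Finite := finite_not_surjective_infinitesimalAction hη (ω - η)
  have hconn : IsPreconnected Sᶜ :=
    (hfin.countable.isPathConnected_compl_of_one_lt_rank (by simp)).isConnected.isPreconnected
  have h1 : ∀ᶠ c in 𝓝 (1 : ℂ), SameOrbit ω (line c) := by
    apply hline.continuousAt.eventually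
    have : line 1 = ω := by simp [line]
    rw [this]
    exact hω.mem_nhds (SameOrbit.refl ω)
  -- Near `1`, outside the finite set, there is a point of the line in the orbit of `ω`.
  obtain ⟨c, hc, hcS⟩ : ∃ c, SameOrbit ω (line c) ∧ c ∈ Sᶜ := by
    have h2 : ∀ᶠ c in 𝓝[≠] (1 : ℂ), c ∈ Sᶜ := by
        have h3 : (S \ {1})ᶜ ∈ 𝓝 (1 : ℂ) :=
          (hfin.subset Set.sdiff_subset).isClosed.isOpen_compl.mem_nhds (by simp)
        filter_upwards [mem_nhdsWithin_of_mem_nhds h3, self_mem_nhdsWithin] with c hc hc1 hcS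
        exact hc ⟨hcS, hc1⟩
    exact ((h1.filter_mono nhdsWithin_le_nhds).and h2).exists
  have hl0 : line 0 = η := by
    show η + (0 : ℂ) • (ω - η) = η
    exact add_zero_smul_form _ _
  have h0S : (0 : ℂ) ∈ Sᶜ := not_not.2 (hl0.symm ▸ hη)
  let f : ℂ → Bool := fun c => decide (SameOrbit η (line c))
  have hf : ContinuousOn f Sᶜ := by
    intro c hc
    have hs : Function.Surjective (infinitesimalAction (line c)) := not_not.1 hc
    have hev : ∀ᶠ d in 𝓝 c, f d = f c := by
      filter_upwards [hline.continuousAt.eventually (eventually_sameOrbit hs)] with d hd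
      exact decide_eq_decide.2 ⟨fun h => h.trans hd.symm, fun h => h.trans hd⟩
    exact (continuousAt_const.congr (hev.mono fun d hd => hd.symm)).continuousWithinAt
  have h := hconn.constant hf h0S hcS
  have h0 : f 0 = true := decide_eq_true (hl0.symm ▸ SameOrbit.refl η)
  rw [h0] at h
  exact (of_decide_eq_true h.symm).trans hc.symm

end AlternatingForms

/-! ### A family of four-forms with open orbits -/

section FourForm

/-- The matrix unit sending the basis vector `q` to the basis vector `p`. -/
def elementaryMap {n : ℕ} (p q : Fin n) : (Fin n → ℂ) →L[ℂ] (Fin n → ℂ) :=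
  (ContinuousLinearMap.proj q).smulRight (Pi.single p 1)

lemma sum_det_updateRow {m : Type*} [Fintype m] [DecidableEq m] {R : Type*} [CommRing R]
    (M N : Matrix m m R) :
    ∑ a, (M.updateRow a (N a)).det = ∑ b, (M.updateCol b (fun a => N a b)).det := by
  have h1 : ∀ a, (M.updateRow a (N a)).det = ∑ b, M.adjugate b a * N a b := by
    intro a
    rw [← Matrix.cramer_transpose_apply, Matrix.cramer_eq_adjugate_mulVec,
      ← Matrix.adjugate_transpose]
    rfl
  have h2 : ∀ b, (M.updateCol b (fun a => N a b)).det = ∑ a, M.adjugate b a * N a b := by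
    intro b
    rw [← Matrix.cramer_apply, Matrix.cramer_eq_adjugate_mulVec]
    rfl
  simp only [h1, h2]
  exact Finset.sum_comm

/-- A matrix unit acts on `detForm r` as a derivation. -/
lemma infinitesimalAction_detForm {k n : ℕ} (r : Fin k → Fin n) (p q : Fin n) :
    infinitesimalAction (detForm r) (elementaryMap p q) =
      ∑ b, if r b = p then detForm (Function.update r b q) else 0 := by
  ext v
  rw [infinitesimalAction_apply, ContinuousAlternatingMap.sum_apply]
  have h := sum_det_updateRow (Matrix.of fun a b => v a (r b))
    (Matrix.of fun a b => if r b = p then v a q else 0)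
  convert h using 2 with a _ b _
  · rw [detForm_apply]
    congr 1
    ext i j
    rcases eq_or_ne i a with rfl | hi
    · simp [elementaryMap, Pi.single_apply]
    · simp [hi]
  · split_ifs with hb
    · rw [detForm_apply]
      congr 1
      ext i j
      rcases eq_or_ne j b with rfl | hj
      · simp [hb]
      · simp [hj]
    · symm
      exact Matrix.det_eq_zero_of_column_eq_zero b fun i => by simp [hb]

lemma zero_form_apply (v : Fin 4 → Fin 7 → ℂ) : (0 : (Fin 7 → ℂ) [⋀^Fin 4]→L[ℂ] ℂ) v = 0 := rfl

/-- The wedge product of four of the seven coordinate functions. -/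
def wedge (a b c d : Fin 7) : (Fin 7 → ℂ) [⋀^Fin 4]→L[ℂ] ℂ := detForm ![a, b, c, d]

lemma wedge_swap₀ {a b : Fin 7} (_ : b < a) (c d : Fin 7) : wedge a b c d = -wedge b a c d := by
  have h := detForm_comp_perm ![b, a, c, d] (Equiv.swap 0 1)
  rw [Equiv.Perm.sign_swap (by decide)] at h
  have e : ![b, a, c, d] ∘ Equiv.swap (0 : Fin 4) 1 = ![a, b, c, d] := by
    ext i; fin_cases i <;> rfl
  rw [e] at h
  rw [wedge, wedge, h]
  ext v
  simp

lemma wedge_swap₁ {b c : Fin 7} (_ : c < b) (a d : Fin 7) : wedge a b c d = -wedge a c b d := by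
  have h := detForm_comp_perm ![a, c, b, d] (Equiv.swap 1 2)
  rw [Equiv.Perm.sign_swap (by decide)] at h
  have e : ![a, c, b, d] ∘ Equiv.swap (1 : Fin 4) 2 = ![a, b, c, d] := by
    ext i; fin_cases i <;> rfl
  rw [e] at h
  rw [wedge, wedge, h]
  ext v
  simp

lemma wedge_swap₂ {c d : Fin 7} (_ : d < c) (a b : Fin 7) : wedge a b c d = -wedge a b d c := by
  have h := detForm_comp_perm ![a, b, d, c] (Equiv.swap 2 3)
  rw [Equiv.Perm.sign_swap (by decide)] at h
  have e : ![a, b, d, c] ∘ Equiv.swap (2 : Fin 4) 3 = ![a, b, c, d] := by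
    ext i; fin_cases i <;> rfl
  rw [e] at h
  rw [wedge, wedge, h]
  ext v
  simp

lemma wedge_self₀ (a c d : Fin 7) : wedge a a c d = 0 :=
  detForm_eq_zero fun h => absurd (@h 0 1 rfl) (by decide)

lemma wedge_self₁ (a b d : Fin 7) : wedge a b b d = 0 :=
  detForm_eq_zero fun h => absurd (@h 1 2 rfl) (by decide)

lemma wedge_self₂ (a b c : Fin 7) : wedge a b c c = 0 :=
  detForm_eq_zero fun h => absurd (@h 2 3 rfl) (by decide)

lemma infinitesimalAction_wedge (a b c d p q : Fin 7) :
    infinitesimalAction (wedge a b c d) (elementaryMap p q) =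
      (if a = p then wedge q b c d else 0) + (if b = p then wedge a q c d else 0) +
      (if c = p then wedge a b q d else 0) + (if d = p then wedge a b c q else 0) := by
  have h0 : Function.update ![a, b, c, d] 0 q = ![q, b, c, d] := by ext i; fin_cases i <;> rfl
  have h1 : Function.update ![a, b, c, d] 1 q = ![a, q, c, d] := by ext i; fin_cases i <;> rfl
  have h2 : Function.update ![a, b, c, d] 2 q = ![a, b, q, d] := by ext i; fin_cases i <;> rfl
  have h3 : Function.update ![a, b, c, d] 3 q = ![a, b, c, q] := by ext i; fin_cases i <;> rfl
  rw [wedge, infinitesimalAction_detForm, Fin.sum_univ_four, h0, h1, h2, h3]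
  rfl

/-- The four-form dual to the three-form
`s e₀₃₅ + e₀₄₆ + e₁₂₅ + s e₁₃₆ + s l e₂₃₄`. -/
def fourForm (l s : ℂ) : (Fin 7 → ℂ) [⋀^Fin 4]→L[ℂ] ℂ :=
  s • wedge 1 2 4 6 + wedge 1 2 3 5 + wedge 0 3 4 6 + s • wedge 0 2 4 5 -
    (s * l) • wedge 0 1 5 6

lemma infinitesimalAction_fourForm (l s : ℂ) (A : (Fin 7 → ℂ) →L[ℂ] (Fin 7 → ℂ)) :
    infinitesimalAction (fourForm l s) A =
      s • infinitesimalAction (wedge 1 2 4 6) A + infinitesimalAction (wedge 1 2 3 5) A +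
      infinitesimalAction (wedge 0 3 4 6) A + s • infinitesimalAction (wedge 0 2 4 5) A +
      (-(s * l)) • infinitesimalAction (wedge 0 1 5 6) A := by
  rw [← infinitesimalAction_smul, ← infinitesimalAction_smul, ← infinitesimalAction_smul,
    ← infinitesimalAction_add, ← infinitesimalAction_add, ← infinitesimalAction_add,
    ← infinitesimalAction_add]
  congr 2
  ext v
  simp [fourForm, sub_eq_add_neg]

lemma exists_wedge_list : ∀ a b c d : Fin 7, a < b → b < c → c < d → (a, b, c, d) ∈
    ([(0, 1, 2, 3), (0, 1, 2, 4), (0, 1, 2, 5), (0, 1, 2, 6), (0, 1, 3, 4), (0, 1, 3, 5), (0, 1, 3, 6), (0, 1, 4, 5), (0, 1, 4, 6), (0, 1, 5, 6), (0, 2, 3, 4), (0, 2, 3, 5), (0, 2, 3, 6), (0, 2, 4, 5), (0, 2, 4, 6), (0, 2, 5, 6), (0, 3, 4, 5), (0, 3, 4, 6), (0, 3, 5, 6), (0, 4, 5, 6), (1, 2, 3, 4), (1, 2, 3, 5), (1, 2, 3, 6), (1, 2, 4, 5), (1, 2, 4, 6), (1, 2, 5, 6), (1, 3, 4, 5), (1,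 3, 4, 6), (1, 3, 5, 6), (1, 4, 5, 6), (2, 3, 4, 5), (2, 3, 4, 6), (2, 3, 5, 6), (2, 4, 5, 6), (3, 4, 5, 6)] : List (Fin 7 × Fin 7 × Fin 7 × Fin 7)) := by
  decide

set_option maxHeartbeats 4000000 in
lemma wedge_mem_range_infinitesimalAction {l s : ℂ} (hl : l ≠ 0) (hs : s ≠ 0) :
    ∀ x ∈ ([(0, 1, 2, 3), (0, 1, 2, 4), (0, 1, 2, 5), (0, 1, 2, 6), (0, 1, 3, 4), (0, 1, 3, 5), (0, 1, 3, 6), (0, 1, 4, 5), (0, 1, 4, 6), (0, 1, 5, 6), (0, 2, 3, 4), (0, 2, 3, 5), (0, 2, 3, 6), (0, 2, 4, 5), (0, 2, 4, 6), (0, 2, 5, 6), (0, 3, 4, 5), (0, 3, 4, 6), (0, 3, 5, 6), (0, 4, 5, 6), (1, 2, 3, 4), (1, 2, 3, 5), (1, 2, 3, 6), (1, 2, 4, 5), (1, 2, 4, 6), (1, 2, 5, 6), (1, 3, 4, 5), (1, 3, 4, 6), (1, 3, 5, 6), (1, 4, 5, 6), (2, 3, 4, 5), (2, 3, 4, 6),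 (2, 3, 5, 6), (2, 4, 5, 6), (3, 4, 5, 6)] : List (Fin 7 × Fin 7 × Fin 7 × Fin 7)),
      wedge x.1 x.2.1 x.2.2.1 x.2.2.2 ∈ (infinitesimalAction (fourForm l s)).range := by
  simp only [List.forall_mem_cons, List.not_mem_nil, false_imp_iff, implies_true, and_true]
  refine ⟨⟨-((1 : ℂ) • elementaryMap 5 0), ?_⟩,
    ⟨-((-s⁻¹ : ℂ) • elementaryMap 5 1), ?_⟩,
    ⟨-(((-1) : ℂ) • elementaryMap 3 0), ?_⟩,
    ⟨-((-s⁻¹ : ℂ) • elementaryMap 4 0), ?_⟩,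
    ⟨-(((-1) : ℂ) • elementaryMap 6 1), ?_⟩,
    ⟨-((1 : ℂ) • elementaryMap 2 0 + (s : ℂ) • elementaryMap 3 1), ?_⟩,
    ⟨-((s : ℂ) • elementaryMap 3 0 + (1 : ℂ) • elementaryMap 4 1), ?_⟩,
    ⟨-((-s⁻¹ : ℂ) • elementaryMap 2 1), ?_⟩,
    ⟨-(((-1) : ℂ) • elementaryMap 3 1), ?_⟩,
    ⟨-(((1 / 2) * s⁻¹ * l⁻¹ : ℂ) • elementaryMap 0 0 + ((1 / 2) * s⁻¹ * l⁻¹ : ℂ) • elementaryMap 1 1 + ((-1 / 4) * s⁻¹ * l⁻¹ : ℂ) • elementaryMap 2 2 + ((-1 / 4) * s⁻¹ * l⁻¹ : ℂ) • elementaryMap 3 3 + ((-1 / 4) * s⁻¹ * l⁻¹ : ℂ) • elementaryMap 4 4), ?_⟩,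
    ⟨-((s * l : ℂ) • elementaryMap 3 0 + ((-1) : ℂ) • elementaryMap 6 2), ?_⟩,
    ⟨-(((-1) : ℂ) • elementaryMap 1 0 + (s : ℂ) • elementaryMap 3 2), ?_⟩,
    ⟨-((1 : ℂ) • elementaryMap 4 2), ?_⟩,
    ⟨-(((-1 / 2) * s⁻¹ : ℂ) • elementaryMap 0 0 + ((1 / 2) * s⁻¹ : ℂ) • elementaryMap 1 1 + ((-3 / 4) * s⁻¹ : ℂ) • elementaryMap 2 2 + ((1 / 4) * s⁻¹ : ℂ) • elementaryMap 3 3 + ((1 / 4) * s⁻¹ : ℂ) • elementaryMap 4 4), ?_⟩,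
    ⟨-(((-1) : ℂ) • elementaryMap 3 2), ?_⟩,
    ⟨-((s⁻¹ * l⁻¹ : ℂ) • elementaryMap 1 2), ?_⟩,
    ⟨-((s : ℂ) • elementaryMap 3 4 + ((-1) : ℂ) • elementaryMap 6 5), ?_⟩,
    ⟨-(((-1 / 2) : ℂ) • elementaryMap 0 0 + ((-1 / 2) : ℂ) • elementaryMap 3 3 + ((1 / 2) : ℂ) • elementaryMap 5 5), ?_⟩,
    ⟨-((-s : ℂ) • elementaryMap 3 6 + ((-1) : ℂ) • elementaryMap 4 5), ?_⟩,
    ⟨-((1 : ℂ) • elementaryMap 3 5), ?_⟩,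
    ⟨-((-s * l : ℂ) • elementaryMap 3 1 + ((-1) : ℂ) • elementaryMap 5 4), ?_⟩,
    ⟨-(((1 / 2) : ℂ) • elementaryMap 0 0 + ((-1 / 2) : ℂ) • elementaryMap 3 3 + ((-1 / 2) : ℂ) • elementaryMap 5 5), ?_⟩,
    ⟨-((s : ℂ) • elementaryMap 3 2 + ((-1) : ℂ) • elementaryMap 5 6), ?_⟩,
    ⟨-(((-1) : ℂ) • elementaryMap 3 4), ?_⟩,
    ⟨-(((1 / 2) * s⁻¹ : ℂ) • elementaryMap 0 0 + ((-1 / 2) * s⁻¹ : ℂ) • elementaryMap 1 1 + ((1 / 4) * s⁻¹ : ℂ) • elementaryMap 2 2 + ((1 / 4) * s⁻¹ : ℂ) • elementaryMap 3 3 + ((-3 / 4) * s⁻¹ : ℂ) • elementaryMap 4 4), ?_⟩,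
    ⟨-((1 : ℂ) • elementaryMap 3 6), ?_⟩,
    ⟨-((1 : ℂ) • elementaryMap 2 4), ?_⟩,
    ⟨-(((-1) : ℂ) • elementaryMap 0 1 + (s : ℂ) • elementaryMap 3 4), ?_⟩,
    ⟨-(((-1) : ℂ) • elementaryMap 2 6 + (-s : ℂ) • elementaryMap 3 5), ?_⟩,
    ⟨-((-s⁻¹ * l⁻¹ : ℂ) • elementaryMap 0 4), ?_⟩,
    ⟨-(((-1) : ℂ) • elementaryMap 1 4 + (s * l : ℂ) • elementaryMap 3 5), ?_⟩,
    ⟨-(((-1) : ℂ) • elementaryMap 0 2 + (-s * l : ℂ) • elementaryMap 3 6), ?_⟩,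
    ⟨-((1 : ℂ) • elementaryMap 1 6), ?_⟩,
    ⟨-((s⁻¹ : ℂ) • elementaryMap 0 6), ?_⟩,
    ⟨-(((-1) : ℂ) • elementaryMap 0 5), ?_⟩⟩
  all_goals
    simp only [map_add, map_smul, map_neg, infinitesimalAction_fourForm, infinitesimalAction_wedge,
      Fin.isValue, Fin.reduceEq, if_true, if_false, wedge_self₀, wedge_self₁, wedge_self₂, add_zero,
      zero_add, ContinuousLinearMap.coe_coe, neg_add_rev, smul_neg, neg_neg, neg_zero, smul_zero, wedge_swap₀, wedge_swap₁, wedge_swap₂, Fin.reduceLT]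
    ext v
    simp only [ContinuousAlternatingMap.add_apply, ContinuousAlternatingMap.smul_apply,
      ContinuousAlternatingMap.neg_apply, smul_eq_mul, zero_form_apply]
  all_goals try field_simp
  all_goals try ring

theorem surjective_infinitesimalAction_fourForm {l s : ℂ} (hl : l ≠ 0) (hs : s ≠ 0) :
    Function.Surjective (infinitesimalAction (fourForm l s)) := by
  suffices h : (infinitesimalAction (fourForm l s)).range = ⊤ from LinearMap.range_eq_top.1 h
  rw [eq_top_iff, ← span_detForm, Submodule.span_le]
  rintro _ ⟨e, rfl⟩
  have he : (e : Fin 4 → Fin 7) = ![e 0, e 1, e 2, e 3] := by ext i; fin_cases i <;> rfl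
  have hmem := exists_wedge_list (e 0) (e 1) (e 2) (e 3) (e.lt_iff_lt.2 (by decide))
    (e.lt_iff_lt.2 (by decide)) (e.lt_iff_lt.2 (by decide))
  have h := wedge_mem_range_infinitesimalAction hl hs _ hmem
  show detForm (e : Fin 4 → Fin 7) ∈ _
  rw [he]
  exact h

end FourForm

/-! ### Projective isomorphisms given by linear maps -/

section ProjectiveIsomorphism

open MvPolynomial

variable {σ τ υ : Type}

lemma ProjectivelyIsomorphic.refl (I : Ideal (MvPolynomial σ ℂ)) : ProjectivelyIsomorphic I I :=
  ⟨AlgEquiv.refl, by ext x; simp⟩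

lemma ProjectivelyIsomorphic.trans {I : Ideal (MvPolynomial σ ℂ)} {J : Ideal (MvPolynomial τ ℂ)}
    {K : Ideal (MvPolynomial υ ℂ)} (h : ProjectivelyIsomorphic I J)
    (h' : ProjectivelyIsomorphic J K) : ProjectivelyIsomorphic I K := by
  obtain ⟨e, he⟩ := h
  obtain ⟨e', he'⟩ := h'
  refine ⟨e.trans e', ?_⟩
  rw [← he', ← he, ← Submodule.map_comp]
  rfl

/-- Mutually inverse linear substitutions identify the quotients by two ideals. -/
lemma projectivelyIsomorphic_of_algHom {I : Ideal (MvPolynomial σ ℂ)}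
    {J : Ideal (MvPolynomial τ ℂ)} (φ : MvPolynomial σ ℂ →ₐ[ℂ] MvPolynomial τ ℂ)
    (ψ : MvPolynomial τ ℂ →ₐ[ℂ] MvPolynomial σ ℂ) (hφ : ∀ i, (φ (X i)).IsHomogeneous 1)
    (hψ : ∀ j, (ψ (X j)).IsHomogeneous 1) (hI : ∀ f ∈ I, φ f ∈ J) (hJ : ∀ f ∈ J, ψ f ∈ I)
    (hφψ : ∀ i, ψ (φ (X i)) - X i ∈ I) (hψφ : ∀ j, φ (ψ (X j)) - X j ∈ J) :
    ProjectivelyIsomorphic I J := by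
  have hdeg : ∀ {α β : Type} (χ : MvPolynomial α ℂ →ₐ[ℂ] MvPolynomial β ℂ)
      (_ : ∀ i, (χ (X i)).IsHomogeneous 1) (f : MvPolynomial α ℂ), f.IsHomogeneous 1 →
      (χ f).IsHomogeneous 1 := by
    intro α β χ hχ f hf
    have h : (aeval (χ ∘ X) f).IsHomogeneous 1 := hf.aeval (fun i => χ (X i)) hχ
    rwa [← aeval_unique χ] at h
  let Φ : (MvPolynomial σ ℂ ⧸ I) →ₐ[ℂ] (MvPolynomial τ ℂ ⧸ J) := Ideal.quotientMapₐ J φ hI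
  let Ψ : (MvPolynomial τ ℂ ⧸ J) →ₐ[ℂ] (MvPolynomial σ ℂ ⧸ I) := Ideal.quotientMapₐ I ψ hJ
  let e : (MvPolynomial σ ℂ ⧸ I) ≃ₐ[ℂ] (MvPolynomial τ ℂ ⧸ J) := AlgEquiv.ofAlgHom Φ Ψ
    (Ideal.Quotient.algHom_ext _ (MvPolynomial.algHom_ext fun j => Ideal.Quotient.eq.2 (hψφ j)))
    (Ideal.Quotient.algHom_ext _ (MvPolynomial.algHom_ext fun i => Ideal.Quotient.eq.2 (hφψ i)))
  refine ⟨e, le_antisymm ?_ ?_⟩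
  · rintro _ ⟨_, ⟨f, hf, rfl⟩, rfl⟩
    exact ⟨φ f, hdeg φ hφ f hf, rfl⟩
  · rintro _ ⟨f, hf, rfl⟩
    exact ⟨Ideal.Quotient.mk I (ψ f), ⟨ψ f, hdeg ψ hψ f hf, rfl⟩,
      e.apply_symm_apply (Ideal.Quotient.mk J f)⟩

variable [Fintype σ] [DecidableEq σ]

/-- The pullback of polynomials along a linear map. -/
def linearPullback (M : (σ → ℂ) →ₗ[ℂ] (τ → ℂ)) : MvPolynomial τ ℂ →ₐ[ℂ] MvPolynomial σ ℂ :=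
  aeval fun j => ∑ i, C (M (Pi.single i 1) j) * X i

lemma isHomogeneous_linearPullback_X (M : (σ → ℂ) →ₗ[ℂ] (τ → ℂ)) (j : τ) :
    (linearPullback M (X j)).IsHomogeneous 1 := by
  rw [linearPullback, aeval_X]
  exact IsHomogeneous.sum _ _ _ fun i _ => by
    simpa using (isHomogeneous_C σ _).mul (isHomogeneous_X ℂ i)

lemma aeval_linearPullback (M : (σ → ℂ) →ₗ[ℂ] (τ → ℂ)) (x : σ → ℂ) (f : MvPolynomial τ ℂ) :
    aeval x (linearPullback M f) = aeval (M x) f := by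
  have h : (aeval x).comp (linearPullback M) = (aeval (M x) : MvPolynomial τ ℂ →ₐ[ℂ] ℂ) := by
    ext j
    have hx : x = ∑ i, x i • (Pi.single i 1 : σ → ℂ) := by
      ext i; simp [Finset.sum_apply, Pi.single_apply]
    conv_rhs => rw [aeval_X, hx, map_sum]
    simp [linearPullback, Finset.sum_apply, mul_comm]
  exact DFunLike.congr_fun h f

/-- Cones identified by linear maps, up to closure, have isomorphic homogeneous coordinate
rings. -/
lemma projectivelyIsomorphic_vanishingIdeal [Fintype τ] [DecidableEq τ] {S : Set (σ → ℂ)}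
    {S' : Set (τ → ℂ)} (M : (σ → ℂ) →ₗ[ℂ] (τ → ℂ)) (M' : (τ → ℂ) →ₗ[ℂ] (σ → ℂ))
    (h : ∀ x ∈ S, (∀ f ∈ vanishingIdeal ℂ S', aeval (M x) f = 0) ∧ M' (M x) = x)
    (h' : ∀ y ∈ S', (∀ f ∈ vanishingIdeal ℂ S, aeval (M' y) f = 0) ∧ M (M' y) = y) :
    ProjectivelyIsomorphic (vanishingIdeal ℂ S) (vanishingIdeal ℂ S') := by
  refine projectivelyIsomorphic_of_algHom (linearPullback M') (linearPullback M)
    (isHomogeneous_linearPullback_X M') (isHomogeneous_linearPullback_X M) ?_ ?_ ?_ ?_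
  · intro f hf
    refine mem_vanishingIdeal_iff.2 fun y hy => ?_
    rw [aeval_linearPullback]
    exact (h' y hy).1 f hf
  · intro f hf
    refine mem_vanishingIdeal_iff.2 fun x hx => ?_
    rw [aeval_linearPullback]
    exact (h x hx).1 f hf
  · intro i
    refine mem_vanishingIdeal_iff.2 fun x hx => ?_
    rw [map_sub, aeval_linearPullback, aeval_linearPullback, (h x hx).2, sub_self]
  · intro j
    refine mem_vanishingIdeal_iff.2 fun y hy => ?_
    rw [map_sub, aeval_linearPullback, aeval_linearPullback, (h' y hy).2, sub_self]

end ProjectiveIsomorphism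

/-! ### Plücker coordinates of five-spaces in a seven-dimensional space -/

section Pluecker

lemma pluecker_eq_detForm (A : Matrix (Fin 5) (Fin 7) ℂ) (e : Fin 5 ↪o Fin 7) :
    pluecker A e = detForm (e : Fin 5 → Fin 7) A.row := by
  rw [pluecker, detForm_apply]
  rfl

/-- Plücker coordinates transform linearly under a linear change of coordinates. -/
lemma exists_linearMap_pluecker_mul (B : Matrix (Fin 7) (Fin 7) ℂ) :
    ∃ M : ((Fin 5 ↪o Fin 7) → ℂ) →ₗ[ℂ] ((Fin 5 ↪o Fin 7) → ℂ),
      ∀ A : Matrix (Fin 5) (Fin 7) ℂ, pluecker (A * B) = M (pluecker A) := by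
  have h : ∀ e : Fin 5 ↪o Fin 7, ∃ c : (Fin 5 ↪o Fin 7) → ℂ, ∀ A : Matrix (Fin 5) (Fin 7) ℂ,
      pluecker (A * B) e = ∑ e', c e' * pluecker A e' := by
    intro e
    obtain ⟨c, hc⟩ := exists_eq_sum_mul_minor
      ((detForm (e : Fin 5 → Fin 7)).toAlternatingMap.compLinearMap B.vecMulLinear)
    refine ⟨c, fun A => ?_⟩
    simp only [pluecker_eq_detForm]
    rw [← hc A.row, AlternatingMap.compLinearMap_apply, ContinuousAlternatingMap.coe_toAlternatingMap]
    congr 1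
  choose c hc using h
  refine ⟨Matrix.mulVecLin (Matrix.of c), fun A => ?_⟩
  ext e
  rw [hc]
  rfl

/-- Forms in the same orbit have projectively equivalent varieties of isotropic subspaces. -/
theorem SameOrbit.projectivelyIsomorphic {ω η : (Fin 7 → ℂ) [⋀^Fin 4]→L[ℂ] ℂ}
    (h : SameOrbit ω η) : ProjectivelyIsomorphic (G2Ideal η) (G2Ideal ω) := by
  classical
  obtain ⟨g, rfl⟩ := h
  let B : Matrix (Fin 7) (Fin 7) ℂ := (LinearMap.toMatrix' (g : (Fin 7 → ℂ) →ₗ[ℂ] (Fin 7 → ℂ))).transpose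
  let B' : Matrix (Fin 7) (Fin 7) ℂ :=
    (LinearMap.toMatrix' (g.symm : (Fin 7 → ℂ) →ₗ[ℂ] (Fin 7 → ℂ))).transpose
  have hBB' : B * B' = 1 := by
    rw [← Matrix.transpose_mul, ← LinearMap.toMatrix'_comp]
    have : (g.symm : (Fin 7 → ℂ) →ₗ[ℂ] (Fin 7 → ℂ)) ∘ₗ (g : (Fin 7 → ℂ) →ₗ[ℂ] (Fin 7 → ℂ)) =
        LinearMap.id := by ext; simp
    rw [this, LinearMap.toMatrix'_id, Matrix.transpose_one]
  have hB'B : B' * B = 1 := mul_eq_one_comm.1 hBB'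
  have hrow : ∀ (A : Matrix (Fin 5) (Fin 7) ℂ), (A * B).row = g ∘ A.row := by
    intro A
    funext i
    have : (A * B).row i = Matrix.mulVec B.transpose (A.row i) := by
      rw [Matrix.mulVec_transpose]; rfl
    rw [this]
    simp only [B, Matrix.transpose_transpose, LinearMap.toMatrix'_mulVec]
    rfl
  have hrow' : ∀ (A : Matrix (Fin 5) (Fin 7) ℂ), (A * B').row = g.symm ∘ A.row := by
    intro A
    funext i
    have : (A * B').row i = Matrix.mulVec B'.transpose (A.row i) := by
      rw [Matrix.mulVec_transpose]; rfl
    rw [this]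
    simp only [B', Matrix.transpose_transpose, LinearMap.toMatrix'_mulVec]
    rfl
  have hspan : ∀ (e : (Fin 7 → ℂ) ≃L[ℂ] (Fin 7 → ℂ)) (A : Matrix (Fin 5) (Fin 7) ℂ),
      ∀ w ∈ Submodule.span ℂ (Set.range (e ∘ A.row)),
        e.symm w ∈ Submodule.span ℂ (Set.range A.row) := by
    intro e A w hw
    rw [Set.range_comp] at hw
    have : w ∈ (Submodule.span ℂ (Set.range A.row)).map (e : (Fin 7 → ℂ) →ₗ[ℂ] (Fin 7 → ℂ)) := by
      rw [Submodule.map_span]; exact hw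
    obtain ⟨u, hu, rfl⟩ := this
    simpa using hu
  obtain ⟨M, hM⟩ := exists_linearMap_pluecker_mul B
  obtain ⟨M', hM'⟩ := exists_linearMap_pluecker_mul B'
  refine projectivelyIsomorphic_vanishingIdeal M M' ?_ ?_
  · rintro _ ⟨A, hA, hiso, rfl⟩
    rw [← hM, ← hM', Matrix.mul_assoc, hBB', Matrix.mul_one]
    refine ⟨fun f hf => MvPolynomial.mem_vanishingIdeal_iff.1 hf _ ⟨A * B, ?_, ?_, rfl⟩, rfl⟩
    · rw [hrow]
      exact hA.map' (g : (Fin 7 → ℂ) →ₗ[ℂ] (Fin 7 → ℂ)) (LinearMap.ker_eq_bot.2 g.injective)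
    · intro v hv
      rw [hrow] at hv
      have := hiso (g.symm ∘ v) fun a => hspan g A _ (hv a)
      simpa [Function.comp_def] using this
  · rintro _ ⟨A, hA, hiso, rfl⟩
    rw [← hM', ← hM, Matrix.mul_assoc, hB'B, Matrix.mul_one]
    refine ⟨fun f hf => MvPolynomial.mem_vanishingIdeal_iff.1 hf _ ⟨A * B', ?_, ?_, rfl⟩, rfl⟩
    · rw [hrow']
      exact hA.map' (g.symm : (Fin 7 → ℂ) →ₗ[ℂ] (Fin 7 → ℂ)) (LinearMap.ker_eq_bot.2 g.symm.injective)
    · intro v hv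
      rw [hrow'] at hv
      exact hiso _ fun a => by simpa using hspan g.symm A _ (hv a)

/-- The entry `(i, j)`, for `i < j`, of the skew-symmetric matrix of Plücker coordinates of a plane
in the linear section with parameters `l` and `s`, in terms of the fourteen coordinates. -/
def pluckerEntry (l s : ℂ) (x : Fin 14 → ℂ) : Matrix (Fin 7) (Fin 7) ℂ :=
  !![0, x 11, x 2, x 5, s * x 7, x 12 + l * x 1, -(s * l * x 0);
     0, 0, -(s * x 5), -x 7, -x 9, -(s * l * x 4), -x 12;
     0, 0, 0, -x 0, -x 1, s * x 6, -x 3;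
     0, 0, 0, 0, -x 4, x 8, -x 6;
     0, 0, 0, 0, 0, x 10, -(s * x 8);
     0, 0, 0, 0, 0, 0, -x 13;
     0, 0, 0, 0, 0, 0, 0]

/-- The Plücker relations of `G(2, 7)` imply the twenty-eight relations. -/
lemma eval_rel_of_pluecker {l s : ℂ} (hs : s ≠ 0) {x : Fin 14 → ℂ} (hP : ∀ i j k m,
    i < j → j < k → k < m →
    pluckerEntry l s x i j * pluckerEntry l s x k m - pluckerEntry l s x i k * pluckerEntry l s x j m
      + pluckerEntry l s x i m * pluckerEntry l s x j k = 0) (k : Fin 28) :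
    MvPolynomial.eval x (rel l s k) = 0 := by
  fin_cases k
  · have h := hP 1 2 3 4 (by decide) (by decide) (by decide)
    simp [pluckerEntry, rel, leadA, leadB, sortA, sortB, pertA, pertB, pertA', pertB', pertC, pertC'] at h ⊢
    linear_combination h
  · have h := hP 2 3 4 5 (by decide) (by decide) (by decide)
    simp [pluckerEntry, rel, leadA, leadB, sortA, sortB, pertA, pertB, pertA', pertB', pertC, pertC'] at h ⊢
    linear_combination -h
  · have h := hP 0 1 2 3 (by decide) (by decide) (by decide)
    simp [pluckerEntry, rel, leadA, leadB, sortA, sortB, pertA, pertB, pertA', pertB', pertC, pertC'] at h ⊢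
    linear_combination -h
  · have h := hP 0 2 3 5 (by decide) (by decide) (by decide)
    simp [pluckerEntry, rel, leadA, leadB, sortA, sortB, pertA, pertB, pertA', pertB', pertC, pertC'] at h ⊢
    linear_combination -h
  · have h := hP 2 3 5 6 (by decide) (by decide) (by decide)
    simp [pluckerEntry, rel, leadA, leadB, sortA, sortB, pertA, pertB, pertA', pertB', pertC, pertC'] at h ⊢
    linear_combination h
  · have h := hP 0 1 2 4 (by decide) (by decide) (by decide)
    simp [pluckerEntry, rel, leadA, leadB, sortA, sortB, pertA, pertB, pertA', pertB', pertC, pertC'] at h ⊢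
    linear_combination -h
  · have h := hP 0 2 4 5 (by decide) (by decide) (by decide)
    simp [pluckerEntry, rel, leadA, leadB, sortA, sortB, pertA, pertB, pertA', pertB', pertC, pertC'] at h ⊢
    linear_combination -h
  · have h := hP 2 4 5 6 (by decide) (by decide) (by decide)
    simp [pluckerEntry, rel, leadA, leadB, sortA, sortB, pertA, pertB, pertA', pertB', pertC, pertC'] at h ⊢
    linear_combination h
  · have h := hP 0 2 3 4 (by decide) (by decide) (by decide)
    simp [pluckerEntry, rel, leadA, leadB, sortA, sortB, pertA, pertB, pertA', pertB', pertC, pertC'] at h ⊢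
    linear_combination -h
  · have h := hP 0 2 5 6 (by decide) (by decide) (by decide)
    simp [pluckerEntry, rel, leadA, leadB, sortA, sortB, pertA, pertB, pertA', pertB', pertC, pertC'] at h ⊢
    linear_combination -h
  · have h := hP 2 3 4 6 (by decide) (by decide) (by decide)
    simp [pluckerEntry, rel, leadA, leadB, sortA, sortB, pertA, pertB, pertA', pertB', pertC, pertC'] at h ⊢
    linear_combination h
  · have h := hP 0 2 3 6 (by decide) (by decide) (by decide)
    simp [pluckerEntry, rel, leadA, leadB, sortA, sortB, pertA, pertB, pertA', pertB', pertC, pertC'] at h ⊢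
    linear_combination h
  · have h := hP 0 2 4 6 (by decide) (by decide) (by decide)
    simp [pluckerEntry, rel, leadA, leadB, sortA, sortB, pertA, pertB, pertA', pertB', pertC, pertC'] at h ⊢
    apply mul_left_cancel₀ hs
    linear_combination h
  · have h := hP 1 2 4 6 (by decide) (by decide) (by decide)
    have h' := hP 0 2 4 5 (by decide) (by decide) (by decide)
    have h'' := hP 0 3 4 6 (by decide) (by decide) (by decide)
    simp [pluckerEntry, rel, leadA, leadB, sortA, sortB, pertA, pertB, pertA', pertB', pertC, pertC'] at h h' h'' ⊢
    linear_combination -h - h' - s * h''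
  · have h := hP 0 1 2 6 (by decide) (by decide) (by decide)
    simp [pluckerEntry, rel, leadA, leadB, sortA, sortB, pertA, pertB, pertA', pertB', pertC, pertC'] at h ⊢
    linear_combination -h
  · have h := hP 0 1 3 4 (by decide) (by decide) (by decide)
    simp [pluckerEntry, rel, leadA, leadB, sortA, sortB, pertA, pertB, pertA', pertB', pertC, pertC'] at h ⊢
    linear_combination -h
  · have h := hP 0 3 4 5 (by decide) (by decide) (by decide)
    simp [pluckerEntry, rel, leadA, leadB, sortA, sortB, pertA, pertB, pertA', pertB', pertC, pertC'] at h ⊢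
    linear_combination -h
  · have h := hP 3 4 5 6 (by decide) (by decide) (by decide)
    simp [pluckerEntry, rel, leadA, leadB, sortA, sortB, pertA, pertB, pertA', pertB', pertC, pertC'] at h ⊢
    linear_combination h
  · have h := hP 0 3 5 6 (by decide) (by decide) (by decide)
    simp [pluckerEntry, rel, leadA, leadB, sortA, sortB, pertA, pertB, pertA', pertB', pertC, pertC'] at h ⊢
    linear_combination -h
  · have h := hP 0 3 4 6 (by decide) (by decide) (by decide)
    simp [pluckerEntry, rel, leadA, leadB, sortA, sortB, pertA, pertB, pertA', pertB', pertC, pertC'] at h ⊢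
    apply mul_left_cancel₀ hs
    linear_combination h
  · have h := hP 1 2 4 5 (by decide) (by decide) (by decide)
    simp [pluckerEntry, rel, leadA, leadB, sortA, sortB, pertA, pertB, pertA', pertB', pertC, pertC'] at h ⊢
    apply mul_left_cancel₀ hs
    linear_combination h
  · have h := hP 0 1 2 5 (by decide) (by decide) (by decide)
    simp [pluckerEntry, rel, leadA, leadB, sortA, sortB, pertA, pertB, pertA', pertB', pertC, pertC'] at h ⊢
    apply mul_left_cancel₀ hs
    linear_combination h
  · have h := hP 0 4 5 6 (by decide) (by decide) (by decide)
    simp [pluckerEntry, rel, leadA, leadB, sortA, sortB, pertA, pertB, pertA', pertB', pertC, pertC'] at h ⊢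
    apply mul_left_cancel₀ hs
    linear_combination -h
  · have h := hP 1 3 4 5 (by decide) (by decide) (by decide)
    simp [pluckerEntry, rel, leadA, leadB, sortA, sortB, pertA, pertB, pertA', pertB', pertC, pertC'] at h ⊢
    linear_combination h
  · have h := hP 0 1 3 5 (by decide) (by decide) (by decide)
    simp [pluckerEntry, rel, leadA, leadB, sortA, sortB, pertA, pertB, pertA', pertB', pertC, pertC'] at h ⊢
    linear_combination h
  · have h := hP 1 4 5 6 (by decide) (by decide) (by decide)
    simp [pluckerEntry, rel, leadA, leadB, sortA, sortB, pertA, pertB, pertA', pertB', pertC, pertC'] at h ⊢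
    linear_combination h
  · have h := hP 0 1 4 5 (by decide) (by decide) (by decide)
    simp [pluckerEntry, rel, leadA, leadB, sortA, sortB, pertA, pertB, pertA', pertB', pertC, pertC'] at h ⊢
    linear_combination h
  · have h := hP 0 1 5 6 (by decide) (by decide) (by decide)
    simp [pluckerEntry, rel, leadA, leadB, sortA, sortB, pertA, pertB, pertA', pertB', pertC, pertC'] at h ⊢
    linear_combination -h

end Pluecker

/-! ### Isotropic five-spaces of the four-forms -/

section Isotropic

/-- The increasing sequence of length five avoiding `i` and `i.succAbove j`. -/
def skip (i : Fin 7) (j : Fin 6) : Fin 5 ↪o Fin 7 :=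
  (Fin.succAboveOrderEmb j).trans (Fin.succAboveOrderEmb i)

/-- The determinant obtained by adding two rows to a `5 × 7` matrix: the value on two linear forms
of the bivector dual to the five-space spanned by the rows. -/
def dualMinor (A : Matrix (Fin 5) (Fin 7) ℂ) (w₀ w₁ : Fin 7 → ℂ) : ℂ :=
  Matrix.det (Matrix.of (Matrix.vecCons w₀ (Matrix.vecCons w₁ A.row)))

lemma dualMinor_single (A : Matrix (Fin 5) (Fin 7) ℂ) (i : Fin 7) (j : Fin 6) :
    dualMinor A (Pi.single i 1) (Pi.single (i.succAbove j) 1) =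
      (-1) ^ ((i : ℕ) + j) * pluecker A (skip i j) := by
  rw [dualMinor, Matrix.det_succ_row_zero, Finset.sum_eq_single i, Matrix.det_succ_row_zero,
    Finset.sum_eq_single j]
  · simp [pow_add, pluecker, mul_assoc]
    rfl
  · intro k _ hk
    have : (Pi.single (i.succAbove j) 1 : Fin 7 → ℂ) (i.succAbove k) = 0 := by
      rw [Pi.single_eq_of_ne]
      exact fun h => hk (Fin.succAbove_right_injective h)
    simp [this]
  · simp
  · intro k _ hk
    simp [hk]
  · simp

/-- If `N` completes a right inverse of `A` by two columns in the kernel of `A`, the dual bivector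
of `A` is, up to scale, the wedge product of these two columns. -/
lemma dualMinor_mul_det (A : Matrix (Fin 5) (Fin 7) ℂ) (N : Matrix (Fin 7) (Fin 7) ℂ)
    (hN : ∀ i k, (A * N) i k = if k = i.succ.succ then 1 else 0) (w₀ w₁ : Fin 7 → ℂ) :
    dualMinor A w₀ w₁ * N.det =
      (w₀ ⬝ᵥ N.col 0) * (w₁ ⬝ᵥ N.col 1) - (w₀ ⬝ᵥ N.col 1) * (w₁ ⬝ᵥ N.col 0) := by
  let e : Fin 2 ⊕ Fin 5 ≃ Fin 7 := finSumFinEquiv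
  let B : Matrix (Fin 2) (Fin 5) ℂ := fun i k =>
    (Matrix.of (Matrix.vecCons w₀ (Matrix.vecCons w₁ A.row)) * N) (e (.inl i)) (e (.inr k))
  have hblock : (Matrix.of (Matrix.vecCons w₀ (Matrix.vecCons w₁ A.row)) * N).submatrix e e =
      Matrix.fromBlocks !![w₀ ⬝ᵥ N.col 0, w₀ ⬝ᵥ N.col 1; w₁ ⬝ᵥ N.col 0, w₁ ⬝ᵥ N.col 1] B 0 1 := by
    have hsucc : ∀ i : Fin 5, e (.inr i) = i.succ.succ := by
      intro i
      fin_cases i <;> rfl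
    ext i k
    rcases i with i | i <;> rcases k with k | k
    · fin_cases i <;> fin_cases k <;> rfl
    · rfl
    · have h := hN i (e (.inl k))
      have hne : e (.inl k) ≠ i.succ.succ := by
        fin_cases k
        · exact (Fin.succ_ne_zero i.succ).symm
        · exact fun h => Fin.succ_ne_zero i (Fin.succ_injective _ (show Fin.succ (0 : Fin 6) = _ from h)).symm
      rw [if_neg hne] at h
      show (Matrix.of (Matrix.vecCons w₀ (Matrix.vecCons w₁ A.row)) * N) (e (.inr i)) _ = 0
      rw [hsucc]
      exact h
    · have h := hN i (e (.inr k))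
      show (Matrix.of (Matrix.vecCons w₀ (Matrix.vecCons w₁ A.row)) * N) (e (.inr i)) _ = _
      rw [hsucc]
      refine Eq.trans h ?_
      rw [hsucc, Matrix.fromBlocks_apply₂₂, Matrix.one_apply]
      simp [Fin.ext_iff, eq_comm]
  rw [dualMinor, ← Matrix.det_mul, ← Matrix.det_submatrix_equiv_self e, hblock,
    Matrix.det_fromBlocks_zero₂₁, Matrix.det_one, mul_one, Matrix.det_fin_two_of]

/-- The Plücker coordinates of a five-space come from a decomposable bivector. -/
lemma exists_dualMinor_eq {A : Matrix (Fin 5) (Fin 7) ℂ} (hA : LinearIndependent ℂ A.row) :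
    ∃ a b : Fin 7 → ℂ, ∀ w₀ w₁, dualMinor A w₀ w₁ =
      (w₀ ⬝ᵥ a) * (w₁ ⬝ᵥ b) - (w₀ ⬝ᵥ b) * (w₁ ⬝ᵥ a) := by
  have hrank : A.rank = 5 := by simpa using hA.rank_matrix
  have hsurj : Function.Surjective A.mulVecLin := by
    rw [← LinearMap.range_eq_top]
    apply Submodule.eq_top_of_finrank_eq
    rw [← Matrix.rank, hrank]
    simp
  have hker : Module.finrank ℂ (LinearMap.ker A.mulVecLin) = 2 := by
    have := A.mulVecLin.finrank_range_add_finrank_ker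
    rw [← Matrix.rank, hrank] at this
    simp at this
    omega
  obtain ⟨R, hR⟩ := A.mulVecLin.exists_rightInverse_of_surjective (LinearMap.range_eq_top.2 hsurj)
  let b := Module.finBasisOfFinrankEq ℂ _ hker
  let C : Fin 7 → Fin 7 → ℂ := Matrix.vecCons (b 0 : Fin 7 → ℂ) (Matrix.vecCons (b 1 : Fin 7 → ℂ)
    fun i => R (Pi.single i 1))
  let N : Matrix (Fin 7) (Fin 7) ℂ := Matrix.of fun i k => C k i
  have hb : ∀ i, A.mulVec (b i : Fin 7 → ℂ) = 0 := fun i => (b i).2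
  have hRA : ∀ v, A.mulVec (R v) = v := fun v => LinearMap.congr_fun hR v
  have hAN : ∀ i k, (A * N) i k = A.mulVec (C k) i := fun i k => rfl
  have hN : ∀ i k, (A * N) i k = if k = i.succ.succ then 1 else 0 := by
    intro i k
    rw [hAN]
    refine Fin.cases ?_ (Fin.cases ?_ fun k => ?_) k
    · show A.mulVec (b 0 : Fin 7 → ℂ) i = _
      rw [hb, if_neg (Fin.succ_ne_zero i.succ).symm]
      rfl
    · show A.mulVec (b 1 : Fin 7 → ℂ) i = _
      rw [hb, if_neg fun h => Fin.succ_ne_zero i (Fin.succ_injective _ h).symm]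
      rfl
    · show A.mulVec (R (Pi.single k 1)) i = _
      rw [hRA, Pi.single_apply]
      simp [eq_comm]
  have hdet : N.det ≠ 0 := by
    intro h0
    obtain ⟨v, hv, hNv⟩ := Matrix.exists_mulVec_eq_zero_iff.2 h0
    have hv2 : ∀ i : Fin 5, v i.succ.succ = 0 := by
      intro i
      have : (A * N).mulVec v i = 0 := by rw [← Matrix.mulVec_mulVec, hNv, Matrix.mulVec_zero]; rfl
      rw [Matrix.mulVec, dotProduct] at this
      simpa only [hN, ite_mul, one_mul, zero_mul, Finset.sum_ite_eq', Finset.sum_ite_eq,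
        Finset.mem_univ, if_true] using this
    have hsum : v 0 • b 0 + v 1 • b 1 = 0 := by
      ext i
      have := congrFun hNv i
      rw [Matrix.mulVec, dotProduct, Fin.sum_univ_succ, Fin.sum_univ_succ] at this
      simp only [hv2, mul_zero, Finset.sum_const_zero, add_zero] at this
      simp only [Submodule.coe_add, Submodule.coe_smul, Pi.add_apply, Pi.smul_apply, smul_eq_mul]
      rw [mul_comm, mul_comm (v 1)]
      exact this
    have hli := Fintype.linearIndependent_iff.1 b.linearIndependent ![v 0, v 1]
      (by rw [Fin.sum_univ_two]; exact hsum)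
    apply hv
    ext i
    refine Fin.cases ?_ (Fin.cases ?_ fun k => ?_) i
    · exact hli 0
    · exact hli 1
    · exact hv2 k
  refine ⟨N.det⁻¹ • N.col 0, N.col 1, fun w₀ w₁ => ?_⟩
  apply mul_right_cancel₀ hdet
  rw [dualMinor_mul_det A N hN, dotProduct_smul, dotProduct_smul, smul_eq_mul, smul_eq_mul]
  field_simp

/-- Any bivector `a ∧ b` with `a = (c, 0, …)`, `b = (0, c, …)` comes from a five-space. -/
lemma exists_matrix_dualMinor_eq {a b : Fin 7 → ℂ} {c : ℂ} (hc : c ≠ 0) (ha0 : a 0 = c)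
    (hb0 : b 0 = 0) (hb1 : b 1 = c) :
    ∃ A : Matrix (Fin 5) (Fin 7) ℂ, LinearIndependent ℂ A.row ∧ ∀ w₀ w₁, dualMinor A w₀ w₁ =
      (w₀ ⬝ᵥ a) * (w₁ ⬝ᵥ b) - (w₀ ⬝ᵥ b) * (w₁ ⬝ᵥ a) := by
  -- The third column is scaled so as to make the determinant equal to `1`.
  let C : Fin 7 → Fin 7 → ℂ := Matrix.vecCons a (Matrix.vecCons b
    (Matrix.vecCons (Pi.single 2 (c ^ 2)⁻¹) fun i => Pi.single i.succ.succ.succ 1))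
  let N : Matrix (Fin 7) (Fin 7) ℂ := Matrix.of fun i k => C k i
  have hdet : N.det = 1 := by
    rw [Matrix.det_of_isLowerTriangular]
    · simp [Fin.prod_univ_succ, N, C, ha0, hb1]
      field_simp
    · intro i j hij
      replace hij : i < j := hij
      show C j i = 0
      fin_cases j
      · exact absurd hij (by simp)
      · have : i = 0 := by ext; have : (i : ℕ) < 1 := hij; simp; omega
        rw [this]; exact hb0
      all_goals exact Pi.single_eq_of_ne hij.ne _
  have hunit : IsUnit N := by rw [Matrix.isUnit_iff_isUnit_det, hdet]; exact isUnit_one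
  have hmul : N⁻¹ * N = 1 := Matrix.nonsing_inv_mul _ (by rw [hdet]; exact isUnit_one)
  let A : Matrix (Fin 5) (Fin 7) ℂ := Matrix.of fun i => N⁻¹ i.succ.succ
  refine ⟨A, ?_, fun w₀ w₁ => ?_⟩
  · have h := Matrix.linearIndependent_rows_of_isUnit ((Matrix.isUnit_nonsing_inv_iff).2 hunit)
    exact h.comp (fun i : Fin 5 => i.succ.succ)
      ((Fin.succ_injective _).comp (Fin.succ_injective _))
  · have h := dualMinor_mul_det A N (fun i k => by
      have : (A * N) i k = (N⁻¹ * N) i.succ.succ k := rfl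
      rw [this, hmul, Matrix.one_apply]
      simp only [eq_comm]) w₀ w₁
    rw [hdet, mul_one] at h
    exact h

/-- Laplace expansion of a maximal minor along its first column. -/
lemma detForm_vecCons (A : Matrix (Fin 5) (Fin 7) ℂ) (k : Fin 7) (r : Fin 4 → Fin 7) :
    detForm (Matrix.vecCons k r) A.row =
      ∑ j : Fin 5, (-1) ^ (j : ℕ) * A j k * detForm r (fun a => A.row (j.succAbove a)) := by
  rw [detForm_apply, Matrix.det_succ_column_zero]
  rfl

lemma sum_mul_fourForm (l s : ℂ) (A : Matrix (Fin 5) (Fin 7) ℂ) (k : Fin 7) :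
    ∑ j : Fin 5, (-1) ^ (j : ℕ) * A j k * fourForm l s (fun a => A.row (j.succAbove a)) =
      s * detForm ![k, 1, 2, 4, 6] A.row + detForm ![k, 1, 2, 3, 5] A.row +
      detForm ![k, 0, 3, 4, 6] A.row + s * detForm ![k, 0, 2, 4, 5] A.row -
      s * l * detForm ![k, 0, 1, 5, 6] A.row := by
  simp only [detForm_vecCons, Finset.mul_sum, ← Finset.sum_add_distrib, ← Finset.sum_sub_distrib]
  refine Finset.sum_congr rfl fun j _ => ?_
  simp only [fourForm, wedge, ContinuousAlternatingMap.add_apply, ContinuousAlternatingMap.sub_apply,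
    ContinuousAlternatingMap.smul_apply, smul_eq_mul]
  ring

/-- The minor on the columns of a permutation beyond the first two, and the dual minor on the first
two. -/
lemma detForm_eq_dualMinor (A : Matrix (Fin 5) (Fin 7) ℂ) (i : Fin 7) (j : Fin 6) {i' : Fin 7}
    (hj : i.succAbove j = i') {r : Fin 5 → Fin 7} (σ : Equiv.Perm (Fin 5))
    (hr : (skip i j : Fin 5 → Fin 7) ∘ σ = r) :
    detForm r A.row = (((-1) ^ ((i : ℕ) + j) * (Equiv.Perm.sign σ : ℤ) : ℤ) : ℂ) *
      dualMinor A (Pi.single i 1) (Pi.single i' 1) := by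
  subst hj hr
  rw [dualMinor_single, detForm_comp_perm, ContinuousAlternatingMap.smul_apply,
    pluecker_eq_detForm, smul_eq_mul]
  push_cast
  have : ((-1 : ℂ) ^ ((i : ℕ) + j)) * (-1) ^ ((i : ℕ) + j) = 1 := by
    rw [← mul_pow]; norm_num
  linear_combination (-(((Equiv.Perm.sign σ : ℤ) : ℂ) * detForm (skip i j : Fin 5 → Fin 7) A.row)) * this

/-- The seven linear equations cutting out, in `G(2, 7)`, the bivectors dual to isotropic
five-spaces. -/
def IsLinearSection (l s : ℂ) (p : Fin 7 → Fin 7 → ℂ) : Prop :=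
  s * p 3 5 + p 4 6 = 0 ∧ p 2 5 + s * p 3 6 = 0 ∧ -p 1 5 + s * l * p 3 4 = 0 ∧
    -(s * p 0 5) - s * p 1 6 - s * l * p 2 4 = 0 ∧ -p 0 6 + s * l * p 2 3 = 0 ∧
    s * p 0 3 + p 1 2 = 0 ∧ p 0 4 + s * p 1 3 = 0

lemma detForm_eq_zero_of_eq {r : Fin 5 → Fin 7} (A : Matrix (Fin 5) (Fin 7) ℂ) {a b : Fin 5}
    (h : r a = r b) (hab : a ≠ b) : detForm r A.row = 0 := by
  rw [detForm_apply]
  exact Matrix.det_zero_of_column_eq hab fun c => by simp [h]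

/-- The rotation of five letters sending the first one to the `m`-th one. -/
def rot : ℕ → Equiv.Perm (Fin 5)
  | 0 => 1
  | m + 1 => Equiv.swap (Fin.ofNat 5 m) (Fin.ofNat 5 (m + 1)) * rot m

lemma sign_rot {m : ℕ} (hm : m < 5) : Equiv.Perm.sign (rot m) = (-1) ^ m := by
  induction m with
  | zero => simp [rot]
  | succ m ih =>
    rw [rot, map_mul, ih (by omega), Equiv.Perm.sign_swap, pow_succ, mul_comm]
    simp only [Fin.ofNat, ne_eq, Fin.mk.injEq]
    omega

lemma sign_rot₀ : Equiv.Perm.sign (rot 0) = 1 := by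
  rw [sign_rot (by norm_num)]; rfl

lemma sign_rot₁ : Equiv.Perm.sign (rot 1) = -1 := by
  rw [sign_rot (by norm_num)]; rfl

lemma sign_rot₂ : Equiv.Perm.sign (rot 2) = 1 := by
  rw [sign_rot (by norm_num)]; rfl

lemma sign_rot₃ : Equiv.Perm.sign (rot 3) = -1 := by
  rw [sign_rot (by norm_num)]; rfl

lemma sign_rot₄ : Equiv.Perm.sign (rot 4) = 1 := by
  rw [sign_rot (by norm_num)]; rfl

lemma sum_mul_fourForm_0 (l s : ℂ) (A : Matrix (Fin 5) (Fin 7) ℂ) : ∑ j : Fin 5, (-1) ^ (j : ℕ) * A j 0 *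
      fourForm l s (fun a => A.row (j.succAbove a)) = -(s * dualMinor A (Pi.single 3 1) (Pi.single 5 1) + dualMinor A (Pi.single 4 1) (Pi.single 6 1)) := by
  rw [sum_mul_fourForm, detForm_eq_dualMinor A 3 4 (i' := 5) (r := ![0, 1, 2, 4, 6]) rfl (rot 0) (by decide),
    detForm_eq_dualMinor A 4 5 (i' := 6) (r := ![0, 1, 2, 3, 5]) rfl (rot 0) (by decide),
    detForm_eq_zero_of_eq (r := ![0, 0, 3, 4, 6]) A (a := 0) (b := 1) rfl (by decide),
    detForm_eq_zero_of_eq (r := ![0, 0, 2, 4, 5]) A (a := 0) (b := 1) rfl (by decide),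
    detForm_eq_zero_of_eq (r := ![0, 0, 1, 5, 6]) A (a := 0) (b := 1) rfl (by decide)]
  simp only [sign_rot₀, sign_rot₁, sign_rot₂, sign_rot₃, sign_rot₄]
  norm_num
  try ring

lemma sum_mul_fourForm_1 (l s : ℂ) (A : Matrix (Fin 5) (Fin 7) ℂ) : ∑ j : Fin 5, (-1) ^ (j : ℕ) * A j 1 *
      fourForm l s (fun a => A.row (j.succAbove a)) = -(dualMinor A (Pi.single 2 1) (Pi.single 5 1) + s * dualMinor A (Pi.single 3 1) (Pi.single 6 1)) := by
  rw [sum_mul_fourForm, detForm_eq_zero_of_eq (r := ![1, 1, 2, 4, 6]) A (a := 0) (b := 1) rfl (by decide),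
    detForm_eq_zero_of_eq (r := ![1, 1, 2, 3, 5]) A (a := 0) (b := 1) rfl (by decide),
    detForm_eq_dualMinor A 2 4 (i' := 5) (r := ![1, 0, 3, 4, 6]) rfl (rot 1) (by decide),
    detForm_eq_dualMinor A 3 5 (i' := 6) (r := ![1, 0, 2, 4, 5]) rfl (rot 1) (by decide),
    detForm_eq_zero_of_eq (r := ![1, 0, 1, 5, 6]) A (a := 0) (b := 2) rfl (by decide)]
  simp only [sign_rot₀, sign_rot₁, sign_rot₂, sign_rot₃, sign_rot₄]
  norm_num
  try ring

lemma sum_mul_fourForm_2 (l s : ℂ) (A : Matrix (Fin 5) (Fin 7) ℂ) : ∑ j : Fin 5, (-1) ^ (j : ℕ) * A j 2 *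
      fourForm l s (fun a => A.row (j.succAbove a)) = -(-dualMinor A (Pi.single 1 1) (Pi.single 5 1) + s * l * dualMinor A (Pi.single 3 1) (Pi.single 4 1)) := by
  rw [sum_mul_fourForm, detForm_eq_zero_of_eq (r := ![2, 1, 2, 4, 6]) A (a := 0) (b := 2) rfl (by decide),
    detForm_eq_zero_of_eq (r := ![2, 1, 2, 3, 5]) A (a := 0) (b := 2) rfl (by decide),
    detForm_eq_dualMinor A 1 4 (i' := 5) (r := ![2, 0, 3, 4, 6]) rfl (rot 1) (by decide),
    detForm_eq_zero_of_eq (r := ![2, 0, 2, 4, 5]) A (a := 0) (b := 2) rfl (by decide),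
    detForm_eq_dualMinor A 3 3 (i' := 4) (r := ![2, 0, 1, 5, 6]) rfl (rot 2) (by decide)]
  simp only [sign_rot₀, sign_rot₁, sign_rot₂, sign_rot₃, sign_rot₄]
  norm_num
  try ring

lemma sum_mul_fourForm_3 (l s : ℂ) (A : Matrix (Fin 5) (Fin 7) ℂ) : ∑ j : Fin 5, (-1) ^ (j : ℕ) * A j 3 *
      fourForm l s (fun a => A.row (j.succAbove a)) = -(-(s * dualMinor A (Pi.single 0 1) (Pi.single 5 1)) - s * dualMinor A (Pi.single 1 1) (Pi.single 6 1) - s * l * dualMinor A (Pi.single 2 1) (Pi.single 4 1)) := by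
  rw [sum_mul_fourForm, detForm_eq_dualMinor A 0 4 (i' := 5) (r := ![3, 1, 2, 4, 6]) rfl (rot 2) (by decide),
    detForm_eq_zero_of_eq (r := ![3, 1, 2, 3, 5]) A (a := 0) (b := 3) rfl (by decide),
    detForm_eq_zero_of_eq (r := ![3, 0, 3, 4, 6]) A (a := 0) (b := 2) rfl (by decide),
    detForm_eq_dualMinor A 1 5 (i' := 6) (r := ![3, 0, 2, 4, 5]) rfl (rot 2) (by decide),
    detForm_eq_dualMinor A 2 3 (i' := 4) (r := ![3, 0, 1, 5, 6]) rfl (rot 2) (by decide)]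
  simp only [sign_rot₀, sign_rot₁, sign_rot₂, sign_rot₃, sign_rot₄]
  norm_num
  try ring

lemma sum_mul_fourForm_4 (l s : ℂ) (A : Matrix (Fin 5) (Fin 7) ℂ) : ∑ j : Fin 5, (-1) ^ (j : ℕ) * A j 4 *
      fourForm l s (fun a => A.row (j.succAbove a)) = -(-dualMinor A (Pi.single 0 1) (Pi.single 6 1) + s * l * dualMinor A (Pi.single 2 1) (Pi.single 3 1)) := by
  rw [sum_mul_fourForm, detForm_eq_zero_of_eq (r := ![4, 1, 2, 4, 6]) A (a := 0) (b := 3) rfl (by decide),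
    detForm_eq_dualMinor A 0 5 (i' := 6) (r := ![4, 1, 2, 3, 5]) rfl (rot 3) (by decide),
    detForm_eq_zero_of_eq (r := ![4, 0, 3, 4, 6]) A (a := 0) (b := 3) rfl (by decide),
    detForm_eq_zero_of_eq (r := ![4, 0, 2, 4, 5]) A (a := 0) (b := 3) rfl (by decide),
    detForm_eq_dualMinor A 2 2 (i' := 3) (r := ![4, 0, 1, 5, 6]) rfl (rot 2) (by decide)]
  simp only [sign_rot₀, sign_rot₁, sign_rot₂, sign_rot₃, sign_rot₄]
  norm_num
  try ring

lemma sum_mul_fourForm_5 (l s : ℂ) (A : Matrix (Fin 5) (Fin 7) ℂ) : ∑ j : Fin 5, (-1) ^ (j : ℕ) * A j 5 *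
      fourForm l s (fun a => A.row (j.succAbove a)) = -(s * dualMinor A (Pi.single 0 1) (Pi.single 3 1) + dualMinor A (Pi.single 1 1) (Pi.single 2 1)) := by
  rw [sum_mul_fourForm, detForm_eq_dualMinor A 0 2 (i' := 3) (r := ![5, 1, 2, 4, 6]) rfl (rot 3) (by decide),
    detForm_eq_zero_of_eq (r := ![5, 1, 2, 3, 5]) A (a := 0) (b := 4) rfl (by decide),
    detForm_eq_dualMinor A 1 1 (i' := 2) (r := ![5, 0, 3, 4, 6]) rfl (rot 3) (by decide),
    detForm_eq_zero_of_eq (r := ![5, 0, 2, 4, 5]) A (a := 0) (b := 4) rfl (by decide),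
    detForm_eq_zero_of_eq (r := ![5, 0, 1, 5, 6]) A (a := 0) (b := 3) rfl (by decide)]
  simp only [sign_rot₀, sign_rot₁, sign_rot₂, sign_rot₃, sign_rot₄]
  norm_num
  try ring

lemma sum_mul_fourForm_6 (l s : ℂ) (A : Matrix (Fin 5) (Fin 7) ℂ) : ∑ j : Fin 5, (-1) ^ (j : ℕ) * A j 6 *
      fourForm l s (fun a => A.row (j.succAbove a)) = -(dualMinor A (Pi.single 0 1) (Pi.single 4 1) + s * dualMinor A (Pi.single 1 1) (Pi.single 3 1)) := by
  rw [sum_mul_fourForm, detForm_eq_zero_of_eq (r := ![6, 1, 2, 4, 6]) A (a := 0) (b := 4) rfl (by decide),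
    detForm_eq_dualMinor A 0 3 (i' := 4) (r := ![6, 1, 2, 3, 5]) rfl (rot 4) (by decide),
    detForm_eq_zero_of_eq (r := ![6, 0, 3, 4, 6]) A (a := 0) (b := 4) rfl (by decide),
    detForm_eq_dualMinor A 1 2 (i' := 3) (r := ![6, 0, 2, 4, 5]) rfl (rot 4) (by decide),
    detForm_eq_zero_of_eq (r := ![6, 0, 1, 5, 6]) A (a := 0) (b := 4) rfl (by decide)]
  simp only [sign_rot₀, sign_rot₁, sign_rot₂, sign_rot₃, sign_rot₄]
  norm_num
  try ring

/-- The contractions of the four-form with a five-space are the seven linear forms in its dual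
Plücker coordinates. -/
lemma isLinearSection_iff (l s : ℂ) (A : Matrix (Fin 5) (Fin 7) ℂ) :
    IsLinearSection l s (fun i j => dualMinor A (Pi.single i 1) (Pi.single j 1)) ↔
      ∀ k, ∑ j : Fin 5, (-1) ^ (j : ℕ) * A j k *
        fourForm l s (fun a => A.row (j.succAbove a)) = 0 := by
  show _ = 0 ∧ _ = 0 ∧ _ = 0 ∧ _ = 0 ∧ _ = 0 ∧ _ = 0 ∧ _ = 0 ↔ _
  simp only [Fin.forall_fin_succ, Fin.succ_zero_eq_one, Fin.succ_one_eq_two, IsEmpty.forall_iff, and_true]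
  exact and_congr (by rw [sum_mul_fourForm_0, neg_eq_zero]) (and_congr (by rw [sum_mul_fourForm_1, neg_eq_zero])
    (and_congr (by rw [sum_mul_fourForm_2, neg_eq_zero]) (and_congr (by erw [sum_mul_fourForm_3, neg_eq_zero])
    (and_congr (by erw [sum_mul_fourForm_4, neg_eq_zero]) (and_congr (by erw [sum_mul_fourForm_5, neg_eq_zero])
    (by erw [sum_mul_fourForm_6, neg_eq_zero]))))))

end Isotropic

/-! ### The variety `G₂` as a member of the two-parameter family -/

section G2

open MvPolynomial

/-- An alternating four-form vanishing on all but one of the rows, for every row, vanishes on the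
span of the rows. -/
lemma isotropic_of_rows {A : Matrix (Fin 5) (Fin 7) ℂ} (hA : LinearIndependent ℂ A.row)
    (η : (Fin 7 → ℂ) [⋀^Fin 4]→L[ℂ] ℂ) (h : ∀ j : Fin 5, η (fun a => A.row (j.succAbove a)) = 0)
    (v : Fin 4 → (Fin 7 → ℂ)) (hv : ∀ a, v a ∈ Submodule.span ℂ (Set.range A.row)) : η v = 0 := by
  let W := Submodule.span ℂ (Set.range A.row)
  let b : Module.Basis (Fin 5) ℂ W := Module.Basis.span hA
  have hb : ∀ i, (b i : Fin 7 → ℂ) = A.row i := fun i =>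
    congrArg Subtype.val (Module.Basis.span_apply hA i)
  have hzero : η.toAlternatingMap.compLinearMap W.subtype = 0 := by
    refine b.ext_alternating fun f hf => ?_
    obtain ⟨j, hj⟩ : ∃ j, ∀ a, f a ≠ j := by
      by_contra hcon
      push Not at hcon
      have := Fintype.card_le_of_surjective f hcon
      simp at this
    choose σ hσ using fun a => Fin.exists_succAbove_eq (hj a)
    have hσinj : Function.Injective σ := fun a a' haa => hf (by rw [← hσ a, ← hσ a', haa])
    let τ : Equiv.Perm (Fin 4) := Equiv.ofBijective σ (Finite.injective_iff_bijective.1 hσinj)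
    have key := η.toAlternatingMap.map_perm (fun a => A.row (j.succAbove a)) τ
    have h0 : η.toAlternatingMap (fun a => A.row (j.succAbove a)) = 0 := h j
    rw [h0, smul_zero] at key
    rw [AlternatingMap.compLinearMap_apply, AlternatingMap.zero_apply, ← key]
    congr 1
    funext a
    show (b (f a) : Fin 7 → ℂ) = A.row (j.succAbove (σ a))
    rw [hb, hσ]
  have := congrArg (fun g => g fun a => (⟨v a, hv a⟩ : W)) hzero
  exact this

/-- A five-space is isotropic if and only if its dual bivector satisfies the seven linear
equations. -/
lemma isotropic_iff_isLinearSection (l s : ℂ) {A : Matrix (Fin 5) (Fin 7) ℂ}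
    (hA : LinearIndependent ℂ A.row) :
    (∀ v : Fin 4 → (Fin 7 → ℂ), (∀ a, v a ∈ Submodule.span ℂ (Set.range A.row)) →
      fourForm l s v = 0) ↔
    IsLinearSection l s (fun i j => dualMinor A (Pi.single i 1) (Pi.single j 1)) := by
  rw [isLinearSection_iff]
  constructor
  · intro h k
    refine Finset.sum_eq_zero fun j _ => ?_
    rw [h _ fun a => Submodule.subset_span ⟨_, rfl⟩, mul_zero]
  · intro h
    refine isotropic_of_rows hA _ fun j => ?_
    have hz := Fintype.linearIndependent_iff.1 hA
      (fun j => (-1) ^ (j : ℕ) * fourForm l s (fun a => A.row (j.succAbove a))) (by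
        ext k
        rw [Finset.sum_apply, Pi.zero_apply, ← h k]
        refine Finset.sum_congr rfl fun j _ => ?_
        rw [Pi.smul_apply, smul_eq_mul]
        show _ * A j k = _
        ring) j
    exact (mul_eq_zero.1 hz).resolve_left (pow_ne_zero _ (by norm_num))

/-- Every increasing sequence of five out of seven indices omits two indices. -/
lemma exists_eq_skip (e : Fin 5 ↪o Fin 7) : ∃ (i : Fin 7) (j : Fin 6),
    (i : ℕ) ≤ j ∧ e = skip i j := by
  classical
  set S : Finset (Fin 7) := Finset.univ.map e.toEmbedding with hS
  have hcard : Sᶜ.card = 2 := by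
    rw [Finset.card_compl, hS, Finset.card_map]
    simp
  obtain ⟨a, b, hab, hSc⟩ := Finset.card_eq_two.1 hcard
  wlog hlt : a < b generalizing a b
  · exact this b a hab.symm (by rw [hSc, Finset.pair_comm]) (lt_of_le_of_ne (not_lt.1 hlt) hab.symm)
  obtain ⟨j, hj⟩ := Fin.exists_succAbove_eq hab.symm
  refine ⟨a, j, ?_, ?_⟩
  · by_contra hcon
    rw [Fin.succAbove_of_castSucc_lt _ _ (by rw [Fin.lt_def]; simpa using hcon)] at hj
    rw [← hj, Fin.lt_def, Fin.val_castSucc] at hlt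
    omega
  · have hmem : ∀ c, skip a j c ∈ S := by
      intro c
      by_contra hc
      rw [← Finset.mem_compl, hSc, Finset.mem_insert, Finset.mem_singleton] at hc
      rcases hc with hc | hc
      · exact Fin.succAbove_ne a _ hc
      · rw [← hj] at hc
        exact Fin.succAbove_ne j _ (Fin.succAbove_right_injective hc)
    have hSr : S = Finset.univ.map (skip a j).toEmbedding := by
      symm
      apply Finset.eq_of_subset_of_card_le
      · intro x hx
        obtain ⟨c, -, rfl⟩ := Finset.mem_map.1 hx
        exact hmem c
      · rw [hS, Finset.card_map, Finset.card_map]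
    have h5 : S.card = 5 := by rw [hS, Finset.card_map]; simp
    have e1 := Finset.orderEmbOfFin_unique' h5 (f := e) (fun x => by simp [hS])
    have e2 := Finset.orderEmbOfFin_unique' h5 (f := skip a j) (fun x => hmem x)
    rw [e1, e2]

lemma pluckerEntry_add (l s : ℂ) (x y : Fin 14 → ℂ) :
    pluckerEntry l s (x + y) = pluckerEntry l s x + pluckerEntry l s y := by
  ext i j
  fin_cases i <;> fin_cases j <;> simp [pluckerEntry] <;> ring

lemma pluckerEntry_smul (l s c : ℂ) (x : Fin 14 → ℂ) :
    pluckerEntry l s (c • x) = c • pluckerEntry l s x := by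
  ext i j
  fin_cases i <;> fin_cases j <;> simp [pluckerEntry] <;> ring

/-- The first of the two indices omitted by an increasing sequence. -/
def omitted₀ (e : Fin 5 ↪o Fin 7) : Fin 7 := (exists_eq_skip e).choose

/-- The position of the second index omitted by an increasing sequence, among the indices
different from the first one. -/
def omitted₁ (e : Fin 5 ↪o Fin 7) : Fin 6 := (exists_eq_skip e).choose_spec.choose

lemma omitted_le (e : Fin 5 ↪o Fin 7) : (omitted₀ e : ℕ) ≤ omitted₁ e :=
  (exists_eq_skip e).choose_spec.choose_spec.1

lemma eq_skip (e : Fin 5 ↪o Fin 7) : e = skip (omitted₀ e) (omitted₁ e) :=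
  (exists_eq_skip e).choose_spec.choose_spec.2

/-- The linear map from the fourteen coordinates to the Plücker coordinates of `G(5, 7)`. -/
def toPluecker (l s : ℂ) : (Fin 14 → ℂ) →ₗ[ℂ] ((Fin 5 ↪o Fin 7) → ℂ) where
  toFun x e := (-1) ^ ((omitted₀ e : ℕ) + omitted₁ e) *
    pluckerEntry l s x (omitted₀ e) ((omitted₀ e).succAbove (omitted₁ e))
  map_add' x y := by
    ext e
    simp [pluckerEntry_add, mul_add]
  map_smul' c x := by
    ext e
    simp [pluckerEntry_smul, mul_left_comm]

/-- The first index of the dual Plücker coordinate equal, up to sign, to each of the fourteen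
coordinates. -/
def coordFst : Fin 14 → Fin 7 := ![2, 2, 0, 2, 3, 0, 3, 1, 3, 1, 4, 0, 1, 5]

/-- The second index of the dual Plücker coordinate equal, up to sign, to each of the fourteen
coordinates, lowered by one. -/
def coordSnd : Fin 14 → Fin 6 := ![2, 3, 1, 5, 3, 2, 5, 2, 4, 3, 4, 0, 5, 5]

/-- The sign relating the fourteen coordinates to dual Plücker coordinates. -/
def coordSign : Fin 14 → ℂ := ![-1, -1, 1, -1, -1, 1, -1, -1, 1, -1, 1, 1, -1, -1]

/-- The linear map selecting the fourteen coordinates among the Plücker coordinates. -/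
def ofPluecker : ((Fin 5 ↪o Fin 7) → ℂ) →ₗ[ℂ] (Fin 14 → ℂ) where
  toFun P n := coordSign n * ((-1) ^ ((coordFst n : ℕ) + coordSnd n) *
    P (skip (coordFst n) (coordSnd n)))
  map_add' x y := by
    ext e
    simp [mul_add]
  map_smul' c x := by
    ext e
    simp [mul_left_comm]

lemma ofPluecker_pluecker (A : Matrix (Fin 5) (Fin 7) ℂ) (n : Fin 14) :
    ofPluecker (pluecker A) n = coordSign n * dualMinor A (Pi.single (coordFst n) 1)
      (Pi.single ((coordFst n).succAbove (coordSnd n)) 1) := by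
  rw [dualMinor_single]
  rfl

lemma coord_pluckerEntry (l s : ℂ) (x : Fin 14 → ℂ) (n : Fin 14) :
    coordSign n * pluckerEntry l s x (coordFst n) ((coordFst n).succAbove (coordSnd n)) = x n := by
  fin_cases n <;> simp [coordSign, coordFst, coordSnd, pluckerEntry, Fin.succAbove, Fin.lt_def]

lemma toPluecker_eq {l s : ℂ} {A : Matrix (Fin 5) (Fin 7) ℂ} {x : Fin 14 → ℂ}
    (h : ∀ i j, i < j → dualMinor A (Pi.single i 1) (Pi.single j 1) = pluckerEntry l s x i j) :
    toPluecker l s x = pluecker A := by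
  ext e
  have hlt : omitted₀ e < (omitted₀ e).succAbove (omitted₁ e) := by
    rw [Fin.succAbove_of_le_castSucc _ _ (by rw [Fin.le_def]; exact omitted_le e), Fin.lt_def]
    have := omitted_le e
    simp
    omega
  have h1 := dualMinor_single A (omitted₀ e) (omitted₁ e)
  rw [h _ _ hlt, ← eq_skip e] at h1
  show (-1) ^ _ * pluckerEntry l s x _ _ = _
  rw [h1, ← mul_assoc, ← mul_pow]
  norm_num

lemma ofPluecker_eq {l s : ℂ} {A : Matrix (Fin 5) (Fin 7) ℂ} {x : Fin 14 → ℂ}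
    (h : ∀ i j, i < j → dualMinor A (Pi.single i 1) (Pi.single j 1) = pluckerEntry l s x i j) :
    ofPluecker (pluecker A) = x := by
  ext n
  rw [ofPluecker_pluecker, h, coord_pluckerEntry]
  fin_cases n <;> simp [coordFst, coordSnd, Fin.succAbove, Fin.lt_def]

/-- The dual Plücker coordinates of an isotropic five-space in terms of the fourteen
coordinates. -/
lemma dualMinor_eq_pluckerEntry {l s : ℂ} (hs : s ≠ 0) {A : Matrix (Fin 5) (Fin 7) ℂ}
    (h : IsLinearSection l s (fun i j => dualMinor A (Pi.single i 1) (Pi.single j 1)))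
    (i j : Fin 7) (hij : i < j) : dualMinor A (Pi.single i 1) (Pi.single j 1) =
      pluckerEntry l s (ofPluecker (pluecker A)) i j := by
  have hx : ∀ n, ofPluecker (pluecker A) n = _ := ofPluecker_pluecker A
  obtain ⟨h0, h1, h2, h3, h4, h5, h6⟩ := h
  have h3' : dualMinor A (Pi.single 0 1) (Pi.single 5 1) +
    dualMinor A (Pi.single 1 1) (Pi.single 6 1) + l * dualMinor A (Pi.single 2 1) (Pi.single 4 1)
      = 0 := by
    apply mul_left_cancel₀ hs
    linear_combination -h3
  revert hij
  fin_cases i <;> fin_cases j <;> intro hij <;>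
    first
    | exact absurd hij (by decide)
    | simp [pluckerEntry, hx, coordSign, coordFst, coordSnd, Fin.succAbove, Fin.lt_def]
  · linear_combination h6
  · linear_combination h3'
  · linear_combination -h4
  · linear_combination h5
  · linear_combination -h2
  · linear_combination h1
  · linear_combination h0

/-- The points of the cone over the parametrized fivefold coming from the chart `u ≠ 0`. -/
def parametrizedCone (l s : ℂ) : Set (Fin 14 → ℂ) :=
  {x | ∃ q : Fin 6 → ℂ, q 4 ≠ 0 ∧ x = quarticVal l s q}

lemma aeval_quarticVal (l s : ℂ) (q : Fin 6 → ℂ) (f : MvPolynomial (Fin 14) ℂ) :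
    aeval (quarticVal l s q) f = eval q (aeval (quartic l s) f) := by
  have h : (aeval (quarticVal l s q) : MvPolynomial (Fin 14) ℂ →ₐ[ℂ] ℂ) =
      (aeval q : MvPolynomial (Fin 6) ℂ →ₐ[ℂ] ℂ).comp (aeval (quartic l s)) := by
    ext j
    rw [aeval_X, AlgHom.comp_apply, aeval_X]
    fin_cases j <;> simp [quartic, quarticVal, quadricVal]
  exact DFunLike.congr_fun h f

lemma vanishingIdeal_parametrizedCone (l s : ℂ) :
    vanishingIdeal ℂ (parametrizedCone l s) = familyIdeal l s := by
  ext f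
  rw [mem_vanishingIdeal_iff, ← aeval_quartic_eq_zero_iff]
  constructor
  · intro h
    have h0 : X 4 * aeval (quartic l s) f = 0 := by
      apply MvPolynomial.funext
      intro q
      rw [map_mul, eval_X, map_zero]
      by_cases hq : q 4 = 0
      · rw [hq, zero_mul]
      · rw [← aeval_quarticVal, h _ ⟨q, hq, rfl⟩, mul_zero]
    exact (mul_eq_zero.1 h0).resolve_left (X_ne_zero _)
  · rintro h _ ⟨q, -, rfl⟩
    rw [aeval_quarticVal, h, map_zero]

/-- The point of the parametrized fivefold with parameter `q`, as a bivector. -/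
lemma pluckerEntry_quarticVal (l s : ℂ) (q : Fin 6 → ℂ) :
    ∃ a b : Fin 7 → ℂ, a 0 = q 4 ^ 2 ∧ b 0 = 0 ∧ b 1 = q 4 ^ 2 ∧ ∀ i j, i < j →
      pluckerEntry l s (quarticVal l s q) i j = a i * b j - b i * a j := by
  refine ⟨![q 4 ^ 2, 0, s * q 0 * q 4, q 1 * q 4, q 2 * q 4, s * l * (q 0 * q 2 - s * q 1 ^ 2),
      q 5 * q 4],
    ![0, q 4 ^ 2, q 3 * q 4, q 0 * q 4, s * q 1 * q 4,
      q 5 * q 4 + l * (q 2 * q 3 - s ^ 2 * (q 0 * q 1)), -(s * l * (q 1 * q 3 - s * q 0 ^ 2))],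
    rfl, rfl, rfl, ?_⟩
  intro i j hij
  revert hij
  fin_cases i <;> fin_cases j <;> intro hij <;>
    first
    | exact absurd hij (by decide)
    | (simp [pluckerEntry, quarticVal, quadricVal, -mul_eq_mul_left_iff, -mul_eq_mul_right_iff];
       try ring)

/-- For `l`, `s` non-zero, the member of the two-parameter family is `G₂`: the seven linear
equations express all Plücker coordinates of isotropic five-spaces in the fourteen coordinates, which
satisfy the Plücker relations; conversely the parametrization gives isotropic five-spaces. -/
theorem projectivelyIsomorphic_familyIdeal_G2Ideal (l : ℂ) {s : ℂ} (hs : s ≠ 0) :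
    ProjectivelyIsomorphic (familyIdeal l s) (G2Ideal (fourForm l s)) := by
  classical
  rw [← vanishingIdeal_parametrizedCone]
  refine projectivelyIsomorphic_vanishingIdeal (toPluecker l s) ofPluecker ?_ ?_
  · rintro _ ⟨q, hq, rfl⟩
    obtain ⟨a, b, ha0, hb0, hb1, hab⟩ := pluckerEntry_quarticVal l s q
    obtain ⟨A, hA, hAab⟩ := exists_matrix_dualMinor_eq (pow_ne_zero 2 hq) ha0 hb0 hb1
    have hE : ∀ i j, i < j → dualMinor A (Pi.single i 1) (Pi.single j 1) =
        pluckerEntry l s (quarticVal l s q) i j := by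
      intro i j hij
      rw [hAab, hab i j hij]
      simp only [single_one_dotProduct]
    rw [toPluecker_eq hE, ofPluecker_eq hE]
    refine ⟨fun f hf => mem_vanishingIdeal_iff.1 hf _ ⟨A, hA, ?_, rfl⟩, rfl⟩
    rw [isotropic_iff_isLinearSection l s hA]
    refine ⟨?_, ?_, ?_, ?_, ?_, ?_, ?_⟩ <;> beta_reduce
    · rw [hE 3 5 (by decide), hE 4 6 (by decide)]
      simp [pluckerEntry]
    · rw [hE 2 5 (by decide), hE 3 6 (by decide)]
      simp [pluckerEntry]
    · rw [hE 1 5 (by decide), hE 3 4 (by decide)]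
      simp [pluckerEntry]
    · rw [hE 0 5 (by decide), hE 1 6 (by decide), hE 2 4 (by decide)]
      simp [pluckerEntry]
      ring
    · rw [hE 0 6 (by decide), hE 2 3 (by decide)]
      simp [pluckerEntry]
    · rw [hE 0 3 (by decide), hE 1 2 (by decide)]
      simp [pluckerEntry]
    · rw [hE 0 4 (by decide), hE 1 3 (by decide)]
      simp [pluckerEntry]
  · rintro _ ⟨A, hA, hiso, rfl⟩
    have hL := (isotropic_iff_isLinearSection l s hA).1 hiso
    have hE := dualMinor_eq_pluckerEntry hs hL
    refine ⟨fun f hf => ?_, toPluecker_eq hE⟩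
    rw [vanishingIdeal_parametrizedCone] at hf
    obtain ⟨a, b, hab⟩ := exists_dualMinor_eq hA
    have hrel : ∀ k, eval (ofPluecker (pluecker A)) (rel l s k) = 0 := by
      refine eval_rel_of_pluecker hs fun i j k m hij hjk hkm => ?_
      rw [← hE i j hij, ← hE k m hkm, ← hE i k (hij.trans hjk), ← hE j m (hjk.trans hkm),
        ← hE i m (hij.trans (hjk.trans hkm)), ← hE j k hjk]
      simp only [hab, single_one_dotProduct]
      ring
    have hle : familyIdeal l s ≤ RingHom.ker (eval (ofPluecker (pluecker A))) := by
      rw [familyIdeal, Ideal.span_le]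
      rintro _ ⟨k, rfl⟩
      exact hrel k
    exact hle hf

/-- For `l`, `s` non-zero, the member of the two-parameter family is the variety of isotropic
five-spaces of any non-degenerate four-form. -/
theorem projectivelyIsomorphic_familyIdeal {ω : (Fin 7 → ℂ) [⋀^Fin 4]→L[ℂ] ℂ}
    (hω : IsNondegenerateForm ω) {l s : ℂ} (hl : l ≠ 0) (hs : s ≠ 0) :
    ProjectivelyIsomorphic (familyIdeal l s) (G2Ideal ω) :=
  (projectivelyIsomorphic_familyIdeal_G2Ideal l hs).trans
    (sameOrbit_of_isOpen (surjective_infinitesimalAction_fourForm hl hs) hω).symm.projectivelyIsomorphic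

/-- The coordinate function of the disc. -/
def HolRing.coord : HolRing :=
  (⟨fun s => (s : ℂ), id, differentiableOn_id, fun _ => rfl⟩ : HolDisc)

/-- The constant functions on the disc. -/
def HolRing.const (c : ℂ) : HolRing :=
  (⟨fun _ => c, fun _ => c, differentiableOn_const c, fun _ => rfl⟩ : HolDisc)

lemma HolRing.ev_coord (s : Disc) : HolRing.ev s HolRing.coord = s := rfl

lemma HolRing.ev_const (s : Disc) (c : ℂ) : HolRing.ev s (HolRing.const c) = c := rfl

/-- `G₂` degenerates to the fivefold obtained from the curve with parameter `s`: let the parameter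
`l` tend to zero, and also `s` if the target is the toric variety. -/
theorem degeneratesOverDisc_G2Ideal {ω : (Fin 7 → ℂ) [⋀^Fin 4]→L[ℂ] ℂ}
    (hω : IsNondegenerateForm ω) (s : ℂ) :
    DegeneratesOverDisc (G2Ideal ω) (familyIdeal 0 s) := by
  have hne : ∀ r : Disc, r ≠ Disc.center → (r : ℂ) ≠ 0 := fun r hr h => hr (Subtype.ext h)
  by_cases hs : s = 0
  · subst hs
    refine ⟨14, familyIdeal HolRing.coord HolRing.coord,
      isFlatFamilyOverDisc_familyIdeal _ _, fun r hr => ?_, ?_⟩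
    · rw [fibreIdeal_familyIdeal, HolRing.ev_coord]
      exact projectivelyIsomorphic_familyIdeal hω (hne r hr) (hne r hr)
    · rw [fibreIdeal_familyIdeal, HolRing.ev_coord]
      exact ProjectivelyIsomorphic.refl _
  · refine ⟨14, familyIdeal HolRing.coord (HolRing.const s),
      isFlatFamilyOverDisc_familyIdeal _ _, fun r hr => ?_, ?_⟩
    · rw [fibreIdeal_familyIdeal, HolRing.ev_coord, HolRing.ev_const]
      exact projectivelyIsomorphic_familyIdeal hω (hne r hr) hs
    · rw [fibreIdeal_familyIdeal, HolRing.ev_coord, HolRing.ev_const]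
      exact ProjectivelyIsomorphic.refl _

lemma specialize_quadric (c : HolRing) (s : Disc) (j : Fin 14) :
    specialize s (quadric c j) = quadric (HolRing.ev s c) j := by
  fin_cases j <;> simp [specialize, quadric, quadricVal]

end G2

/-! ### The lattice polytope of the toric fibre -/

section Polytope

/-- The position of the five torus coordinates `x, y, z, t, v` among the six letters. -/
def letter : Fin 5 → Fin 6 := ![0, 1, 2, 3, 5]

/-- The exponent, in the letters `x, y, z, t, v`, of the `j`-th degree two monomial; the
letter `u` is set to `1`. -/
def character (j : Fin 14) (i : Fin 5) : ℤ :=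
  (if lo j = letter i then 1 else 0) + (if hi j = letter i then 1 else 0)

/-- The constant terms of the nine facet inequalities. -/
def facetConst : Fin 9 → ℤ := ![0, 0, 0, 0, 0, 2, 1, 1, 1]

/-- The normal vectors of the nine facets: the six letters and the three conditions
`y + z ≤ 1`, `x + y ≤ 1`, `t + x ≤ 1`. -/
def facetNormal : Fin 9 → Fin 5 → ℤ :=
  ![![1, 0, 0, 0, 0], ![0, 1, 0, 0, 0], ![0, 0, 1, 0, 0], ![0, 0, 0, 1, 0], ![0, 0, 0, 0, 1],
    ![-1, -1, -1, -1, -1], ![0, -1, -1, 0, 0], ![-1, -1, 0, 0, 0], ![-1, 0, 0, -1, 0]]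

/-- The linear part of the `l`-th facet inequality. -/
def facetForm (l : Fin 9) : (Fin 5 → ℤ) →+ ℤ where
  toFun a := ∑ i, facetNormal l i * a i
  map_zero' := by simp
  map_add' a b := by simp [mul_add, Finset.sum_add_distrib]

lemma facetForm_apply (l : Fin 9) (a : Fin 5 → ℤ) :
    facetForm l a = ∑ i, facetNormal l i * a i := rfl

/-- The value at the `j`-th lattice point of the `l`-th facet inequality. -/
def facetHeight (l : Fin 9) (j : Fin 14) : ℕ :=
  (![![0, 0, 0, 0, 1, 1, 1, 0, 0, 0, 0, 0, 0, 0], ![1, 0, 0, 0, 0, 0, 0, 1, 1, 0, 0, 0, 0, 0],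
    ![0, 1, 0, 0, 1, 0, 0, 0, 0, 1, 1, 0, 0, 0], ![1, 1, 1, 1, 0, 0, 0, 0, 0, 0, 0, 0, 0, 0],
    ![0, 0, 0, 1, 0, 0, 1, 0, 1, 0, 1, 0, 1, 2], ![0, 0, 1, 0, 0, 1, 0, 1, 0, 1, 0, 2, 1, 0],
    ![0, 0, 1, 1, 0, 1, 1, 0, 0, 0, 0, 1, 1, 1], ![0, 1, 1, 1, 0, 0, 0, 0, 0, 1, 1, 1, 1, 1],
    ![0, 0, 0, 0, 0, 0, 0, 1, 1, 1, 1, 1, 1, 1]] : Fin 9 → Fin 14 → ℕ) l j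

lemma facetHeight_eq (l : Fin 9) (j : Fin 14) :
    (facetHeight l j : ℤ) = facetConst l + facetForm l (character j) := by
  rw [facetForm_apply]
  revert l j
  decide

/-- The tangent cone of the polytope at the `j`-th lattice point. -/
def coneAt (j : Fin 14) : AddSubmonoid (Fin 5 → ℤ) where
  carrier := {a | ∀ l, facetHeight l j = 0 → 0 ≤ facetForm l a}
  zero_mem' := by intro l _; simp
  add_mem' := by
    intro a b ha hb l hl
    rw [map_add]
    exact add_nonneg (ha l hl) (hb l hl)

/-- A non-zero lattice point in the cone over the polytope can be diminished by a lattice point of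
the polytope itself: such a point has to lie on all the facets `y + z = 1`, `x + y = 1`,
`t + x = 1` on which the given point lies. -/
lemma exists_facetHeight_le {d : ℤ} (hd : 0 < d) {a : Fin 5 → ℤ}
    (h : ∀ l, 0 ≤ d * facetConst l + facetForm l a) :
    ∃ j, ∀ l, (facetHeight l j : ℤ) ≤ d * facetConst l + facetForm l a := by
  have key : ∀ P : Fin 9 → Prop, (∀ l, P l) ↔ P 0 ∧ P 1 ∧ P 2 ∧ P 3 ∧ P 4 ∧ P 5 ∧ P 6 ∧ P 7 ∧ P 8 :=
    fun P => ⟨fun h => ⟨h 0, h 1, h 2, h 3, h 4, h 5, h 6, h 7, h 8⟩, by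
      rintro ⟨h0, h1, h2, h3, h4, h5, h6, h7, h8⟩ l
      fin_cases l <;> assumption⟩
  simp only [key, facetForm_apply, Fin.sum_univ_five, facetHeight, facetConst, facetNormal] at h ⊢
  generalize a 0 = x, a 1 = y, a 2 = z, a 3 = t, a 4 = v at h ⊢
  simp at h ⊢
  have pick : ∀ (P : Fin 14 → Prop) (j : Fin 14), P j → ∃ j, P j := fun P j h => ⟨j, h⟩
  by_cases hα : d = y + z <;> by_cases hβ : d = x + y <;> by_cases hγ : d = x + t
  · by_cases hx : 0 < x
    · refine ⟨4, ?_⟩; simp; omega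
    · refine ⟨0, ?_⟩; simp; omega
  · by_cases hv : 0 < v
    · refine ⟨8, ?_⟩; simp; omega
    · refine ⟨7, ?_⟩; simp; omega
  · refine ⟨1, ?_⟩; simp; omega
  · by_cases hv : 0 < v
    · refine ⟨10, ?_⟩; simp; omega
    · refine ⟨9, ?_⟩; simp; omega
  · by_cases hv : 0 < v
    · refine ⟨6, ?_⟩; simp; omega
    · refine ⟨5, ?_⟩; simp; omega
  · by_cases hv : 0 < v
    · refine ⟨6, ?_⟩; simp; omega
    · refine ⟨5, ?_⟩; simp; omega
  · by_cases hv : 0 < v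
    · refine ⟨3, ?_⟩; simp; omega
    · refine ⟨2, ?_⟩; simp; omega
  · by_cases hv : v = 0
    · refine ⟨11, ?_⟩; simp; omega
    · by_cases hv' : v = 1
      · refine ⟨12, ?_⟩; simp; omega
      · refine ⟨13, ?_⟩; simp; omega

/-- The polytope is normal: the lattice points of its `d`-fold multiple are sums of `d` of its
lattice points. -/
lemma exists_multiset_sum_character (d : ℕ) {a : Fin 5 → ℤ}
    (h : ∀ l, 0 ≤ d * facetConst l + facetForm l a) :
    ∃ M : Multiset (Fin 14), M.card = d ∧ (M.map character).sum = a := by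
  induction d generalizing a with
  | zero =>
    refine ⟨0, rfl, ?_⟩
    simp only [facetForm_apply, Fin.sum_univ_five, facetConst, facetNormal] at h
    have h0 := h 0; have h1 := h 1; have h2 := h 2; have h3 := h 3; have h4 := h 4; have h5 := h 5
    simp at h0 h1 h2 h3 h4 h5
    funext i
    fin_cases i <;> simp <;> omega
  | succ d ih =>
    obtain ⟨j, hj⟩ := exists_facetHeight_le (by positivity) h
    obtain ⟨M, hM, hs⟩ := ih (a := a - character j) fun l => by
      have := hj l
      rw [facetHeight_eq] at this
      rw [map_sub]
      push_cast at this
      linarith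
    exact ⟨j ::ₘ M, by simp [hM], by simp [hs]⟩

/-- The tangent cones are generated by the differences of the lattice points of the polytope. -/
lemma coneAt_eq_closure (j : Fin 14) :
    coneAt j = AddSubmonoid.closure (Set.range fun k => character k - character j) := by
  apply le_antisymm
  · intro a ha
    -- Far away from the facets that do not contain the `j`-th lattice point `m j`, their conditions
    -- on `a + d • m j` are void.
    obtain ⟨d, hd⟩ : ∃ d : ℕ, ∀ l, -facetForm l a ≤ d := by
      refine ⟨∑ l, (facetForm l a).natAbs, fun l => ?_⟩
      have : (facetForm l a).natAbs ≤ ∑ l, (facetForm l a).natAbs :=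
        Finset.single_le_sum (f := fun l => (facetForm l a).natAbs) (fun _ _ => Nat.zero_le _)
          (Finset.mem_univ l)
      omega
    obtain ⟨M, hM, hs⟩ := exists_multiset_sum_character d (a := a + d • character j) fun l => by
      rw [map_add, map_nsmul, nsmul_eq_mul, ← add_assoc, add_comm _ (facetForm l a), add_assoc,
        ← mul_add, ← facetHeight_eq]
      rcases Nat.eq_zero_or_pos (facetHeight l j) with h0 | h0
      · have := ha l h0
        simpa [h0] using this
      · have := hd l
        have : (d : ℤ) * 1 ≤ d * facetHeight l j :=
          mul_le_mul_of_nonneg_left (by exact_mod_cast h0) (by positivity)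
        linarith
    have : a = (M.map fun k => character k - character j).sum := by
      rw [Multiset.sum_map_sub, hs]
      simp [hM]
    rw [this]
    refine multiset_sum_mem _ fun b hb => ?_
    obtain ⟨k, -, rfl⟩ := Multiset.mem_map.1 hb
    exact AddSubmonoid.subset_closure ⟨k, rfl⟩
  · rw [AddSubmonoid.closure_le]
    rintro _ ⟨k, rfl⟩ l hl
    have h1 := facetHeight_eq l k
    have h2 := facetHeight_eq l j
    rw [hl] at h2
    rw [map_sub]
    push_cast at h2
    have : (0 : ℤ) ≤ facetHeight l k := by positivity
    linarith

lemma character_sub_mem_coneAt (k j : Fin 14) : character k - character j ∈ coneAt j := by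
  rw [coneAt_eq_closure]
  exact AddSubmonoid.subset_closure ⟨k, rfl⟩

lemma facetForm_character_sub {l : Fin 9} {j : Fin 14} (hl : facetHeight l j = 0) (k : Fin 14) :
    facetForm l (character k - character j) = facetHeight l k := by
  have h1 := facetHeight_eq l k
  have h2 := facetHeight_eq l j
  rw [hl] at h2
  rw [map_sub]
  push_cast at h2
  linarith

end Polytope

/-! ### Laurent polynomials and the affine charts of the toric fibre -/

section Laurent

/-- The ring of Laurent polynomials in five variables, the coordinate ring of the torus. -/
abbrev Laurent : Type := AddMonoidAlgebra ℂ (Fin 5 → ℤ)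

/-- The Laurent monomial with exponent `a`. -/
def chi (a : Fin 5 → ℤ) : Laurent := AddMonoidAlgebra.single a 1

lemma chi_zero : chi 0 = 1 := rfl

lemma chi_add (a b : Fin 5 → ℤ) : chi (a + b) = chi a * chi b := by
  simp [chi, AddMonoidAlgebra.single_mul_single]

lemma chi_ne_zero (a : Fin 5 → ℤ) : chi a ≠ 0 := by
  intro h
  have := congrArg (fun f : Laurent => f.coeff a) h
  simp [chi] at this

lemma isUnit_chi (a : Fin 5 → ℤ) : IsUnit (chi a) :=
  IsUnit.of_mul_eq_one (chi (-a)) (by rw [← chi_add, add_neg_cancel, chi_zero])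

lemma chi_nsmul (n : ℕ) (a : Fin 5 → ℤ) : chi (n • a) = chi a ^ n := by
  induction n with
  | zero => simp [chi_zero]
  | succ n ih => rw [succ_nsmul, chi_add, ih, pow_succ]

lemma chi_sum {ι : Type*} (s : Finset ι) (a : ι → Fin 5 → ℤ) :
    chi (∑ i ∈ s, a i) = ∏ i ∈ s, chi (a i) := by
  classical
  induction s using Finset.induction_on with
  | empty => simp [chi_zero]
  | insert i s hi ih => rw [Finset.sum_insert hi, Finset.prod_insert hi, chi_add, ih]

lemma eq_sum_smul_chi (f : Laurent) : f = ∑ a ∈ f.coeff.support, f.coeff a • chi a := by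
  apply AddMonoidAlgebra.coeff_injective
  rw [AddMonoidAlgebra.coeff_sum]
  conv_lhs => rw [← Finsupp.sum_single f.coeff]
  rw [Finsupp.sum]
  refine Finset.sum_congr rfl fun a _ => ?_
  simp [chi]

/-- The Laurent polynomials all of whose exponents lie in `s`. -/
def suppIn (s : Set (Fin 5 → ℤ)) : Submodule ℂ Laurent where
  carrier := {f | ∀ a, f.coeff a ≠ 0 → a ∈ s}
  zero_mem' := by simp
  add_mem' := by
    intro f g hf hg a ha
    by_contra h
    refine ha ?_
    rw [AddMonoidAlgebra.coeff_add, Finsupp.add_apply, not_not.1 (mt (hf a) h),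
      not_not.1 (mt (hg a) h), add_zero]
  smul_mem' := by
    intro c f hf a ha
    exact hf a fun h => ha (by simp [h])

lemma chi_mem_suppIn {s : Set (Fin 5 → ℤ)} {a : Fin 5 → ℤ} (ha : a ∈ s) : chi a ∈ suppIn s := by
  intro b hb
  by_cases h : a = b
  · exact h ▸ ha
  · simp [chi, Finsupp.single_apply, h] at hb

lemma mem_of_chi_mem_suppIn {s : Set (Fin 5 → ℤ)} {a : Fin 5 → ℤ} (h : chi a ∈ suppIn s) :
    a ∈ s := h a (by simp [chi])

lemma suppIn_mono {s t : Set (Fin 5 → ℤ)} (h : s ⊆ t) : suppIn s ≤ suppIn t :=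
  fun _ hf a ha => h (hf a ha)

lemma mul_mem_suppIn {s t u : Set (Fin 5 → ℤ)} (h : ∀ a ∈ s, ∀ b ∈ t, a + b ∈ u) {f g : Laurent}
    (hf : f ∈ suppIn s) (hg : g ∈ suppIn t) : f * g ∈ suppIn u := by
  rw [eq_sum_smul_chi f, eq_sum_smul_chi g, Finset.sum_mul_sum]
  refine sum_mem fun a ha => sum_mem fun b hb => ?_
  rw [smul_mul_smul_comm, ← chi_add]
  exact Submodule.smul_mem _ _ (chi_mem_suppIn (h a (hf a (Finsupp.mem_support_iff.1 ha)) b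
    (hg b (Finsupp.mem_support_iff.1 hb))))

/-- The monoid algebra of a submonoid of the lattice, as a ring of Laurent polynomials. -/
def monoidSubalgebra (S : AddSubmonoid (Fin 5 → ℤ)) : Subalgebra ℂ Laurent where
  toSubsemiring :=
    { carrier := suppIn (S : Set (Fin 5 → ℤ))
      mul_mem' := fun hf hg => mul_mem_suppIn (fun _ ha _ hb => S.add_mem ha hb) hf hg
      one_mem' := by
        rw [← chi_zero]
        exact chi_mem_suppIn S.zero_mem
      add_mem' := fun hf hg => add_mem hf hg
      zero_mem' := zero_mem _ }
  algebraMap_mem' c := by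
    have h : (algebraMap ℂ Laurent c) ∈ suppIn (S : Set (Fin 5 → ℤ)) := by
      rw [Algebra.algebraMap_eq_smul_one]
      refine Submodule.smul_mem _ _ ?_
      rw [← chi_zero]
      exact chi_mem_suppIn S.zero_mem
    exact h

lemma chi_mem_monoidSubalgebra {S : AddSubmonoid (Fin 5 → ℤ)} {a : Fin 5 → ℤ} :
    chi a ∈ monoidSubalgebra S ↔ a ∈ S :=
  ⟨fun h => mem_of_chi_mem_suppIn h, fun h => chi_mem_suppIn h⟩

lemma monoidSubalgebra_le_iff {S : AddSubmonoid (Fin 5 → ℤ)} {B : Subalgebra ℂ Laurent} :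
    monoidSubalgebra S ≤ B ↔ ∀ a ∈ S, chi a ∈ B := by
  refine ⟨fun h a ha => h (chi_mem_monoidSubalgebra.2 ha), fun h f hf => ?_⟩
  rw [eq_sum_smul_chi f]
  exact sum_mem fun a ha => B.smul_mem (h a (hf a (Finsupp.mem_support_iff.1 ha))) _

lemma monoidSubalgebra_closure (s : Set (Fin 5 → ℤ)) :
    monoidSubalgebra (AddSubmonoid.closure s) = Algebra.adjoin ℂ (chi '' s) := by
  apply le_antisymm
  · rw [monoidSubalgebra_le_iff]
    intro a ha
    induction ha using AddSubmonoid.closure_induction with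
    | mem a ha => exact Algebra.subset_adjoin ⟨a, ha, rfl⟩
    | zero => rw [chi_zero]; exact one_mem _
    | add a b _ _ ha hb => rw [chi_add]; exact mul_mem ha hb
  · rw [Algebra.adjoin_le_iff]
    rintro _ ⟨a, ha, rfl⟩
    exact chi_mem_monoidSubalgebra.2 (AddSubmonoid.subset_closure ha)

/-- The affine coordinate ring of the `j`-th chart: the monoid algebra of the tangent cone. -/
def coneAlgebra (j : Fin 14) : Subalgebra ℂ Laurent := monoidSubalgebra (coneAt j)

lemma coneAlgebra_eq_adjoin (j : Fin 14) :
    coneAlgebra j = Algebra.adjoin ℂ (Set.range fun k => chi (character k - character j)) := by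
  rw [coneAlgebra, coneAt_eq_closure, monoidSubalgebra_closure, ← Set.range_comp]
  rfl

end Laurent

section Charts

open MvPolynomial

/-- The homogeneous ideal of the toric fibre, generated by the twenty-eight binomials. -/
def toricIdeal : Ideal (MvPolynomial (Fin 14) ℂ) := familyIdeal 0 0

lemma quadric_zero (j : Fin 14) : quadric (0 : ℂ) j = X (lo j) * X (hi j) := by
  fin_cases j <;> simp [quadric, quadricVal, lo, hi] <;> ring

lemma mem_toricIdeal {f : MvPolynomial (Fin 14) ℂ} :
    f ∈ toricIdeal ↔ aeval (fun j => (X (lo j) * X (hi j) : MvPolynomial (Fin 6) ℂ)) f = 0 := by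
  have h := imageIdeal_quadric (0 : ℂ)
  rw [toricIdeal, ← h, imageIdeal, RingHom.mem_ker]
  have : quadric (0 : ℂ) = fun j => X (lo j) * X (hi j) := funext quadric_zero
  rw [this]

instance isPrime_toricIdeal : toricIdeal.IsPrime := by
  have h := imageIdeal_quadric (0 : ℂ)
  rw [toricIdeal, ← h]
  exact RingHom.ker_isPrime _

lemma isHomogeneousIdeal_toricIdeal : IsHomogeneousIdeal toricIdeal :=
  fun _ hf d => homogeneousComponent_mem_familyIdeal 0 0 hf d

/-- The exponents of the six letters in the torus coordinates. -/
def letterExp (i : Fin 6) : Fin 5 → ℤ := fun k => if i = letter k then 1 else 0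

lemma letterExp_add (j : Fin 14) : letterExp (lo j) + letterExp (hi j) = character j := rfl

/-- Dehomogenization of polynomials in the six letters by setting `u = 1`. -/
def dehomogenize : MvPolynomial (Fin 6) ℂ →ₐ[ℂ] Laurent := aeval fun i => chi (letterExp i)

lemma dehomogenize_monomial (d : Fin 6 →₀ ℕ) (c : ℂ) :
    dehomogenize (monomial d c) = c • chi (fun k => (d (letter k) : ℤ)) := by
  rw [dehomogenize, aeval_monomial, Algebra.smul_def, Finsupp.prod_fintype _ _ (by simp)]
  congr 1
  simp_rw [← chi_nsmul]
  rw [← chi_sum]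
  congr 1
  funext k
  simp [Finset.sum_apply, letterExp]

/-- Dehomogenization is injective on homogeneous polynomials. -/
lemma eq_zero_of_dehomogenize_eq_zero {F : MvPolynomial (Fin 6) ℂ} {n : ℕ}
    (hF : F.IsHomogeneous n) (h : dehomogenize F = 0) : F = 0 := by
  ext d
  rw [coeff_zero]
  by_contra hd
  have hdeg : ∀ e, coeff e F ≠ 0 → e 0 + e 1 + e 2 + e 3 + e 4 + e 5 = n := by
    intro e he
    have := hF he
    rw [Finsupp.weight_apply, Finsupp.sum_fintype _ _ (by simp)] at this
    simpa [Fin.sum_univ_six] using this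
  have h2 := congrArg (fun f : Laurent => f.coeff fun k => (d (letter k) : ℤ)) h
  rw [F.as_sum, map_sum] at h2
  simp only [dehomogenize_monomial, AddMonoidAlgebra.coeff_sum, chi, AddMonoidAlgebra.coeff_smul,
    AddMonoidAlgebra.coeff_single, Finsupp.finset_sum_apply, Finsupp.smul_apply,
    AddMonoidAlgebra.coeff_zero, Finsupp.zero_apply] at h2
  rw [Finset.sum_eq_single d] at h2
  · simp at h2
    exact hd h2
  · intro e he hed
    have he' := mem_support_iff.1 he
    rw [Finsupp.single_eq_of_ne, smul_zero]
    intro heq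
    apply hed
    have e0 : d 0 = e 0 := by exact_mod_cast congrFun heq 0
    have e1 : d 1 = e 1 := by exact_mod_cast congrFun heq 1
    have e2 : d 2 = e 2 := by exact_mod_cast congrFun heq 2
    have e3 : d 3 = e 3 := by exact_mod_cast congrFun heq 3
    have e5 : d 5 = e 5 := by exact_mod_cast congrFun heq 4
    have := hdeg e he'
    have := hdeg d hd
    ext i
    fin_cases i <;> simp <;> omega
  · intro h'
    exact absurd (mem_support_iff.2 hd) h'

/-- The parametrization of the `j`-th chart by the torus. -/
def chartHom (j : Fin 14) : MvPolynomial (Fin 14) ℂ →ₐ[ℂ] Laurent :=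
  aeval fun k => chi (character k - character j)

lemma chartHom_X (j k : Fin 14) : chartHom j (X k) = chi (character k - character j) := by
  simp [chartHom]

lemma aeval_mul_of_isHomogeneous {σ A : Type*} [Fintype σ] [CommRing A] [Algebra ℂ A] (u : A)
    (φ : σ → A) {F : MvPolynomial σ ℂ} {n : ℕ} (hF : F.IsHomogeneous n) :
    aeval (fun k => u * φ k) F = u ^ n * aeval φ F := by
  have h1 : ∀ d ∈ F.support, aeval (fun k => u * φ k) (monomial d (coeff d F)) =
      u ^ n * aeval φ (monomial d (coeff d F)) := by
    intro d hd
    have hn : ∑ k, d k = n := by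
      have := hF (mem_support_iff.1 hd)
      rw [Finsupp.weight_apply, Finsupp.sum_fintype _ _ (by simp)] at this
      simpa using this
    rw [aeval_monomial, aeval_monomial, Finsupp.prod_fintype _ _ (by simp),
      Finsupp.prod_fintype _ _ (by simp), ← hn, ← Finset.prod_pow_eq_pow_sum, mul_left_comm,
      ← Finset.prod_mul_distrib]
    simp_rw [mul_pow]
  conv_lhs => rw [F.as_sum]
  conv_rhs => rw [F.as_sum]
  rw [map_sum, map_sum, Finset.mul_sum]
  exact Finset.sum_congr rfl h1

lemma chi_mul_chartHom {F : MvPolynomial (Fin 14) ℂ} {n : ℕ} (hF : F.IsHomogeneous n)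
    (j : Fin 14) : chi (character j) ^ n * chartHom j F = dehomogenize
      (aeval (fun j => (X (lo j) * X (hi j) : MvPolynomial (Fin 6) ℂ)) F) := by
  rw [chartHom, ← aeval_mul_of_isHomogeneous _ _ hF, ← AlgHom.comp_apply]
  refine congrFun (congrArg _ (algHom_ext fun k => ?_)) F
  rw [AlgHom.comp_apply, aeval_X, aeval_X, ← chi_add, map_mul, dehomogenize, aeval_X, aeval_X,
    ← chi_add, letterExp_add, add_sub_cancel]

lemma isHomogeneous_aeval_edges {F : MvPolynomial (Fin 14) ℂ} {n : ℕ} (hF : F.IsHomogeneous n) :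
    (aeval (fun j => (X (lo j) * X (hi j) : MvPolynomial (Fin 6) ℂ)) F).IsHomogeneous (2 * n) := by
  have := hF.aeval (fun j => (X (lo j) * X (hi j) : MvPolynomial (Fin 6) ℂ)) (n := 2)
    fun j => (isHomogeneous_X ℂ _).mul (isHomogeneous_X ℂ _)
  exact this

lemma chartHom_eq_zero_iff {F : MvPolynomial (Fin 14) ℂ} {n : ℕ} (hF : F.IsHomogeneous n)
    (j : Fin 14) : chartHom j F = 0 ↔ F ∈ toricIdeal := by
  rw [mem_toricIdeal]
  constructor
  · intro h
    refine eq_zero_of_dehomogenize_eq_zero (isHomogeneous_aeval_edges hF) ?_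
    rw [← chi_mul_chartHom hF j, h, mul_zero]
  · intro h
    have := chi_mul_chartHom hF j
    rw [h, map_zero] at this
    exact (mul_eq_zero.1 this).resolve_left (pow_ne_zero _ (chi_ne_zero _))

/-- The kernel of the parametrization is the ideal of the chart: a polynomial in it becomes, after
multiplication of its homogeneous components by powers of the `j`-th variable, a homogeneous
element of the toric ideal. -/
lemma ker_chartHom (j : Fin 14) :
    RingHom.ker (chartHom j) = toricIdeal ⊔ Ideal.span {X j - 1} := by
  apply le_antisymm
  · intro f hf
    rw [RingHom.mem_ker] at hf
    set D := f.totalDegree with hD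
    let F : MvPolynomial (Fin 14) ℂ :=
      ∑ d ∈ Finset.range (D + 1), X j ^ (D - d) * homogeneousComponent d f
    have hsum : f = ∑ d ∈ Finset.range (D + 1), homogeneousComponent d f :=
      (sum_homogeneousComponent f).symm
    have hFh : F.IsHomogeneous D := by
      refine IsHomogeneous.sum _ _ _ fun d hd => ?_
      have hdD : D - d + d = D := Nat.sub_add_cancel (Nat.lt_succ_iff.1 (Finset.mem_range.1 hd))
      have := (isHomogeneous_X_pow (R := ℂ) j (D - d)).mul (homogeneousComponent_isHomogeneous d f)
      rwa [hdD] at this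
    have h1 : F - f ∈ Ideal.span {(X j - 1 : MvPolynomial (Fin 14) ℂ)} := by
      have : F - f = ∑ d ∈ Finset.range (D + 1), (X j ^ (D - d) - 1) * homogeneousComponent d f := by
        conv_lhs => rw [hsum]
        rw [← Finset.sum_sub_distrib]
        exact Finset.sum_congr rfl fun d _ => by ring
      rw [this]
      refine sum_mem fun d _ => Ideal.mul_mem_right _ _ (Ideal.mem_span_singleton.2 ?_)
      simpa using sub_dvd_pow_sub_pow (X j : MvPolynomial (Fin 14) ℂ) 1 (D - d)
    have h2 : chartHom j F = 0 := by
      have h3 : chartHom j (F - f) = 0 := by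
        obtain ⟨g, hg⟩ := Ideal.mem_span_singleton.1 h1
        rw [hg, map_mul, map_sub, chartHom_X, sub_self, chi_zero, map_one, sub_self, zero_mul]
      rw [map_sub, hf, sub_zero] at h3
      exact h3
    have h4 := (chartHom_eq_zero_iff hFh j).1 h2
    have : f = F - (F - f) := by ring
    rw [this]
    exact Ideal.sub_mem _ (Ideal.mem_sup_left h4) (Ideal.mem_sup_right h1)
  · rw [sup_le_iff, Ideal.span_singleton_le_iff_mem]
    constructor
    · intro f hf
      rw [RingHom.mem_ker, ← sum_homogeneousComponent f, map_sum]
      refine Finset.sum_eq_zero fun d _ => ?_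
      exact (chartHom_eq_zero_iff (homogeneousComponent_isHomogeneous d f) j).2
        (isHomogeneousIdeal_toricIdeal f hf d)
    · rw [RingHom.mem_ker, map_sub, chartHom_X, sub_self, chi_zero, map_one, sub_self]

lemma range_chartHom (j : Fin 14) : (chartHom j).range = coneAlgebra j := by
  rw [coneAlgebra_eq_adjoin, chartHom, Algebra.adjoin_range_eq_range_aeval]

/-- The coordinate ring of the `j`-th chart is the monoid algebra of the tangent cone. -/
def chartEquiv (j : Fin 14) : Chart toricIdeal j ≃ₐ[ℂ] coneAlgebra j :=
  (Ideal.quotientEquivAlgOfEq ℂ (ker_chartHom j).symm).trans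
    ((Ideal.quotientKerEquivRange (chartHom j)).trans
      (Subalgebra.equivOfEq _ _ (range_chartHom j)))

lemma chartEquiv_mk (j : Fin 14) (f : MvPolynomial (Fin 14) ℂ) :
    (chartEquiv j (Ideal.Quotient.mk _ f) : Laurent) = chartHom j f := rfl

instance isDomain_chart (j : Fin 14) : IsDomain (Chart toricIdeal j) :=
  (chartEquiv j).toMulEquiv.isDomain _

end Charts

/-! ### The torus orbit -/

section TorusOrbit

open MvPolynomial

lemma prod_letters {M : Type*} [CommMonoid M] (w : Fin 5 → M) (i : Fin 6) :
    ∏ k, w k ^ (if i = letter k then 1 else 0) =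
      (![w 0, w 1, w 2, w 3, 1, w 4] : Fin 6 → M) i := by
  fin_cases i <;> simp [Fin.prod_univ_five, letter]

/-- The torus orbit of the point with all coordinates `1`, in terms of the six letters. -/
lemma torusAct_character (t : Fin 5 → ℂˣ) (j : Fin 14) :
    torusAct character t (fun _ => 1) j =
      (![t 0, t 1, t 2, t 3, 1, t 4] : Fin 6 → ℂˣ) (lo j) *
        (![t 0, t 1, t 2, t 3, 1, t 4] : Fin 6 → ℂˣ) (hi j) := by
  rw [torusAct, mul_one, ← Units.val_mul, ← prod_letters, ← prod_letters, ← Finset.prod_mul_distrib]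
  congr 1
  refine Finset.prod_congr rfl fun k _ => ?_
  rw [character, zpow_add]
  congr 1 <;> split_ifs <;> simp

/-- The variety is the closure of a torus orbit. -/
theorem isProjectiveToric_toricIdeal : IsProjectiveToric toricIdeal character := by
  refine ⟨?_, fun _ => 1, fun _ => one_ne_zero, ?_⟩
  · rw [eq_top_iff]
    have h : ∀ i : Fin 5, Pi.single i (1 : ℤ) ∈
        AddSubgroup.closure {a | ∃ i j, a = character i - character j} := by
      intro i
      refine AddSubgroup.subset_closure ⟨(![5, 7, 9, 2, 12] : Fin 5 → Fin 14) i, 11, ?_⟩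
      revert i
      decide
    intro a _
    have : a = ∑ i, a i • Pi.single i (1 : ℤ) := by
      funext k
      simp [Finset.sum_apply, Pi.single_apply]
    rw [this]
    exact sum_mem fun i _ => AddSubgroup.zsmul_mem _ (h i) _
  · ext f
    rw [mem_toricIdeal, orbitIdeal, mem_vanishingIdeal_iff]
    have hev : ∀ p : Fin 6 → ℂ, aeval (fun j => p (lo j) * p (hi j)) f =
        aeval p (aeval (fun j => (X (lo j) * X (hi j) : MvPolynomial (Fin 6) ℂ)) f) := by
      intro p
      rw [← AlgHom.comp_apply]
      refine congrFun (congrArg _ (algHom_ext fun k => ?_)) f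
      simp
    constructor
    · rintro hf q ⟨c, t, rfl⟩
      obtain ⟨b, rfl⟩ : ∃ b : ℂ, c = b * b := by
        obtain ⟨b, hb⟩ := IsAlgClosed.exists_pow_nat_eq c (n := 2) (by norm_num)
        exact ⟨b, by rw [← hb, sq]⟩
      have : (b * b) • torusAct character t (fun _ => (1 : ℂ)) =
          fun j => (b * ((![t 0, t 1, t 2, t 3, 1, t 4] : Fin 6 → ℂˣ) (lo j) : ℂ)) *
            (b * ((![t 0, t 1, t 2, t 3, 1, t 4] : Fin 6 → ℂˣ) (hi j) : ℂ)) := by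
        funext j
        rw [Pi.smul_apply, torusAct_character, smul_eq_mul]
        ring
      rw [this, hev fun i => b * ((![t 0, t 1, t 2, t 3, 1, t 4] : Fin 6 → ℂˣ) i : ℂ), hf, map_zero]
    · intro hf
      set F := aeval (fun j => (X (lo j) * X (hi j) : MvPolynomial (Fin 6) ℂ)) f with hF
      -- The polynomial vanishes where no coordinate does, hence after multiplication by all
      -- coordinates it vanishes everywhere.
      have hvan : F * ∏ i, X i = 0 := by
        refine MvPolynomial.funext fun p => ?_
        rw [map_mul, map_zero, map_prod]
        by_cases hp : ∃ i, p i = 0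
        · obtain ⟨i, hi'⟩ := hp
          rw [Finset.prod_eq_zero (Finset.mem_univ i) (by simpa using hi'), mul_zero]
        · push Not at hp
          have h4 : p 4 ≠ 0 := hp 4
          let t : Fin 5 → ℂˣ := fun k => Units.mk0 (p (letter k) / p 4) (div_ne_zero (hp _) h4)
          have ht : ∀ i, p 4 * ((![t 0, t 1, t 2, t 3, 1, t 4] : Fin 6 → ℂˣ) i : ℂ) = p i := by
            intro i
            fin_cases i <;> simp [t, letter] <;> field_simp
          have h := hf _ ⟨p 4 * p 4, t, rfl⟩
          have h2 : (p 4 * p 4) • torusAct character t (fun _ => (1 : ℂ)) =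
              fun j => p (lo j) * p (hi j) := by
            funext j
            rw [Pi.smul_apply, torusAct_character, smul_eq_mul, ← ht (lo j), ← ht (hi j)]
            ring
          rw [h2, hev] at h
          have h3 : eval p F = 0 := h
          rw [h3, zero_mul]
      exact (mul_eq_zero.1 hvan).resolve_right
        (Finset.prod_ne_zero_iff.2 fun i _ => X_ne_zero i)

end TorusOrbit

/-! ### Dimension -/

section Dimension

open MvPolynomial

lemma ringKrullDim_le_of_isIntegral (R S : Type*) [CommRing R] [CommRing S] [Algebra R S]
    [Algebra.IsIntegral R S] : ringKrullDim S ≤ ringKrullDim R :=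
  Order.krullDim_le_of_strictMono
    (fun I : PrimeSpectrum S => (⟨I.asIdeal.comap (algebraMap R S), inferInstance⟩ : PrimeSpectrum R))
    fun I J h => Ideal.IsIntegral.comap_lt_comap (I := I.asIdeal) (J := J.asIdeal) h

/-- The Krull dimension of an affine algebra is at most its transcendence degree, by Noether
normalization. -/
lemma ringKrullDim_le_of_trdeg_le {k A : Type} [Field k] [CommRing A] [Algebra k A]
    [Algebra.FiniteType k A] [Nontrivial A] {n : ℕ} (h : Algebra.trdeg k A ≤ n) :
    ringKrullDim A ≤ n := by
  obtain ⟨s, g, hg, hfin⟩ := exists_finite_inj_algHom_of_fg k A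
  have hs : s ≤ n := by
    have h1 := lift_trdeg_le_of_injective g hg
    rw [Cardinal.lift_id, Cardinal.lift_id, MvPolynomial.trdeg_of_isDomain] at h1
    have h2 := h1.trans h
    simpa using h2
  algebraize [g.toRingHom]
  have : Algebra.IsIntegral (MvPolynomial (Fin s) k) A := ⟨hfin.to_isIntegral⟩
  have h1 := ringKrullDim_le_of_isIntegral (MvPolynomial (Fin s) k) A
  rw [MvPolynomial.ringKrullDim_of_isNoetherianRing, ringKrullDim_eq_zero_of_field, zero_add,
    Nat.card_eq_fintype_card, Fintype.card_fin] at h1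
  exact h1.trans (by exact_mod_cast hs)

/-- The ring of Laurent polynomials in five variables has transcendence degree at most five. -/
lemma trdeg_laurent_le : Algebra.trdeg ℂ Laurent ≤ 5 := by
  let s : Set Laurent := Set.range fun i : Fin 5 => chi (Pi.single i 1)
  let B := Algebra.adjoin ℂ s
  have : IsDomain B := inferInstance
  have hgen : ∀ i : Fin 5, ∀ n : ℤ, chi (Pi.single i n) ∈ Subalgebra.algebraicClosure B Laurent := by
    have hpos : ∀ i : Fin 5, ∀ n : ℕ, chi (Pi.single i (n : ℤ)) ∈ B := by
      intro i n
      have : (Pi.single i (n : ℤ) : Fin 5 → ℤ) = n • Pi.single i 1 := by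
        rw [← Pi.single_smul]; simp
      rw [this, chi_nsmul]
      have hi' : chi (Pi.single i 1) ∈ B := Algebra.subset_adjoin (Set.mem_range_self i)
      exact pow_mem hi' n
    intro i n
    rw [Subalgebra.mem_algebraicClosure]
    obtain ⟨m, rfl | rfl⟩ := Int.eq_nat_or_neg n
    · exact isAlgebraic_algebraMap (A := Laurent) (⟨chi (Pi.single i (m : ℤ)), hpos i m⟩ : B)
    · -- The inverse of a monomial `b` is a root of `b X - 1`.
      let b : B := ⟨chi (Pi.single i (m : ℤ)), hpos i m⟩
      have hb : b ≠ 0 := fun h => chi_ne_zero _ (congrArg Subtype.val h)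
      refine ⟨Polynomial.C b * Polynomial.X - 1, ?_, ?_⟩
      · intro h
        have := congrArg (fun p => Polynomial.coeff p 1) h
        simp [Polynomial.coeff_one] at this
        exact hb this
      · simp only [map_sub, map_mul, Polynomial.aeval_C, Polynomial.aeval_X, map_one]
        change chi (Pi.single i (m : ℤ)) * _ - 1 = 0
        rw [← chi_add, Pi.single_neg, add_neg_cancel, chi_zero, sub_self]
  have : Algebra.IsAlgebraic B Laurent := by
    refine ⟨fun f => ?_⟩
    rw [← Subalgebra.mem_algebraicClosure, eq_sum_smul_chi f]
    refine sum_mem fun a _ => ?_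
    rw [Algebra.smul_def]
    refine mul_mem ?_ ?_
    · have : algebraMap ℂ Laurent (f.coeff a) = algebraMap B Laurent (algebraMap ℂ B (f.coeff a)) :=
        rfl
      rw [this]
      exact Subalgebra.algebraMap_mem _ _
    · have : a = ∑ i, Pi.single i (a i) := (Finset.univ_sum_single a).symm
      rw [this, chi_sum]
      exact prod_mem fun i _ => hgen i (a i)
  refine (Algebra.IsAlgebraic.trdeg_le_cardinalMk ℂ s).trans ?_
  refine Cardinal.mk_range_le.trans ?_
  simp

lemma ringKrullDim_chart_le (j : Fin 14) : ringKrullDim (Chart toricIdeal j) ≤ 5 := by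
  have h : Algebra.trdeg ℂ (Chart toricIdeal j) ≤ (5 : ℕ) :=
    (trdeg_le_of_injective ((coneAlgebra j).val.comp (chartEquiv j).toAlgHom)
      (Subtype.val_injective.comp (chartEquiv j).injective)).trans (by exact_mod_cast trdeg_laurent_le)
  exact ringKrullDim_le_of_trdeg_le h

lemma ringKrullDim_localization_chart_le (j : Fin 14) (𝔪 : Ideal (Chart toricIdeal j)) [𝔪.IsPrime] :
    ringKrullDim (Localization.AtPrime 𝔪) ≤ 5 :=
  by
  rw [IsLocalization.AtPrime.ringKrullDim_eq_height 𝔪 (Localization.AtPrime 𝔪)]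
  exact (Ideal.height_le_ringKrullDim_of_ne_top (Ideal.IsPrime.ne_top ‹_›)).trans
    (ringKrullDim_chart_le j)

/-- The order in which the letters are killed in a maximal chain of primes. -/
def killOrder : Fin 6 → ℕ := ![0, 1, 2, 3, 5, 4]

/-- The parametrization of the cone over the variety in which the first `k` letters are killed. -/
def killHom (k : ℕ) : MvPolynomial (Fin 14) ℂ →ₐ[ℂ] MvPolynomial (Fin 6) ℂ :=
  (aeval fun i => if k ≤ killOrder i then (X i : MvPolynomial (Fin 6) ℂ) else 0).comp
    (aeval fun j => (X (lo j) * X (hi j) : MvPolynomial (Fin 6) ℂ))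

lemma killHom_X (k : ℕ) (j : Fin 14) : killHom k (X j) =
    (if k ≤ killOrder (lo j) then X (lo j) else 0) * (if k ≤ killOrder (hi j) then X (hi j) else 0) := by
  simp [killHom]

lemma six_le_ringKrullDim : 6 ≤ ringKrullDim (MvPolynomial (Fin 14) ℂ ⧸ toricIdeal) := by
  have hle : ∀ k, toricIdeal ≤ RingHom.ker (killHom k).toRingHom := by
    intro k f hf
    rw [mem_toricIdeal] at hf
    rw [RingHom.mem_ker]
    change killHom k f = 0
    rw [killHom, AlgHom.comp_apply, hf, map_zero]
  let φ : ℕ → (MvPolynomial (Fin 14) ℂ ⧸ toricIdeal) →+* MvPolynomial (Fin 6) ℂ := fun k =>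
    Ideal.Quotient.lift toricIdeal (killHom k).toRingHom fun f hf => hle k hf
  have hstep : ∀ k : Fin 6, RingHom.ker (φ k) < RingHom.ker (φ (k + 1)) := by
    intro k
    refine lt_of_le_of_ne ?_ ?_
    · intro f hf
      obtain ⟨f, rfl⟩ := Ideal.Quotient.mk_surjective f
      rw [RingHom.mem_ker] at hf ⊢
      change killHom k f = 0 at hf
      change killHom (k + 1) f = 0
      have : killHom (k + 1) = (aeval fun i =>
          if (k : ℕ) + 1 ≤ killOrder i then (X i : MvPolynomial (Fin 6) ℂ) else 0).comp (killHom k) := by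
        refine algHom_ext fun j => ?_
        rw [AlgHom.comp_apply, killHom_X, killHom_X, map_mul]
        have key : ∀ i : Fin 6, (if (k : ℕ) + 1 ≤ killOrder i then X i else 0) =
            aeval (fun i => if (k : ℕ) + 1 ≤ killOrder i then (X i : MvPolynomial (Fin 6) ℂ) else 0)
              (if (k : ℕ) ≤ killOrder i then (X i : MvPolynomial (Fin 6) ℂ) else 0) := by
          intro i
          by_cases h : (k : ℕ) + 1 ≤ killOrder i
          · rw [if_pos h, if_pos (by omega), aeval_X, if_pos h]
          · rw [if_neg h]
            split_ifs
            · rw [aeval_X, if_neg h]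
            · simp
        rw [← key, ← key]
      rw [this, AlgHom.comp_apply, hf, map_zero]
    · intro h
      let j : Fin 14 := (![4, 0, 1, 2, 13, 11] : Fin 6 → Fin 14) k
      have h1 : Ideal.Quotient.mk toricIdeal (X j) ∈ RingHom.ker (φ (k + 1)) := by
        rw [RingHom.mem_ker]
        change killHom (k + 1) (X j) = 0
        rw [killHom_X]
        fin_cases k <;> simp [j, killOrder, lo, hi]
      rw [← h, RingHom.mem_ker] at h1
      change killHom k (X j) = 0 at h1
      rw [killHom_X] at h1
      fin_cases k <;> simp [j, killOrder, lo, hi] at h1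
  let p : LTSeries (PrimeSpectrum (MvPolynomial (Fin 14) ℂ ⧸ toricIdeal)) :=
    { length := 6
      toFun := fun k => ⟨RingHom.ker (φ k), RingHom.ker_isPrime _⟩
      step := fun k => hstep k }
  exact Order.LTSeries.length_le_krullDim p

theorem isProjectiveVariety_toricIdeal : IsProjectiveVariety toricIdeal 5 := by
  refine ⟨isPrime_toricIdeal, isHomogeneousIdeal_toricIdeal, le_antisymm ?_ ?_⟩
  · have h : Algebra.trdeg ℂ (MvPolynomial (Fin 14) ℂ ⧸ toricIdeal) ≤ (6 : ℕ) := by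
      let ψ : (MvPolynomial (Fin 14) ℂ ⧸ toricIdeal) →ₐ[ℂ] MvPolynomial (Fin 6) ℂ :=
        Ideal.Quotient.liftₐ toricIdeal
          (aeval fun j => (X (lo j) * X (hi j) : MvPolynomial (Fin 6) ℂ))
          fun f hf => mem_toricIdeal.1 hf
      refine (trdeg_le_of_injective ψ ?_).trans ?_
      · rw [injective_iff_map_eq_zero]
        intro f hf
        obtain ⟨f, rfl⟩ := Ideal.Quotient.mk_surjective f
        exact Ideal.Quotient.eq_zero_iff_mem.2 (mem_toricIdeal.2 hf)
      · rw [MvPolynomial.trdeg_of_isDomain]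
        simp
    have := ringKrullDim_le_of_trdeg_le h
    norm_num
    exact_mod_cast this
  · norm_num
    exact six_le_ringKrullDim

end Dimension

/-! ### Facets and normality -/

section Facets

/-- The part of a Laurent polynomial with exponents on the hyperplane `ℓ = c`. -/
def facePart (ℓ : (Fin 5 → ℤ) →+ ℤ) (c : ℤ) : Laurent →ₗ[ℂ] Laurent where
  toFun f := .ofCoeff (f.coeff.filter fun a => ℓ a = c)
  map_add' f g := by simp [Finsupp.filter_add]
  map_smul' r f := by simp [Finsupp.filter_smul]

lemma coeff_facePart (ℓ : (Fin 5 → ℤ) →+ ℤ) (c : ℤ) (f : Laurent) (a : Fin 5 → ℤ) :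
    (facePart ℓ c f).coeff a = if ℓ a = c then f.coeff a else 0 := by
  simp [facePart, Finsupp.filter_apply]

lemma facePart_eq_self {ℓ : (Fin 5 → ℤ) →+ ℤ} {c : ℤ} {f : Laurent} (h : f ∈ suppIn {a | ℓ a = c}) :
    facePart ℓ c f = f := by
  apply AddMonoidAlgebra.coeff_injective
  ext a
  rw [coeff_facePart]
  split_ifs with ha
  · rfl
  · by_contra h'
    exact ha (h a (Ne.symm h'))

lemma facePart_eq_zero {ℓ : (Fin 5 → ℤ) →+ ℤ} {c : ℤ} {f : Laurent}
    (h : f ∈ suppIn {a | ℓ a ≠ c}) : facePart ℓ c f = 0 := by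
  apply AddMonoidAlgebra.coeff_injective
  ext a
  rw [coeff_facePart]
  split_ifs with ha
  · by_contra h'
    exact h a h' ha
  · rfl

lemma facePart_mem (ℓ : (Fin 5 → ℤ) →+ ℤ) (c : ℤ) (f : Laurent) :
    facePart ℓ c f ∈ suppIn {a | ℓ a = c} := by
  intro a ha
  by_contra h
  rw [coeff_facePart, if_neg (show ¬ ℓ a = c from h)] at ha
  exact ha rfl

lemma sub_facePart_mem {ℓ : (Fin 5 → ℤ) →+ ℤ} {c : ℤ} {f : Laurent} (h : f ∈ suppIn {a | c ≤ ℓ a}) :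
    f - facePart ℓ c f ∈ suppIn {a | c < ℓ a} := by
  intro a ha
  rw [AddMonoidAlgebra.coeff_sub, Finsupp.sub_apply, coeff_facePart] at ha
  split_ifs at ha with h'
  · simp at ha
  · rw [sub_zero] at ha
    exact lt_of_le_of_ne (h a ha) (Ne.symm h')

lemma facePart_mul {ℓ : (Fin 5 → ℤ) →+ ℤ} {c d : ℤ} {f g : Laurent}
    (hf : f ∈ suppIn {a | c ≤ ℓ a}) (hg : g ∈ suppIn {a | d ≤ ℓ a}) :
    facePart ℓ (c + d) (f * g) = facePart ℓ c f * facePart ℓ d g := by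
  have e : f * g = facePart ℓ c f * facePart ℓ d g +
      (facePart ℓ c f * (g - facePart ℓ d g) + (f - facePart ℓ c f) * g) := by ring
  have h1 : facePart ℓ c f * facePart ℓ d g ∈ suppIn {a | ℓ a = c + d} :=
    mul_mem_suppIn (fun a (ha : ℓ a = c) b (hb : ℓ b = d) => by
      rw [Set.mem_ofPred_eq, map_add, ha, hb]) (facePart_mem ℓ c f) (facePart_mem ℓ d g)
  have h2 : facePart ℓ c f * (g - facePart ℓ d g) ∈ suppIn {a | ℓ a ≠ c + d} :=
    mul_mem_suppIn (fun a (ha : ℓ a = c) b (hb : d < ℓ b) => by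
      rw [Set.mem_ofPred_eq, map_add]; omega) (facePart_mem ℓ c f) (sub_facePart_mem hg)
  have h3 : (f - facePart ℓ c f) * g ∈ suppIn {a | ℓ a ≠ c + d} :=
    mul_mem_suppIn (fun a (ha : c < ℓ a) b (hb : d ≤ ℓ b) => by
      rw [Set.mem_ofPred_eq, map_add]; omega) (sub_facePart_mem hf) hg
  rw [e, map_add, facePart_eq_self h1, facePart_eq_zero (add_mem h2 h3), add_zero]

lemma pow_mem_suppIn {ℓ : (Fin 5 → ℤ) →+ ℤ} {c : ℤ} {f : Laurent} (hf : f ∈ suppIn {a | c ≤ ℓ a})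
    (n : ℕ) : f ^ n ∈ suppIn {a | n * c ≤ ℓ a} := by
  induction n with
  | zero =>
    rw [pow_zero, ← chi_zero]
    exact chi_mem_suppIn (by simp)
  | succ n ih =>
    rw [pow_succ]
    refine mul_mem_suppIn (fun a ha b hb => ?_) ih hf
    rw [Set.mem_ofPred_eq] at *
    rw [map_add]; push_cast; linarith

lemma facePart_pow {ℓ : (Fin 5 → ℤ) →+ ℤ} {c : ℤ} {f : Laurent} (hf : f ∈ suppIn {a | c ≤ ℓ a})
    (n : ℕ) : facePart ℓ (n * c) (f ^ n) = facePart ℓ c f ^ n := by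
  induction n with
  | zero =>
    rw [pow_zero, pow_zero, facePart_eq_self]
    rw [← chi_zero]
    exact chi_mem_suppIn (by simp)
  | succ n ih =>
    rw [pow_succ, pow_succ, ← ih, ← facePart_mul (pow_mem_suppIn hf n) hf]
    congr 2
    push_cast; ring

/-- A non-zero Laurent polynomial has exponents on a supporting hyperplane `ℓ = c`. -/
lemma exists_facePart_ne_zero (ℓ : (Fin 5 → ℤ) →+ ℤ) {f : Laurent} (hf : f ≠ 0) :
    ∃ c, f ∈ suppIn {a | c ≤ ℓ a} ∧ facePart ℓ c f ≠ 0 := by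
  have hne : f.coeff.support.Nonempty := by
    rw [Finsupp.support_nonempty_iff]
    exact fun h => hf (AddMonoidAlgebra.coeff_eq_zero.1 h)
  obtain ⟨a, ha, hmin⟩ := Finset.exists_min_image _ ℓ hne
  refine ⟨ℓ a, fun b hb => hmin b (Finsupp.mem_support_iff.2 hb), fun h => ?_⟩
  have := congrArg (fun f : Laurent => f.coeff a) h
  simp only [coeff_facePart, if_true] at this
  exact Finsupp.mem_support_iff.1 ha this

/-- A Laurent polynomial that is integral over the polynomials supported in a half-space is itself
supported there: compare the lowest terms in an equation of integral dependence. -/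
lemma mem_suppIn_of_isIntegral {ℓ : (Fin 5 → ℤ) →+ ℤ} {A : Subalgebra ℂ Laurent}
    (hA : ∀ g ∈ A, g ∈ suppIn {a | 0 ≤ ℓ a}) {f : Laurent} (hf : IsIntegral A f) :
    f ∈ suppIn {a | 0 ≤ ℓ a} := by
  by_cases h0 : f = 0
  · rw [h0]; exact zero_mem _
  obtain ⟨c, hc, hne⟩ := exists_facePart_ne_zero ℓ h0
  rcases le_or_gt 0 c with hc0 | hc0
  · exact suppIn_mono (fun a (ha : c ≤ ℓ a) => hc0.trans ha) hc
  exfalso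
  obtain ⟨p, hp, hpf⟩ := hf
  have h1 : f ^ p.natDegree + ∑ i ∈ Finset.range p.natDegree, (p.coeff i : Laurent) * f ^ i = 0 := by
    rw [hp.as_sum] at hpf
    simpa [Polynomial.eval₂_finset_sum] using hpf
  have h2 : ∑ i ∈ Finset.range p.natDegree, (p.coeff i : Laurent) * f ^ i ∈
      suppIn {a | ℓ a ≠ p.natDegree * c} := by
    refine sum_mem fun i hi => mul_mem_suppIn (fun a (ha : 0 ≤ ℓ a) b hb => ?_)
      (hA _ (p.coeff i).2) (pow_mem_suppIn hc i)
    rw [Set.mem_ofPred_eq] at hb ⊢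
    rw [map_add]
    have : (i : ℤ) < p.natDegree := by exact_mod_cast Finset.mem_range.1 hi
    have := mul_lt_mul_of_neg_right this hc0
    omega
  have h3 := congrArg (facePart ℓ (p.natDegree * c)) h1
  rw [map_add, facePart_eq_zero h2, add_zero, facePart_pow hc, map_zero] at h3
  exact hne (eq_zero_of_pow_eq_zero h3)

lemma mem_coneAlgebra_iff {j : Fin 14} {f : Laurent} : f ∈ coneAlgebra j ↔
    ∀ l, facetHeight l j = 0 → f ∈ suppIn {a | 0 ≤ facetForm l a} :=
  ⟨fun h l hl a ha => h a ha l hl, fun h a ha l hl => h l hl a ha⟩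

lemma chi_mem_coneAlgebra {j : Fin 14} {a : Fin 5 → ℤ} : chi a ∈ coneAlgebra j ↔ a ∈ coneAt j :=
  chi_mem_monoidSubalgebra

/-- An interior point of the tangent cone at the `j`-th lattice point. -/
def interiorPoint (j : Fin 14) : Fin 5 → ℤ := ∑ k, (character k - character j)

lemma interiorPoint_mem (j : Fin 14) : interiorPoint j ∈ coneAt j :=
  sum_mem fun k _ => character_sub_mem_coneAt k j

lemma facetForm_interiorPoint {l : Fin 9} {j : Fin 14} (hl : facetHeight l j = 0) :
    0 < facetForm l (interiorPoint j) := by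
  rw [interiorPoint, map_sum, Finset.sum_congr rfl fun k _ => facetForm_character_sub hl k]
  revert l
  decide +revert

lemma exists_add_nsmul_interiorPoint_mem (j : Fin 14) (s : Finset (Fin 5 → ℤ)) :
    ∃ n : ℕ, ∀ a ∈ s, n • interiorPoint j + a ∈ coneAt j := by
  refine ⟨∑ a ∈ s, ∑ l, (facetForm l a).natAbs, fun a ha l hl => ?_⟩
  have h1 : (facetForm l a).natAbs ≤ ∑ l, (facetForm l a).natAbs :=
    Finset.single_le_sum (f := fun l => (facetForm l a).natAbs) (fun _ _ => Nat.zero_le _)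
      (Finset.mem_univ l)
  have h2 : ∑ l, (facetForm l a).natAbs ≤ ∑ a ∈ s, ∑ l, (facetForm l a).natAbs :=
    Finset.single_le_sum (f := fun a => ∑ l, (facetForm l a).natAbs) (fun _ _ => Nat.zero_le _) ha
  rw [map_add, map_nsmul, nsmul_eq_mul]
  have h3 := facetForm_interiorPoint hl
  set n := ∑ a ∈ s, ∑ l, (facetForm l a).natAbs
  have h4 : (n : ℤ) * 1 ≤ n * facetForm l (interiorPoint j) :=
    mul_le_mul_of_nonneg_left (by omega) (by positivity)
  omega

/-- Every Laurent polynomial is a fraction with numerator in the coordinate ring of the chart and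
denominator a monomial. -/
lemma exists_chi_mul_mem_coneAlgebra (j : Fin 14) (f : Laurent) :
    ∃ n : ℕ, chi (n • interiorPoint j) * f ∈ coneAlgebra j := by
  obtain ⟨n, hn⟩ := exists_add_nsmul_interiorPoint_mem j f.coeff.support
  refine ⟨n, mul_mem_suppIn (s := {n • interiorPoint j}) (t := f.coeff.support) ?_
    (chi_mem_suppIn rfl) fun a ha => Finsupp.mem_support_iff.2 ha⟩
  rintro _ rfl b hb
  exact hn b hb

instance isLocalization_laurent (j : Fin 14) : IsLocalization.Away
    (⟨chi (interiorPoint j), chi_mem_coneAlgebra.2 (interiorPoint_mem j)⟩ : coneAlgebra j)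
    Laurent where
  map_units := by
    rintro ⟨_, n, rfl⟩
    rw [map_pow]
    exact (isUnit_chi _).pow n
  surj f := by
    obtain ⟨n, hn⟩ := exists_chi_mul_mem_coneAlgebra j f
    rw [chi_nsmul] at hn
    refine ⟨⟨⟨_, hn⟩, ⟨_, n, rfl⟩⟩, ?_⟩
    rw [map_pow, mul_comm]
    rfl
  exists_of_eq {f g} h := ⟨1, by simpa using Subtype.val_injective h⟩

end Facets

section UniqueFactorization

open MvPolynomial

lemma aeval_chi_monomial {σ : Type*} [Fintype σ] (b : σ → Fin 5 → ℤ) (d : σ →₀ ℕ) (c : ℂ) :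
    aeval (fun i => chi (b i)) (monomial d c) = c • chi (∑ i, d i • b i) := by
  rw [aeval_monomial, Algebra.smul_def, Finsupp.prod_fintype _ _ (by simp), chi_sum]
  simp_rw [chi_nsmul]

/-- Monomials with distinct images are linearly independent. -/
lemma eq_zero_of_aeval_chi_eq_zero {σ : Type*} [Fintype σ] (b : σ → Fin 5 → ℤ)
    {f : MvPolynomial σ ℂ} (hb : Set.InjOn (fun d : σ →₀ ℕ => ∑ i, d i • b i) f.support)
    (h : aeval (fun i => chi (b i)) f = 0) : f = 0 := by
  ext d
  rw [coeff_zero]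
  by_contra hd
  have h1 : aeval (fun i => chi (b i)) f =
      ∑ e ∈ f.support, coeff e f • chi (∑ i, e i • b i) := by
    conv_lhs => rw [f.as_sum, map_sum]
    exact Finset.sum_congr rfl fun e _ => aeval_chi_monomial b e _
  have h2 := congrArg (fun f : Laurent => f.coeff (∑ i, d i • b i)) (h1.symm.trans h)
  simp only [AddMonoidAlgebra.coeff_sum, chi, AddMonoidAlgebra.coeff_smul,
    AddMonoidAlgebra.coeff_single, Finsupp.finset_sum_apply, Finsupp.smul_apply,
    AddMonoidAlgebra.coeff_zero, Finsupp.zero_apply] at h2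
  rw [Finset.sum_eq_single d] at h2
  · simp at h2
    exact hd h2
  · intro e he hed
    rw [Finsupp.single_eq_of_ne, smul_zero]
    exact fun heq => hed (hb he (mem_support_iff.2 hd) heq.symm)
  · intro h'
    exact absurd (mem_support_iff.2 hd) h'

instance uniqueFactorizationMonoid_laurent : UniqueFactorizationMonoid Laurent := by
  let φ : MvPolynomial (Fin 5) ℂ →ₐ[ℂ] Laurent := aeval fun i => chi (Pi.single i 1)
  have hexp : ∀ d : Fin 5 →₀ ℕ, ∑ i, d i • (Pi.single i 1 : Fin 5 → ℤ) = fun i => (d i : ℤ) := by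
    intro d
    funext k
    simp [Finset.sum_apply, Pi.single_apply]
  have hφ : Function.Injective φ := by
    rw [injective_iff_map_eq_zero]
    intro f hf
    refine eq_zero_of_aeval_chi_eq_zero _ (fun d _ e _ hde => ?_) hf
    simp only [hexp] at hde
    ext i
    exact_mod_cast congrFun hde i
  have hmon : ∀ a : Fin 5 → ℤ, (∀ i, 0 ≤ a i) → chi a ∈ φ.range := by
    intro a ha
    refine ⟨monomial (Finsupp.equivFunOnFinite.symm fun i => (a i).toNat) 1, ?_⟩
    change φ _ = _
    rw [aeval_chi_monomial, hexp, one_smul]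
    congr 1
    funext i
    simp [ha i]
  letI : Algebra (MvPolynomial (Fin 5) ℂ) Laurent := φ.toRingHom.toAlgebra
  have : IsLocalization (Submonoid.powers (∏ i : Fin 5, (X i : MvPolynomial (Fin 5) ℂ))) Laurent := by
    have hprod : φ (∏ i : Fin 5, X i) = chi fun _ => 1 := by
      rw [map_prod]
      simp only [φ, aeval_X]
      rw [← chi_sum, Finset.univ_sum_single]
    refine ⟨?_, ?_, ?_⟩
    · rintro ⟨_, n, rfl⟩
      change IsUnit (φ _)
      rw [map_pow, hprod]
      exact (isUnit_chi _).pow n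
    · intro f
      obtain ⟨n, hn⟩ : ∃ n : ℕ, chi (n • fun _ => 1) * f ∈ φ.range := by
        refine ⟨∑ a ∈ f.coeff.support, ∑ i, (a i).natAbs, ?_⟩
        set n := ∑ a ∈ f.coeff.support, ∑ i, (a i).natAbs with hn
        rw [eq_sum_smul_chi f, Finset.mul_sum]
        refine sum_mem fun a ha => ?_
        rw [mul_smul_comm, ← chi_add]
        refine Subalgebra.smul_mem _ (hmon _ fun i => ?_) _
        have h1 : (a i).natAbs ≤ ∑ i, (a i).natAbs :=
          Finset.single_le_sum (f := fun i => (a i).natAbs) (fun _ _ => Nat.zero_le _)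
            (Finset.mem_univ i)
        have h2 : ∑ i, (a i).natAbs ≤ n :=
          Finset.single_le_sum (f := fun a : Fin 5 → ℤ => ∑ i, (a i).natAbs)
            (fun _ _ => Nat.zero_le _) ha
        simp
        omega
      obtain ⟨g, hg⟩ := hn
      refine ⟨⟨g, ⟨_, n, rfl⟩⟩, ?_⟩
      change f * φ _ = φ g
      rw [map_pow, hprod, ← chi_nsmul, mul_comm]
      exact hg.symm
    · intro f g h
      exact ⟨1, by rw [hφ h]⟩
  exact UniqueFactorizationMonoid.of_isLocalization
    (S := Submonoid.powers (∏ i : Fin 5, (X i : MvPolynomial (Fin 5) ℂ))) Laurent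

instance isIntegrallyClosed_coneAlgebra (j : Fin 14) : IsIntegrallyClosed (coneAlgebra j) := by
  have : IsIntegrallyClosedIn (coneAlgebra j) Laurent := by
    rw [isIntegrallyClosedIn_iff]
    refine ⟨Subtype.val_injective, fun {f} hf => ⟨⟨f, mem_coneAlgebra_iff.2 fun l hl => ?_⟩, rfl⟩⟩
    exact mem_suppIn_of_isIntegral (fun g hg => mem_coneAlgebra_iff.1 hg l hl) hf
  exact IsIntegrallyClosed.of_isIntegrallyClosed_of_isIntegrallyClosedIn (coneAlgebra j) Laurent

theorem isNormalVariety_toricIdeal : IsNormalVariety toricIdeal := fun j _ =>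
  ⟨inferInstance, IsIntegrallyClosed.of_equiv (chartEquiv j).symm.toRingEquiv⟩

end UniqueFactorization

/-! ### Differential forms on the torus -/

section Differentials

open KaehlerDifferential

/-- The logarithmic derivation `x_k ∂/∂x_k` of the ring of Laurent polynomials. -/
def torusDeriv (k : Fin 5) : Laurent →ₗ[ℂ] Laurent where
  toFun f := .ofCoeff (Finsupp.onFinset f.coeff.support (fun a => (a k : ℂ) * f.coeff a)
    fun a ha => Finsupp.mem_support_iff.2 (right_ne_zero_of_mul ha))
  map_add' f g := by
    apply AddMonoidAlgebra.coeff_injective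
    ext a
    simp [mul_add]
  map_smul' c f := by
    apply AddMonoidAlgebra.coeff_injective
    ext a
    simp
    ring

lemma coeff_torusDeriv (k : Fin 5) (f : Laurent) (a : Fin 5 → ℤ) :
    (torusDeriv k f).coeff a = (a k : ℂ) * f.coeff a := rfl

lemma torusDeriv_chi (k : Fin 5) (a : Fin 5 → ℤ) : torusDeriv k (chi a) = (a k : ℂ) • chi a := by
  apply AddMonoidAlgebra.coeff_injective
  ext b
  rw [coeff_torusDeriv]
  by_cases h : a = b <;> simp [chi, Finsupp.single_apply, h]

variable (K : Type) [Field K] [Algebra ℂ K] [Algebra Laurent K] [IsScalarTower ℂ Laurent K]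

lemma algebraMap_chi_add (a b : Fin 5 → ℤ) : algebraMap Laurent K (chi (a + b)) =
    algebraMap Laurent K (chi a) * algebraMap Laurent K (chi b) := by
  rw [chi_add, map_mul]

lemma algebraMap_chi_neg_mul (a : Fin 5 → ℤ) : algebraMap Laurent K (chi (-a)) *
    algebraMap Laurent K (chi a) = 1 := by
  rw [← algebraMap_chi_add, neg_add_cancel, chi_zero, map_one]

lemma algebraMap_chi_ne_zero (a : Fin 5 → ℤ) : algebraMap Laurent K (chi a) ≠ 0 :=
  right_ne_zero_of_mul_eq_one (algebraMap_chi_neg_mul K a)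

/-- The logarithmic differentials of the monomials. -/
def dlog : (Fin 5 → ℤ) →+ Ω[K⁄ℂ] where
  toFun a := algebraMap Laurent K (chi (-a)) • D ℂ K (algebraMap Laurent K (chi a))
  map_zero' := by simp [chi_zero]
  map_add' a b := by
    have ha := algebraMap_chi_neg_mul K a
    have hb := algebraMap_chi_neg_mul K b
    rw [algebraMap_chi_add, Derivation.leibniz, neg_add, algebraMap_chi_add, smul_add, smul_smul,
      smul_smul, add_comm]
    congr 1
    · congr 1
      linear_combination algebraMap Laurent K (chi (-a)) * hb
    · congr 1
      linear_combination algebraMap Laurent K (chi (-b)) * ha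

lemma D_chi (a : Fin 5 → ℤ) : D ℂ K (algebraMap Laurent K (chi a)) =
    algebraMap Laurent K (chi a) • dlog K a := by
  change _ = algebraMap Laurent K (chi a) • algebraMap Laurent K (chi (-a)) •
    D ℂ K (algebraMap Laurent K (chi a))
  rw [smul_smul, mul_comm, algebraMap_chi_neg_mul, one_smul]

lemma dlog_eq_sum (a : Fin 5 → ℤ) : dlog K a = ∑ k, (a k : K) • dlog K (Pi.single k 1) := by
  have : a = ∑ k, a k • Pi.single k (1 : ℤ) := by
    funext i
    simp [Finset.sum_apply, Pi.single_apply]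
  conv_lhs => rw [this]
  rw [map_sum]
  refine Finset.sum_congr rfl fun k _ => ?_
  rw [map_zsmul, Int.cast_smul_eq_zsmul]

lemma D_laurent (f : Laurent) : D ℂ K (algebraMap Laurent K f) =
    ∑ k, algebraMap Laurent K (torusDeriv k f) • dlog K (Pi.single k 1) := by
  have hc : ∀ (c : ℂ) (g : Laurent), algebraMap Laurent K (c • g) = c • algebraMap Laurent K g := by
    intro c g
    exact ((IsScalarTower.toAlgHom ℂ Laurent K).toLinearMap).map_smul c g
  have h : f ∈ Submodule.span ℂ (Set.range chi) := by
    rw [eq_sum_smul_chi f]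
    exact sum_mem fun a _ => Submodule.smul_mem _ _ (Submodule.subset_span ⟨a, rfl⟩)
  induction h using Submodule.span_induction with
  | mem f hf =>
    obtain ⟨a, rfl⟩ := hf
    rw [D_chi, dlog_eq_sum, Finset.smul_sum]
    refine Finset.sum_congr rfl fun k _ => ?_
    rw [torusDeriv_chi, hc, smul_smul, Algebra.smul_def, map_intCast, mul_comm]
  | zero => simp
  | add f g _ _ hf hg =>
    rw [map_add, map_add, hf, hg, ← Finset.sum_add_distrib]
    refine Finset.sum_congr rfl fun k _ => ?_
    rw [map_add, map_add, add_smul]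
  | smul c f _ hf =>
    rw [hc, Derivation.map_smul, hf, Finset.smul_sum]
    refine Finset.sum_congr rfl fun k _ => ?_
    rw [map_smul, hc, smul_assoc]

/-- The logarithmic derivation with values in the function field, as a homomorphism to the dual
numbers. -/
def torusDerivHom (k : Fin 5) : Laurent →ₐ[ℂ] TrivSqZeroExt K K :=
  AddMonoidAlgebra.lift ℂ (TrivSqZeroExt K K) (Fin 5 → ℤ)
    { toFun := fun a => TrivSqZeroExt.inl (algebraMap Laurent K (chi a.toAdd)) +
        TrivSqZeroExt.inr ((a.toAdd k : K) * algebraMap Laurent K (chi a.toAdd))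
      map_one' := by ext <;> simp [chi_zero]
      map_mul' := fun a b => by
        ext
        · simp [chi_add]
        · simp [chi_add]
          ring }

lemma torusDerivHom_chi (k : Fin 5) (a : Fin 5 → ℤ) : torusDerivHom K k (chi a) =
    TrivSqZeroExt.inl (algebraMap Laurent K (chi a)) +
      TrivSqZeroExt.inr ((a k : K) * algebraMap Laurent K (chi a)) := by
  rw [torusDerivHom, chi, AddMonoidAlgebra.lift_single, one_smul]
  rfl

lemma fst_torusDerivHom (k : Fin 5) (f : Laurent) :
    (torusDerivHom K k f).fst = algebraMap Laurent K f := by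
  have : (TrivSqZeroExt.fstHom ℂ K K).comp (torusDerivHom K k) =
      IsScalarTower.toAlgHom ℂ Laurent K := by
    refine AddMonoidAlgebra.algHom_ext (fun a => ?_) ?_
    · change (torusDerivHom K k (chi a)).fst = algebraMap Laurent K (chi a)
      rw [torusDerivHom_chi]
      simp
    · ext
  exact congrArg (fun φ => φ f) this

variable [IsFractionRing Laurent K]

/-- The logarithmic derivation of the function field, as a homomorphism to the dual numbers. -/
def fieldDerivHom (k : Fin 5) : K →+* TrivSqZeroExt K K :=
  IsLocalization.lift (M := nonZeroDivisors Laurent) (g := (torusDerivHom K k).toRingHom) fun f => by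
    rw [TrivSqZeroExt.isUnit_iff_isUnit_fst]
    change IsUnit (torusDerivHom K k f).fst
    rw [fst_torusDerivHom]
    exact IsLocalization.map_units K f

lemma fieldDerivHom_algebraMap (k : Fin 5) (f : Laurent) :
    fieldDerivHom K k (algebraMap Laurent K f) = torusDerivHom K k f :=
  IsLocalization.lift_eq _ f

lemma fst_fieldDerivHom (k : Fin 5) (x : K) : (fieldDerivHom K k x).fst = x := by
  have : (TrivSqZeroExt.fstHom ℂ K K).toRingHom.comp (fieldDerivHom K k) = RingHom.id K := by
    refine IsLocalization.ringHom_ext (nonZeroDivisors Laurent) (RingHom.ext fun f => ?_)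
    change (fieldDerivHom K k (algebraMap Laurent K f)).fst = algebraMap Laurent K f
    rw [fieldDerivHom_algebraMap, fst_torusDerivHom]
  exact congrArg (fun φ => φ x) this

/-- The logarithmic derivation of the function field. -/
def fieldDeriv (k : Fin 5) : Derivation ℂ K K :=
  Derivation.mk'
    { toFun := fun x => (fieldDerivHom K k x).snd
      map_add' := fun x y => by simp
      map_smul' := fun c x => by
        have hc : fieldDerivHom K k (algebraMap ℂ K c) = TrivSqZeroExt.inl (algebraMap ℂ K c) := by
          rw [IsScalarTower.algebraMap_apply ℂ Laurent K, fieldDerivHom_algebraMap,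
            AlgHom.commutes, TrivSqZeroExt.algebraMap_eq_inl', ← IsScalarTower.algebraMap_apply]
        rw [Algebra.smul_def, map_mul, hc]
        simp [Algebra.smul_def] }
    fun x y => by
      simp [fst_fieldDerivHom, mul_comm y]

lemma fieldDeriv_chi (k : Fin 5) (a : Fin 5 → ℤ) : fieldDeriv K k (algebraMap Laurent K (chi a)) =
    (a k : K) * algebraMap Laurent K (chi a) := by
  change (fieldDerivHom K k _).snd = _
  rw [fieldDerivHom_algebraMap, torusDerivHom_chi]
  simp

lemma liftKaehlerDifferential_dlog (k : Fin 5) (a : Fin 5 → ℤ) :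
    (fieldDeriv K k).liftKaehlerDifferential (dlog K a) = a k := by
  change (fieldDeriv K k).liftKaehlerDifferential
    (algebraMap Laurent K (chi (-a)) • D ℂ K (algebraMap Laurent K (chi a))) = _
  rw [map_smul, Derivation.liftKaehlerDifferential_comp_D, fieldDeriv_chi, smul_eq_mul,
    mul_left_comm, algebraMap_chi_neg_mul, mul_one]

lemma span_dlog : ⊤ ≤ Submodule.span K (Set.range fun k : Fin 5 => dlog K (Pi.single k 1)) := by
  rw [← KaehlerDifferential.span_range_derivation, Submodule.span_le]
  have hL : ∀ f : Laurent, D ℂ K (algebraMap Laurent K f) ∈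
      Submodule.span K (Set.range fun k : Fin 5 => dlog K (Pi.single k 1)) := by
    intro f
    rw [D_laurent]
    exact sum_mem fun k _ => Submodule.smul_mem _ _ (Submodule.subset_span ⟨k, rfl⟩)
  rintro _ ⟨x, rfl⟩
  obtain ⟨f, g, -, rfl⟩ := IsFractionRing.div_surjective (A := Laurent) x
  rw [Derivation.leibniz_div]
  exact Submodule.smul_mem _ _ (sub_mem (Submodule.smul_mem _ _ (hL f))
    (Submodule.smul_mem _ _ (hL g)))

lemma linearIndependent_dlog : LinearIndependent K fun k : Fin 5 => dlog K (Pi.single k 1) := by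
  rw [Fintype.linearIndependent_iff]
  intro c hc i
  have := congrArg (fieldDeriv K i).liftKaehlerDifferential hc
  simpa [liftKaehlerDifferential_dlog, Pi.single_apply] using this

/-- The logarithmic differentials of the torus coordinates form a basis of the differentials of
the function field. -/
def dlogBasis : Module.Basis (Fin 5) K (Ω[K⁄ℂ]) :=
  Module.Basis.mk (linearIndependent_dlog K) (span_dlog K)

lemma dlogBasis_apply (k : Fin 5) : dlogBasis K k = dlog K (Pi.single k 1) := by
  simp [dlogBasis]

/-- The coefficient of a `5`-form with respect to the invariant form
`dx/x ∧ dy/y ∧ dz/z ∧ dt/t ∧ dv/v`. -/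
def formCoeff : (⋀[K]^5 (Ω[K⁄ℂ])) →ₗ[K] K :=
  exteriorPower.alternatingMapLinearEquiv (dlogBasis K).det

lemma formCoeff_ιMulti (v : Fin 5 → Ω[K⁄ℂ]) :
    formCoeff K (exteriorPower.ιMulti K 5 v) = (dlogBasis K).det v := by
  simp [formCoeff]

/-- The invariant form. -/
def invariantForm : ⋀[K]^5 (Ω[K⁄ℂ]) := exteriorPower.ιMulti K 5 (dlogBasis K)

lemma formCoeff_invariantForm : formCoeff K (invariantForm K) = 1 := by
  rw [invariantForm, formCoeff_ιMulti, Module.Basis.det_self]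

lemma formCoeff_injective : Function.Injective (formCoeff K) := by
  have : Module.Finite K (Ω[K⁄ℂ]) := Module.Finite.of_basis (dlogBasis K)
  refine (LinearMap.injective_iff_surjective_of_finrank_eq_finrank ?_).2 fun c => ?_
  · rw [exteriorPower.finrank_eq, Module.finrank_eq_card_basis (dlogBasis K), Module.finrank_self]
    simp
  · exact ⟨c • invariantForm K, by rw [map_smul, formCoeff_invariantForm, smul_eq_mul, mul_one]⟩

lemma formCoeff_ιMulti_D (f : Fin 5 → Laurent) : formCoeff K (exteriorPower.ιMulti K 5 fun i =>
    D ℂ K (algebraMap Laurent K (f i))) =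
      algebraMap Laurent K (Matrix.of fun k i => torusDeriv k (f i)).det := by
  rw [formCoeff_ιMulti, Module.Basis.det_apply, RingHom.map_det]
  congr 1
  ext k i
  rw [Module.Basis.toMatrix_apply, D_laurent]
  simp_rw [← dlogBasis_apply]
  rw [Module.Basis.repr_sum_self]
  rfl

end Differentials

/-! ### Toric prime divisors and the canonical module -/

section CanonicalIdeal

lemma suppIn_pos_iff {ℓ : (Fin 5 → ℤ) →+ ℤ} {f : Laurent} (hf : f ∈ suppIn {a | 0 ≤ ℓ a}) :
    facePart ℓ 0 f = 0 ↔ f ∈ suppIn {a | 1 ≤ ℓ a} := by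
  constructor
  · intro h
    have := sub_facePart_mem hf
    rwa [h, sub_zero] at this
  · intro h
    exact facePart_eq_zero (suppIn_mono (fun a (ha : 1 ≤ ℓ a) => by
      rw [Set.mem_ofPred_eq]; omega) h)

/-- Restriction of regular functions on the `j`-th chart to the divisor of a facet through the
`j`-th lattice point. -/
def faceHom {j : Fin 14} {l : Fin 9} (hl : facetHeight l j = 0) : coneAlgebra j →+* Laurent where
  toFun f := facePart (facetForm l) 0 f
  map_one' := facePart_eq_self (by
    rw [OneMemClass.coe_one, ← chi_zero]
    exact chi_mem_suppIn (by simp))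
  map_mul' f g := by
    have := facePart_mul (mem_coneAlgebra_iff.1 f.2 l hl) (mem_coneAlgebra_iff.1 g.2 l hl)
    rwa [add_zero] at this
  map_zero' := map_zero _
  map_add' f g := map_add _ _ _

/-- The prime ideal of the divisor of a facet. -/
def facetPrime {j : Fin 14} {l : Fin 9} (hl : facetHeight l j = 0) : Ideal (coneAlgebra j) :=
  RingHom.ker (faceHom hl)

instance isPrime_facetPrime {j : Fin 14} {l : Fin 9} (hl : facetHeight l j = 0) :
    (facetPrime hl).IsPrime := RingHom.ker_isPrime _

lemma mem_facetPrime {j : Fin 14} {l : Fin 9} {hl : facetHeight l j = 0} {f : coneAlgebra j} :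
    f ∈ facetPrime hl ↔ (f : Laurent) ∈ suppIn {a | 1 ≤ facetForm l a} :=
  suppIn_pos_iff (mem_coneAlgebra_iff.1 f.2 l hl)

/-- Translation by a large multiple of a point `w` of the tangent cone moves into the cone all
points that satisfy the conditions of the facets containing `w`. -/
lemma exists_nsmul_add_mem {j : Fin 14} {w : Fin 5 → ℤ} (hw : w ∈ coneAt j)
    (s : Finset (Fin 5 → ℤ))
    (hs : ∀ a ∈ s, ∀ l, facetHeight l j = 0 → facetForm l w = 0 → 0 ≤ facetForm l a) :
    ∃ n : ℕ, 2 ≤ n ∧ ∀ a ∈ s, n • w + a ∈ coneAt j := by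
  refine ⟨2 + ∑ a ∈ s, ∑ l, (facetForm l a).natAbs, Nat.le_add_right _ _, fun a ha l hl => ?_⟩
  rw [map_add, map_nsmul, nsmul_eq_mul]
  rcases eq_or_ne (facetForm l w) 0 with h0 | h0
  · rw [h0, mul_zero, zero_add]
    exact hs a ha l hl h0
  have h1 : (facetForm l a).natAbs ≤ ∑ l, (facetForm l a).natAbs :=
    Finset.single_le_sum (f := fun l => (facetForm l a).natAbs) (fun _ _ => Nat.zero_le _)
      (Finset.mem_univ l)
  have h2 : ∑ l, (facetForm l a).natAbs ≤ ∑ a ∈ s, ∑ l, (facetForm l a).natAbs :=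
    Finset.single_le_sum (f := fun a => ∑ l, (facetForm l a).natAbs) (fun _ _ => Nat.zero_le _) ha
  set n := ∑ a ∈ s, ∑ l, (facetForm l a).natAbs
  have h3 : 1 ≤ facetForm l w := by
    have := hw l hl
    omega
  have h4 : ((2 + n : ℕ) : ℤ) * 1 ≤ (2 + n : ℕ) * facetForm l w :=
    mul_le_mul_of_nonneg_left h3 (by positivity)
  push_cast at h4 ⊢
  omega

/-- A point in the relative interior of the cone over a facet through the `j`-th lattice point. -/
def facePoint (j : Fin 14) (l : Fin 9) : Fin 5 → ℤ :=
  ∑ k with facetHeight l k = 0, (character k - character j)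

lemma facePoint_mem (j : Fin 14) (l : Fin 9) : facePoint j l ∈ coneAt j :=
  sum_mem fun k _ => character_sub_mem_coneAt k j

lemma facetForm_facePoint {l l' : Fin 9} {j : Fin 14} (hl' : facetHeight l' j = 0) :
    facetForm l' (facePoint j l) = 0 ↔ l' = l := by
  have h : facetForm l' (facePoint j l) =
      ((∑ k with facetHeight l k = 0, facetHeight l' k : ℕ) : ℤ) := by
    rw [facePoint, map_sum, Finset.sum_congr rfl fun k _ => facetForm_character_sub hl' k]
    push_cast
    rfl
  rw [h, Nat.cast_eq_zero]
  revert l l'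
  decide +revert

instance finiteType_coneAlgebra (j : Fin 14) : Algebra.FiniteType ℂ (coneAlgebra j) :=
  Algebra.FiniteType.equiv inferInstance (chartEquiv j)

instance isNoetherianRing_coneAlgebra (j : Fin 14) : IsNoetherianRing (coneAlgebra j) :=
  Algebra.FiniteType.isNoetherianRing ℂ _

instance isNoetherianRing_laurent : IsNoetherianRing Laurent :=
  IsLocalization.isNoetherianRing (Submonoid.powers (⟨chi (interiorPoint 0),
    chi_mem_coneAlgebra.2 (interiorPoint_mem 0)⟩ : coneAlgebra 0)) Laurent inferInstance

/-- A prime ideal that contains a monomial contains the ideal of a facet: a power of a product of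
elements of all the facet ideals is divisible by the monomial. -/
lemma exists_facetPrime_le {j : Fin 14} {𝔮 : Ideal (coneAlgebra j)} (h𝔮 : 𝔮.IsPrime)
    {b : Fin 5 → ℤ} (hb : b ∈ coneAt j)
    (h : (⟨chi b, chi_mem_coneAlgebra.2 hb⟩ : coneAlgebra j) ∈ 𝔮) :
    ∃ (l : Fin 9) (hl : facetHeight l j = 0), facetPrime hl ≤ 𝔮 := by
  by_contra! hcon
  have hex : ∀ l : Fin 9, ∃ f : coneAlgebra j, f ∉ 𝔮 ∧
      ∀ hl : facetHeight l j = 0, f ∈ facetPrime hl := by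
    intro l
    by_cases hl : facetHeight l j = 0
    · obtain ⟨f, hf, hf'⟩ := Set.not_subset.1 (hcon l hl)
      exact ⟨f, hf', fun _ => hf⟩
    · exact ⟨1, (Ideal.ne_top_iff_one 𝔮).1 h𝔮.ne_top, fun h => absurd h hl⟩
  choose f hf hf' using hex
  have hg : ∏ l, f l ∉ 𝔮 := by
    rw [h𝔮.prod_mem_iff]
    push Not
    exact fun l _ => hf l
  obtain ⟨N, hN⟩ : ∃ N : ℕ, ∀ l, facetForm l b ≤ N :=
    ⟨∑ l, (facetForm l b).natAbs, fun l => by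
      have : (facetForm l b).natAbs ≤ ∑ l, (facetForm l b).natAbs :=
        Finset.single_le_sum (f := fun l => (facetForm l b).natAbs) (fun _ _ => Nat.zero_le _)
          (Finset.mem_univ l)
      omega⟩
  have hdiv : chi (-b) * (((∏ l, f l) ^ N : coneAlgebra j) : Laurent) ∈ coneAlgebra j := by
    rw [mem_coneAlgebra_iff]
    intro l hl
    have h1 : ∏ l, f l ∈ facetPrime hl :=
      Ideal.prod_mem _ (Finset.mem_univ l) (hf' l hl)
    have h2 := pow_mem_suppIn (mem_facetPrime.1 h1) N
    refine mul_mem_suppIn (s := {-b}) ?_ (chi_mem_suppIn rfl) h2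
    rintro _ rfl a ha
    rw [Set.mem_ofPred_eq] at ha ⊢
    rw [map_add, map_neg]
    have := hN l
    linarith
  have h3 : (∏ l, f l) ^ N = (⟨chi b, chi_mem_coneAlgebra.2 hb⟩ : coneAlgebra j) * ⟨_, hdiv⟩ := by
    apply Subtype.val_injective
    change _ = chi b * (chi (-b) * _)
    rw [← mul_assoc, ← chi_add, add_neg_cancel, chi_zero, one_mul]
  exact hg (h𝔮.mem_of_pow_mem N (h3 ▸ Ideal.mul_mem_right _ _ h))

/-- Lattice vectors, one for each coordinate, that form a basis of the lattice and of which all but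
one lie on the hyperplane of the `l`-th facet, the last one being at height `1`. -/
def facetBasis (l : Fin 9) : Matrix (Fin 5) (Fin 5) ℤ :=
  (![1, 1, 1, 1, 1,
    !![1, 0, 0, 0, -1; 0, 1, 0, 0, -1; 0, 0, 1, 0, -1; 0, 0, 0, 1, -1; 0, 0, 0, 0, -1],
    !![1, 0, 0, 0, 0; 0, 1, -1, 0, 0; 0, 0, -1, 0, 0; 0, 0, 0, 1, 0; 0, 0, 0, 0, 1],
    !![1, -1, 0, 0, 0; 0, -1, 0, 0, 0; 0, 0, 1, 0, 0; 0, 0, 0, 1, 0; 0, 0, 0, 0, 1],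
    !![1, 0, 0, -1, 0; 0, 1, 0, 0, 0; 0, 0, 1, 0, 0; 0, 0, 0, -1, 0; 0, 0, 0, 0, 1]] :
    Fin 9 → Matrix (Fin 5) (Fin 5) ℤ) l

lemma facetBasis_mul_self (l : Fin 9) : facetBasis l * facetBasis l = 1 := by
  revert l
  decide

lemma facetForm_facetBasis (l : Fin 9) :
    (∀ i, 0 ≤ facetForm l (facetBasis l i)) ∧ ∑ i, facetForm l (facetBasis l i) = 1 := by
  simp only [facetForm_apply]
  revert l
  decide

/-- An integral matrix congruent to an invertible one is non-singular. -/
lemma det_ne_zero_of_congr {n : ℕ} (hn : 2 ≤ n) {V W : Matrix (Fin 5) (Fin 5) ℤ} (hV : V * V = 1)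
    (hVW : ∀ i k, (n : ℤ) ∣ W i k - V i k) : W.det ≠ 0 := by
  intro h
  have h1 : (Int.castRingHom (ZMod n)).mapMatrix W = (Int.castRingHom (ZMod n)).mapMatrix V := by
    ext i k
    have := (ZMod.intCast_zmod_eq_zero_iff_dvd (W i k - V i k) n).2 (hVW i k)
    push_cast at this
    exact sub_eq_zero.1 this
  have h2 : (Int.castRingHom (ZMod n)) (V.det * V.det) = 0 := by
    rw [map_mul, RingHom.map_det _ V, ← h1, ← RingHom.map_det, h, map_zero, zero_mul]
  rw [← Matrix.det_mul, hV, Matrix.det_one, map_one] at h2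
  have : Fact (1 < n) := ⟨hn⟩
  exact one_ne_zero h2

/-- The module of Laurent polynomials `h` such that `h dx/x ∧ ⋯ ∧ dv/v` is regular on the `j`-th
chart in codimension one. -/
def canonicalIdeal (j : Fin 14) : Submodule (coneAlgebra j) Laurent where
  carrier := {f | ∀ l, facetHeight l j = 0 → f ∈ suppIn {a | 1 ≤ facetForm l a}}
  zero_mem' := fun _ _ => zero_mem _
  add_mem' hf hg l hl := add_mem (hf l hl) (hg l hl)
  smul_mem' c f hf l hl := mul_mem_suppIn (fun a (ha : 0 ≤ facetForm l a) b hb => by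
    rw [Set.mem_ofPred_eq] at *
    rw [map_add]
    omega) (mem_coneAlgebra_iff.1 c.2 l hl) (hf l hl)

lemma mem_canonicalIdeal {j : Fin 14} {f : Laurent} : f ∈ canonicalIdeal j ↔
    ∀ l, facetHeight l j = 0 → f ∈ suppIn {a | 1 ≤ facetForm l a} := Iff.rfl

/-- The exponent of the generator of the canonical module of the `j`-th chart. -/
def canonicalExp (j : Fin 14) : Fin 5 → ℤ := (fun _ => 1) - 3 • character j

lemma facetForm_canonicalExp {l : Fin 9} {j : Fin 14} (hl : facetHeight l j = 0) :
    facetForm l (canonicalExp j) = 1 := by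
  simp only [facetForm_apply]
  revert l j
  decide

/-- The canonical module is free: all facets through a lattice point have distance `1` from the
same point. -/
lemma mem_canonicalIdeal_iff {j : Fin 14} {f : Laurent} :
    f ∈ canonicalIdeal j ↔ chi (-canonicalExp j) * f ∈ coneAlgebra j := by
  rw [mem_canonicalIdeal, mem_coneAlgebra_iff]
  refine forall₂_congr fun l hl => ⟨fun h => ?_, fun h => ?_⟩
  · refine mul_mem_suppIn (s := {-canonicalExp j}) ?_ (chi_mem_suppIn rfl) h
    rintro _ rfl a ha
    rw [Set.mem_ofPred_eq] at *
    rw [map_add, map_neg, facetForm_canonicalExp hl]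
    omega
  · have e : f = chi (canonicalExp j) * (chi (-canonicalExp j) * f) := by
      rw [← mul_assoc, ← chi_add, add_neg_cancel, chi_zero, one_mul]
    rw [e]
    refine mul_mem_suppIn (s := {canonicalExp j}) ?_ (chi_mem_suppIn rfl) h
    rintro _ rfl a ha
    rw [Set.mem_ofPred_eq] at *
    rw [map_add, facetForm_canonicalExp hl]
    omega

/-- The module of coefficients of the `5`-forms generated by the differentials of regular
functions on the `j`-th chart. -/
def jacobianModule (j : Fin 14) : Submodule (coneAlgebra j) Laurent :=
  Submodule.span (coneAlgebra j) (Set.range fun f : Fin 5 → coneAlgebra j =>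
    (Matrix.of fun k i => torusDeriv k (f i : Laurent)).det)

lemma torusDeriv_mem_suppIn {s : Set (Fin 5 → ℤ)} {f : Laurent} (hf : f ∈ suppIn s) (k : Fin 5) :
    torusDeriv k f ∈ suppIn s := fun a ha => hf a fun h => ha (by rw [coeff_torusDeriv, h, mul_zero])

/-- The Jacobian determinants vanish along the divisors of the facets, since functions on such a
divisor are killed by a logarithmic vector field. -/
lemma jacobianModule_le (j : Fin 14) : jacobianModule j ≤ canonicalIdeal j := by
  rw [jacobianModule, Submodule.span_le]
  rintro _ ⟨f, rfl⟩ l hl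
  let M : Matrix (Fin 5) (Fin 5) (coneAlgebra j) :=
    Matrix.of fun k i => ⟨torusDeriv k (f i : Laurent), torusDeriv_mem_suppIn (f i).2 k⟩
  have hM : (Matrix.of fun k i => torusDeriv k (f i : Laurent)).det = ((M.det : coneAlgebra j) :
      Laurent) := ((coneAlgebra j).val.map_det M).symm
  change (Matrix.of fun k i => torusDeriv k (f i : Laurent)).det ∈ suppIn _
  rw [hM, ← mem_facetPrime (hl := hl), facetPrime, RingHom.mem_ker, RingHom.map_det]
  rw [← Matrix.exists_vecMul_eq_zero_iff]
  refine ⟨fun k => algebraMap ℂ Laurent (facetNormal l k), fun h => ?_, ?_⟩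
  · have h0 : ∀ k, facetNormal l k = 0 := by
      intro k
      have := congrFun h k
      rw [Pi.zero_apply, map_eq_zero_iff _ (algebraMap ℂ Laurent).injective] at this
      exact_mod_cast this
    revert h0
    clear * -
    revert l
    decide
  · funext i
    change ∑ k, algebraMap ℂ Laurent (facetNormal l k) *
      facePart (facetForm l) 0 (torusDeriv k (f i : Laurent)) = 0
    apply AddMonoidAlgebra.coeff_injective
    ext a
    simp only [← Algebra.smul_def, AddMonoidAlgebra.coeff_sum, AddMonoidAlgebra.coeff_smul,
      Finsupp.finset_sum_apply, Finsupp.smul_apply, coeff_facePart, coeff_torusDeriv, smul_eq_mul,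
      AddMonoidAlgebra.coeff_zero, Finsupp.zero_apply]
    by_cases ha : facetForm l a = 0
    · simp only [if_pos ha, ← mul_assoc]
      rw [← Finset.sum_mul]
      have : (∑ k, (facetNormal l k : ℂ) * (a k : ℂ)) = ((facetForm l a : ℤ) : ℂ) := by
        rw [facetForm_apply]
        push_cast
        rfl
      rw [this, ha]
      simp
    · simp [if_neg ha]

/-- Let `w` be a point of the tangent cone and `V` a basis of the lattice whose members lie on the
right side of the facets through `w`, with sum of heights at most `1`. Then the generator of the
canonical module becomes a Jacobian after multiplication by a multiple of `w`. -/
lemma exists_chi_mul_mem_jacobianModule {j : Fin 14} {w : Fin 5 → ℤ} (hw : w ∈ coneAt j)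
    {V : Matrix (Fin 5) (Fin 5) ℤ} (hV : V * V = 1)
    (h1 : ∀ l, facetHeight l j = 0 → facetForm l w = 0 → ∀ i, 0 ≤ facetForm l (V i))
    (h2 : ∀ l, facetHeight l j = 0 → facetForm l w = 0 → ∑ i, facetForm l (V i) ≤ 1) :
    ∃ n : ℕ, chi (n • w) * chi (canonicalExp j) ∈ jacobianModule j := by
  obtain ⟨N, hN2, hN⟩ := exists_nsmul_add_mem hw (Finset.univ.image V) (by
    intro a ha l hl h0
    obtain ⟨i, -, rfl⟩ := Finset.mem_image.1 ha
    exact h1 l hl h0 i)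
  let U : Fin 5 → Fin 5 → ℤ := fun i => N • w + V i
  let W : Matrix (Fin 5) (Fin 5) ℤ := Matrix.of U
  have hW : ∀ i, U i ∈ coneAt j := fun i => hN _ (Finset.mem_image_of_mem _ (Finset.mem_univ i))
  have hdet : W.det ≠ 0 := det_ne_zero_of_congr hN2 hV fun i k => ⟨w k, by simp [W, U]⟩
  obtain ⟨n, -, hn⟩ := exists_nsmul_add_mem hw {canonicalExp j - ∑ i, U i} (by
    intro a ha l hl h0
    rw [Finset.mem_singleton.1 ha, map_sub, map_sum, facetForm_canonicalExp hl]
    have : ∀ i, facetForm l (U i) = facetForm l (V i) := fun i => by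
      change facetForm l (N • w + V i) = _
      rw [map_add, map_nsmul, h0, smul_zero, zero_add]
    simp_rw [this]
    have := h2 l hl h0
    omega)
  refine ⟨n, ?_⟩
  have hJ : (Matrix.of fun k i => torusDeriv k (chi (U i))).det ∈ jacobianModule j :=
    Submodule.subset_span ⟨fun i => ⟨chi (U i), chi_mem_coneAlgebra.2 (hW i)⟩, rfl⟩
  have hval : (Matrix.of fun k i => torusDeriv k (chi (U i))).det =
      algebraMap ℂ Laurent W.det * chi (∑ i, U i) := by
    have : (Matrix.of fun k i => torusDeriv k (chi (U i))) =
        Matrix.of fun k i => chi (U i) *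
          ((algebraMap ℂ Laurent).comp (Int.castRingHom ℂ)).mapMatrix W.transpose k i := by
      ext1 k i
      rw [Matrix.of_apply, Matrix.of_apply, torusDeriv_chi, Algebra.smul_def, mul_comm]
      rfl
    rw [this, Matrix.det_mul_row, ← RingHom.map_det, Matrix.det_transpose, chi_sum, mul_comm]
    rfl
  have hgoal : chi (n • w) * chi (canonicalExp j) =
      (⟨_, (coneAlgebra j).smul_mem (chi_mem_coneAlgebra.2 (hn _ (Finset.mem_singleton_self _)))
        ((W.det : ℂ)⁻¹)⟩ : coneAlgebra j) •
          (Matrix.of fun k i => torusDeriv k (chi (U i))).det := by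
    rw [hval]
    change _ = ((W.det : ℂ)⁻¹ • chi _) * _
    rw [← Algebra.smul_def, smul_mul_smul_comm, inv_mul_cancel₀ (by exact_mod_cast hdet), one_smul,
      ← chi_add, ← chi_add]
    congr 1
    abel
  rw [hgoal]
  exact Submodule.smul_mem _ _ hJ

/-- At a prime of height one, the generator of the canonical module is a Jacobian up to a factor
outside the prime. -/
lemma exists_smul_mem_jacobianModule {j : Fin 14} {𝔮 : Ideal (coneAlgebra j)} (h𝔮 : 𝔮.IsPrime)
    (hht : 𝔮.height = 1) : ∃ s : coneAlgebra j, s ∉ 𝔮 ∧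
      (s : Laurent) * chi (canonicalExp j) ∈ jacobianModule j := by
  by_cases hmon : ∃ (b : Fin 5 → ℤ) (hb : b ∈ coneAt j),
      (⟨chi b, chi_mem_coneAlgebra.2 hb⟩ : coneAlgebra j) ∈ 𝔮
  · obtain ⟨b, hb, hb𝔮⟩ := hmon
    obtain ⟨l, hl, hle⟩ := exists_facetPrime_le h𝔮 hb hb𝔮
    have heq : facetPrime hl = 𝔮 := by
      by_contra hne
      have hbot : facetPrime hl ≠ ⊥ := by
        intro h
        have : (⟨chi (interiorPoint j), chi_mem_coneAlgebra.2 (interiorPoint_mem j)⟩ :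
            coneAlgebra j) ∈ facetPrime hl :=
          mem_facetPrime.2 (chi_mem_suppIn (facetForm_interiorPoint hl))
        rw [h, Ideal.mem_bot] at this
        exact chi_ne_zero _ (congrArg Subtype.val this)
      have h1 := Ideal.height_add_one_le_of_lt_of_isPrime (lt_of_le_of_ne hle hne)
      rw [hht] at h1
      have h2 : (facetPrime hl).height = 0 := by
        by_contra h0
        have := Order.one_le_iff_pos.2 (pos_iff_ne_zero.2 h0)
        have h3 := (add_le_add_left this 1).trans h1
        norm_num at h3
      exact hbot (Ideal.height_eq_zero_iff_eq_bot.1 h2)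
    obtain ⟨n, hn⟩ := exists_chi_mul_mem_jacobianModule (facePoint_mem j l) (facetBasis_mul_self l)
      (fun l' hl' h0 i => by
        rw [facetForm_facePoint hl'] at h0
        exact h0 ▸ (facetForm_facetBasis l').1 i)
      (fun l' hl' h0 => by
        rw [facetForm_facePoint hl'] at h0
        exact h0 ▸ (facetForm_facetBasis l').2.le)
    refine ⟨⟨chi (n • facePoint j l), chi_mem_coneAlgebra.2
      ((coneAt j).nsmul_mem (facePoint_mem j l) n)⟩, fun h => ?_, hn⟩
    rw [← heq, mem_facetPrime] at h
    have := mem_of_chi_mem_suppIn h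
    rw [Set.mem_ofPred_eq, map_nsmul, (facetForm_facePoint hl).2 rfl, smul_zero] at this
    omega
  · push Not at hmon
    obtain ⟨n, hn⟩ := exists_chi_mul_mem_jacobianModule (interiorPoint_mem j) (V := 1)
      (mul_one 1) (fun l hl h0 => absurd h0 (facetForm_interiorPoint hl).ne')
      (fun l hl h0 => absurd h0 (facetForm_interiorPoint hl).ne')
    exact ⟨⟨chi (n • interiorPoint j), chi_mem_coneAlgebra.2
      ((coneAt j).nsmul_mem (interiorPoint_mem j) n)⟩, hmon _ ((coneAt j).nsmul_mem
      (interiorPoint_mem j) n), hn⟩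

/-- The ideal of a facet has height one: near a general point of the facet it is principal. -/
lemma height_facetPrime {j : Fin 14} {l : Fin 9} (hl : facetHeight l j = 0) :
    (facetPrime hl).height = 1 := by
  obtain ⟨i, hi⟩ : ∃ i, facetForm l (facetBasis l i) = 1 := by
    simp only [facetForm_apply]
    clear hl
    revert l
    decide
  set e := facetBasis l i
  have hface : ∀ l', facetHeight l' j = 0 → facetForm l' (facePoint j l) = 0 → l' = l :=
    fun l' hl' h0 => (facetForm_facePoint hl').1 h0
  have hw0 : facetForm l (facePoint j l) = 0 := (facetForm_facePoint hl).2 rfl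
  obtain ⟨n, -, hn⟩ := exists_nsmul_add_mem (facePoint_mem j l) {e} (by
    intro a ha l' hl' h0
    rw [Finset.mem_singleton.1 ha, hface l' hl' h0, hi]
    exact zero_le_one)
  have hne := hn e (Finset.mem_singleton_self _)
  let x : coneAlgebra j := ⟨chi (n • facePoint j l + e), chi_mem_coneAlgebra.2 hne⟩
  have hx : x ∈ facetPrime hl := mem_facetPrime.2 (chi_mem_suppIn (by
    rw [Set.mem_ofPred_eq, map_add, map_nsmul, hw0, smul_zero, zero_add, hi]))
  have hx0 : x ≠ 0 := fun h => chi_ne_zero _ (congrArg Subtype.val h)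
  have hmin : facetPrime hl ∈ (Ideal.span {x}).minimalPrimes := by
    refine ⟨⟨inferInstance, (Ideal.span_singleton_le_iff_mem _).2 hx⟩, ?_⟩
    rintro 𝔮 ⟨h𝔮, hx𝔮⟩ hle p hp
    have hp' := mem_facetPrime.1 hp
    -- A multiple of `p` by a monomial that does not vanish on the facet is divisible by `x`.
    obtain ⟨m, -, hm⟩ := exists_nsmul_add_mem (facePoint_mem j l)
      ((p : Laurent).coeff.support.image fun a => a - e - n • facePoint j l) (by
        intro a ha l' hl' h0
        obtain ⟨b, hb, rfl⟩ := Finset.mem_image.1 ha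
        have := hp' b (Finsupp.mem_support_iff.1 hb)
        rw [Set.mem_ofPred_eq] at this
        rw [hface l' hl' h0, map_sub, map_sub, hi, map_nsmul, hw0, smul_zero]
        omega)
    have hq : chi (m • facePoint j l - e - n • facePoint j l) * (p : Laurent) ∈ coneAlgebra j := by
      refine mul_mem_suppIn (s := {m • facePoint j l - e - n • facePoint j l})
        (t := (p : Laurent).coeff.support) ?_ (chi_mem_suppIn rfl)
        fun a ha => Finsupp.mem_support_iff.2 ha
      rintro _ rfl b hb
      have := hm _ (Finset.mem_image_of_mem _ hb)
      have e : m • facePoint j l - e - n • facePoint j l + b =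
        m • facePoint j l + (b - e - n • facePoint j l) := by abel
      rw [e]
      exact this
    have hprod : (⟨chi (m • facePoint j l), chi_mem_coneAlgebra.2
        ((coneAt j).nsmul_mem (facePoint_mem j l) m)⟩ : coneAlgebra j) * p = x * ⟨_, hq⟩ := by
      apply Subtype.val_injective
      change chi _ * (p : Laurent) = chi _ * (chi _ * (p : Laurent))
      rw [← mul_assoc, ← chi_add]
      congr 2
      abel
    have hmem : (⟨chi (m • facePoint j l), chi_mem_coneAlgebra.2
        ((coneAt j).nsmul_mem (facePoint_mem j l) m)⟩ : coneAlgebra j) * p ∈ 𝔮 := by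
      rw [hprod]
      exact Ideal.mul_mem_right _ _ (hx𝔮 (Ideal.mem_span_singleton_self x))
    refine (h𝔮.mem_or_mem hmem).resolve_left fun h => ?_
    have := mem_of_chi_mem_suppIn (mem_facetPrime.1 (hle h))
    rw [Set.mem_ofPred_eq, map_nsmul, hw0, smul_zero] at this
    omega
  refine le_antisymm (Ideal.height_le_one_of_isPrincipal_of_mem_minimalPrimes _ _ hmin) ?_
  rw [Order.one_le_iff_pos, pos_iff_ne_zero, Ne, Ideal.height_eq_zero_iff_eq_bot]
  intro h
  rw [h, Ideal.mem_bot] at hx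
  exact hx0 hx

/-- A Laurent polynomial that is a Jacobian up to factors outside each facet ideal satisfies the
facet conditions. -/
lemma mem_canonicalIdeal_of_forall {j : Fin 14} {h : Laurent}
    (hh : ∀ 𝔮 : Ideal (coneAlgebra j), 𝔮.IsPrime → 𝔮.height = 1 →
      ∃ s : coneAlgebra j, s ∉ 𝔮 ∧ (s : Laurent) * h ∈ jacobianModule j) :
    h ∈ canonicalIdeal j := by
  intro l hl
  by_cases h0 : h = 0
  · rw [h0]; exact zero_mem _
  obtain ⟨s, hs, hsh⟩ := hh (facetPrime hl) inferInstance (height_facetPrime hl)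
  obtain ⟨c, hc, hne⟩ := exists_facePart_ne_zero (facetForm l) h0
  have h1 := facePart_mul (mem_coneAlgebra_iff.1 s.2 l hl) hc
  have h2 : facePart (facetForm l) 0 (s : Laurent) ≠ 0 := hs
  have h3 := jacobianModule_le j hsh l hl
  rcases le_or_gt 1 c with hc1 | hc1
  · exact suppIn_mono (fun a (ha : c ≤ facetForm l a) => hc1.trans ha) hc
  · rw [facePart_eq_zero (suppIn_mono (fun a (ha : 1 ≤ facetForm l a) => by
      rw [Set.mem_ofPred_eq]; omega) h3)] at h1
    exact absurd h1.symm (mul_ne_zero h2 hne)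

end CanonicalIdeal

/-! ### The canonical sheaf of the toric fibre -/

section CanonicalModule

open KaehlerDifferential

variable (K : Type) [Field K] [Algebra ℂ K] [Algebra Laurent K] [IsScalarTower ℂ Laurent K]
  [IsFractionRing Laurent K]

/-- The coordinate ring of the `j`-th chart, as a subring of the function field. -/
def chartRing (j : Fin 14) : Subalgebra ℂ K :=
  (coneAlgebra j).map (IsScalarTower.toAlgHom ℂ Laurent K)

lemma laurent_injective : Function.Injective (algebraMap Laurent K) := IsFractionRing.injective _ _

/-- The coordinate ring of the `j`-th chart inside the function field is isomorphic to that inside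
the ring of Laurent polynomials. -/
def chartRingEquiv (j : Fin 14) : coneAlgebra j ≃ₐ[ℂ] chartRing K j :=
  (coneAlgebra j).equivMapOfInjective _ (laurent_injective K)

lemma coe_chartRingEquiv (j : Fin 14) (f : coneAlgebra j) :
    (chartRingEquiv K j f : K) = algebraMap Laurent K f := rfl

/-- The forms generated by the differentials of regular functions, in terms of coefficients. -/
lemma mem_span_ιMulti_iff (j : Fin 14) (θ : ⋀[K]^5 (Ω[K⁄ℂ])) :
    θ ∈ Submodule.span (chartRing K j) (Set.range fun f : Fin 5 → chartRing K j =>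
      exteriorPower.ιMulti K 5 fun k => D ℂ K (f k : K)) ↔
    ∃ g ∈ jacobianModule j, formCoeff K θ = algebraMap Laurent K g := by
  constructor
  · intro h
    induction h using Submodule.span_induction with
    | mem θ hθ =>
      obtain ⟨f, rfl⟩ := hθ
      obtain ⟨g, rfl⟩ : ∃ g : Fin 5 → coneAlgebra j, f = fun i => chartRingEquiv K j (g i) :=
        ⟨fun i => (chartRingEquiv K j).symm (f i),
          funext fun i => ((chartRingEquiv K j).apply_symm_apply (f i)).symm⟩
      exact ⟨_, Submodule.subset_span ⟨g, rfl⟩, formCoeff_ιMulti_D K fun i => (g i : Laurent)⟩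
    | zero => exact ⟨0, zero_mem _, by simp⟩
    | add θ θ' _ _ h h' =>
      obtain ⟨g, hg, e⟩ := h
      obtain ⟨g', hg', e'⟩ := h'
      exact ⟨g + g', add_mem hg hg', by rw [map_add, map_add, e, e']⟩
    | smul s θ _ h =>
      obtain ⟨g, hg, e⟩ := h
      refine ⟨(chartRingEquiv K j).symm s • g, Submodule.smul_mem _ _ hg, ?_⟩
      change formCoeff K ((s : K) • θ) = algebraMap Laurent K (_ * g)
      rw [map_smul, e, map_mul, ← coe_chartRingEquiv, AlgEquiv.apply_symm_apply, smul_eq_mul]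
  · rintro ⟨g, hg, e⟩
    obtain ⟨θ', hθ', e'⟩ : ∃ θ' ∈ Submodule.span (chartRing K j)
        (Set.range fun f : Fin 5 → chartRing K j => exteriorPower.ιMulti K 5 fun k =>
          D ℂ K (f k : K)), formCoeff K θ' = algebraMap Laurent K g := by
      clear e
      induction hg using Submodule.span_induction with
      | mem g hg =>
        obtain ⟨f, rfl⟩ := hg
        exact ⟨_, Submodule.subset_span ⟨fun i => chartRingEquiv K j (f i), rfl⟩,
          formCoeff_ιMulti_D K fun i => f i⟩
      | zero => exact ⟨0, zero_mem _, by simp⟩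
      | add g g' _ _ h h' =>
        obtain ⟨θ, hθ, e⟩ := h
        obtain ⟨θ', hθ', e'⟩ := h'
        exact ⟨θ + θ', add_mem hθ hθ', by rw [map_add, map_add, e, e']⟩
      | smul s g _ h =>
        obtain ⟨θ, hθ, e⟩ := h
        refine ⟨chartRingEquiv K j s • θ, Submodule.smul_mem _ _ hθ, ?_⟩
        change formCoeff K ((chartRingEquiv K j s : K) • θ) = algebraMap Laurent K ((s : Laurent) * g)
        rw [map_smul, e, map_mul, coe_chartRingEquiv, smul_eq_mul]
    rwa [formCoeff_injective K (e.trans e'.symm)]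

lemma mem_canonicalModule_iff_forall (j : Fin 14) (η : ⋀[K]^5 (Ω[K⁄ℂ])) :
    η ∈ canonicalModule 5 (chartRing K j) ↔ ∀ 𝔮 : Ideal (coneAlgebra j), 𝔮.IsPrime →
      𝔮.height = 1 → ∃ s : coneAlgebra j, s ∉ 𝔮 ∧ ∃ g ∈ jacobianModule j,
        algebraMap Laurent K s * formCoeff K η = algebraMap Laurent K g := by
  let e := (chartRingEquiv K j).toRingEquiv
  constructor
  · intro h 𝔮 h𝔮 hht
    obtain ⟨s, hs, hsη⟩ := h (𝔮.comap e.symm) inferInstance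
      (by rw [RingEquiv.height_comap]; exact hht)
    obtain ⟨g, hg, hgs⟩ := (mem_span_ιMulti_iff K j _).1 hsη
    refine ⟨e.symm s, hs, g, hg, ?_⟩
    rw [← hgs]
    change _ = formCoeff K ((s : K) • η)
    rw [map_smul, smul_eq_mul, ← coe_chartRingEquiv]
    congr 2
    exact e.apply_symm_apply s
  · intro h 𝔭 h𝔭 hht
    obtain ⟨s, hs, g, hg, hgs⟩ := h (𝔭.comap e) inferInstance
      (by rw [RingEquiv.height_comap]; exact hht)
    refine ⟨e s, hs, (mem_span_ιMulti_iff K j _).2 ⟨g, hg, ?_⟩⟩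
    change formCoeff K ((chartRingEquiv K j s : K) • η) = _
    rw [map_smul, smul_eq_mul, coe_chartRingEquiv, hgs]

/-- A `5`-form that is regular in codimension one on a chart is regular on the torus: no prime of
the factorial ring of Laurent polynomials divides the denominator of its coefficient. -/
lemma exists_formCoeff_eq (j : Fin 14) {c : K} (hc : ∀ 𝔮 : Ideal (coneAlgebra j), 𝔮.IsPrime →
      𝔮.height = 1 → ∃ s : coneAlgebra j, s ∉ 𝔮 ∧ ∃ g ∈ jacobianModule j,
        algebraMap Laurent K s * c = algebraMap Laurent K g) :
    ∃ h : Laurent, c = algebraMap Laurent K h := by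
  obtain ⟨p, q, hpq, rfl⟩ := IsFractionRing.exists_reduced_fraction (A := Laurent) c
  by_cases hq : IsUnit (q : Laurent)
  · obtain ⟨u, hu⟩ := hq
    refine ⟨p * (u⁻¹ : Laurentˣ), ?_⟩
    rw [IsLocalization.mk'_eq_iff_eq_mul, ← map_mul, ← hu, mul_assoc, Units.inv_mul, mul_one]
  exfalso
  obtain ⟨π, hπ, hπq⟩ := WfDvdMonoid.exists_irreducible_factor hq (nonZeroDivisors.ne_zero q.2)
  have hprime : Prime π := hπ.prime
  have hP : (Ideal.span {π} : Ideal Laurent).IsPrime :=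
    (Ideal.span_singleton_prime hprime.ne_zero).2 hprime
  have hht : (Ideal.span {π} : Ideal Laurent).height = 1 := by
    refine le_antisymm (Ideal.height_le_one_of_isPrincipal_of_mem_minimalPrimes (Ideal.span {π}) _
      ?_) ?_
    · rw [Ideal.minimalPrimes_eq_subsingleton_self]
      rfl
    · rw [Order.one_le_iff_pos, pos_iff_ne_zero, Ne, Ideal.height_eq_zero_iff_eq_bot]
      simpa using hprime.ne_zero
  have hht' := IsLocalization.height_under (Submonoid.powers (⟨chi (interiorPoint j),
    chi_mem_coneAlgebra.2 (interiorPoint_mem j)⟩ : coneAlgebra j)) (Ideal.span {π} : Ideal Laurent)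
  obtain ⟨s, hs, g, -, hg⟩ := hc ((Ideal.span {π} : Ideal Laurent).under (coneAlgebra j))
    inferInstance (hht'.trans hht)
  have h1 : (s : Laurent) * p = g * q := by
    apply laurent_injective K
    rw [map_mul, map_mul, ← hg, mul_assoc, IsLocalization.mk'_spec]
  have h2 : π ∣ s * p := h1 ▸ (hπq.mul_left g)
  rcases hprime.dvd_or_dvd h2 with h | h
  · exact hs (Ideal.mem_span_singleton.2 h)
  · exact hπ.not_isUnit (hpq h hπq)

/-- The canonical module of the `j`-th chart, in terms of coefficients. -/
theorem mem_canonicalModule_iff (j : Fin 14) (η : ⋀[K]^5 (Ω[K⁄ℂ])) :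
    η ∈ canonicalModule 5 (chartRing K j) ↔
      ∃ h ∈ canonicalIdeal j, formCoeff K η = algebraMap Laurent K h := by
  rw [mem_canonicalModule_iff_forall]
  constructor
  · intro h
    obtain ⟨f, hf⟩ := exists_formCoeff_eq K j h
    refine ⟨f, mem_canonicalIdeal_of_forall fun 𝔮 h𝔮 hht => ?_, hf⟩
    obtain ⟨s, hs, g, hg, hgs⟩ := h 𝔮 h𝔮 hht
    refine ⟨s, hs, ?_⟩
    rw [hf, ← map_mul] at hgs
    rwa [laurent_injective K hgs]
  · rintro ⟨f, hf, hfη⟩ 𝔮 h𝔮 hht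
    obtain ⟨s, hs, hsm⟩ := exists_smul_mem_jacobianModule h𝔮 hht
    refine ⟨s, hs, _, Submodule.smul_mem _ ⟨_, mem_canonicalIdeal_iff.1 hf⟩ hsm, ?_⟩
    rw [hfη, ← map_mul]
    congr 1
    change _ = (chi (-canonicalExp j) * f) * (s * chi (canonicalExp j))
    have : chi (-canonicalExp j) * chi (canonicalExp j) = 1 := by
      rw [← chi_add, neg_add_cancel, chi_zero]
    linear_combination -(s : Laurent) * f * this

lemma invertible_of_eq_span {K V : Type} [Field K] [Algebra ℂ K] [AddCommGroup V] [Module K V]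
    (A : Subalgebra ℂ K) {θ : V} (hθ : θ ≠ 0) {M : Submodule A V}
    (hM : M = Submodule.span A {θ}) : Module.Invertible A M := by
  subst hM
  have : Module.IsTorsionFree A V := Module.IsTorsionFree.of_smul_eq_zero fun a v h => by
    have h' : (a : K) • v = 0 := h
    rcases smul_eq_zero.1 h' with h | h
    · exact Or.inl (Subtype.ext h)
    · exact Or.inr h
  exact Module.Invertible.congr (LinearEquiv.toSpanNonzeroSingleton _ _ _ hθ)

/-- The rational `5`-form `dx ∧ dy ∧ dz ∧ dt ∧ dv`. -/
def volumeForm : ⋀[K]^5 (Ω[K⁄ℂ]) := algebraMap Laurent K (chi fun _ => 1) • invariantForm K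

theorem canonicalModule_chartRing (j : Fin 14) : canonicalModule 5 (chartRing K j) =
    Submodule.span (chartRing K j)
      {(algebraMap Laurent K (chi (character j)) ^ 3)⁻¹ • volumeForm K} := by
  have hgen : formCoeff K ((algebraMap Laurent K (chi (character j)) ^ 3)⁻¹ • volumeForm K) =
      algebraMap Laurent K (chi (canonicalExp j)) := by
    rw [volumeForm, map_smul, map_smul, formCoeff_invariantForm, smul_eq_mul, smul_eq_mul, mul_one,
      inv_mul_eq_iff_eq_mul₀ (pow_ne_zero _ (algebraMap_chi_ne_zero K _)), ← map_pow, ← map_mul,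
      ← chi_nsmul, ← chi_add, canonicalExp, add_sub_cancel]
  ext η
  rw [mem_canonicalModule_iff, Submodule.mem_span_singleton]
  constructor
  · rintro ⟨f, hf, hfη⟩
    refine ⟨chartRingEquiv K j ⟨_, mem_canonicalIdeal_iff.1 hf⟩, formCoeff_injective K ?_⟩
    change formCoeff K ((chartRingEquiv K j _ : K) • _) = _
    rw [map_smul, hgen, coe_chartRingEquiv, hfη, smul_eq_mul, ← map_mul]
    congr 1
    change (chi (-canonicalExp j) * f) * chi (canonicalExp j) = f
    have : chi (-canonicalExp j) * chi (canonicalExp j) = 1 := by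
      rw [← chi_add, neg_add_cancel, chi_zero]
    linear_combination f * this
  · rintro ⟨s, rfl⟩
    refine ⟨((chartRingEquiv K j).symm s : Laurent) * chi (canonicalExp j), ?_, ?_⟩
    · rw [mem_canonicalIdeal_iff, mul_left_comm, ← chi_add, neg_add_cancel, chi_zero, mul_one]
      exact ((chartRingEquiv K j).symm s).2
    · change formCoeff K ((s : K) • _) = _
      rw [map_smul, hgen, map_mul, ← coe_chartRingEquiv, AlgEquiv.apply_symm_apply, smul_eq_mul]

lemma volumeForm_ne_zero : volumeForm K ≠ 0 := by
  intro h
  have := congrArg (formCoeff K) h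
  rw [volumeForm, map_smul, formCoeff_invariantForm, map_zero, smul_eq_mul, mul_one] at this
  exact algebraMap_chi_ne_zero K _ this

end CanonicalModule

section ToricField

open MvPolynomial

/-- The function field, as the fraction field of the chart `u ^ 2 ≠ 0`. -/
abbrev ToricField : Type := FractionRing (Chart toricIdeal 11)

/-- Laurent polynomials as rational functions. -/
def laurentToField : Laurent →ₐ[ℂ] ToricField :=
  IsLocalization.liftAlgHom (M := Submonoid.powers (⟨chi (interiorPoint 11),
    chi_mem_coneAlgebra.2 (interiorPoint_mem 11)⟩ : coneAlgebra 11))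
    (f := (Algebra.ofId (Chart toricIdeal 11) ToricField |>.restrictScalars ℂ).comp
      (chartEquiv 11).symm.toAlgHom) (by
    rintro ⟨_, n, rfl⟩
    rw [map_pow]
    refine IsUnit.pow _ (isUnit_iff_ne_zero.2 fun h => ?_)
    have h1 : algebraMap (Chart toricIdeal 11) ToricField ((chartEquiv 11).symm
      ⟨chi (interiorPoint 11), chi_mem_coneAlgebra.2 (interiorPoint_mem 11)⟩) = 0 := h
    rw [map_eq_zero_iff _ (IsFractionRing.injective _ _), map_eq_zero_iff _ (chartEquiv 11).symm.injective] at h1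
    exact chi_ne_zero _ (congrArg Subtype.val h1))

lemma laurentToField_coe (f : coneAlgebra 11) : laurentToField f =
    algebraMap (Chart toricIdeal 11) ToricField ((chartEquiv 11).symm f) := by
  exact IsLocalization.lift_eq _ f

instance algebraLaurentField : Algebra Laurent ToricField := laurentToField.toRingHom.toAlgebra

instance isScalarTowerLaurentField : IsScalarTower ℂ Laurent ToricField :=
  IsScalarTower.of_algebraMap_eq fun c => (laurentToField.commutes c).symm

instance isFractionRingLaurentField : IsFractionRing Laurent ToricField := by
  letI : Algebra (Chart toricIdeal 11) Laurent :=
    ((coneAlgebra 11).val.toRingHom.comp (chartEquiv 11).toRingEquiv.toRingHom).toAlgebra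
  have hmap : ∀ f : Chart toricIdeal 11, algebraMap (Chart toricIdeal 11) Laurent f =
    (chartEquiv 11 f : Laurent) := fun _ => rfl
  have : IsScalarTower (Chart toricIdeal 11) Laurent ToricField := by
    refine IsScalarTower.of_algebraMap_eq fun f => ?_
    rw [hmap]
    change _ = laurentToField _
    rw [laurentToField_coe, AlgEquiv.symm_apply_apply]
  have : IsLocalization (Submonoid.powers ((chartEquiv 11).symm ⟨chi (interiorPoint 11),
      chi_mem_coneAlgebra.2 (interiorPoint_mem 11)⟩)) Laurent := by
    have := IsLocalization.isLocalization_of_base_ringEquiv (Submonoid.powers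
      (⟨chi (interiorPoint 11), chi_mem_coneAlgebra.2 (interiorPoint_mem 11)⟩ : coneAlgebra 11))
      Laurent (chartEquiv 11).symm.toRingEquiv
    rw [Submonoid.map_powers] at this
    exact this
  exact IsFractionRing.isFractionRing_of_isDomain_of_isLocalization (Submonoid.powers
    ((chartEquiv 11).symm ⟨chi (interiorPoint 11), chi_mem_coneAlgebra.2 (interiorPoint_mem 11)⟩))
    Laurent ToricField

lemma ratCoord_toricIdeal (k : Fin 14) :
    ratCoord toricIdeal 11 k = algebraMap Laurent ToricField (chi (character k)) := by
  have h : (chartEquiv 11 (Ideal.Quotient.mk _ (X k)) : Laurent) = chi (character k) := by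
    rw [chartEquiv_mk, chartHom_X]
    congr 1
    have : character 11 = 0 := by decide
    rw [this, sub_zero]
  rw [← h]
  change _ = laurentToField _
  rw [laurentToField_coe, AlgEquiv.symm_apply_apply]
  rfl

lemma chartSubalgebra_toricIdeal (j : Fin 14) :
    chartSubalgebra toricIdeal 11 j = chartRing ToricField j := by
  rw [chartRing, coneAlgebra_eq_adjoin, AlgHom.map_adjoin, ← Set.range_comp, chartSubalgebra]
  congr 2
  funext k
  rw [ratCoord_toricIdeal, ratCoord_toricIdeal, div_eq_iff (algebraMap_chi_ne_zero _ _)]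
  change _ = algebraMap Laurent ToricField _ * _
  rw [← map_mul, ← chi_add, sub_add_cancel]

lemma canonicalModule_eq_span (j : Fin 14) (A : Subalgebra ℂ ToricField)
    (h : A = chartRing ToricField j) : canonicalModule 5 A =
      Submodule.span A {((ratCoord toricIdeal 11 j) ^ 3)⁻¹ • volumeForm ToricField} := by
  subst h
  have h := canonicalModule_chartRing ToricField j
  have h2 := congrArg (fun a : ToricField =>
    Submodule.span (chartRing ToricField j) {(a ^ 3)⁻¹ • volumeForm ToricField})
    (ratCoord_toricIdeal j)
  exact h.trans h2.symm

theorem isFanoVariety_toricIdeal : IsFanoVariety toricIdeal 5 :=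
  ⟨3, by norm_num, 11, isDomain_chart 11, volumeForm ToricField, volumeForm_ne_zero _,
    fun j _ => canonicalModule_eq_span j _ (chartSubalgebra_toricIdeal j)⟩

theorem canonicalSheafInvertible_toricIdeal : CanonicalSheafInvertible toricIdeal 5 := by
  refine ⟨11, isDomain_chart 11, fun j _ => ?_⟩
  have h := canonicalModule_eq_span j _ (chartSubalgebra_toricIdeal j)
  have h0 : ratCoord toricIdeal 11 j ≠ 0 := ratCoord_toricIdeal j ▸ algebraMap_chi_ne_zero _ _
  exact invertible_of_eq_span _
    (smul_ne_zero (inv_ne_zero (pow_ne_zero 3 h0)) (volumeForm_ne_zero ToricField)) h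

end ToricField

/-! ### Local rings of dimension five -/

section LocalRings

open MvPolynomial RingTheory.Sequence

lemma isWeaklyRegular_X (n : ℕ) :
    IsWeaklyRegular (MvPolynomial (Fin n) ℂ) (List.ofFn fun i : Fin n => (X i : MvPolynomial (Fin n) ℂ)) := by
  rw [isWeaklyRegular_iff_Fin]
  rintro ⟨k, hk⟩
  rw [List.length_ofFn] at hk
  have hideal : (Ideal.ofList ((List.ofFn fun i : Fin n => (X i : MvPolynomial (Fin n) ℂ)).take k) •
      ⊤ : Submodule (MvPolynomial (Fin n) ℂ) (MvPolynomial (Fin n) ℂ)) =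
      Ideal.span (X '' {i : Fin n | (i : ℕ) < k}) := by
    rw [smul_eq_mul, Ideal.mul_top, Ideal.ofList]
    congr 1
    ext f
    simp only [List.mem_take_iff_getElem, List.getElem_ofFn, List.length_ofFn]
    constructor
    · rintro ⟨i, hi, rfl⟩
      exact ⟨⟨i, by omega⟩, show i < k by omega, rfl⟩
    · rintro ⟨i, hi, rfl⟩
      exact ⟨i, lt_min hi i.2, rfl⟩
  have hget : (List.ofFn fun i : Fin n => (X i : MvPolynomial (Fin n) ℂ))[k]'(by simpa) =
    X ⟨k, hk⟩ := by simp
  rw [hideal]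
  refine hget.symm ▸ ?_
  intro a b hab
  obtain ⟨a, rfl⟩ := Ideal.Quotient.mk_surjective a
  obtain ⟨b, rfl⟩ := Ideal.Quotient.mk_surjective b
  have h1 : Ideal.Quotient.mk (Ideal.span (X '' {i : Fin n | (i : ℕ) < k})) (X ⟨k, hk⟩ * a) =
    Ideal.Quotient.mk _ (X ⟨k, hk⟩ * b) := hab
  rw [Ideal.Quotient.eq, ← mul_sub, mem_ideal_span_X_image] at h1
  rw [Ideal.Quotient.eq, mem_ideal_span_X_image]
  intro m hm
  obtain ⟨i, hi, him⟩ := h1 (m + Finsupp.single ⟨k, hk⟩ 1) (by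
    rw [mem_support_iff, mul_comm, coeff_mul_X]
    exact mem_support_iff.1 hm)
  refine ⟨i, hi, ?_⟩
  have : (⟨k, hk⟩ : Fin n) ≠ i := by
    rintro rfl
    exact lt_irrefl k hi
  rwa [Finsupp.add_apply, Finsupp.single_eq_of_ne' this, add_zero] at him

/-- A local ring of dimension at most `n` that is flat over the polynomial ring in `n` variables,
the variables going to the maximal ideal, is Cohen-Macaulay of dimension `n`. -/
theorem isCohenMacaulayLocal_of_flat {R : Type} [CommRing R] [IsLocalRing R] [IsNoetherianRing R]
    {n : ℕ} (hdim : ringKrullDim R ≤ n) {φ : MvPolynomial (Fin n) ℂ →+* R} (hφ : φ.Flat)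
    (hmem : ∀ i, φ (X i) ∈ IsLocalRing.maximalIdeal R) :
    IsCohenMacaulayLocal R ∧ ringKrullDim R = n := by
  algebraize [φ]
  have hreg : IsWeaklyRegular R ((List.ofFn fun i : Fin n => (X i : MvPolynomial (Fin n) ℂ)).map φ) :=
    (isWeaklyRegular_X n).of_flat
  have hmem' : ∀ r ∈ (List.ofFn fun i : Fin n => (X i : MvPolynomial (Fin n) ℂ)).map φ,
      r ∈ IsLocalRing.maximalIdeal R := by
    simpa [List.mem_ofFn] using hmem
  have hreg' := IsRegular.of_isWeaklyRegular_of_mem_maximalIdeal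
    R hmem' hreg
  have hd := ringKrullDim_add_length_eq_ringKrullDim_of_isRegular _ hreg'
  have hnt : Nontrivial (R ⧸ Ideal.ofList
      ((List.ofFn fun i : Fin n => (X i : MvPolynomial (Fin n) ℂ)).map φ)) := by
    refine Ideal.Quotient.nontrivial_iff.2 (ne_top_of_le_ne_top (Ideal.IsPrime.ne_top
      (IsLocalRing.maximalIdeal.isMaximal R).isPrime) (Ideal.span_le.2 hmem'))
  have hlen : (((List.ofFn fun i : Fin n => (X i : MvPolynomial (Fin n) ℂ)).map φ).length :
      WithBot ℕ∞) = n := by simp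
  have hd' : ringKrullDim R = n := by
    refine le_antisymm hdim ?_
    rw [← hd, hlen]
    exact le_add_of_nonneg_left ringKrullDim_nonneg_of_nontrivial
  exact ⟨⟨inferInstance, _, hmem', hreg', hlen.trans hd'.symm⟩, hd'⟩

/-- Via `g`, the local ring `R` is the localization of its subring `N` at the kernel of the
`ℂ`-point `c` of `N`. -/
structure IsLocalModel {N R : Type} [CommRing N] [Algebra ℂ N] [CommRing R] [Algebra ℂ R]
    [IsLocalRing R] (g : N →ₐ[ℂ] R) (c : N →ₐ[ℂ] ℂ) : Prop where
  injective : Function.Injective g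
  isUnit : ∀ a, c a ≠ 0 → IsUnit (g a)
  mem_maximalIdeal : ∀ a, c a = 0 → g a ∈ IsLocalRing.maximalIdeal R
  surj : ∀ r, ∃ a b, c b ≠ 0 ∧ r * g b = g a

namespace IsLocalModel

variable {N R : Type} [CommRing N] [Algebra ℂ N] [CommRing R] [Algebra ℂ R]
  [IsLocalRing R] {g : N →ₐ[ℂ] R} {c : N →ₐ[ℂ] ℂ}

lemma isLocalization (h : IsLocalModel g c) :
    @IsLocalization.AtPrime N _ R _ g.toRingHom.toAlgebra (RingHom.ker c.toRingHom)
      (RingHom.ker_isPrime _) := by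
  letI := g.toRingHom.toAlgebra
  haveI : (RingHom.ker c.toRingHom).IsPrime := RingHom.ker_isPrime _
  refine ⟨⟨fun a => h.isUnit a a.2, fun r => ?_, fun {a b} hab => ⟨1, ?_⟩⟩⟩
  · obtain ⟨a, b, hb, e⟩ := h.surj r
    exact ⟨(a, ⟨b, hb⟩), e⟩
  · rw [h.injective hab]

lemma map_ker (h : IsLocalModel g c) :
    (RingHom.ker c.toRingHom).map g.toRingHom = IsLocalRing.maximalIdeal R := by
  letI := g.toRingHom.toAlgebra
  haveI : (RingHom.ker c.toRingHom).IsPrime := RingHom.ker_isPrime _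
  haveI := h.isLocalization
  exact IsLocalization.AtPrime.map_eq_maximalIdeal (RingHom.ker c.toRingHom) R

lemma flat (h : IsLocalModel g c) : g.toRingHom.Flat := by
  letI := g.toRingHom.toAlgebra
  haveI : (RingHom.ker c.toRingHom).IsPrime := RingHom.ker_isPrime _
  haveI := h.isLocalization
  exact IsLocalization.flat R (RingHom.ker c.toRingHom).primeCompl

/-- The translation by `c` of affine space, on polynomials. -/
def _root_.MvPolynomial.translate {n : ℕ} (c : Fin n → ℂ) :
    MvPolynomial (Fin n) ℂ ≃ₐ[ℂ] MvPolynomial (Fin n) ℂ :=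
  AlgEquiv.ofAlgHom (aeval fun i => X i + C (c i)) (aeval fun i => X i - C (c i))
    (by ext i; simp [← algebraMap_eq]) (by ext i; simp [← algebraMap_eq])

theorem isCohenMacaulayLocal [IsNoetherianRing R] (h : IsLocalModel g c) {n : ℕ}
    (hdim : ringKrullDim R ≤ n) {ψ : MvPolynomial (Fin n) ℂ →ₐ[ℂ] N} (hψ : ψ.toRingHom.Flat) :
    IsCohenMacaulayLocal R ∧ ringKrullDim R = n := by
  have hflat := ((RingHom.Flat.of_bijective (MvPolynomial.translate fun i =>
    -c (ψ (X i))).toRingEquiv.bijective).comp hψ).comp h.flat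
  refine isCohenMacaulayLocal_of_flat hdim hflat fun i => ?_
  refine h.mem_maximalIdeal _ ?_
  change c (ψ (aeval _ (X i))) = 0
  rw [aeval_X, map_add, map_add, ← algebraMap_eq, AlgHom.commutes, AlgHom.commutes]
  simp

/-- The maximal ideal is generated by the translates to the origin of generators of the model. -/
lemma maximalIdeal_eq_span (h : IsLocalModel g c) {n : ℕ} {x : Fin n → N}
    (hx : Algebra.adjoin ℂ (Set.range x) = ⊤) : IsLocalRing.maximalIdeal R =
      Ideal.span (Set.range fun l => g (x l) - algebraMap ℂ R (c (x l))) := by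
  refine le_antisymm ?_ (Ideal.span_le.2 ?_)
  · rw [← h.map_ker, Ideal.map_le_iff_le_comap]
    intro a ha
    have hind : ∀ a : N, g a - algebraMap ℂ R (c a) ∈
        Ideal.span (Set.range fun l => g (x l) - algebraMap ℂ R (c (x l))) := by
      intro a
      have haa : a ∈ Algebra.adjoin ℂ (Set.range x) := hx ▸ Algebra.mem_top
      induction haa using Algebra.adjoin_induction with
      | mem a ha =>
        obtain ⟨l, rfl⟩ := ha
        exact Ideal.subset_span ⟨l, rfl⟩
      | algebraMap r => simp
      | add a b _ _ ha hb =>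
        rw [map_add, map_add, map_add, add_sub_add_comm]
        exact add_mem ha hb
      | mul a b _ _ ha hb =>
        have : g (a * b) - algebraMap ℂ R (c (a * b)) = g a * (g b - algebraMap ℂ R (c b)) +
            algebraMap ℂ R (c b) * (g a - algebraMap ℂ R (c a)) := by
          rw [map_mul, map_mul, map_mul]; ring
        rw [this]
        exact add_mem (Ideal.mul_mem_left _ _ hb) (Ideal.mul_mem_left _ _ ha)
    have h0 : c a = 0 := ha
    have := hind a
    rw [h0, map_zero, sub_zero] at this
    exact this
  · rintro _ ⟨l, rfl⟩
    have := h.mem_maximalIdeal (x l - algebraMap ℂ N (c (x l))) (by simp)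
    rwa [map_sub, AlgHom.commutes] at this

/-- A local model with a homomorphism onto the ring of first order deformations of a point in more
than `dim R` independent directions is not regular. -/
theorem not_isRegularLocalRing (h : IsLocalModel g c) {d n : ℕ} (hdim : ringKrullDim R ≤ d)
    (hdn : d < n) (τ : N →ₐ[ℂ] TrivSqZeroExt ℂ (Fin n → ℂ)) (hτ : ∀ a, (τ a).fst = c a)
    (hτ' : ∀ l, ∃ a, τ a = TrivSqZeroExt.inr (Pi.single l 1)) : ¬ IsRegularLocalRing R := by
  intro hR
  letI := g.toRingHom.toAlgebra
  haveI : (RingHom.ker c.toRingHom).IsPrime := RingHom.ker_isPrime _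
  haveI := h.isLocalization
  let σ : R →+* TrivSqZeroExt ℂ (Fin n → ℂ) :=
    IsLocalization.lift (M := (RingHom.ker c.toRingHom).primeCompl) (g := τ.toRingHom) (by
      rintro ⟨a, ha⟩
      rw [TrivSqZeroExt.isUnit_iff_isUnit_fst, isUnit_iff_ne_zero]
      change (τ a).fst ≠ 0
      rw [hτ]
      exact ha)
  have hσ : ∀ a, σ (g a) = τ a := fun a => IsLocalization.lift_eq _ a
  have hσm : ∀ r ∈ IsLocalRing.maximalIdeal R, (σ r).fst = 0 := by
    intro r hr
    by_contra hne
    obtain ⟨a, b, hb, e⟩ := h.surj r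
    have h1 : (σ r).fst * c b = c a := by
      rw [← hτ, ← hτ, ← hσ, ← hσ, ← e, map_mul, TrivSqZeroExt.fst_mul]
    have h2 : IsUnit (r * g b) := e ▸ h.isUnit a (h1 ▸ mul_ne_zero hne hb)
    exact (IsLocalRing.mem_maximalIdeal r).1 hr (isUnit_of_mul_isUnit_left h2)
  obtain ⟨s, hs, hspan⟩ := (IsNoetherian.noetherian
    (IsLocalRing.maximalIdeal R)).exists_span_finset_card_eq_spanFinrank
  have hs' : s.card ≤ d := by
    have h1 := hR.spanFinrank_maximalIdeal
    rw [← hs] at h1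
    exact_mod_cast h1.le.trans hdim
  have htop : Submodule.span ℂ ((s.image fun r => (σ r).snd : Finset (Fin n → ℂ)) :
      Set (Fin n → ℂ)) = ⊤ := by
    have hmem : ∀ r ∈ IsLocalRing.maximalIdeal R, (σ r).snd ∈ Submodule.span ℂ
        ((s.image fun r => (σ r).snd : Finset (Fin n → ℂ)) : Set (Fin n → ℂ)) := by
      intro r hr
      have hr' := hr
      rw [← hspan] at hr'
      induction hr' using Submodule.span_induction with
      | mem r hrs =>
        exact Submodule.subset_span (Finset.mem_coe.2 (Finset.mem_image_of_mem _ hrs))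
      | zero => simp
      | add a b ha hb iha ihb =>
        rw [map_add, TrivSqZeroExt.snd_add]
        rw [hspan] at ha hb
        exact add_mem (iha ha) (ihb hb)
      | smul a b hb ih =>
        rw [hspan] at hb
        rw [smul_eq_mul, map_mul, TrivSqZeroExt.snd_mul, hσm b hb]
        simpa using Submodule.smul_mem _ _ (ih hb)
    rw [eq_top_iff, ← (Pi.basisFun ℂ (Fin n)).span_eq, Submodule.span_le]
    rintro _ ⟨l, rfl⟩
    obtain ⟨a, ha⟩ := hτ' l
    have h1 := hmem (g a) (h.mem_maximalIdeal a (by rw [← hτ, ha, TrivSqZeroExt.fst_inr]))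
    rw [hσ, ha, TrivSqZeroExt.snd_inr] at h1
    simpa using h1
  have h1 := finrank_span_finset_le_card (R := ℂ) (s.image fun r => (σ r).snd)
  rw [Set.finrank, htop, finrank_top, Module.finrank_fin_fun] at h1
  have h2 := Finset.card_image_le (s := s) (f := fun r => (σ r).snd)
  omega

end IsLocalModel

lemma isRegularLocalRing_of_span {R : Type} [CommRing R] [IsLocalRing R] [IsNoetherianRing R]
    {n : ℕ} (hdim : ringKrullDim R = n) {y : Fin n → R}
    (hy : IsLocalRing.maximalIdeal R = Ideal.span (Set.range y)) : IsRegularLocalRing R := by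
  refine IsRegularLocalRing.of_spanFinrank_maximalIdeal_le R ?_
  rw [hdim, hy]
  have h1 := Submodule.spanFinrank_span_le_ncard_of_finite (R := R) (Set.finite_range y)
  have h2 : (Set.range y).ncard ≤ n := by
    rw [← Set.image_univ]
    refine (Set.ncard_image_le).trans ?_
    simp [Set.ncard_univ]
  exact_mod_cast h1.trans h2

end LocalRings

/-! ### Completions -/

section Completion

open MvPolynomial

/-- A homomorphism to a complete ring inducing isomorphisms modulo all powers of two ideals
identifies that ring with the completion of the source. -/
theorem nonempty_adicCompletion_algEquiv {R E : Type} [CommRing R] [Algebra ℂ R] [CommRing E]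
    [Algebra ℂ E] {J : Ideal R} {I : Ideal E} [IsAdicComplete I E] (f : R →ₐ[ℂ] E)
    (hJ : ∀ n, ∀ r, r ∈ J ^ n ↔ f r ∈ I ^ n) (hsurj : ∀ n e, ∃ r, f r - e ∈ I ^ n) :
    Nonempty (AdicCompletion J R ≃ₐ[ℂ] E) := by
  have hle : ∀ n, J ^ n ≤ (I ^ n).comap f := fun n r hr => (hJ n r).1 hr
  let fn : ∀ n, R ⧸ J ^ n →ₐ[ℂ] E ⧸ I ^ n := fun n => Ideal.quotientMapₐ (I ^ n) f (hle n)
  have hfn : ∀ n r, fn n (Ideal.Quotient.mk _ r) = Ideal.Quotient.mk _ (f r) := fun n r => rfl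
  have hbij : ∀ n, Function.Bijective (fn n) := by
    intro n
    constructor
    · rw [injective_iff_map_eq_zero]
      intro x hx
      obtain ⟨r, rfl⟩ := Ideal.Quotient.mk_surjective x
      rw [hfn, Ideal.Quotient.eq_zero_iff_mem] at hx
      exact Ideal.Quotient.eq_zero_iff_mem.2 ((hJ n r).2 hx)
    · intro y
      obtain ⟨e, rfl⟩ := Ideal.Quotient.mk_surjective y
      obtain ⟨r, hr⟩ := hsurj n e
      exact ⟨Ideal.Quotient.mk _ r, (hfn n r).trans (Ideal.Quotient.eq.2 hr)⟩
  let gn : ∀ n, E →ₐ[ℂ] R ⧸ J ^ n := fun n =>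
    (AlgEquiv.ofBijective (fn n) (hbij n)).symm.toAlgHom.comp (Ideal.Quotient.mkₐ ℂ (I ^ n))
  have hgn : ∀ n e, fn n (gn n e) = Ideal.Quotient.mk _ e := fun n e =>
    (AlgEquiv.ofBijective (fn n) (hbij n)).apply_symm_apply _
  have hcompat : ∀ {m n : ℕ} (hmn : m ≤ n),
      (Ideal.Quotient.factorₐ ℂ (Ideal.pow_le_pow_right hmn)).comp (gn n) = gn m := by
    intro m n hmn
    ext e
    apply (hbij m).1
    rw [hgn]
    obtain ⟨r, hr⟩ := Ideal.Quotient.mk_surjective (gn n e)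
    have h1 := hgn n e
    rw [← hr, hfn, Ideal.Quotient.eq] at h1
    rw [AlgHom.comp_apply, ← hr]
    exact Ideal.Quotient.eq.2 (Ideal.pow_le_pow_right hmn h1)
  let G : E →ₐ[ℂ] AdicCompletion J R := AdicCompletion.liftAlgHom J gn hcompat
  have hG : ∀ n e, fn n (AdicCompletion.evalₐ J n (G e)) = Ideal.Quotient.mk _ e := by
    intro n e
    rw [AdicCompletion.evalₐ_liftAlgHom, hgn]
  refine ⟨(AlgEquiv.ofBijective G ⟨?_, ?_⟩).symm⟩
  · rw [injective_iff_map_eq_zero]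
    intro e he
    refine IsHausdorff.haus (I := I) inferInstance e fun n => ?_
    rw [SModEq.zero, smul_eq_mul, Ideal.mul_top, ← Ideal.Quotient.eq_zero_iff_mem, ← hG, he,
      map_zero, map_zero]
  · intro x
    choose r hr using fun n => Ideal.Quotient.mk_surjective (AdicCompletion.evalₐ J n x)
    have hr' : ∀ {m n : ℕ}, m ≤ n → r m - r n ∈ J ^ m := by
      intro m n hmn
      have h1 : Ideal.Quotient.factor (Ideal.pow_le_pow_right hmn) (AdicCompletion.evalₐ J n x) =
          AdicCompletion.evalₐ J m x := by
        obtain ⟨a, rfl⟩ := AdicCompletion.mk_surjective J R x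
        rw [AdicCompletion.evalₐ_mk, AdicCompletion.evalₐ_mk]
        exact AdicCompletion.Ideal.mk_eq_mk J hmn a
      rw [← hr, ← hr] at h1
      exact Ideal.Quotient.eq.1 h1.symm
    obtain ⟨e, he⟩ := IsPrecomplete.prec (I := I) inferInstance (f := fun n => f (r n)) (by
      intro m n hmn
      rw [SModEq.sub_mem, smul_eq_mul, Ideal.mul_top, ← map_sub]
      exact (hJ m _).1 (hr' hmn))
    refine ⟨e, AdicCompletion.ext_evalₐ fun n => (hbij n).1 ?_⟩
    have h1 := he n
    rw [SModEq.sub_mem, smul_eq_mul, Ideal.mul_top] at h1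
    change fn n (AdicCompletion.evalₐ J n (G e)) = _
    rw [hG, ← hr, hfn]
    exact (Ideal.Quotient.eq.2 h1).symm

variable {n : ℕ}

/-- The ideal of power series generated by the variables. -/
abbrev MvPowerSeries.varIdeal (n : ℕ) : Ideal (MvPowerSeries (Fin n) ℂ) :=
  Ideal.span (Set.range MvPowerSeries.X)

lemma MvPowerSeries.map_idealOfVars : (idealOfVars (Fin n) ℂ).map
    (algebraMap (MvPolynomial (Fin n) ℂ) (MvPowerSeries (Fin n) ℂ)) =
      MvPowerSeries.varIdeal n := by
  rw [idealOfVars, Ideal.map_span, ← Set.range_comp]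
  congr 2
  ext1 i
  simp [MvPowerSeries.algebraMap_apply']

lemma MvPowerSeries.mem_pow_varIdeal_iff {p : MvPowerSeries (Fin n) ℂ} {k : ℕ} :
    p ∈ MvPowerSeries.varIdeal n ^ k ↔ ∀ m : Fin n →₀ ℕ, m.degree < k → p.coeff m = 0 := by
  have hker : p.truncTotal k = 0 ↔ ∀ m : Fin n →₀ ℕ, m.degree < k → p.coeff m = 0 := by
    rw [MvPolynomial.ext_iff]
    refine forall_congr' fun m => ?_
    rw [MvPowerSeries.coeff_truncTotal_eq_ite]
    simp
  rw [← hker]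
  constructor
  · intro hp
    have h1 : p ∈ RingHom.ker (MvPowerSeries.truncTotalAlgHom (Fin n) ℂ k) := by
      have : MvPowerSeries.varIdeal n ^ k ≤
          RingHom.ker (MvPowerSeries.truncTotalAlgHom (Fin n) ℂ k) := by
        rw [← MvPowerSeries.map_idealOfVars, ← Ideal.map_pow, Ideal.map_le_iff_le_comap]
        intro q hq
        rw [Ideal.mem_comap, RingHom.mem_ker, AlgHom.commutes]
        exact Ideal.Quotient.eq_zero_iff_mem.2 hq
      exact this hp
    have h2 : p.truncTotal k ∈ idealOfVars (Fin n) ℂ ^ k := Ideal.Quotient.eq_zero_iff_mem.1 h1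
    rw [mem_pow_idealOfVars_iff'] at h2
    ext m
    by_cases hm : m.degree < k
    · rw [h2 m hm, MvPolynomial.coeff_zero]
    · rw [MvPowerSeries.coeff_truncTotal_eq_zero _ (not_lt.1 hm), MvPolynomial.coeff_zero]
  · intro hp
    let e := MvPowerSeries.toAdicCompletionAlgEquiv (Fin n) ℂ
    have h1 : e p ∈ (idealOfVars (Fin n) ℂ ^ k • ⊤ : Submodule (MvPolynomial (Fin n) ℂ)
        (AdicCompletion (idealOfVars (Fin n) ℂ) (MvPolynomial (Fin n) ℂ))) := by
      rw [AdicCompletion.pow_smul_top_eq_ker_eval (idealOfVars_fg (Fin n) ℂ), LinearMap.mem_ker,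
        AdicCompletion.eval_apply, MvPowerSeries.toAdicCompletionAlgEquiv_apply,
        MvPowerSeries.toAdicCompletion_apply_eq_mk_truncTotal, hp]
      rfl
    have h2 : p ∈ (idealOfVars (Fin n) ℂ ^ k • ⊤ : Submodule (MvPolynomial (Fin n) ℂ)
        (MvPowerSeries (Fin n) ℂ)) := by
      have h3 := Submodule.mem_map_of_mem (f := e.symm.toLinearMap) h1
      rw [Submodule.map_smul''] at h3
      have h4 : e.symm.toLinearMap (e p) = p := e.symm_apply_apply p
      rw [h4] at h3
      exact Submodule.smul_mono le_rfl le_top h3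
    rw [Ideal.smul_top_eq_map, Submodule.restrictScalars_mem, Ideal.map_pow,
      MvPowerSeries.map_idealOfVars] at h2
    exact h2

lemma MvPowerSeries.coe_mem_pow_varIdeal_iff {p : MvPolynomial (Fin n) ℂ} {k : ℕ} :
    (p : MvPowerSeries (Fin n) ℂ) ∈ MvPowerSeries.varIdeal n ^ k ↔
      p ∈ idealOfVars (Fin n) ℂ ^ k := by
  rw [MvPowerSeries.mem_pow_varIdeal_iff, mem_pow_idealOfVars_iff']
  simp only [coeff_coe]

lemma MvPowerSeries.sub_truncTotal_mem (p : MvPowerSeries (Fin n) ℂ) (k : ℕ) :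
    p - (p.truncTotal k : MvPolynomial (Fin n) ℂ) ∈ MvPowerSeries.varIdeal n ^ k := by
  rw [MvPowerSeries.mem_pow_varIdeal_iff]
  intro m hm
  rw [map_sub, coeff_coe, MvPowerSeries.coeff_truncTotal _ hm, sub_self]

lemma MvPowerSeries.varIdeal_ne_top : MvPowerSeries.varIdeal n ≠ ⊤ := by
  intro h
  have h1 : (1 : MvPowerSeries (Fin n) ℂ) ∈ MvPowerSeries.varIdeal n ^ 1 := by
    rw [pow_one, h]
    trivial
  rw [MvPowerSeries.mem_pow_varIdeal_iff] at h1
  simpa using h1 0 (by simp)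

/-- Quotients of the ring of power series are complete. -/
lemma MvPowerSeries.isAdicComplete_quotient (𝔟 : Ideal (MvPowerSeries (Fin n) ℂ)) :
    IsAdicComplete ((MvPowerSeries.varIdeal n).map (Ideal.Quotient.mk 𝔟))
      (MvPowerSeries (Fin n) ℂ ⧸ 𝔟) := by
  have h1 : IsHausdorff (MvPowerSeries.varIdeal n) (MvPowerSeries (Fin n) ℂ ⧸ 𝔟) :=
    IsHausdorff.of_isLocalRing _ _ MvPowerSeries.varIdeal_ne_top
  have h2 : IsPrecomplete (MvPowerSeries.varIdeal n) (MvPowerSeries (Fin n) ℂ ⧸ 𝔟) := by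
    rw [← AdicCompletion.of_surjective_iff]
    intro x
    obtain ⟨y, rfl⟩ := AdicCompletion.map_surjective (MvPowerSeries.varIdeal n)
      (Submodule.mkQ_surjective 𝔟) x
    obtain ⟨z, rfl⟩ := AdicCompletion.of_surjective (MvPowerSeries.varIdeal n)
      (MvPowerSeries (Fin n) ℂ) y
    exact ⟨Submodule.mkQ 𝔟 z, (AdicCompletion.map_of _ _ _).symm⟩
  have h3 : IsAdicComplete (MvPowerSeries.varIdeal n) (MvPowerSeries (Fin n) ℂ ⧸ 𝔟) :=
    { h1, h2 with }
  exact (IsAdicComplete.map_algebraMap_iff _ _).2 h3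

/-- The completion of the local ring of a hypersurface at the origin. -/
theorem IsLocalModel.nonempty_adicCompletion_algEquiv {R : Type} [CommRing R] [Algebra ℂ R]
    [IsLocalRing R] {N : Type} [CommRing N] [Algebra ℂ N] {g : N →ₐ[ℂ] R}
    {c : N →ₐ[ℂ] ℂ} (h : IsLocalModel g c) {F : MvPolynomial (Fin n) ℂ}
    {π : MvPolynomial (Fin n) ℂ →ₐ[ℂ] N} (hπ : Function.Surjective π)
    (hker : RingHom.ker π = Ideal.span {F})
    (hc : ∀ i, c (π (X i)) = 0) :
    Nonempty (AdicCompletion (IsLocalRing.maximalIdeal R) R ≃ₐ[ℂ]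
      (MvPowerSeries (Fin n) ℂ ⧸ Ideal.span {(F : MvPowerSeries (Fin n) ℂ)})) := by
  set 𝔟 := Ideal.span {(F : MvPowerSeries (Fin n) ℂ)} with h𝔟
  have hcc : ∀ p : MvPolynomial (Fin n) ℂ, c (π p) = constantCoeff p := by
    intro p
    have : c.comp π = aeval fun _ => (0 : ℂ) := by
      ext i
      simpa using hc i
    have h1 := congrArg (fun φ : MvPolynomial (Fin n) ℂ →ₐ[ℂ] ℂ => φ p) this
    rw [MvPolynomial.aeval_zero'] at h1
    exact h1
  have hπF : RingHom.ker π ≤ RingHom.ker ((Ideal.Quotient.mkₐ ℂ 𝔟).comp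
      (MvPolynomial.coeToMvPowerSeries.algHom ℂ)) := by
    rw [hker, Ideal.span_singleton_le_iff_mem]
    refine Ideal.Quotient.eq_zero_iff_mem.2 (Ideal.subset_span ?_)
    simp
  let ν : N →ₐ[ℂ] (MvPowerSeries (Fin n) ℂ ⧸ 𝔟) :=
    (Ideal.Quotient.liftₐ (RingHom.ker π) ((Ideal.Quotient.mkₐ ℂ 𝔟).comp
      (MvPolynomial.coeToMvPowerSeries.algHom ℂ)) hπF).comp
      (Ideal.quotientKerAlgEquivOfSurjective hπ).symm.toAlgHom
  have hν : ∀ p : MvPolynomial (Fin n) ℂ, ν (π p) =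
      Ideal.Quotient.mk 𝔟 (p : MvPowerSeries (Fin n) ℂ) := by
    intro p
    have h1 : (Ideal.quotientKerAlgEquivOfSurjective hπ).symm (π p) =
        Ideal.Quotient.mk (RingHom.ker π) p := by
      exact (AlgEquiv.symm_apply_eq _).2 rfl
    have h2 : ν (π p) = Ideal.Quotient.liftₐ (RingHom.ker π) ((Ideal.Quotient.mkₐ ℂ 𝔟).comp
      (MvPolynomial.coeToMvPowerSeries.algHom ℂ)) hπF
        ((Ideal.quotientKerAlgEquivOfSurjective hπ).symm (π p)) := rfl
    rw [h2, h1]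
    change Ideal.Quotient.mk 𝔟 _ = _
    simp
  letI := g.toRingHom.toAlgebra
  haveI : IsScalarTower ℂ N R :=
    IsScalarTower.of_algebraMap_eq fun r => (g.commutes r).symm
  haveI : (RingHom.ker c.toRingHom).IsPrime := RingHom.ker_isPrime _
  haveI := h.isLocalization
  let f : R →ₐ[ℂ] (MvPowerSeries (Fin n) ℂ ⧸ 𝔟) :=
    IsLocalization.liftAlgHom (M := (RingHom.ker c.toRingHom).primeCompl) (f := ν) (by
      rintro ⟨a, ha⟩
      obtain ⟨p, rfl⟩ := hπ a
      change IsUnit (ν _)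
      rw [hν]
      refine IsUnit.map _ ?_
      rw [MvPowerSeries.isUnit_iff_constantCoeff, isUnit_iff_ne_zero]
      have h1 : c (π p) ≠ 0 := ha
      rw [hcc] at h1
      rwa [← MvPowerSeries.coeff_zero_eq_constantCoeff_apply, coeff_coe])
  have hf : ∀ p : MvPolynomial (Fin n) ℂ, f (g (π p)) =
      Ideal.Quotient.mk 𝔟 (p : MvPowerSeries (Fin n) ℂ) := fun p =>
    (IsLocalization.lift_eq (M := (RingHom.ker c.toRingHom).primeCompl) _
      (π p)).trans (hν p)
  have hmax : ∀ p : MvPolynomial (Fin n) ℂ, ∀ k, p ∈ idealOfVars (Fin n) ℂ ^ k →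
      g (π p) ∈ IsLocalRing.maximalIdeal R ^ k := by
    intro p k hp
    have h1 : idealOfVars (Fin n) ℂ ≤ (IsLocalRing.maximalIdeal R).comap
        (g.toRingHom.comp π.toRingHom) := by
      rw [idealOfVars, Ideal.span_le]
      rintro _ ⟨i, rfl⟩
      exact h.mem_maximalIdeal _ (hc i)
    exact Ideal.le_comap_pow (g.toRingHom.comp π.toRingHom) k (Ideal.pow_right_mono h1 k hp)
  haveI := MvPowerSeries.isAdicComplete_quotient 𝔟
  set I := (MvPowerSeries.varIdeal n).map (Ideal.Quotient.mk 𝔟) with hI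
  refine _root_.nonempty_adicCompletion_algEquiv (I := I) f (fun k r => ⟨fun hr => ?_, fun hr => ?_⟩)
    fun k e => ?_
  · have h1 : IsLocalRing.maximalIdeal R ≤ I.comap f := by
      rw [← h.map_ker, Ideal.map_le_iff_le_comap]
      intro a ha
      obtain ⟨p, rfl⟩ := hπ a
      change f (g _) ∈ I
      rw [hf]
      refine Ideal.mem_map_of_mem _ ?_
      have h0 : c (π p) = 0 := ha
      rw [hcc] at h0
      rw [← pow_one (MvPowerSeries.varIdeal n), MvPowerSeries.mem_pow_varIdeal_iff]
      intro m hm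
      rw [Nat.lt_one_iff, Finsupp.degree_eq_zero_iff] at hm
      rw [hm, coeff_coe]
      exact h0
    exact Ideal.le_comap_pow _ k (Ideal.pow_right_mono h1 k hr)
  · obtain ⟨a, b, hb, e⟩ := h.surj r
    obtain ⟨p, rfl⟩ := hπ a
    have hu := h.isUnit b hb
    rw [← Ideal.mul_unit_mem_iff_mem _ hu, e]
    have h1 : f (g (π p)) ∈ I ^ k := by
      rw [← e, map_mul]
      exact Ideal.mul_mem_right _ _ hr
    rw [hf, hI, ← Ideal.map_pow, Ideal.mem_map_iff_of_surjective _ Ideal.Quotient.mk_surjective] at h1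
    obtain ⟨q, hq, hqp⟩ := h1
    rw [Ideal.Quotient.eq, h𝔟, Ideal.mem_span_singleton] at hqp
    obtain ⟨w, hw⟩ := hqp
    have h2 : p + F * w.truncTotal k ∈ idealOfVars (Fin n) ℂ ^ k := by
      rw [← MvPowerSeries.coe_mem_pow_varIdeal_iff]
      have h3 : ((p + F * w.truncTotal k : MvPolynomial (Fin n) ℂ) : MvPowerSeries (Fin n) ℂ) =
          q - F * (w - (w.truncTotal k : MvPolynomial (Fin n) ℂ)) := by
        rw [mul_sub, ← hw]
        push_cast
        ring
      rw [h3]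
      exact sub_mem hq (Ideal.mul_mem_left _ _ (MvPowerSeries.sub_truncTotal_mem w k))
    have h4 := hmax _ _ h2
    have hF : π F = 0 := by
      rw [← RingHom.mem_ker, hker]
      exact Ideal.mem_span_singleton_self F
    rwa [map_add, map_mul, hF, zero_mul, add_zero] at h4
  · obtain ⟨q, rfl⟩ := Ideal.Quotient.mk_surjective e
    refine ⟨g (π (q.truncTotal k)), ?_⟩
    rw [hf, ← map_sub, hI, ← Ideal.map_pow]
    refine Ideal.mem_map_of_mem _ ?_
    rw [← neg_mem_iff, neg_sub]
    exact MvPowerSeries.sub_truncTotal_mem q k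

end Completion

/-! ### Local rings of the toric fibre -/

section LocalModel

open MvPolynomial

/-- Closed points of a chart are `ℂ`-points. -/
lemma exists_algHom_ker_eq {n : ℕ} {I : Ideal (MvPolynomial (Fin n) ℂ)} {i : Fin n}
    (𝔪 : Ideal (Chart I i)) [𝔪.IsMaximal] : ∃ p : Chart I i →ₐ[ℂ] ℂ, RingHom.ker p = 𝔪 := by
  letI : Field (Chart I i ⧸ 𝔪) := Ideal.Quotient.field 𝔪
  have hfin : Module.Finite ℂ (Chart I i ⧸ 𝔪) := finite_of_finite_type_of_isJacobsonRing ℂ _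
  have hbij : Function.Bijective (algebraMap ℂ (Chart I i ⧸ 𝔪)) :=
    IsAlgClosed.algebraMap_bijective_of_isIntegral
  let e : ℂ ≃ₐ[ℂ] (Chart I i ⧸ 𝔪) := AlgEquiv.ofBijective (Algebra.ofId ℂ _) hbij
  refine ⟨e.symm.toAlgHom.comp (Ideal.Quotient.mkₐ ℂ 𝔪), ?_⟩
  ext a
  rw [RingHom.mem_ker]
  change e.symm (Ideal.Quotient.mk 𝔪 a) = 0 ↔ _
  rw [map_eq_zero_iff _ e.symm.injective, Ideal.Quotient.eq_zero_iff_mem]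

/-- The class in the local ring at `𝔪` of the `k`-th coordinate. -/
def localCoord {i : Fin 14} (𝔪 : Ideal (Chart toricIdeal i)) [𝔪.IsPrime] (k : Fin 14) :
    Localization.AtPrime 𝔪 :=
  algebraMap (Chart toricIdeal i) _ (Ideal.Quotient.mk _ (X k))

/-- The inclusion of the local ring at `𝔪` in the function field. -/
def localToField {i : Fin 14} (𝔪 : Ideal (Chart toricIdeal i)) [𝔪.IsPrime] :
    Localization.AtPrime 𝔪 →ₐ[ℂ] FractionRing Laurent :=
  IsLocalization.liftAlgHom (M := 𝔪.primeCompl)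
    (f := (IsScalarTower.toAlgHom ℂ Laurent (FractionRing Laurent)).comp
      ((coneAlgebra i).val.comp (chartEquiv i).toAlgHom)) (by
    rintro ⟨a, ha⟩
    rw [isUnit_iff_ne_zero]
    intro h
    have h1 : algebraMap Laurent (FractionRing Laurent) (chartEquiv i a : Laurent) = 0 := h
    rw [map_eq_zero_iff _ (IsFractionRing.injective Laurent (FractionRing Laurent)),
      ZeroMemClass.coe_eq_zero, map_eq_zero_iff _ (chartEquiv i).injective] at h1
    exact ha (h1 ▸ zero_mem 𝔪))

variable {i : Fin 14} (𝔪 : Ideal (Chart toricIdeal i)) [𝔪.IsPrime]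

lemma localToField_algebraMap (a : Chart toricIdeal i) :
    localToField 𝔪 (algebraMap _ _ a) =
      algebraMap Laurent (FractionRing Laurent) (chartEquiv i a : Laurent) :=
  IsLocalization.lift_eq (M := 𝔪.primeCompl) _ a

lemma localToField_localCoord (k : Fin 14) : localToField 𝔪 (localCoord 𝔪 k) =
    algebraMap Laurent (FractionRing Laurent) (chi (character k - character i)) := by
  rw [localCoord, localToField_algebraMap, chartEquiv_mk, chartHom_X]

lemma localToField_injective : Function.Injective (localToField 𝔪) := by
  rw [injective_iff_map_eq_zero]
  intro r hr
  obtain ⟨a, s, rfl⟩ := IsLocalization.exists_mk'_eq 𝔪.primeCompl r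
  have h1 : localToField 𝔪 (algebraMap _ _ a) = 0 := by
    rw [← IsLocalization.mk'_spec (Localization.AtPrime 𝔪) a s, map_mul, hr, zero_mul]
  rw [localToField_algebraMap,
    map_eq_zero_iff _ (IsFractionRing.injective Laurent (FractionRing Laurent)),
    ZeroMemClass.coe_eq_zero, map_eq_zero_iff _ (chartEquiv i).injective] at h1
  rw [h1, IsLocalization.mk'_zero]

lemma localCoord_mul_eq {j k : Fin 14} {r : Localization.AtPrime 𝔪} {a : Fin 5 → ℤ}
    (hr : localToField 𝔪 r = algebraMap Laurent (FractionRing Laurent) (chi a))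
    (h : a = character k - character j) : r * localCoord 𝔪 j = localCoord 𝔪 k := by
  apply localToField_injective 𝔪
  rw [map_mul, hr, localToField_localCoord, localToField_localCoord, ← map_mul, ← chi_add, h,
    sub_add_sub_cancel]

/-- A recognition principle for local rings. A subring `N` of the ring of Laurent polynomials
generated by quotients of coordinates, with denominators that do not vanish at a point, and
containing the homogeneous coordinates up to a common factor, has the same local ring at that
point as the toric variety. -/
theorem exists_isLocalModel {N : Type} [CommRing N] [Algebra ℂ N] {h : N →ₐ[ℂ] Laurent}
    (hinj : Function.Injective h) {n : ℕ} {x : Fin n → N}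
    (hx : Algebra.adjoin ℂ (Set.range x) = ⊤) {num den : Fin n → Fin 14}
    (hxl : ∀ l, h (x l) = chi (character (num l) - character (den l)))
    {w : Fin 14 → N} {d : Fin 5 → ℤ} (hw : ∀ k, h (w k) = chi (character k - d))
    {p : Chart toricIdeal i →ₐ[ℂ] ℂ} (hp : RingHom.ker p = 𝔪)
    (hden : ∀ l, p (Ideal.Quotient.mk _ (X (den l))) ≠ 0) {j₀ a b : Fin 14}
    (hj₀ : character j₀ - d = character a - character b)
    (hpa : p (Ideal.Quotient.mk _ (X a)) ≠ 0) :
    ∃ (g : N →ₐ[ℂ] Localization.AtPrime 𝔪) (c : N →ₐ[ℂ] ℂ),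
      IsLocalModel (R := Localization.AtPrime 𝔪) g c ∧
      (∀ l, c (x l) * p (Ideal.Quotient.mk _ (X (den l))) = p (Ideal.Quotient.mk _ (X (num l)))) ∧
      c (w j₀) ≠ 0 ∧ ∀ k, c (w k) * p (Ideal.Quotient.mk _ (X j₀)) =
        c (w j₀) * p (Ideal.Quotient.mk _ (X k)) := by
  have hmem : ∀ a, a ∈ 𝔪 ↔ p a = 0 := fun a => (SetLike.ext_iff.1 hp a).symm.trans Iff.rfl
  have hunit : ∀ a : Chart toricIdeal i, p a ≠ 0 →
      IsUnit (algebraMap _ (Localization.AtPrime 𝔪) a) := fun a ha =>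
    IsLocalization.map_units (Localization.AtPrime 𝔪) (⟨a, fun h => ha ((hmem a).1 h)⟩ : 𝔪.primeCompl)
  let ρ : Localization.AtPrime 𝔪 →ₐ[ℂ] ℂ :=
    IsLocalization.liftAlgHom (M := 𝔪.primeCompl) (f := p) (by
      rintro ⟨a, ha⟩
      rw [isUnit_iff_ne_zero]
      exact fun h0 => ha ((hmem a).2 h0))
  have hρ : ∀ a : Chart toricIdeal i, ρ (algebraMap _ _ a) = p a := fun a =>
    IsLocalization.lift_eq (M := 𝔪.primeCompl) _ a
  have hρu : ∀ r, ρ r ≠ 0 → IsUnit r := by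
    intro r hr
    obtain ⟨a, s, rfl⟩ := IsLocalization.exists_mk'_eq 𝔪.primeCompl r
    have h1 := IsLocalization.mk'_spec (Localization.AtPrime 𝔪) a s
    refine isUnit_of_mul_isUnit_left (h1 ▸ hunit a ?_ :
      IsUnit (_ * algebraMap _ (Localization.AtPrime 𝔪) (s : Chart toricIdeal i)))
    rw [← hρ, ← h1, map_mul]
    refine mul_ne_zero hr ?_
    rw [hρ]
    exact fun h0 => s.2 ((hmem s).2 h0)
  let h' : N →ₐ[ℂ] FractionRing Laurent := (IsScalarTower.toAlgHom ℂ Laurent _).comp h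
  have hh' : ∀ a, h' a = algebraMap Laurent _ (h a) := fun _ => rfl
  have hrange : ∀ a, h' a ∈ (localToField 𝔪).range := by
    intro a
    have ha : a ∈ Algebra.adjoin ℂ (Set.range x) := hx ▸ Algebra.mem_top
    induction ha using Algebra.adjoin_induction with
    | mem a ha =>
      obtain ⟨l, rfl⟩ := ha
      obtain ⟨v, hv⟩ := hunit _ (hden l)
      refine ⟨localCoord 𝔪 (num l) * (v⁻¹ : (Localization.AtPrime 𝔪)ˣ), ?_⟩
      have h0 : localToField 𝔪 (localCoord 𝔪 (den l)) ≠ 0 := by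
        rw [localToField_localCoord]
        exact algebraMap_chi_ne_zero _ _
      refine mul_right_cancel₀ h0 ?_
      change localToField 𝔪 _ * _ = _
      have h1 : localCoord 𝔪 (den l) = v := hv.symm
      rw [← map_mul, h1, mul_assoc, Units.inv_mul, mul_one, ← h1, localToField_localCoord,
        localToField_localCoord, hh', hxl, ← map_mul, ← chi_add, sub_add_sub_cancel]
    | algebraMap r => exact (h'.commutes r) ▸ Subalgebra.algebraMap_mem _ r
    | add a b _ _ ha hb => exact (map_add h' a b) ▸ add_mem ha hb
    | mul a b _ _ ha hb => exact (map_mul h' a b) ▸ mul_mem ha hb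
  let g : N →ₐ[ℂ] Localization.AtPrime 𝔪 :=
    (AlgEquiv.ofInjective _ (localToField_injective 𝔪)).symm.toAlgHom.comp
      (h'.codRestrict _ hrange)
  have hg : ∀ a, localToField 𝔪 (g a) = algebraMap Laurent _ (h a) := fun a =>
    congrArg Subtype.val ((AlgEquiv.ofInjective _ (localToField_injective 𝔪)).apply_symm_apply
      ⟨h' a, hrange a⟩)
  have hgx : ∀ l, g (x l) * localCoord 𝔪 (den l) = localCoord 𝔪 (num l) := fun l =>
    localCoord_mul_eq 𝔪 ((hg _).trans (by rw [hxl])) rfl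
  have hgw : ∀ k j, g (w k) * localCoord 𝔪 j = g (w j) * localCoord 𝔪 k := by
    intro k j
    apply localToField_injective 𝔪
    rw [map_mul, map_mul, hg, hg, hw, hw, localToField_localCoord, localToField_localCoord,
      ← map_mul, ← map_mul, ← chi_add, ← chi_add]
    congr 2
    abel
  have hone : localCoord 𝔪 i = 1 := by
    apply localToField_injective 𝔪
    rw [localToField_localCoord, sub_self, chi_zero, map_one, map_one]
  have hwj : IsUnit (g (w j₀)) := by
    have h1 : g (w j₀) * localCoord 𝔪 b = localCoord 𝔪 a :=
      localCoord_mul_eq 𝔪 ((hg _).trans (by rw [hw])) hj₀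
    have h2 : IsUnit (localCoord 𝔪 a) := hunit _ hpa
    rw [← h1] at h2
    exact isUnit_of_mul_isUnit_left h2
  have hwi : IsUnit (g (w i)) := by
    have h1 := hgw i j₀
    rw [hone, mul_one] at h1
    exact isUnit_of_mul_isUnit_left (h1 ▸ hwj)
  have hfrac : ∀ a : Chart toricIdeal i, ∃ m m', IsUnit (g m') ∧
      algebraMap _ (Localization.AtPrime 𝔪) a * g m' = g m := by
    intro a
    obtain ⟨f, rfl⟩ := Ideal.Quotient.mk_surjective a
    induction f using MvPolynomial.induction_on with
    | C r =>
      refine ⟨algebraMap ℂ N r, 1, by simp, ?_⟩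
      rw [map_one, mul_one, AlgHom.commutes, IsScalarTower.algebraMap_apply ℂ (Chart toricIdeal i)]
      rfl
    | add f₁ f₂ h₁ h₂ =>
      obtain ⟨m₁, m₁', u₁, e₁⟩ := h₁
      obtain ⟨m₂, m₂', u₂, e₂⟩ := h₂
      refine ⟨m₁ * m₂' + m₂ * m₁', m₁' * m₂', by rw [map_mul]; exact u₁.mul u₂, ?_⟩
      rw [map_add, map_add, map_add, map_mul, map_mul, map_mul, ← e₁, ← e₂]
      ring
    | mul_X f k hf =>
      obtain ⟨m, m', u, e⟩ := hf
      refine ⟨m * w k, m' * w i, by rw [map_mul]; exact u.mul hwi, ?_⟩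
      have h1 : g (w k) = g (w i) * localCoord 𝔪 k := by
        rw [← hgw, hone, mul_one]
      rw [map_mul, map_mul, map_mul, map_mul, ← e, h1, localCoord]
      ring
  have hcu : ∀ m, IsUnit (g m) → ρ (g m) ≠ 0 := fun m hm => (hm.map ρ).ne_zero
  refine ⟨g, ρ.comp g, ⟨?_, fun m hm => hρu _ hm, ?_, ?_⟩, fun l => ?_, hcu _ hwj, fun k => ?_⟩
  · intro m m' hm
    apply hinj
    apply IsFractionRing.injective Laurent (FractionRing Laurent)
    rw [← hg, ← hg, hm]
  · intro m hm
    rw [IsLocalRing.mem_maximalIdeal]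
    exact fun hu => hcu m hu hm
  · intro r
    obtain ⟨a, s, rfl⟩ := IsLocalization.exists_mk'_eq 𝔪.primeCompl r
    obtain ⟨m₁, m₁', u₁, e₁⟩ := hfrac a
    obtain ⟨m₂, m₂', u₂, e₂⟩ := hfrac s
    have hs : IsUnit (algebraMap _ (Localization.AtPrime 𝔪) (s : Chart toricIdeal i)) :=
      IsLocalization.map_units _ s
    refine ⟨m₁ * m₂', m₁' * m₂, ?_, ?_⟩
    · refine hcu _ ?_
      rw [map_mul, ← e₂]
      exact u₁.mul (hs.mul u₂)
    · rw [map_mul, map_mul, ← e₂, ← e₁, ← IsLocalization.mk'_spec (Localization.AtPrime 𝔪) a s]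
      ring
  · have h1 := congrArg ρ (hgx l)
    rw [map_mul, localCoord, localCoord, hρ, hρ] at h1
    exact h1
  · have h1 := congrArg ρ (hgw k j₀)
    rw [map_mul, map_mul, localCoord, localCoord, hρ, hρ] at h1
    exact h1

end LocalModel

/-! ### Affine toric varieties defined by quadratic binomials -/

section QuadraticModel

open MvPolynomial

variable {n m : ℕ}

/-- The ideal generated by the binomials `xₐ x_b - x_c x_d`, for a list of quadruples of
indices. -/
def quadIdeal (q : Fin m → Fin n × Fin n × Fin n × Fin n) : Ideal (MvPolynomial (Fin n) ℂ) :=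
  Ideal.span (Set.range fun r => X (q r).1 * X (q r).2.1 - X (q r).2.2.1 * X (q r).2.2.2)

/-- The algebra defined by the binomials `xₐ x_b - x_c x_d`. -/
abbrev QuadModel (q : Fin m → Fin n × Fin n × Fin n × Fin n) : Type :=
  MvPolynomial (Fin n) ℂ ⧸ quadIdeal q

/-- The class of a variable. -/
def quadVar (q : Fin m → Fin n × Fin n × Fin n × Fin n) (l : Fin n) : QuadModel q :=
  Ideal.Quotient.mk _ (X l)

variable (q : Fin m → Fin n × Fin n × Fin n × Fin n)

lemma quadVar_mul (r : Fin m) : quadVar q (q r).1 * quadVar q (q r).2.1 =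
    quadVar q (q r).2.2.1 * quadVar q (q r).2.2.2 := by
  rw [quadVar, quadVar, quadVar, quadVar, ← map_mul, ← map_mul, Ideal.Quotient.eq]
  exact Ideal.subset_span ⟨r, rfl⟩

lemma adjoin_quadVar : Algebra.adjoin ℂ (Set.range (quadVar q)) = ⊤ := by
  have h : Set.range (quadVar q) = Ideal.Quotient.mkₐ ℂ (quadIdeal q) '' Set.range X := by
    rw [← Set.range_comp]
    rfl
  rw [h, ← AlgHom.map_adjoin, MvPolynomial.adjoin_range_X, Algebra.map_top, AlgHom.range_eq_top]
  exact Ideal.Quotient.mk_surjective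

/-- The homomorphism with given values at the variables. -/
def quadLift {S : Type} [CommRing S] [Algebra ℂ S] (y : Fin n → S)
    (hy : ∀ r, y (q r).1 * y (q r).2.1 = y (q r).2.2.1 * y (q r).2.2.2) : QuadModel q →ₐ[ℂ] S :=
  Ideal.Quotient.liftₐ _ (aeval y) (by
    intro a ha
    have h : quadIdeal q ≤ RingHom.ker (aeval y : MvPolynomial (Fin n) ℂ →ₐ[ℂ] S) := by
      rw [quadIdeal, Ideal.span_le]
      rintro _ ⟨r, rfl⟩
      simp [hy]
    exact h ha)

@[simp]
lemma quadLift_quadVar {S : Type} [CommRing S] [Algebra ℂ S] {y : Fin n → S}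
    (hy : ∀ r, y (q r).1 * y (q r).2.1 = y (q r).2.2.1 * y (q r).2.2.2) (l : Fin n) :
    quadLift q y hy (quadVar q l) = y l := by
  change aeval y (X l) = y l
  rw [aeval_X]

/-- Exponents of monomials that are not divisible by the leading monomial `xₐ x_b` of any of the
binomials. -/
def IsStandard (e : Fin n →₀ ℕ) : Prop := ∀ r, e (q r).1 = 0 ∨ e (q r).2.1 = 0

variable {q}

/-- If the binomials, read as rules `xₐ x_b → x_c x_d`, decrease some weight, then every monomial
is equivalent to a standard one. -/
lemma exists_isStandard (hq : ∀ r, (q r).1 ≠ (q r).2.1) {μ : Fin n → ℕ}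
    (hμ : ∀ r, μ (q r).2.2.1 + μ (q r).2.2.2 < μ (q r).1 + μ (q r).2.1) (d : Fin n →₀ ℕ) :
    ∃ e, IsStandard q e ∧ (monomial d 1 - monomial e 1 : MvPolynomial (Fin n) ℂ) ∈ quadIdeal q := by
  generalize hk : Finsupp.weight μ d = k
  induction k using Nat.strong_induction_on generalizing d with
  | _ k ih =>
    by_cases hd : IsStandard q d
    · exact ⟨d, hd, by simp⟩
    · simp only [IsStandard, not_forall, not_or] at hd
      obtain ⟨r, h1, h2⟩ := hd
      obtain ⟨d', rfl⟩ : ∃ d', d = d' + (Finsupp.single (q r).1 1 + Finsupp.single (q r).2.1 1) := by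
        refine ⟨d - (Finsupp.single (q r).1 1 + Finsupp.single (q r).2.1 1),
          (tsub_add_cancel_of_le ?_).symm⟩
        intro l
        rw [Finsupp.add_apply, Finsupp.single_apply, Finsupp.single_apply]
        have := hq r
        split_ifs with ha hb hb
        · exact absurd (ha.trans hb.symm) this
        · subst ha; omega
        · subst hb; omega
        · omega
      have hw : ∀ a b, Finsupp.weight μ (d' + (Finsupp.single a 1 + Finsupp.single b 1)) =
          Finsupp.weight μ d' + (μ a + μ b) := by
        intro a b
        simp [Finsupp.weight_single]
      obtain ⟨e, he, hde⟩ := ih _ (by rw [← hk, hw, hw]; exact Nat.add_lt_add_left (hμ r) _)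
        (d' + (Finsupp.single (q r).2.2.1 1 + Finsupp.single (q r).2.2.2 1)) rfl
      refine ⟨e, he, ?_⟩
      have h3 : ∀ a b : Fin n, (monomial (d' + (Finsupp.single a 1 + Finsupp.single b 1)) 1 :
          MvPolynomial (Fin n) ℂ) = monomial d' 1 * (X a * X b) := by
        intro a b
        rw [X, X, monomial_mul, monomial_mul, one_mul, one_mul]
      rw [h3] at hde ⊢
      have h4 : (X (q r).1 * X (q r).2.1 - X (q r).2.2.1 * X (q r).2.2.2 :
        MvPolynomial (Fin n) ℂ) ∈ quadIdeal q := Ideal.subset_span ⟨r, rfl⟩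
      have h5 := add_mem (Ideal.mul_mem_left _ (monomial d' 1) h4) hde
      convert h5 using 1
      ring

/-- If standard monomials have distinct images under a homomorphism to Laurent polynomials sending
variables to characters, then that homomorphism is injective. -/
lemma quadLift_injective (hq : ∀ r, (q r).1 ≠ (q r).2.1) {μ : Fin n → ℕ}
    (hμ : ∀ r, μ (q r).2.2.1 + μ (q r).2.2.2 < μ (q r).1 + μ (q r).2.1) {b : Fin n → Fin 5 → ℤ}
    (hb : ∀ r, chi (b (q r).1) * chi (b (q r).2.1) = chi (b (q r).2.2.1) * chi (b (q r).2.2.2))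
    (hinj : ∀ e e' : Fin n →₀ ℕ, IsStandard q e → IsStandard q e' →
      ∑ l, e l • b l = ∑ l, e' l • b l → e = e') :
    Function.Injective (quadLift q (fun l => chi (b l)) hb) := by
  rw [injective_iff_map_eq_zero]
  intro a ha
  obtain ⟨f, rfl⟩ := Ideal.Quotient.mk_surjective a
  choose ν hν hν' using exists_isStandard hq hμ
  have h1 : (f - ∑ d ∈ f.support, monomial (ν d) (coeff d f)) ∈ quadIdeal q := by
    have h2 : f - ∑ d ∈ f.support, monomial (ν d) (coeff d f) =
        ∑ d ∈ f.support, (monomial d (coeff d f) - monomial (ν d) (coeff d f)) := by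
      rw [Finset.sum_sub_distrib, ← f.as_sum]
    rw [h2]
    refine sum_mem fun d _ => ?_
    have h2 := Ideal.mul_mem_left _ (C (coeff d f)) (hν' d)
    rwa [mul_sub, C_mul_monomial, C_mul_monomial, mul_one] at h2
  have h2 := Ideal.Quotient.eq.2 h1
  rw [h2] at ha ⊢
  have h3 : ∑ d ∈ f.support, monomial (ν d) (coeff d f) = 0 := by
    refine eq_zero_of_aeval_chi_eq_zero b ?_ ha
    have hstd : ∀ e ∈ (∑ d ∈ f.support, monomial (ν d) (coeff d f)).support, IsStandard q e := by
      intro e he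
      have h4 := MvPolynomial.support_sum he
      simp only [Finset.mem_biUnion] at h4
      obtain ⟨d, _, hd⟩ := h4
      have h5 := MvPolynomial.support_monomial_subset hd
      rw [Finset.mem_singleton] at h5
      rw [h5]
      exact hν d
    exact fun e he e' he' h => hinj e e' (hstd e he) (hstd e' he') h
  rw [h3, map_zero]

end QuadraticModel

/-! ### Finite free algebras from multiplication tables -/

section Free

open MvPolynomial

/-- Pairwise commuting elements of an algebra can be substituted in polynomials. -/
lemma exists_algHom_of_commute {R A : Type} [CommRing R] [Ring A] [Algebra R A] {k : ℕ}
    (Z : Fin k → A) (hZ : ∀ s t, Commute (Z s) (Z t)) :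
    ∃ φ : MvPolynomial (Fin k) R →ₐ[R] A, ∀ t, φ (X t) = Z t := by
  letI : CommRing (Algebra.adjoin R (Set.range Z)) := Algebra.adjoinCommRingOfComm R (by
    rintro _ ⟨s, rfl⟩ _ ⟨t, rfl⟩
    exact hZ s t)
  let φ : MvPolynomial (Fin k) R →ₐ[R] Algebra.adjoin R (Set.range Z) :=
    aeval fun t => (⟨Z t, Algebra.subset_adjoin ⟨t, rfl⟩⟩ : Algebra.adjoin R (Set.range Z))
  refine ⟨(Algebra.adjoin R (Set.range Z)).val.comp φ, fun t => ?_⟩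
  change ((φ (X t) : Algebra.adjoin R (Set.range Z)) : A) = Z t
  rw [aeval_X]

/-- An algebra is free over `P` if it is spanned by the elements `e i` and acts on the free module
with basis `i`, compatibly with its action on the `e i`. -/
theorem flat_of_matrix {P N : Type} [CommRing P] [Algebra ℂ P] [CommRing N] [Algebra ℂ N]
    {ψ : P →ₐ[ℂ] N} {r k : ℕ} {e : Fin r → N} {o : Fin r} (ho : e o = 1) {z : Fin k → N}
    {Z : Fin k → Matrix (Fin r) (Fin r) P}
    (hmul : ∀ t i, z t * e i = ∑ j, ψ (Z t j i) * e j)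
    (hgen : Algebra.adjoin ℂ (Set.range ψ ∪ Set.range z) = ⊤)
    (M : N →ₐ[ℂ] Matrix (Fin r) (Fin r) P) (hMψ : ∀ p, M (ψ p) = algebraMap P _ p)
    (hM : ∀ i, (M (e i)).col o = Pi.single i 1) : ψ.toRingHom.Flat := by
  letI := ψ.toRingHom.toAlgebra
  have hsmul : ∀ (p : P) (a : N), p • a = ψ p * a := fun _ _ => rfl
  have hspan : ⊤ ≤ Submodule.span P (Set.range e) := by
    have hclosed : ∀ a ∈ Algebra.adjoin ℂ (Set.range ψ ∪ Set.range z),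
        ∀ w ∈ Submodule.span P (Set.range e), a * w ∈ Submodule.span P (Set.range e) := by
      intro a ha
      induction ha using Algebra.adjoin_induction with
      | mem a ha =>
        intro w hw
        rcases ha with ⟨p, rfl⟩ | ⟨t, rfl⟩
        · exact Submodule.smul_mem _ p hw
        · induction hw using Submodule.span_induction with
          | mem w hw =>
            obtain ⟨i, rfl⟩ := hw
            rw [hmul]
            exact sum_mem fun j _ => Submodule.smul_mem _ _ (Submodule.subset_span ⟨j, rfl⟩)
          | zero => simp
          | add u v _ _ hu hv => rw [mul_add]; exact add_mem hu hv
          | smul p u _ hu =>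
            rw [hsmul, mul_left_comm]
            exact Submodule.smul_mem _ p hu
      | algebraMap c =>
        intro w hw
        rw [← ψ.commutes]
        exact Submodule.smul_mem _ _ hw
      | add a b _ _ ha hb =>
        intro w hw
        rw [add_mul]
        exact add_mem (ha w hw) (hb w hw)
      | mul a b _ _ ha hb =>
        intro w hw
        rw [mul_assoc]
        exact ha _ (hb w hw)
    intro a _
    have h1 := hclosed a (hgen ▸ Algebra.mem_top) _ (Submodule.subset_span ⟨o, rfl⟩)
    rwa [ho, mul_one] at h1
  have hli : LinearIndependent P e := by
    rw [Fintype.linearIndependent_iff]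
    intro p hp i
    have h1 := congrArg (fun a => (M a) i o) hp
    simp only [hsmul, map_sum, map_mul, hMψ, map_zero, Matrix.sum_apply,
      Matrix.algebraMap_eq_diagonal, Matrix.diagonal_mul, Matrix.zero_apply] at h1
    rw [Finset.sum_eq_single i] at h1
    · have h2 := congrFun (hM i) i
      rw [Pi.single_eq_same] at h2
      change M (e i) i o = 1 at h2
      rw [h2] at h1
      simpa using h1
    · intro j _ hj
      have h2 := congrFun (hM j) i
      rw [Pi.single_eq_of_ne hj.symm] at h2
      change M (e j) i o = 0 at h2
      rw [h2, mul_zero]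
    · simp
  have : Module.Free P N := Module.Free.of_basis (Module.Basis.mk hli hspan)
  exact (inferInstance : Module.Flat P N)

end Free

/-! ### The three local models -/

section Models

open MvPolynomial

/-- Five-dimensional affine space: no relations. -/
def smoothQuads : Fin 0 → Fin 5 × Fin 5 × Fin 5 × Fin 5 := Fin.elim0

/-- The product of the conifold `x₀ x₁ = x₂ x₃` with a plane. -/
def conifoldQuads : Fin 1 → Fin 6 × Fin 6 × Fin 6 × Fin 6 := ![(0, 1, 2, 3)]

/-- The affine toric variety at the two points where two of the singular strata meet: with
variables `A, …, H`, the relations `AG = BF`, `AE = BD`, `FE = GD`, `FC = AH`, `GC = BH`. The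
leading monomials are the non-edges of the pentagon `A, F, G, E, C`. -/
def pentagonQuads : Fin 5 → Fin 8 × Fin 8 × Fin 8 × Fin 8 :=
  ![(0, 6, 1, 5), (0, 4, 1, 3), (5, 4, 6, 3), (5, 2, 0, 7), (6, 2, 1, 7)]

lemma flat_smooth :
    (aeval (quadVar smoothQuads) : MvPolynomial (Fin 5) ℂ →ₐ[ℂ] QuadModel smoothQuads).toRingHom.Flat := by
  refine RingHom.Flat.of_bijective ?_
  let e := quadLift smoothQuads (X : Fin 5 → MvPolynomial (Fin 5) ℂ) (fun r => r.elim0)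
  have h1 : e.comp (aeval (quadVar smoothQuads)) = AlgHom.id ℂ _ := by
    ext l
    simp [e]
  have h2 : (aeval (quadVar smoothQuads)).comp e = AlgHom.id ℂ _ := by
    refine Ideal.Quotient.algHom_ext _ ?_
    ext l
    change aeval (quadVar smoothQuads) (e (quadVar smoothQuads l)) = quadVar smoothQuads l
    simp [e]
  exact Function.bijective_iff_has_inverse.2 ⟨e, fun a => congrArg (fun φ : _ →ₐ[ℂ] _ => φ a) h1,
    fun a => congrArg (fun φ : _ →ₐ[ℂ] _ => φ a) h2⟩

/-- A noncommutative version of `quadLift`, for values that are polynomials in commuting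
elements. -/
lemma exists_algHom_quadModel {n m k : ℕ} (q : Fin m → Fin n × Fin n × Fin n × Fin n) {P A : Type}
    [CommRing P] [Algebra ℂ P] [Ring A] [Algebra P A] [Algebra ℂ A] [IsScalarTower ℂ P A]
    (Z : Fin k → A) (hZ : ∀ s t, Commute (Z s) (Z t)) (u : Fin n → MvPolynomial (Fin k) P) :
    ∃ φ : MvPolynomial (Fin k) P →ₐ[P] A, (∀ t, φ (X t) = Z t) ∧
      ((∀ r, φ (u (q r).1) * φ (u (q r).2.1) = φ (u (q r).2.2.1) * φ (u (q r).2.2.2)) →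
      ∃ M : QuadModel q →ₐ[ℂ] A, ∀ l, M (quadVar q l) = φ (u l)) := by
  obtain ⟨φ, hφ⟩ := exists_algHom_of_commute (R := P) Z hZ
  refine ⟨φ, hφ, fun hr => ?_⟩
  let χ : MvPolynomial (Fin n) ℂ →ₐ[ℂ] A := (φ.restrictScalars ℂ).comp (aeval u)
  have hχ : ∀ l, χ (X l) = φ (u l) := by
    intro l
    change φ (aeval u (X l)) = _
    rw [aeval_X]
  refine ⟨Ideal.Quotient.liftₐ _ χ ?_, fun l => hχ l⟩
  intro a ha
  have h : quadIdeal q ≤ RingHom.ker χ := by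
    rw [quadIdeal, Ideal.span_le]
    rintro _ ⟨r, rfl⟩
    rw [SetLike.mem_coe, RingHom.mem_ker, map_sub, map_mul, map_mul, hχ, hχ, hχ, hχ, hr, sub_self]
  exact h ha

/-- The parameters `x₀ + x₁, x₂, x₃, x₄, x₅` on the conifold. -/
def conifoldParam : MvPolynomial (Fin 5) ℂ →ₐ[ℂ] QuadModel conifoldQuads :=
  aeval ![quadVar conifoldQuads 0 + quadVar conifoldQuads 1, quadVar conifoldQuads 2,
    quadVar conifoldQuads 3, quadVar conifoldQuads 4, quadVar conifoldQuads 5]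

/-- The parameters `B, D, H, A + G + C, F + E + C` on the pentagonal model. -/
def pentagonParam : MvPolynomial (Fin 5) ℂ →ₐ[ℂ] QuadModel pentagonQuads :=
  aeval ![quadVar pentagonQuads 1, quadVar pentagonQuads 3, quadVar pentagonQuads 7,
    quadVar pentagonQuads 0 + quadVar pentagonQuads 6 + quadVar pentagonQuads 2,
    quadVar pentagonQuads 5 + quadVar pentagonQuads 4 + quadVar pentagonQuads 2]

lemma forall_fin_five {p : Fin 5 → Prop} (h0 : p 0) (h1 : p 1) (h2 : p 2) (h3 : p 3) (h4 : p 4) :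
    ∀ i, p i := by
  intro i
  fin_cases i <;> assumption

lemma adjoin_range_union_eq_top {n m k : ℕ} {q : Fin m → Fin n × Fin n × Fin n × Fin n} {P : Type}
    [CommRing P] [Algebra ℂ P] {ψ : P →ₐ[ℂ] QuadModel q} {z : Fin k → QuadModel q}
    (h : ∀ l, quadVar q l ∈ Algebra.adjoin ℂ (Set.range ψ ∪ Set.range z)) :
    Algebra.adjoin ℂ (Set.range ψ ∪ Set.range z) = ⊤ := by
  rw [eq_top_iff, ← adjoin_quadVar, Algebra.adjoin_le_iff]
  rintro _ ⟨l, rfl⟩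
  exact h l

/-- The conifold is free of rank two over its parameters, with basis `1, x₀`. -/
lemma flat_conifold : conifoldParam.toRingHom.Flat := by
  let x := quadVar conifoldQuads
  have hx : x 0 * x 1 = x 2 * x 3 := quadVar_mul conifoldQuads 0
  let Z : Fin 1 → Matrix (Fin 2) (Fin 2) (MvPolynomial (Fin 5) ℂ) :=
    ![!![0, -(X 1 * X 2); 1, X 0]]
  let u : Fin 6 → MvPolynomial (Fin 1) (MvPolynomial (Fin 5) ℂ) :=
    ![X 0, C (X 0) - X 0, C (X 1), C (X 2), C (X 3), C (X 4)]
  obtain ⟨φ, hφ, hM⟩ := exists_algHom_quadModel conifoldQuads Z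
    (fun s t => (Subsingleton.elim s t) ▸ Commute.refl _) u
  have hC : ∀ p, φ (C p) = algebraMap (MvPolynomial (Fin 5) ℂ) _ p := φ.commutes
  obtain ⟨M, hM⟩ := hM (by
    intro r
    rw [Subsingleton.elim r 0]
    simp only [conifoldQuads, u, Matrix.cons_val, map_sub, hφ, hC, Algebra.algebraMap_eq_smul_one]
    ext1 i j
    simp only [Matrix.mul_apply, Fin.sum_univ_two, Matrix.sub_apply, Matrix.smul_apply,
      Matrix.one_apply]
    fin_cases i <;> fin_cases j <;> simp [Z])
  refine flat_of_matrix (e := ![1, x 0]) (o := 0) rfl (z := ![x 0]) (Z := Z) ?_ ?_ M ?_ ?_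
  · intro t i
    rw [Subsingleton.elim t 0]
    fin_cases i
    · simp [Fin.sum_univ_two, Z]
    · simp [Fin.sum_univ_two, Z, conifoldParam]
      change x 0 * x 0 = -(x 2 * x 3) + (x 0 + x 1) * x 0
      linear_combination -hx
  · have hz : x 0 ∈ Algebra.adjoin ℂ (Set.range conifoldParam ∪ Set.range ![x 0]) :=
      Algebra.subset_adjoin (Or.inr ⟨0, rfl⟩)
    have hp : ∀ i, conifoldParam (X i) ∈
        Algebra.adjoin ℂ (Set.range conifoldParam ∪ Set.range ![x 0]) :=
      fun i => Algebra.subset_adjoin (Or.inl ⟨_, rfl⟩)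
    simp only [conifoldParam, aeval_X] at hp
    refine adjoin_range_union_eq_top fun l => ?_
    fin_cases l
    · exact hz
    · have h1 := sub_mem (hp 0) hz
      rwa [show ∀ a b : QuadModel conifoldQuads, ![a + b, x 2, x 3, x 4, x 5] 0 - a = b from
        fun a b => add_sub_cancel_left a b] at h1
    · exact hp 1
    · exact hp 2
    · exact hp 3
    · exact hp 4
  · have h1 : M.comp conifoldParam = Algebra.algHom ℂ _ _ := by
      refine MvPolynomial.algHom_ext (forall_fin_five ?_ ?_ ?_ ?_ ?_) <;>
        (simp [conifoldParam, hM, u, hC]; rfl)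
    exact fun p => congrArg (fun f : _ →ₐ[ℂ] _ => f p) h1
  · intro i
    fin_cases i
    · simp only [Fin.zero_eta, Matrix.cons_val_zero, map_one]
      ext j
      fin_cases j <;> simp
    · simp only [Fin.mk_one, Matrix.cons_val, x, hM, u, hφ, Z]
      ext j
      fin_cases j <;> simp

section PentagonMatrices

variable {P : Type} [CommRing P] (B D H p q : P)

/-- Multiplication by `A`, `F` and `C` in the basis `1, A, F, C, AC` of the pentagonal model, where
`p = A + G + C` and `q = F + E + C`. -/
def pentagonMatrix : Fin 3 → Matrix (Fin 5) (Fin 5) P :=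
  ![!![0, 0, -(B * D), 0, 0;
      1, p, q, 0, H * p - B * H;
      0, -B, 0, 0, -(H * B);
      0, 0, 0, 0, B * D;
      0, -1, -1, 1, p - q - H],
    !![0, -(B * D), -(D * p), 0, 0;
      0, q, D - H, H, H * p;
      1, 0, q, 0, -(H * B);
      0, 0, D, 0, 0;
      0, -1, 0, 0, -H],
    !![0, 0, 0, -(B * H), 0;
      0, 0, H, 0, -(H * p);
      0, 0, 0, 0, H * B;
      1, 0, 0, p, -(B * D);
      0, 1, 0, -1, q + H]]

local notation "𝐙" => pentagonMatrix B D H p q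

lemma pentagonMatrix_one_mul_two : 𝐙 1 * 𝐙 2 = H • 𝐙 0 := by
  ext i j
  simp only [Matrix.mul_apply, Fin.sum_univ_five, Matrix.smul_apply, pentagonMatrix]
  revert i j
  refine forall_fin_five ?_ ?_ ?_ ?_ ?_ <;> refine forall_fin_five ?_ ?_ ?_ ?_ ?_ <;>
    simp only [Matrix.cons_val', Matrix.cons_val, Matrix.of_apply] <;> ring

lemma pentagonMatrix_two_mul_one : 𝐙 2 * 𝐙 1 = H • 𝐙 0 := by
  ext i j
  simp only [Matrix.mul_apply, Fin.sum_univ_five, Matrix.smul_apply, pentagonMatrix]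
  revert i j
  refine forall_fin_five ?_ ?_ ?_ ?_ ?_ <;> refine forall_fin_five ?_ ?_ ?_ ?_ ?_ <;>
    simp only [Matrix.cons_val', Matrix.cons_val, Matrix.of_apply] <;> ring

lemma pentagonMatrix_two_mul_zero : 𝐙 2 * 𝐙 0 = 𝐙 0 * 𝐙 2 := by
  ext i j
  simp only [Matrix.mul_apply, Fin.sum_univ_five, pentagonMatrix]
  revert i j
  refine forall_fin_five ?_ ?_ ?_ ?_ ?_ <;> refine forall_fin_five ?_ ?_ ?_ ?_ ?_ <;>
    simp only [Matrix.cons_val', Matrix.cons_val, Matrix.of_apply] <;> ring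

lemma pentagonMatrix_zero_mul_one :
    𝐙 0 * 𝐙 1 = q • 𝐙 0 - 𝐙 0 * 𝐙 2 - (B * D) • (1 : Matrix (Fin 5) (Fin 5) P) := by
  ext i j
  simp only [Matrix.mul_apply, Fin.sum_univ_five, Matrix.sub_apply, Matrix.smul_apply,
    Matrix.one_apply, pentagonMatrix]
  revert i j
  refine forall_fin_five ?_ ?_ ?_ ?_ ?_ <;> refine forall_fin_five ?_ ?_ ?_ ?_ ?_ <;>
    simp only [Matrix.cons_val', Matrix.cons_val, Matrix.of_apply, Fin.reduceEq, reduceIte] <;> ring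

lemma pentagonMatrix_one_mul_zero :
    𝐙 1 * 𝐙 0 = q • 𝐙 0 - 𝐙 0 * 𝐙 2 - (B * D) • (1 : Matrix (Fin 5) (Fin 5) P) := by
  ext i j
  simp only [Matrix.mul_apply, Fin.sum_univ_five, Matrix.sub_apply, Matrix.smul_apply,
    Matrix.one_apply, pentagonMatrix]
  revert i j
  refine forall_fin_five ?_ ?_ ?_ ?_ ?_ <;> refine forall_fin_five ?_ ?_ ?_ ?_ ?_ <;>
    simp only [Matrix.cons_val', Matrix.cons_val, Matrix.of_apply, Fin.reduceEq, reduceIte] <;> ring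

lemma pentagonMatrix_zero_sq : 𝐙 0 * 𝐙 0 = p • 𝐙 0 - 𝐙 0 * 𝐙 2 - B • 𝐙 1 := by
  ext i j
  simp only [Matrix.mul_apply, Fin.sum_univ_five, Matrix.sub_apply, Matrix.smul_apply,
    pentagonMatrix]
  revert i j
  refine forall_fin_five ?_ ?_ ?_ ?_ ?_ <;> refine forall_fin_five ?_ ?_ ?_ ?_ ?_ <;>
    simp only [Matrix.cons_val', Matrix.cons_val, Matrix.of_apply] <;> ring

lemma pentagonMatrix_one_sq : 𝐙 1 * 𝐙 1 = q • 𝐙 1 - 𝐙 1 * 𝐙 2 -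
    (p • 1 - 𝐙 0 - 𝐙 2) * (D • (1 : Matrix (Fin 5) (Fin 5) P)) := by
  rw [mul_smul_comm, mul_one]
  ext i j
  simp only [Matrix.mul_apply, Fin.sum_univ_five, Matrix.sub_apply, Matrix.smul_apply,
    Matrix.one_apply, pentagonMatrix]
  revert i j
  refine forall_fin_five ?_ ?_ ?_ ?_ ?_ <;> refine forall_fin_five ?_ ?_ ?_ ?_ ?_ <;>
    simp only [Matrix.cons_val', Matrix.cons_val, Matrix.of_apply, Fin.reduceEq, reduceIte] <;> ring

lemma pentagonMatrix_two_sq : 𝐙 2 * 𝐙 2 =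
    p • 𝐙 2 - 𝐙 0 * 𝐙 2 - (B * H) • (1 : Matrix (Fin 5) (Fin 5) P) := by
  ext i j
  simp only [Matrix.mul_apply, Fin.sum_univ_five, Matrix.sub_apply, Matrix.smul_apply,
    Matrix.one_apply, pentagonMatrix]
  revert i j
  refine forall_fin_five ?_ ?_ ?_ ?_ ?_ <;> refine forall_fin_five ?_ ?_ ?_ ?_ ?_ <;>
    simp only [Matrix.cons_val', Matrix.cons_val, Matrix.of_apply, Fin.reduceEq, reduceIte] <;> ring

lemma commute_pentagonMatrix (s t : Fin 3) : Commute (𝐙 s) (𝐙 t) := by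
  have h01 : Commute (𝐙 0) (𝐙 1) :=
    (pentagonMatrix_zero_mul_one ..).trans (pentagonMatrix_one_mul_zero ..).symm
  have h02 : Commute (𝐙 0) (𝐙 2) := (pentagonMatrix_two_mul_zero ..).symm
  have h12 : Commute (𝐙 1) (𝐙 2) :=
    (pentagonMatrix_one_mul_two ..).trans (pentagonMatrix_two_mul_one ..).symm
  fin_cases s <;> fin_cases t
  exacts [Commute.refl _, h01, h02, h01.symm, Commute.refl _, h12, h02.symm, h12.symm,
    Commute.refl _]

end PentagonMatrices

lemma exists_algHom_pentagon {P A : Type} [CommRing P] [Algebra ℂ P] [Ring A] [Algebra P A]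
    [Algebra ℂ A] [IsScalarTower ℂ P A] {B D H p q : P} {Z : Fin 3 → A}
    (hZ : ∀ s t, Commute (Z s) (Z t))
    (h00 : Z 0 * Z 0 = p • Z 0 - Z 0 * Z 2 - B • Z 1)
    (h01 : Z 0 * Z 1 = q • Z 0 - Z 0 * Z 2 - (B * D) • 1)
    (h11 : Z 1 * Z 1 = q • Z 1 - Z 1 * Z 2 - (p • 1 - Z 0 - Z 2) * (D • 1))
    (h12 : Z 1 * Z 2 = H • Z 0)
    (h22 : Z 2 * Z 2 = p • Z 2 - Z 0 * Z 2 - (B * H) • 1) :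
    ∃ M : QuadModel pentagonQuads →ₐ[ℂ] A, ∀ l, M (quadVar pentagonQuads l) =
      ![Z 0, B • 1, Z 2, D • 1, q • 1 - Z 1 - Z 2, Z 1, p • 1 - Z 0 - Z 2, H • 1] l := by
  let u : Fin 8 → MvPolynomial (Fin 3) P :=
    ![X 0, C B, X 2, C D, C q - X 1 - X 2, X 1, C p - X 0 - X 2, C H]
  obtain ⟨φ, hφ, hM⟩ := exists_algHom_quadModel pentagonQuads Z hZ u
  have hC : ∀ p, φ (C p) = p • 1 := fun p =>
    (φ.commutes p).trans (Algebra.algebraMap_eq_smul_one p)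
  have hu : ∀ l, φ (u l) =
      ![Z 0, B • 1, Z 2, D • 1, q • 1 - Z 1 - Z 2, Z 1, p • 1 - Z 0 - Z 2, H • 1] l := by
    intro l
    fin_cases l <;> simp [u, hφ, hC]
  obtain ⟨M, hM⟩ := hM (by
    simp only [hu]
    refine forall_fin_five ?_ ?_ ?_ ?_ ?_
    · change Z 0 * (p • 1 - Z 0 - Z 2) = B • 1 * Z 1
      rw [mul_sub, mul_sub, h00, mul_smul_comm, mul_one, smul_mul_assoc, one_mul]
      abel
    · change Z 0 * (q • 1 - Z 1 - Z 2) = B • 1 * D • 1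
      rw [mul_sub, mul_sub, h01, mul_smul_comm, mul_one, smul_mul_assoc, one_mul, smul_smul]
      abel
    · change Z 1 * (q • 1 - Z 1 - Z 2) = (p • 1 - Z 0 - Z 2) * D • 1
      rw [mul_sub, mul_sub, h11, mul_smul_comm, mul_one]
      abel
    · change Z 1 * Z 2 = Z 0 * H • 1
      rw [h12, mul_smul_comm, mul_one]
    · change (p • 1 - Z 0 - Z 2) * Z 2 = B • 1 * H • 1
      rw [sub_mul, sub_mul, h22, smul_mul_assoc, one_mul, smul_mul_assoc, one_mul, smul_smul]
      abel)
  exact ⟨M, fun l => (hM l).trans (hu l)⟩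

lemma map_pentagonMatrix {P N : Type} [CommRing P] [CommRing N] (f : P →+* N) (B D H p q : P)
    (t : Fin 3) (j i : Fin 5) : f (pentagonMatrix B D H p q t j i) =
      pentagonMatrix (f B) (f D) (f H) (f p) (f q) t j i := by
  fin_cases t <;> fin_cases j <;> fin_cases i <;> simp [pentagonMatrix]

lemma sum_pentagonMatrix {N : Type} [CommRing N] {A B C D E F G H : N} (h1 : A * G = B * F)
    (h2 : A * E = B * D) (h3 : F * E = G * D) (h4 : F * C = A * H) (h5 : G * C = B * H) (t : Fin 3)
    (i : Fin 5) : ![A, F, C] t * ![1, A, F, C, A * C] i =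
      ∑ j, pentagonMatrix B D H (A + G + C) (F + E + C) t j i * ![1, A, F, C, A * C] j := by
  have h6 : A * C * C = (F + E + C + H) * (A * C) - H * (A + G + C) * A + H * B * F - B * D * C := by
    linear_combination -A * h4 - C * h2 + H * h1
  fin_cases t <;> fin_cases i <;> simp [Fin.sum_univ_five, pentagonMatrix]
  · linear_combination -h1
  · linear_combination -h2
  · linear_combination (A - B) * h4 + C * h2 - (C + H) * h1
  · linear_combination -h2
  · linear_combination -h3 - h4
  · linear_combination h4
  · linear_combination A * h4 - H * h1
  · ring
  · linear_combination h4
  · linear_combination -h5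
  · linear_combination h6

/-- The pentagonal model is free of rank five over its parameters, with basis `1, A, F, C, AC`. -/
lemma flat_pentagon : pentagonParam.toRingHom.Flat := by
  let x := quadVar pentagonQuads
  have hp : ∀ i, pentagonParam (X i) = ![x 1, x 3, x 7, x 0 + x 6 + x 2, x 5 + x 4 + x 2] i :=
    fun i => aeval_X _ i
  obtain ⟨M, hM⟩ := exists_algHom_pentagon
    (commute_pentagonMatrix (X 0 : MvPolynomial (Fin 5) ℂ) (X 1) (X 2) (X 3) (X 4))
    (pentagonMatrix_zero_sq ..) (pentagonMatrix_zero_mul_one ..) (pentagonMatrix_one_sq ..)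
    (pentagonMatrix_one_mul_two ..) (pentagonMatrix_two_sq ..)
  refine flat_of_matrix (e := ![1, x 0, x 5, x 2, x 0 * x 2]) (o := 0) rfl (z := ![x 0, x 5, x 2])
    (Z := pentagonMatrix (X 0) (X 1) (X 2) (X 3) (X 4)) (fun t i => ?_) ?_ M ?_ ?_
  · have h1 : ∀ j, pentagonParam (pentagonMatrix (X 0) (X 1) (X 2) (X 3) (X 4) t j i) =
        pentagonMatrix (x 1) (x 3) (x 7) (x 0 + x 6 + x 2) (x 5 + x 4 + x 2) t j i := by
      intro j
      have h2 := map_pentagonMatrix pentagonParam.toRingHom (X 0) (X 1) (X 2) (X 3) (X 4) t j i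
      simp only [AlgHom.toRingHom_eq_coe, RingHom.coe_coe, hp] at h2
      exact h2
    simp only [h1]
    exact sum_pentagonMatrix (quadVar_mul pentagonQuads 0) (quadVar_mul pentagonQuads 1)
      (quadVar_mul pentagonQuads 2) (quadVar_mul pentagonQuads 3) (quadVar_mul pentagonQuads 4) t i
  · have hz : ∀ t, ![x 0, x 5, x 2] t ∈
        Algebra.adjoin ℂ (Set.range pentagonParam ∪ Set.range ![x 0, x 5, x 2]) :=
      fun t => Algebra.subset_adjoin (Or.inr ⟨t, rfl⟩)
    have hx : ∀ i, ![x 1, x 3, x 7, x 0 + x 6 + x 2, x 5 + x 4 + x 2] i ∈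
        Algebra.adjoin ℂ (Set.range pentagonParam ∪ Set.range ![x 0, x 5, x 2]) :=
      fun i => hp i ▸ Algebra.subset_adjoin (Or.inl ⟨_, rfl⟩)
    have h7 : ∀ a b c : QuadModel pentagonQuads, a + b + c - a - c = b := fun a b c => by ring
    have h6 : x 6 ∈ Algebra.adjoin ℂ (Set.range pentagonParam ∪ Set.range ![x 0, x 5, x 2]) :=
      h7 (x 0) (x 6) (x 2) ▸ sub_mem (sub_mem (hx 3) (hz 0)) (hz 2)
    have h4 : x 4 ∈ Algebra.adjoin ℂ (Set.range pentagonParam ∪ Set.range ![x 0, x 5, x 2]) :=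
      h7 (x 5) (x 4) (x 2) ▸ sub_mem (sub_mem (hx 4) (hz 1)) (hz 2)
    refine adjoin_range_union_eq_top fun l => ?_
    fin_cases l
    exacts [hz 0, hx 0, hz 2, hx 1, h4, hz 1, h6, hx 2]
  · have h1 : M.comp pentagonParam =
        (Algebra.ofId (MvPolynomial (Fin 5) ℂ) (Matrix (Fin 5) (Fin 5) _)).restrictScalars ℂ := by
      refine MvPolynomial.algHom_ext fun i => ?_
      rw [AlgHom.comp_apply, hp]
      change _ = algebraMap (MvPolynomial (Fin 5) ℂ) (Matrix (Fin 5) (Fin 5) _) (X i)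
      rw [Algebra.algebraMap_eq_smul_one]
      revert i
      refine forall_fin_five ?_ ?_ ?_ ?_ ?_
      · exact hM 1
      · exact hM 3
      · exact hM 7
      · change M (x 0 + x 6 + x 2) = _
        rw [map_add, map_add, hM, hM, hM]
        simp only [Matrix.cons_val]
        abel
      · change M (x 5 + x 4 + x 2) = _
        rw [map_add, map_add, hM, hM, hM]
        simp only [Matrix.cons_val]
        abel
    exact fun p => congrArg (fun f : _ →ₐ[ℂ] _ => f p) h1
  · have hA : M (x 0) = _ := hM 0
    have hC : M (x 2) = _ := hM 2
    have hF : M (x 5) = _ := hM 5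
    refine forall_fin_five ?_ ?_ ?_ ?_ ?_
    · change (M 1).col 0 = _
      rw [map_one]
      ext1 j
      fin_cases j <;> simp
    · change (M (x 0)).col 0 = _
      rw [hA]
      ext1 j
      fin_cases j <;> simp [pentagonMatrix]
    · change (M (x 5)).col 0 = _
      rw [hF]
      ext1 j
      fin_cases j <;> simp [pentagonMatrix]
    · change (M (x 2)).col 0 = _
      rw [hC]
      ext1 j
      fin_cases j <;> simp [pentagonMatrix]
    · change (M (x 0 * x 2)).col 0 = _
      rw [map_mul, hA, hC]
      ext1 j
      simp only [Matrix.col_apply, Matrix.cons_val, Matrix.mul_apply, Fin.sum_univ_five,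
        pentagonMatrix]
      fin_cases j <;> simp

end Models

/-! ### Local rings with a quadratic model -/

section QuadraticLocal

open MvPolynomial

lemma quad_algHom_ext {n m : ℕ} {q : Fin m → Fin n × Fin n × Fin n × Fin n} {S : Type} [Semiring S]
    [Algebra ℂ S] {f g : QuadModel q →ₐ[ℂ] S} (h : ∀ l, f (quadVar q l) = g (quadVar q l)) :
    f = g := by
  refine Ideal.Quotient.algHom_ext _ ?_
  ext l
  exact h l

variable {n m : ℕ} {q : Fin m → Fin n × Fin n × Fin n × Fin n} {R : Type} [CommRing R] [Algebra ℂ R]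
  [IsLocalRing R] {g : QuadModel q →ₐ[ℂ] R} {c : QuadModel q →ₐ[ℂ] ℂ}

/-- Where the gradients of all the binomials vanish the tangent space has dimension `n`. -/
theorem IsLocalModel.not_isRegularLocalRing_quad (h : IsLocalModel g c) {d : ℕ}
    (hdim : ringKrullDim R ≤ d) (hdn : d < n)
    (hc : ∀ r, c (quadVar q (q r).1) = 0 ∧ c (quadVar q (q r).2.1) = 0 ∧
      c (quadVar q (q r).2.2.1) = 0 ∧ c (quadVar q (q r).2.2.2) = 0) : ¬ IsRegularLocalRing R := by
  let y : Fin n → TrivSqZeroExt ℂ (Fin n → ℂ) := fun l =>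
    algebraMap ℂ _ (c (quadVar q l)) + TrivSqZeroExt.inr (Pi.single l 1)
  let τ : QuadModel q →ₐ[ℂ] TrivSqZeroExt ℂ (Fin n → ℂ) := quadLift q y (by
    intro r
    obtain ⟨h1, h2, h3, h4⟩ := hc r
    simp only [y, h1, h2, h3, h4, map_zero, zero_add, TrivSqZeroExt.inr_mul_inr])
  refine h.not_isRegularLocalRing hdim hdn τ (fun a => ?_) fun l =>
    ⟨quadVar q l - algebraMap ℂ _ (c (quadVar q l)), ?_⟩
  · have h1 : (TrivSqZeroExt.fstHom ℂ ℂ (Fin n → ℂ)).comp τ = c := by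
      refine quad_algHom_ext fun l => ?_
      rw [AlgHom.comp_apply, quadLift_quadVar, map_add, AlgHom.commutes]
      simp
    exact congrArg (fun f : QuadModel q →ₐ[ℂ] ℂ => f a) h1
  · rw [map_sub, quadLift_quadVar, AlgHom.commutes, add_sub_cancel_left]

theorem isRegularLocalRing_of_isLocalModel_smooth [IsNoetherianRing R]
    (hdim : ringKrullDim R ≤ (5 : ℕ)) {g : QuadModel smoothQuads →ₐ[ℂ] R}
    {c : QuadModel smoothQuads →ₐ[ℂ] ℂ} (h : IsLocalModel g c) :
    IsCohenMacaulayLocal R ∧ IsRegularLocalRing R := by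
  obtain ⟨hCM, hd⟩ := h.isCohenMacaulayLocal hdim flat_smooth
  exact ⟨hCM, isRegularLocalRing_of_span hd (h.maximalIdeal_eq_span (adjoin_quadVar _))⟩

lemma span_range_eq_succAbove {R : Type} [CommRing R] {n : ℕ} {y : Fin (n + 1) → R} {i : Fin (n + 1)}
    (h : y i ∈ Ideal.span (Set.range fun l => y (i.succAbove l))) :
    Ideal.span (Set.range y) = Ideal.span (Set.range fun l => y (i.succAbove l)) := by
  refine le_antisymm (Ideal.span_le.2 ?_) (Ideal.span_mono ?_)
  · rintro _ ⟨l, rfl⟩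
    rcases Fin.eq_self_or_eq_succAbove i l with rfl | ⟨l, rfl⟩
    · exact h
    · exact Ideal.subset_span ⟨l, rfl⟩
  · rintro _ ⟨l, rfl⟩
    exact ⟨_, rfl⟩

/-- The differential of `x₀ x₁ - x₂ x₃` at a point where `x₁` does not vanish eliminates `x₀`. -/
lemma sub_mem_span_of_isUnit {R : Type} [CommRing R] {I : Ideal R} {a₀ a₁ a₂ a₃ c₀ c₁ c₂ c₃ : R}
    (ha : a₀ * a₁ = a₂ * a₃) (hc : c₀ * c₁ = c₂ * c₃) (hu : IsUnit a₁) (h1 : a₁ - c₁ ∈ I)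
    (h2 : a₂ - c₂ ∈ I) (h3 : a₃ - c₃ ∈ I) : a₀ - c₀ ∈ I := by
  rw [← Ideal.mul_unit_mem_iff_mem I hu]
  have : (a₀ - c₀) * a₁ = a₃ * (a₂ - c₂) + c₂ * (a₃ - c₃) - c₀ * (a₁ - c₁) := by
    linear_combination ha - hc
  rw [this]
  exact sub_mem (add_mem (Ideal.mul_mem_left _ _ h2) (Ideal.mul_mem_left _ _ h3))
    (Ideal.mul_mem_left _ _ h1)

lemma quadIdeal_conifoldQuads : quadIdeal conifoldQuads =
    Ideal.span {(X 0 * X 1 - X 2 * X 3 : MvPolynomial (Fin 6) ℂ)} := by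
  rw [quadIdeal, Set.range_unique]
  rfl

section Conifold

variable {g : QuadModel conifoldQuads →ₐ[ℂ] R} {c : QuadModel conifoldQuads →ₐ[ℂ] ℂ}

theorem IsLocalModel.isRegularLocalRing_conifold [IsNoetherianRing R] (h : IsLocalModel g c)
    (hd : ringKrullDim R = (5 : ℕ)) {i : Fin 4}
    (hi : c (quadVar conifoldQuads (Fin.castLE (by norm_num) i)) ≠ 0) : IsRegularLocalRing R := by
  let a : Fin 6 → R := fun l => g (quadVar conifoldQuads l)
  let b : Fin 6 → R := fun l => algebraMap ℂ R (c (quadVar conifoldQuads l))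
  have ha : a 0 * a 1 = a 2 * a 3 := by
    have h1 := congrArg g (quadVar_mul conifoldQuads 0)
    rwa [map_mul, map_mul] at h1
  have hb : b 0 * b 1 = b 2 * b 3 := by
    have h1 := congrArg (fun x => algebraMap ℂ R (c x)) (quadVar_mul conifoldQuads 0)
    simp only [map_mul] at h1
    exact h1
  have hmax := h.maximalIdeal_eq_span (adjoin_quadVar _)
  have hu : IsUnit (a (Fin.castLE (by norm_num) i)) := h.isUnit _ hi
  have key : ∀ k : Fin 6, (∀ I : Ideal R, (∀ l, l ≠ k → a l - b l ∈ I) → a k - b k ∈ I) →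
      IsRegularLocalRing R := by
    intro k hk
    refine isRegularLocalRing_of_span hd (hmax.trans (span_range_eq_succAbove (i := k) ?_))
    refine hk _ fun l hl => ?_
    obtain ⟨l, rfl⟩ := Fin.exists_succAbove_eq hl
    exact Ideal.subset_span ⟨l, rfl⟩
  fin_cases i
  · exact key 1 fun I hI => sub_mem_span_of_isUnit (a₁ := a 0) (c₁ := b 0) (by rw [mul_comm, ha])
      (by rw [mul_comm, hb]) hu (hI 0 (by decide)) (hI 2 (by decide)) (hI 3 (by decide))
  · exact key 0 fun I hI => sub_mem_span_of_isUnit ha hb hu (hI 1 (by decide)) (hI 2 (by decide))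
      (hI 3 (by decide))
  · exact key 3 fun I hI => sub_mem_span_of_isUnit (a₁ := a 2) (c₁ := b 2) (by rw [mul_comm, ← ha])
      (by rw [mul_comm, ← hb]) hu (hI 2 (by decide)) (hI 0 (by decide)) (hI 1 (by decide))
  · exact key 2 fun I hI => sub_mem_span_of_isUnit ha.symm hb.symm hu (hI 3 (by decide))
      (hI 0 (by decide)) (hI 1 (by decide))

theorem IsLocalModel.isConifoldLocal (h : IsLocalModel g c)
    (hc : ∀ i : Fin 4, c (quadVar conifoldQuads (Fin.castLE (by norm_num) i)) = 0) :
    IsConifoldLocal R := by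
  let T := MvPolynomial.translate fun l => -c (quadVar conifoldQuads l)
  have hT : ∀ l, T (X l) = X l + C (-c (quadVar conifoldQuads l)) := fun l => aeval_X _ l
  let F : MvPolynomial (Fin 6) ℂ := X 0 * X 1 - X 2 * X 3
  have hF : T F = F := by
    have h0 : c (quadVar conifoldQuads 0) = 0 := hc 0
    have h1 : c (quadVar conifoldQuads 1) = 0 := hc 1
    have h2 : c (quadVar conifoldQuads 2) = 0 := hc 2
    have h3 : c (quadVar conifoldQuads 3) = 0 := hc 3
    simp only [F, map_sub, map_mul, hT]
    simp [h0, h1, h2, h3]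
  let π : MvPolynomial (Fin 6) ℂ →ₐ[ℂ] QuadModel conifoldQuads :=
    (Ideal.Quotient.mkₐ ℂ _).comp T.toAlgHom
  have hπ : Function.Surjective π := Ideal.Quotient.mk_surjective.comp T.surjective
  have hker : RingHom.ker π = Ideal.span {F} := by
    ext f
    rw [RingHom.mem_ker]
    change Ideal.Quotient.mk _ (T f) = 0 ↔ _
    rw [Ideal.Quotient.eq_zero_iff_mem, quadIdeal_conifoldQuads, Ideal.mem_span_singleton,
      Ideal.mem_span_singleton]
    change F ∣ T f ↔ _
    nth_rewrite 1 [← hF]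
    exact map_dvd_iff T
  have h1 := h.nonempty_adicCompletion_algEquiv hπ hker (fun l => by
    change c (Ideal.Quotient.mk _ (T (X l))) = 0
    rw [hT, map_add, map_add]
    change c (quadVar _ l) + c (algebraMap ℂ _ _) = 0
    rw [AlgHom.commutes]
    simp)
  have h2 : (F : MvPowerSeries (Fin 6) ℂ) = MvPowerSeries.X 0 * MvPowerSeries.X 1 -
      MvPowerSeries.X 2 * MvPowerSeries.X 3 := by
    change MvPolynomial.coeToMvPowerSeries.ringHom F = _
    simp only [F, map_sub, map_mul, MvPolynomial.coeToMvPowerSeries.ringHom_apply,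
      MvPolynomial.coe_X]
  rwa [h2] at h1

/-- The trichotomy at a conifold chart: the local ring is Cohen-Macaulay, and either regular or a
conifold singularity according to whether one of the first four variables is non-zero. -/
theorem IsLocalModel.conifold [IsNoetherianRing R] (h : IsLocalModel g c)
    (hdim : ringKrullDim R ≤ (5 : ℕ)) :
    IsCohenMacaulayLocal R ∧ (¬ IsRegularLocalRing R ↔
      ∀ i : Fin 4, c (quadVar conifoldQuads (Fin.castLE (by norm_num) i)) = 0) ∧
    ((∀ i : Fin 4, c (quadVar conifoldQuads (Fin.castLE (by norm_num) i)) = 0) →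
      IsConifoldLocal R) := by
  obtain ⟨hCM, hd⟩ := h.isCohenMacaulayLocal hdim flat_conifold
  refine ⟨hCM, ⟨fun hR => ?_, fun hc => ?_⟩, h.isConifoldLocal⟩
  · by_contra! hc
    obtain ⟨i, hi⟩ := hc
    exact hR (h.isRegularLocalRing_conifold hd hi)
  · refine h.not_isRegularLocalRing_quad hdim (by norm_num) fun r => ?_
    rw [Subsingleton.elim r 0]
    exact ⟨hc 0, hc 1, hc 2, hc 3⟩

end Conifold

end QuadraticLocal

/-! ### The local charts of the toric fibre -/

section LocalCharts

open MvPolynomial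

/-- Combinatorial data identifying the toric variety, near points where the coordinates `base` and
`other` do not vanish, with an affine toric variety with `n` variables. The `l`-th variable is the
quotient of the coordinates `num l` and `base`; up to a common factor the `k`-th coordinate is the
product of the variables in the list `word k`; and `toStd` is a change of coordinates of the lattice
that brings the characters of the variables into a standard form. -/
structure LocalChart (n : ℕ) where
  base : Fin 14
  other : Fin 14
  num : Fin n → Fin 14
  word : Fin 14 → List (Fin n)
  toStd : Fin 5 → Fin 5 → ℤ

/-- The homogeneous coordinates of a closed point of a chart, normalized on that chart. -/
def pointCoord {i : Fin 14} (p : Chart toricIdeal i →ₐ[ℂ] ℂ) (k : Fin 14) : ℂ :=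
  p (Ideal.Quotient.mk _ (X k))

namespace LocalChart

variable {n m : ℕ} (D : LocalChart n)

/-- The character of the `l`-th variable. -/
def dir (l : Fin n) : Fin 5 → ℤ := character (D.num l) - character D.base

/-- The data are consistent with the standard form `std` of the characters of the variables. -/
def IsConsistent (std : Fin n → Fin 5 → ℤ) : Prop :=
  (∀ l i, ∑ j, D.toStd i j * D.dir l j = std l i) ∧
  ∀ k i, ((D.word k).map fun l => D.dir l i).sum =
    character k i - (character D.base i + character D.base i - character D.other i)

instance (std : Fin n → Fin 5 → ℤ) : Decidable (D.IsConsistent std) := by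
  unfold IsConsistent
  infer_instance

/-- The conditions on a presentation by binomials `xₐ x_b - x_c x_d` and on characters `std`
under which it presents the algebra generated by these characters. -/
structure IsPresentation (q : Fin m → Fin n × Fin n × Fin n × Fin n) (std : Fin n → Fin 5 → ℤ) :
    Prop where
  ne : ∀ r, (q r).1 ≠ (q r).2.1
  weight : ∃ μ : Fin n → ℕ, ∀ r, μ (q r).2.2.1 + μ (q r).2.2.2 < μ (q r).1 + μ (q r).2.1
  inj : ∀ e e' : Fin n →₀ ℕ, IsStandard q e → IsStandard q e' →
    (∀ i, ∑ l, (e l : ℤ) * std l i = ∑ l, (e' l : ℤ) * std l i) → e = e'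

variable {D}

lemma chi_list_sum (L : List (Fin n)) (b : Fin n → Fin 5 → ℤ) :
    chi (L.map b).sum = (L.map fun l => chi (b l)).prod := by
  induction L with
  | nil => exact chi_zero
  | cons l L ih => rw [List.map_cons, List.map_cons, List.sum_cons, List.prod_cons, chi_add, ih]

lemma IsConsistent.sum_word {std : Fin n → Fin 5 → ℤ} (hD : D.IsConsistent std) (k : Fin 14) :
    ((D.word k).map D.dir).sum =
      character k - (character D.base + character D.base - character D.other) := by
  ext i
  rw [Pi.sub_apply, Pi.sub_apply, Pi.add_apply, ← hD.2 k i]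
  generalize D.word k = L
  induction L with
  | nil => rfl
  | cons l L ih =>
    rw [List.map_cons, List.map_cons, List.sum_cons, List.sum_cons, Pi.add_apply, ih]

lemma IsConsistent.sum_mul_std {std : Fin n → Fin 5 → ℤ} (hD : D.IsConsistent std) (e : Fin n →₀ ℕ)
    (i : Fin 5) : ∑ l, (e l : ℤ) * std l i = ∑ j, D.toStd i j * (∑ l, e l • D.dir l) j := by
  have h2 : ∀ j, (∑ l, e l • D.dir l) j = ∑ l, (e l : ℤ) * D.dir l j := fun j =>
    (Finset.sum_apply _ _ _).trans (Finset.sum_congr rfl fun l _ =>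
      (Pi.smul_apply _ _ _).trans (nsmul_eq_mul _ _))
  simp only [← hD.1, Finset.mul_sum, h2]
  rw [Finset.sum_comm]
  exact Finset.sum_congr rfl fun j _ => Finset.sum_congr rfl fun l _ => mul_left_comm _ _ _

lemma exists_injective {q : Fin m → Fin n × Fin n × Fin n × Fin n} {std : Fin n → Fin 5 → ℤ}
    (hq : IsPresentation q std) (hD : D.IsConsistent std)
    (hrel : ∀ r, D.dir (q r).1 + D.dir (q r).2.1 = D.dir (q r).2.2.1 + D.dir (q r).2.2.2) :
    ∃ h : QuadModel q →ₐ[ℂ] Laurent, Function.Injective h ∧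
      ∀ l, h (quadVar q l) = chi (D.dir l) := by
  obtain ⟨μ, hμ⟩ := hq.weight
  have hb' : ∀ r, chi (D.dir (q r).1) * chi (D.dir (q r).2.1) =
      chi (D.dir (q r).2.2.1) * chi (D.dir (q r).2.2.2) := by
    intro r
    rw [← chi_add, ← chi_add, hrel]
  refine ⟨quadLift q (fun l => chi (D.dir l)) hb', ?_,
    fun l => quadLift_quadVar (y := fun l => chi (D.dir l)) q hb' l⟩
  refine quadLift_injective (b := D.dir) hq.ne hμ hb' fun e e' he he' h => ?_
  refine hq.inj e e' he he' fun i => ?_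
  rw [hD.sum_mul_std, hD.sum_mul_std, h]

/-- A coordinate vanishes at a point if and only if one of the factors of its word does. -/
theorem exists_isLocalModel {q : Fin m → Fin n × Fin n × Fin n × Fin n} {std : Fin n → Fin 5 → ℤ}
    (hq : IsPresentation q std) (hD : D.IsConsistent std)
    (hrel : ∀ r, D.dir (q r).1 + D.dir (q r).2.1 = D.dir (q r).2.2.1 + D.dir (q r).2.2.2)
    {i : Fin 14} {𝔪 : Ideal (Chart toricIdeal i)} [𝔪.IsMaximal]
    {p : Chart toricIdeal i →ₐ[ℂ] ℂ} (hp : RingHom.ker p = 𝔪)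
    (hb : pointCoord p D.base ≠ 0) (ho : pointCoord p D.other ≠ 0) :
    ∃ (g : QuadModel q →ₐ[ℂ] Localization.AtPrime 𝔪) (c : QuadModel q →ₐ[ℂ] ℂ),
      IsLocalModel (R := Localization.AtPrime 𝔪) g c ∧
      (∀ l, c (quadVar q l) = 0 ↔ pointCoord p (D.num l) = 0) ∧
      ∀ k, pointCoord p k = 0 ↔ ∃ l ∈ D.word k, pointCoord p (D.num l) = 0 := by
  obtain ⟨h, hinj, hh⟩ := exists_injective hq hD hrel
  have hword : ∀ k, h ((D.word k).map (quadVar q)).prod =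
      chi (character k - (character D.base + character D.base - character D.other)) := by
    intro k
    rw [map_list_prod, List.map_map, ← hD.sum_word k, chi_list_sum]
    congr 2
    exact funext hh
  obtain ⟨g, c, hgc, hnum, hw0, hw⟩ := _root_.exists_isLocalModel (𝔪 := 𝔪) hinj (adjoin_quadVar q)
    (num := D.num) (den := fun _ => D.base) hh hword hp (fun _ => hb) (j₀ := D.base) (a := D.other)
    (b := D.base) (by rw [sub_sub_eq_add_sub, add_sub_add_left_eq_sub]) ho
  change ∀ l, _ * pointCoord p D.base = pointCoord p (D.num l) at hnum
  change ∀ k, _ * pointCoord p D.base = _ * pointCoord p k at hw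
  have hc : ∀ l, c (quadVar q l) = 0 ↔ pointCoord p (D.num l) = 0 := by
    intro l
    rw [← hnum l, mul_eq_zero, or_iff_left hb]
  refine ⟨g, c, hgc, hc, fun k => ?_⟩
  have h1 : pointCoord p k = 0 ↔ c ((D.word k).map (quadVar q)).prod = 0 := by
    have h2 := hw k
    constructor
    · intro h
      rw [h, mul_zero] at h2
      exact (mul_eq_zero.1 h2).resolve_right hb
    · intro h
      rw [h, zero_mul] at h2
      exact (mul_eq_zero.1 h2.symm).resolve_left hw0
  rw [h1, map_list_prod, List.prod_eq_zero_iff]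
  simp only [List.mem_map]
  constructor
  · rintro ⟨_, ⟨l, hl, rfl⟩, h⟩
    exact ⟨l, hl, (hc l).1 h⟩
  · rintro ⟨l, hl, h⟩
    exact ⟨_, ⟨l, hl, rfl⟩, (hc l).2 h⟩

end LocalChart

open LocalChart

/-- The exponents of the coordinates of affine space. -/
def smoothStd : Fin 5 → Fin 5 → ℤ := fun l i => if i = l then 1 else 0

/-- Exponents of a monomial parametrization of `x₀ x₁ = x₂ x₃`. -/
def conifoldStd : Fin 6 → Fin 5 → ℤ :=
  ![![1, 0, 0, 0, 0], ![0, 1, 0, 0, 0], ![0, 0, 1, 0, 0], ![1, 1, -1, 0, 0], ![0, 0, 0, 1, 0],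
    ![0, 0, 0, 0, 1]]

/-- Exponents of a monomial parametrization of the variety of `pentagonQuads`. -/
def pentagonStd : Fin 8 → Fin 5 → ℤ :=
  ![![1, 0, 0, 0, 0], ![0, 1, 0, 0, 0], ![0, 0, 1, 0, 0], ![0, 0, 0, 1, 0], ![-1, 1, 0, 1, 0],
    ![0, 0, 0, 0, 1], ![-1, 1, 0, 0, 1], ![-1, 0, 1, 0, 1]]

lemma isPresentation_smooth : IsPresentation smoothQuads smoothStd where
  ne r := r.elim0
  weight := ⟨0, fun r => r.elim0⟩
  inj e e' _ _ h := by
    ext l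
    simpa [smoothStd] using h l

lemma isPresentation_conifold : IsPresentation conifoldQuads conifoldStd where
  ne := by decide
  weight := ⟨![1, 1, 0, 0, 0, 0], by decide⟩
  inj e e' he he' h := by
    have h0 := he 0
    have h0' := he' 0
    have e0 := h 0
    have e1 := h 1
    have e2 := h 2
    have e3 := h 3
    have e4 := h 4
    simp [conifoldQuads, conifoldStd, Fin.sum_univ_succ] at h0 h0' e0 e1 e2 e3 e4
    ext l
    fin_cases l <;> simp <;> omega

set_option maxHeartbeats 1000000 in
lemma isPresentation_pentagon : IsPresentation pentagonQuads pentagonStd where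
  ne := by decide
  weight := ⟨![1, 0, 1, 0, 1, 1, 1, 0], by decide⟩
  inj e e' he he' h := by
    have h0 := he 0
    have h1 := he 1
    have h2 := he 2
    have h3 := he 3
    have h4 := he 4
    have h0' := he' 0
    have h1' := he' 1
    have h2' := he' 2
    have h3' := he' 3
    have h4' := he' 4
    have e0 := h 0
    have e1 := h 1
    have e2 := h 2
    have e3 := h 3
    have e4 := h 4
    simp [pentagonQuads] at h0 h0' h1 h1' h2 h2' h3 h3' h4 h4'
    simp [pentagonStd, Fin.sum_univ_succ] at e0 e1 e2 e3 e4
    have hA : e 0 = e' 0 ∧ e 4 = e' 4 := by omega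
    ext l
    fin_cases l <;> simp <;> omega

/-- Charts at six of the fixed points of the torus: near the points where `uu`, `vv`, `zu`,
`tu`, `zv` or `tv` does not vanish, the variety is an affine space. -/
def smoothChart : Fin 6 → LocalChart 5 :=
  ![
    ⟨11, 11, ![5, 7, 9, 2, 12],
      ![[1, 3], [2, 3], [3], [3, 4], [0, 2], [0], [0, 4],
        [1], [1, 4], [2], [2, 4], [], [4], [4, 4]],
      ![![1, 0, 0, 0, 0], ![0, 1, 0, 0, 0], ![0, 0, 1, 0, 0],
        ![0, 0, 0, 1, 0], ![0, 0, 0, 0, 1]]⟩,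
    ⟨13, 13, ![6, 8, 10, 3, 12],
      ![[1, 3], [2, 3], [3, 4], [3], [0, 2], [0, 4], [0],
        [1, 4], [1], [2, 4], [2], [4, 4], [4], []],
      ![![1, 0, 0, 0, 0], ![0, 1, 0, 0, 0], ![0, 0, 1, 0, 0],
        ![0, 0, 0, 1, 0], ![-1, -1, -1, -1, -1]]⟩,
    ⟨9, 9, ![11, 4, 1, 10, 7],
      ![[2, 4], [2], [0, 2], [0, 2, 3], [1], [0, 1], [0, 1, 3],
        [4], [3, 4], [], [3], [0], [0, 3], [0, 3, 3]],
      ![![0, -1, -1, 0, 0], ![1, 0, 0, 0, 0], ![0, 0, 0, 1, 0],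
        ![0, 0, 0, 0, 1], ![0, 1, 0, 0, 0]]⟩,
    ⟨2, 2, ![11, 0, 1, 3, 5],
      ![[1], [2], [], [3], [2, 4], [4], [3, 4],
        [0, 1], [0, 1, 3], [0, 2], [0, 2, 3], [0], [0, 3], [0, 3, 3]],
      ![![-1, 0, 0, -1, 0], ![0, 1, 0, 0, 0], ![0, 0, 1, 0, 0],
        ![0, 0, 0, 0, 1], ![1, 0, 0, 0, 0]]⟩,
    ⟨10, 10, ![13, 4, 1, 9, 8],
      ![[2, 4], [2], [0, 2, 3], [0, 2], [1], [0, 1, 3], [0, 1],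
        [3, 4], [4], [3], [], [0, 3, 3], [0, 3], [0]],
      ![![0, -1, -1, 0, 0], ![1, 0, 0, 0, 0], ![0, 0, 0, 1, 0],
        ![-1, -1, -1, -1, -1], ![0, 1, 0, 0, 0]]⟩,
    ⟨3, 3, ![13, 0, 1, 2, 6],
      ![[1], [2], [3], [], [2, 4], [3, 4], [4],
        [0, 1, 3], [0, 1], [0, 2, 3], [0, 2], [0, 3, 3], [0, 3], [0]],
      ![![-1, 0, 0, -1, 0], ![0, 1, 0, 0, 0], ![0, 0, 1, 0, 0],
        ![-1, -1, -1, -1, -1], ![1, 0, 0, 0, 0]]⟩]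

/-- Charts near the points where `ux`, `vx`, `uy`, `vy` or `tz` does not vanish, and near those where both
`xz` and `ty` do not vanish. -/
def conifoldChart : Fin 6 → LocalChart 6 :=
  ![
    ⟨5, 5, ![0, 11, 2, 7, 6, 4],
      ![[0], [2, 5], [2], [2, 4], [5], [], [4],
        [3], [3, 4], [1, 5], [1, 4, 5], [1], [1, 4], [1, 4, 4]],
      ![![0, 1, 0, 0, 0], ![-1, 0, 0, -1, 0], ![0, -1, 0, 1, 0],
        ![0, 0, 0, 0, 1], ![0, 0, 1, 0, 0]]⟩,
    ⟨6, 6, ![0, 13, 3, 8, 5, 4],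
      ![[0], [2, 5], [2, 4], [2], [5], [4], [],
        [3, 4], [3], [1, 4, 5], [1, 5], [1, 4, 4], [1, 4], [1]],
      ![![0, 1, 0, 0, 0], ![-1, 0, 0, -1, 0], ![0, -1, 0, 1, 0],
        ![-1, -1, -1, -1, -1], ![0, 0, 1, 0, 0]]⟩,
    ⟨7, 7, ![4, 11, 9, 5, 8, 0],
      ![[5], [2, 5], [1, 5], [1, 4, 5], [0], [3], [3, 4],
        [], [4], [2], [2, 4], [1], [1, 4], [1, 4, 4]],
      ![![1, 0, 0, 0, 0], ![0, -1, -1, 0, 0], ![-1, 0, 1, 0, 0],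
        ![0, 0, 0, 0, 1], ![0, 0, 0, 1, 0]]⟩,
    ⟨8, 8, ![4, 13, 10, 6, 7, 0],
      ![[5], [2, 5], [1, 4, 5], [1, 5], [0], [3, 4], [3],
        [4], [], [2, 4], [2], [1, 4, 4], [1, 4], [1]],
      ![![1, 0, 0, 0, 0], ![0, -1, -1, 0, 0], ![-1, 0, 1, 0, 0],
        ![-1, -1, -1, -1, -1], ![0, 0, 0, 1, 0]]⟩,
    ⟨1, 1, ![2, 10, 9, 3, 0, 4],
      ![[4], [], [0], [3], [5], [0, 5], [3, 5],
        [2, 4], [1, 4], [2], [1], [0, 2], [0, 1], [1, 3]],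
      ![![0, -1, -1, 0, 0], ![0, 0, 0, 0, 1], ![-1, 0, 0, -1, -1],
        ![0, 1, 0, 0, 0], ![1, 0, 0, 0, 0]]⟩,
    ⟨4, 0, ![5, 8, 6, 7, 0, 1],
      ![[4, 4], [4, 5], [0, 4, 5], [2, 4, 5], [4], [0, 4], [2, 4],
        [3, 4], [1, 4], [3, 5], [1, 5], [0, 3, 5], [0, 1, 5], [1, 2, 5]],
      ![![-1, -1, -1, -1, -1], ![-1, 0, 0, -1, 0], ![1, 0, 0, 1, 1],
        ![1, 1, 0, 1, 0], ![-1, -1, 0, 0, 0]]⟩]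

/-- Charts near the points where `xz` or `ty` does not vanish. -/
def pentagonChart : Fin 2 → LocalChart 8 :=
  ![
    ⟨4, 4, ![9, 10, 1, 5, 6, 7, 8, 0],
      ![[7], [2], [2, 3], [2, 4], [], [3], [4],
        [5], [6], [0], [1], [0, 3], [0, 4], [1, 4]],
      ![![-1, -1, 0, -1, -1], ![0, 0, 0, 0, 1], ![0, 0, 0, 1, 0],
        ![0, -1, -1, 0, 0], ![0, 1, 0, 0, 0]]⟩,
    ⟨0, 0, ![2, 3, 1, 7, 8, 5, 6, 4],
      ![[], [2], [0], [1], [7], [5], [6],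
        [3], [4], [2, 3], [2, 4], [0, 3], [0, 4], [1, 4]],
      ![![-1, -1, -1, 0, -1], ![0, 0, 0, 0, 1], ![0, 0, 1, 0, 0],
        ![-1, 0, 0, -1, 0], ![1, 0, 0, 0, 0]]⟩]

lemma dir_conifoldChart : ∀ t r, (conifoldChart t).dir (conifoldQuads r).1 +
    (conifoldChart t).dir (conifoldQuads r).2.1 = (conifoldChart t).dir (conifoldQuads r).2.2.1 +
      (conifoldChart t).dir (conifoldQuads r).2.2.2 := by
  decide

lemma dir_pentagonChart : ∀ t r, (pentagonChart t).dir (pentagonQuads r).1 +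
    (pentagonChart t).dir (pentagonQuads r).2.1 = (pentagonChart t).dir (pentagonQuads r).2.2.1 +
      (pentagonChart t).dir (pentagonQuads r).2.2.2 := by
  decide

lemma isConsistent_smoothChart : ∀ t, (smoothChart t).IsConsistent smoothStd := by
  decide

lemma isConsistent_conifoldChart : ∀ t, (conifoldChart t).IsConsistent conifoldStd := by
  decide

lemma isConsistent_pentagonChart : ∀ t, (pentagonChart t).IsConsistent pentagonStd := by
  decide

end LocalCharts

/-! ### Singularities of the toric fibre -/

section LocalGeometry

open MvPolynomial

/-- The three coordinates that do not vanish identically on the `k`-th singular stratum. -/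
def stratum : Fin 3 → Finset (Fin 14) := ![{0, 1, 4}, {4, 5, 6}, {0, 7, 8}]

variable {i : Fin 14}

/-- The point with evaluation `p` lies on the `k`-th singular stratum. -/
def OnStratum (p : Chart toricIdeal i →ₐ[ℂ] ℂ) (k : Fin 3) : Prop :=
  ∀ j ∉ stratum k, pointCoord p j = 0

lemma pointCoord_uv_sq (p : Chart toricIdeal i →ₐ[ℂ] ℂ) :
    pointCoord p 12 * pointCoord p 12 = pointCoord p 11 * pointCoord p 13 := by
  simp only [pointCoord, ← map_mul]
  congr 1
  rw [Ideal.Quotient.eq]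
  refine Ideal.mem_sup_left ?_
  rw [mem_toricIdeal, map_sub, map_mul, map_mul, aeval_X, aeval_X, aeval_X]
  simp only [lo, hi]
  simp
  ring

/-- A point lies on a chart where one of the coordinates does not vanish. -/
lemma exists_pointCoord_ne_zero (p : Chart toricIdeal i →ₐ[ℂ] ℂ) :
    (∃ t, pointCoord p (smoothChart t).base ≠ 0) ∨
      (∃ t, pointCoord p (conifoldChart t).base ≠ 0 ∧ pointCoord p (conifoldChart t).other ≠ 0) ∨
      ∃ t, pointCoord p (pentagonChart t).base ≠ 0 ∧
        ∀ j ≠ (pentagonChart t).base, pointCoord p j = 0 := by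
  have hi : pointCoord p i = 1 := by
    have h : (Ideal.Quotient.mk (toricIdeal ⊔ Ideal.span {X i - 1})) (X i) = 1 := by
      rw [← map_one (Ideal.Quotient.mk _), Ideal.Quotient.eq]
      exact Ideal.mem_sup_right (Ideal.subset_span rfl)
    rw [pointCoord, h, map_one]
  by_contra! h
  obtain ⟨hs, hc, hp⟩ := h
  have h12 : pointCoord p 12 = 0 := by
    have := pointCoord_uv_sq p
    rw [show pointCoord p 11 = 0 from hs 0, zero_mul] at this
    exact mul_self_eq_zero.1 this
  have hzero : ∀ j, j ≠ 0 → j ≠ 4 → pointCoord p j = 0 := by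
    have hcc : ∀ t, (conifoldChart t).base = (conifoldChart t).other →
        pointCoord p (conifoldChart t).base = 0 := by
      intro t ht
      by_contra h
      exact h ((congrArg (pointCoord p) ht).trans (hc t h))
    intro j h0 h4
    fin_cases j
    exacts [absurd rfl h0, hcc 4 rfl, hs 3, hs 5, absurd rfl h4, hcc 0 rfl, hcc 1 rfl, hcc 2 rfl,
      hcc 3 rfl, hs 2, hs 4, hs 0, h12, hs 1]
  have h5 : pointCoord p 4 ≠ 0 → pointCoord p 0 = 0 := hc 5
  by_cases h4 : pointCoord p 4 = 0
  · by_cases h0 : pointCoord p 0 = 0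
    · have hall : ∀ j, pointCoord p j = 0 := by
        intro j
        by_cases h0' : j = 0
        · rw [h0', h0]
        · by_cases h4' : j = 4
          · rw [h4', h4]
          · exact hzero j h0' h4'
      exact one_ne_zero (hi.symm.trans (hall i))
    · obtain ⟨j, hj, hj'⟩ := hp 1 h0
      refine hj' ?_
      by_cases h4' : j = 4
      · rw [h4', h4]
      · exact hzero j hj h4'
  · obtain ⟨j, hj, hj'⟩ := hp 0 h4
    refine hj' ?_
    by_cases h0' : j = 0
    · rw [h0', h5 h4]
    · exact hzero j h0' hj

/-- At every closed point the local ring is Cohen-Macaulay; it is singular exactly on the three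
strata; and it is a conifold singularity on each of them outside the other two. -/
theorem localization_chart_toricIdeal {𝔪 : Ideal (Chart toricIdeal i)} [𝔪.IsMaximal]
    {p : Chart toricIdeal i →ₐ[ℂ] ℂ} (hp : RingHom.ker p = 𝔪) :
    IsCohenMacaulayLocal (Localization.AtPrime 𝔪) ∧
    (¬ IsRegularLocalRing (Localization.AtPrime 𝔪) ↔ ∃ k, OnStratum p k) ∧
    ((∃! k, OnStratum p k) → IsConifoldLocal (Localization.AtPrime 𝔪)) := by
  have hdim : ringKrullDim (Localization.AtPrime 𝔪) ≤ (5 : ℕ) :=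
    ringKrullDim_localization_chart_le i 𝔪
  have : IsNoetherianRing (Localization.AtPrime 𝔪) := IsLocalization.isNoetherianRing 𝔪.primeCompl _
    inferInstance
  rcases exists_pointCoord_ne_zero p with ⟨t, ht⟩ | ⟨t, ht, ht'⟩ | ⟨t, ht, ht'⟩
  · have hbase : ∀ t, (smoothChart t).base = (smoothChart t).other := by decide
    obtain ⟨g, c, h, -, -⟩ := LocalChart.exists_isLocalModel isPresentation_smooth
      (isConsistent_smoothChart t) (fun r => r.elim0) hp ht (hbase t ▸ ht)
    obtain ⟨hCM, hreg⟩ := isRegularLocalRing_of_isLocalModel_smooth hdim h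
    have hmem : ∀ t k, (smoothChart t).base ∉ stratum k := by decide
    have hno : ∀ k, ¬ OnStratum p k := fun k hk => ht (hk _ (hmem t k))
    exact ⟨hCM, iff_of_false (not_not_intro hreg) fun ⟨k, hk⟩ => hno k hk,
      fun ⟨k, hk, _⟩ => absurd hk (hno k)⟩
  · obtain ⟨g, c, h, hc, hword⟩ := LocalChart.exists_isLocalModel isPresentation_conifold
      (isConsistent_conifoldChart t) (dir_conifoldChart t) hp ht ht'
    obtain ⟨hCM, hreg, hcon⟩ := h.conifold hdim
    have hstrat : ∀ k, OnStratum p k →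
        ∀ i : Fin 4, c (quadVar conifoldQuads (Fin.castLE (by norm_num) i)) = 0 := by
      have h1 : ∀ t k, (conifoldChart t).base ∈ stratum k → (conifoldChart t).other ∈ stratum k →
          ∀ i : Fin 4, (conifoldChart t).num (Fin.castLE (by norm_num) i) ∉ stratum k := by decide
      intro k hk i
      refine (hc _).2 (hk _ (h1 t k ?_ ?_ i))
      · by_contra hn
        exact ht (hk _ hn)
      · by_contra hn
        exact ht' (hk _ hn)
    have hstrat' : (∀ i : Fin 4, c (quadVar conifoldQuads (Fin.castLE (by norm_num) i)) = 0) →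
        ∃ k, OnStratum p k := by
      have h1 : ∀ t, ∃ k, ∀ j ∉ stratum k, ∃ i : Fin 4,
          (Fin.castLE (by norm_num) i : Fin 6) ∈ (conifoldChart t).word j := by decide
      intro h0
      obtain ⟨k, hk⟩ := h1 t
      refine ⟨k, fun j hj => ?_⟩
      obtain ⟨i, hi⟩ := hk j hj
      exact (hword j).2 ⟨_, hi, (hc _).1 (h0 i)⟩
    exact ⟨hCM, hreg.trans ⟨hstrat', fun ⟨k, hk⟩ => hstrat k hk⟩, fun ⟨k, hk, _⟩ => hcon (hstrat k hk)⟩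
  · have hbase : ∀ t, (pentagonChart t).base = (pentagonChart t).other := by decide
    obtain ⟨g, c, h, hc, -⟩ := LocalChart.exists_isLocalModel isPresentation_pentagon
      (isConsistent_pentagonChart t) (dir_pentagonChart t) hp ht (hbase t ▸ ht)
    have hnum : ∀ t l, (pentagonChart t).num l ≠ (pentagonChart t).base := by decide
    have hc0 : ∀ l, c (quadVar pentagonQuads l) = 0 := fun l => (hc l).2 (ht' _ (hnum t l))
    have hreg := h.not_isRegularLocalRing_quad hdim (by norm_num) fun r =>
      ⟨hc0 _, hc0 _, hc0 _, hc0 _⟩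
    have htwo : ∀ t, ∃ k k', k ≠ k' ∧ (pentagonChart t).base ∈ stratum k ∧
        (pentagonChart t).base ∈ stratum k' := by decide
    obtain ⟨k, k', hkk', hk, hk'⟩ := htwo t
    have hon : ∀ k, (pentagonChart t).base ∈ stratum k → OnStratum p k := fun k hk j hj =>
      ht' j fun h0 => hj (h0 ▸ hk)
    exact ⟨(h.isCohenMacaulayLocal hdim flat_pentagon).1, iff_of_true hreg ⟨k, hon k hk⟩,
      fun hu => absurd (hu.unique (hon k hk) (hon k' hk')) hkk'⟩

lemma isCohenMacaulayVariety_toricIdeal : IsCohenMacaulayVariety toricIdeal := by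
  intro i 𝔪 _
  obtain ⟨p, hp⟩ := exists_algHom_ker_eq 𝔪
  exact (localization_chart_toricIdeal hp).1

theorem isGorensteinVariety_toricIdeal : IsGorensteinVariety toricIdeal 5 :=
  ⟨isNormalVariety_toricIdeal, isCohenMacaulayVariety_toricIdeal,
    canonicalSheafInvertible_toricIdeal⟩

end LocalGeometry

/-! ### The singular strata -/

section Strata

open MvPolynomial

/-- The three coordinates on the `k`-th singular stratum, which is a plane. -/
def stratumCoord : Fin 3 → Fin 3 → Fin 14 := ![![0, 1, 4], ![4, 5, 6], ![0, 7, 8]]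

lemma mem_stratum_iff : ∀ k j, j ∈ stratum k ↔ ∃ l, stratumCoord k l = j := by decide

lemma stratumCoord_injective : ∀ k l l', stratumCoord k l = stratumCoord k l' → l = l' := by decide

/-- Restriction of forms to the `k`-th singular stratum. -/
def restrictStratum (k : Fin 3) : MvPolynomial (Fin 14) ℂ →ₐ[ℂ] MvPolynomial (Fin 3) ℂ :=
  aeval fun j => ∑ l, if stratumCoord k l = j then X l else 0

lemma restrictStratum_X (k l : Fin 3) : restrictStratum k (X (stratumCoord k l)) = X l := by
  rw [restrictStratum, aeval_X, Finset.sum_eq_single l, if_pos rfl]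
  · exact fun l' _ h => if_neg fun h' => h (stratumCoord_injective k _ _ h')
  · exact fun h => absurd (Finset.mem_univ l) h

lemma restrictStratum_X_of_notMem {k : Fin 3} {j : Fin 14} (hj : j ∉ stratum k) :
    restrictStratum k (X j) = 0 := by
  rw [restrictStratum, aeval_X]
  exact Finset.sum_eq_zero fun l _ => if_neg fun h => hj ((mem_stratum_iff k j).2 ⟨l, h⟩)

lemma restrictStratum_rename (k : Fin 3) (f : MvPolynomial (Fin 3) ℂ) :
    restrictStratum k (rename (stratumCoord k) f) = f := by
  rw [← AlgHom.comp_apply]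
  refine (congrArg (fun φ : _ →ₐ[ℂ] _ => φ f) (algHom_ext fun l => ?_ :
    (restrictStratum k).comp (rename (stratumCoord k)) = AlgHom.id ℂ _))
  rw [AlgHom.comp_apply, rename_X, restrictStratum_X, AlgHom.id_apply]

lemma aeval_eq_aeval_restrictStratum {k : Fin 3} {z : Fin 14 → ℂ} (hz : ∀ j ∉ stratum k, z j = 0)
    (f : MvPolynomial (Fin 14) ℂ) :
    aeval z f = aeval (fun l => z (stratumCoord k l)) (restrictStratum k f) := by
  rw [← AlgHom.comp_apply]
  refine congrArg (fun φ : _ →ₐ[ℂ] _ => φ f) (algHom_ext fun j => ?_)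
  rw [AlgHom.comp_apply, aeval_X]
  by_cases hj : j ∈ stratum k
  · obtain ⟨l, rfl⟩ := (mem_stratum_iff k j).1 hj
    rw [restrictStratum_X, aeval_X]
  · rw [restrictStratum_X_of_notMem hj, map_zero, hz j hj]

lemma isHomogeneous_restrictStratum {k : Fin 3} {f : MvPolynomial (Fin 14) ℂ} {d : ℕ}
    (hf : f.IsHomogeneous d) : (restrictStratum k f).IsHomogeneous d := by
  have h := hf.aeval (fun j => ∑ l, if stratumCoord k l = j then (X l : MvPolynomial (Fin 3) ℂ)
    else 0) (n := 1) fun j => IsHomogeneous.sum _ _ _ fun l _ => by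
      split_ifs
      · exact isHomogeneous_X _ _
      · exact isHomogeneous_zero _ _ _
  rwa [one_mul] at h

/-- A point of the two-dimensional orbit in the `k`-th singular stratum. -/
def stratumPoint (k : Fin 3) (j : Fin 14) : ℂ := if j ∈ stratum k then 1 else 0

/-- One-parameter subgroups dual to the characters of the three coordinates of a stratum. -/
def dualCocharacter : Fin 3 → Fin 5 → Fin 3 → ℤ :=
  ![![![0, 0, 1], ![1, -1, 0], ![0, 0, 0], ![0, 1, 0], ![0, 0, 0]],
    ![![0, 1, 0], ![0, 0, 0], ![1, -1, 0], ![0, 0, 0], ![0, -1, 1]],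
    ![![0, 0, 0], ![0, 1, 0], ![0, 0, 0], ![1, -1, 0], ![0, -1, 1]]]

lemma sum_dualCocharacter : ∀ k l l', ∑ i, dualCocharacter k i l' * character (stratumCoord k l) i =
    if l' = l then 1 else 0 := by decide

/-- The torus acts transitively on the points of a stratum with non-vanishing coordinates. -/
lemma exists_torusAct_eq (k : Fin 3) (z : Fin 3 → ℂˣ) : ∃ t : Fin 5 → ℂˣ,
    ∀ l, torusAct character t (stratumPoint k) (stratumCoord k l) = z l := by
  refine ⟨fun i => ∏ l', z l' ^ dualCocharacter k i l', fun l => ?_⟩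
  rw [torusAct, stratumPoint, if_pos ((mem_stratum_iff k _).2 ⟨l, rfl⟩), mul_one]
  congr 1
  simp only [← Finset.prod_zpow, ← zpow_mul]
  rw [Finset.prod_comm]
  have h : ∀ l', ∏ i, z l' ^ (dualCocharacter k i l' * character (stratumCoord k l) i) =
      if l' = l then z l' else 1 := by
    intro l'
    have h1 : ∀ a : Fin 5 → ℤ, ∏ i, z l' ^ a i = z l' ^ ∑ i, a i := fun a => by
      simp only [Fin.prod_univ_five, Fin.sum_univ_five, zpow_add]
    rw [h1, sum_dualCocharacter]
    split_ifs
    · exact zpow_one _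
    · exact zpow_zero _
  simp only [h]
  rw [Finset.prod_ite_eq' Finset.univ l z, if_pos (Finset.mem_univ l)]

lemma orbitIdeal_stratumPoint (k : Fin 3) :
    orbitIdeal character (stratumPoint k) = RingHom.ker (restrictStratum k) := by
  ext f
  rw [orbitIdeal, mem_vanishingIdeal_iff, RingHom.mem_ker]
  have hzero : ∀ (c : ℂ) (t : Fin 5 → ℂˣ), ∀ j ∉ stratum k,
      (c • torusAct character t (stratumPoint k)) j = 0 := by
    intro c t j hj
    rw [Pi.smul_apply, torusAct, stratumPoint, if_neg hj, mul_zero, smul_zero]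
  constructor
  · intro hf
    have hvan : restrictStratum k f * ∏ i, X i = 0 := by
      refine MvPolynomial.funext fun p => ?_
      rw [map_mul, map_zero, map_prod]
      by_cases hp : ∃ i, p i = 0
      · obtain ⟨i, hi⟩ := hp
        rw [Finset.prod_eq_zero (Finset.mem_univ i) (by simpa using hi), mul_zero]
      · push Not at hp
        obtain ⟨t, ht⟩ := exists_torusAct_eq k fun l => Units.mk0 (p l) (hp l)
        have h := hf _ ⟨1, t, rfl⟩
        rw [aeval_eq_aeval_restrictStratum (hzero 1 t)] at h
        have h2 : (fun l => ((1 : ℂ) • torusAct character t (stratumPoint k)) (stratumCoord k l)) =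
            p := funext fun l => by rw [one_smul, ht, Units.val_mk0]
        rw [h2] at h
        have h3 : eval p (restrictStratum k f) = 0 := h
        rw [h3, zero_mul]
    exact (mul_eq_zero.1 hvan).resolve_right (Finset.prod_ne_zero_iff.2 fun i _ => X_ne_zero i)
  · rintro hf _ ⟨c, t, rfl⟩
    rw [aeval_eq_aeval_restrictStratum (hzero c t), hf, map_zero]

/-- The homogeneous coordinate ring of a stratum is a polynomial ring in three variables. -/
def stratumEquiv (k : Fin 3) : (MvPolynomial (Fin 14) ℂ ⧸ orbitIdeal character (stratumPoint k)) ≃ₐ[ℂ]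
    MvPolynomial (Fin 3) ℂ :=
  (Ideal.quotientEquivAlgOfEq ℂ (orbitIdeal_stratumPoint k)).trans
    (Ideal.quotientKerAlgEquivOfRightInverse (restrictStratum_rename k))

lemma isProjectiveVariety_stratum (k : Fin 3) :
    IsProjectiveVariety (orbitIdeal character (stratumPoint k)) 2 where
  prime := by
    rw [orbitIdeal_stratumPoint]
    exact RingHom.ker_isPrime _
  homogeneous := by
    rw [orbitIdeal_stratumPoint]
    intro f hf d
    rw [RingHom.mem_ker] at hf ⊢
    have h1 := congrArg (homogeneousComponent d) hf
    rw [map_zero, ← sum_homogeneousComponent f, map_sum, map_sum] at h1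
    by_cases hd : d ∈ Finset.range (f.totalDegree + 1)
    · rw [Finset.sum_eq_single_of_mem d hd] at h1
      · rwa [homogeneousComponent_of_mem (isHomogeneous_restrictStratum
          (homogeneousComponent_isHomogeneous d f)), if_pos rfl] at h1
      · intro e _ hed
        rw [homogeneousComponent_of_mem (isHomogeneous_restrictStratum
          (homogeneousComponent_isHomogeneous e f)), if_neg hed.symm]
    · rw [Finset.mem_range, not_lt] at hd
      rw [homogeneousComponent_eq_zero d f hd, map_zero]
  dim := by
    rw [ringKrullDim_eq_of_ringEquiv (stratumEquiv k).toRingEquiv,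
      MvPolynomial.ringKrullDim_of_isNoetherianRing, ringKrullDim_eq_zero_of_field, zero_add,
      Nat.card_fin]
    norm_num

lemma finrank_homogeneousSubmodule_fin_three (d : ℕ) :
    Module.finrank ℂ (homogeneousSubmodule (Fin 3) ℂ d) = (d + 2).choose 2 := by
  rw [homogeneousSubmodule_eq_finsupp_supported,
    (AddMonoidAlgebra.supportedEquivFinsupp _).finrank_eq]
  have h : {e : Fin 3 →₀ ℕ | e.degree = d} = (Finset.univ.finsuppAntidiag d : Finset (Fin 3 →₀ ℕ)) := by
    ext e
    simp [Finsupp.degree_eq_sum]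
  rw [h, Module.finrank_finsupp_self]
  simp only [Finset.coe_sort_coe, Fintype.card_coe]
  rw [ Finset.card_finsuppAntidiag_nat_eq_choose,
    Finset.card_univ, Fintype.card_fin, show 3 + d - 1 = d + 2 by omega, Nat.choose_symm_add]

lemma finrank_gradedPiece_stratum (k : Fin 3) (d : ℕ) :
    Module.finrank ℂ (gradedPiece (orbitIdeal character (stratumPoint k)) d) =
      (d + 2).choose 2 := by
  have h : (gradedPiece (orbitIdeal character (stratumPoint k)) d).map
      (stratumEquiv k).toLinearEquiv.toLinearMap = homogeneousSubmodule (Fin 3) ℂ d := by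
    ext f
    rw [gradedPiece, Submodule.mem_map, mem_homogeneousSubmodule]
    constructor
    · rintro ⟨_, ⟨a, ha, rfl⟩, rfl⟩
      exact isHomogeneous_restrictStratum ha
    · intro hf
      exact ⟨_, ⟨rename (stratumCoord k) f, hf.rename_isHomogeneous, rfl⟩,
        restrictStratum_rename k f⟩
  rw [← finrank_homogeneousSubmodule_fin_three, ← h]
  exact ((stratumEquiv k).toLinearEquiv.finrank_map_eq _).symm

lemma hasDegree_stratum (k : Fin 3) : HasDegree (orbitIdeal character (stratumPoint k)) 2 1 := by
  have h0 : Filter.Tendsto (fun d : ℕ => ((d : ℝ))⁻¹) Filter.atTop (𝓝 0) :=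
    tendsto_inv_atTop_zero.comp tendsto_natCast_atTop_atTop
  have h1 : Filter.Tendsto (fun d : ℕ => (1 + 2 * (d : ℝ)⁻¹) * (1 + (d : ℝ)⁻¹)) Filter.atTop
      (𝓝 ((1 + 2 * 0) * (1 + 0))) :=
    ((h0.const_mul 2).const_add 1).mul (h0.const_add 1)
  rw [HasDegree]
  convert h1.congr' ?_ using 2
  · norm_num
  · filter_upwards [Filter.eventually_gt_atTop 0] with d hd
    have hd' : (d : ℝ) ≠ 0 := by exact_mod_cast hd.ne'
    rw [finrank_gradedPiece_stratum, Nat.cast_choose_two, Nat.factorial_two]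
    push_cast
    field_simp
    ring

lemma liesOn_stratum_iff {i : Fin 14} {𝔪 : Ideal (Chart toricIdeal i)} {p : Chart toricIdeal i →ₐ[ℂ] ℂ}
    (hp : RingHom.ker p = 𝔪) (k : Fin 3) :
    LiesOn 𝔪 (orbitIdeal character (stratumPoint k)) ↔ OnStratum p k := by
  have hev : ∀ f, p (Ideal.Quotient.mk _ f) = aeval (pointCoord p) f := by
    intro f
    refine congrArg (fun φ : _ →ₐ[ℂ] _ => φ f) (algHom_ext fun j => ?_ :
      p.comp (Ideal.Quotient.mkₐ ℂ _) = aeval (pointCoord p))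
    rw [aeval_X]
    rfl
  rw [LiesOn, Ideal.map_le_iff_le_comap, orbitIdeal_stratumPoint, ← hp]
  constructor
  · intro h j hj
    exact h (restrictStratum_X_of_notMem hj)
  · intro h f hf
    change p (Ideal.Quotient.mk _ f) = 0
    rw [hev, aeval_eq_aeval_restrictStratum h, (RingHom.mem_ker).1 hf, map_zero]

/-- Weights of the six letters, giving the curve `b ↦ (b ^ (weight of lo j + weight of hi j))ⱼ` on
the variety, with limit the point `stratumPoint k` for `b → 0`. -/
def limitWeight : Fin 3 → Fin 6 → ℤ :=
  ![![0, 0, 0, 0, 1, 1], ![-1, 1, 1, 1, 1, 1], ![1, -1, 1, 1, 1, 1]]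

lemma stratumPoint_mem_zeroLocus (k : Fin 3) : stratumPoint k ∈ zeroLocus ℂ toricIdeal := by
  intro f hf
  obtain ⟨e, he, he0⟩ : ∃ e : Fin 14 → ℕ,
      (∀ j, (e j : ℤ) = limitWeight k (lo j) + limitWeight k (hi j)) ∧
        ∀ j, e j = 0 ↔ j ∈ stratum k :=
    ⟨fun j => (limitWeight k (lo j) + limitWeight k (hi j)).toNat, by revert k; decide,
      by revert k; decide⟩
  let P : Polynomial ℂ := aeval (fun j => Polynomial.X ^ e j) f
  have hP : ∀ b : ℂ, P.eval b = aeval (fun j => b ^ e j) f := by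
    intro b
    change Polynomial.evalRingHom b (aeval _ f) = _
    rw [← Polynomial.coe_aeval_eq_evalRingHom, RingHom.coe_coe, ← AlgHom.comp_apply]
    refine congrArg (fun φ : _ →ₐ[ℂ] _ => φ f) (algHom_ext fun j => ?_)
    simp
  have hX : P * Polynomial.X = 0 := by
    refine Polynomial.funext fun b => ?_
    rw [Polynomial.eval_mul, Polynomial.eval_X, Polynomial.eval_zero]
    by_cases hb : b = 0
    · rw [hb, mul_zero]
    · have h1 := congrArg (aeval fun i => b ^ limitWeight k i) (mem_toricIdeal.1 hf)
      rw [map_zero, ← AlgHom.comp_apply, comp_aeval] at h1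
      have h2 : (fun j => aeval (fun i => b ^ limitWeight k i)
          (X (lo j) * X (hi j) : MvPolynomial (Fin 6) ℂ)) = fun j => b ^ e j := by
        funext j
        rw [map_mul, aeval_X, aeval_X, ← zpow_add₀ hb, ← he, zpow_natCast]
      rw [h2] at h1
      rw [hP, h1, zero_mul]
  have h0 := hP 0
  rw [(mul_eq_zero.1 hX).resolve_right Polynomial.X_ne_zero, Polynomial.eval_zero] at h0
  have h1 : stratumPoint k = fun j => (0 : ℂ) ^ e j := by
    funext j
    rw [stratumPoint, zero_pow_eq, if_congr (he0 j).symm rfl rfl]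
  rw [h1, ← h0]

theorem hasThreeConifoldStrata_toricIdeal : HasThreeConifoldStrata toricIdeal character := by
  refine ⟨stratumPoint, fun k => ⟨fun h => ?_, stratumPoint_mem_zeroLocus k⟩, fun k k' h => ?_,
    fun k => ⟨isProjectiveVariety_stratum k, hasDegree_stratum k⟩, fun i 𝔪 _ => ?_⟩
  · have h1 := congrFun h (stratumCoord k 0)
    rw [stratumPoint, if_pos ((mem_stratum_iff k _).2 ⟨0, rfl⟩)] at h1
    exact one_ne_zero h1
  · have hsub : ∀ l, stratumCoord k l ∈ stratum k' := by
      intro l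
      by_contra hl
      have h1 := restrictStratum_X_of_notMem hl
      simp only [orbitIdeal_stratumPoint] at h
      rw [← RingHom.mem_ker, ← h, RingHom.mem_ker, restrictStratum_X] at h1
      exact X_ne_zero l h1
    have h1 : ∀ k k', (∀ l, stratumCoord k l ∈ stratum k') → k = k' := by decide
    exact h1 k k' hsub
  · obtain ⟨p, hp⟩ := exists_algHom_ker_eq 𝔪
    simp only [liesOn_stratum_iff hp]
    exact (localization_chart_toricIdeal hp).2

end Strata

/-! ### The degeneration of `G₂` -/

theorem mainTheorem5 (ω : (Fin 7 → ℂ) [⋀^Fin 4]→L[ℂ] ℂ) (hω : IsNondegenerateForm ω) :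
    (∀ s : Disc, s ≠ Disc.center → IsTwistedCubicCone (cubicCone s)) ∧
    IsChainOfThreeLinesCone (cubicCone 0) ∧
    ∃ 𝓠 : Fin 14 → MvPolynomial (Fin 6) HolRing,
      (∀ s : Disc, IsBasisOf (fun j => specialize s (𝓠 j)) (quadricsThrough (cubicCone s))) ∧
      IsFlatFamilyOverDisc (imageIdeal 𝓠) ∧
      (∀ s : Disc,
        fibreIdeal (imageIdeal 𝓠) s = imageIdeal (fun j => specialize s (𝓠 j))) ∧
      (∀ s : Disc, DegeneratesOverDisc (G2Ideal ω) (imageIdeal (fun j => specialize s (𝓠 j)))) ∧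
      ∃ T : Ideal (MvPolynomial (Fin 14) ℂ),
        T = imageIdeal (fun j => specialize Disc.center (𝓠 j)) ∧
        DegeneratesOverDisc (G2Ideal ω) T ∧
        IsProjectiveVariety T 5 ∧
        IsGorensteinVariety T 5 ∧
        IsFanoVariety T 5 ∧
        ∃ m : Fin 14 → Fin 5 → ℤ,
          IsProjectiveToric T m ∧
          HasThreeConifoldStrata T m := by
  have hspec : ∀ s : Disc, (fun j => specialize s (quadric HolRing.coord j)) = quadric (s : ℂ) :=
    fun s => funext fun j => specialize_quadric _ s j
  refine ⟨fun s hs => isTwistedCubicCone_cubicCone fun h => hs (Subtype.ext h),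
    isChainOfThreeLinesCone_cubicCone, quadric HolRing.coord, fun s => ?_, ?_, fun s => ?_,
    fun s => ?_, toricIdeal, ?_, degeneratesOverDisc_G2Ideal hω 0, isProjectiveVariety_toricIdeal,
    isGorensteinVariety_toricIdeal, isFanoVariety_toricIdeal, character,
    isProjectiveToric_toricIdeal, hasThreeConifoldStrata_toricIdeal⟩
  · rw [hspec]
    exact isBasisOf_quadric s
  · rw [imageIdeal_quadric]
    exact isFlatFamilyOverDisc_familyIdeal _ _
  · rw [hspec, imageIdeal_quadric, imageIdeal_quadric, fibreIdeal_familyIdeal, map_zero]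
    rfl
  · rw [hspec, imageIdeal_quadric]
    exact degeneratesOverDisc_G2Ideal hω s
  · rw [hspec, imageIdeal_quadric]
    rfl

end
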